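/- **Setting.** All algebras are over $\mathbb{C}$. $\mathtt{DGA}^+$ is the category of unital associative dg-algebras $A=\bigoplus_{n\ge 0}A_n$ with differential of degree $-1$, and $\mathtt{CDGA}^+$ its full subcategory of graded-commutative dg-algebras. For an algebra $S$ (placed in degree $0$), $\mathtt{DGA}_S^+$ is the category of objects of $\mathtt{DGA}^+$ under $S$. Weak equivalences are the quasi-isomorphisms, fibrations are the maps that are surjective in all strictly positive degrees, and cofibrations are the maps with the left lifting property with respect to all acyclic fibrations in $\mathtt{DGA}^+$; a map in $\mathtt{DGA}_S^+$ belongs to one of these classes if the underlying map in $\mathtt{DGA}^+$ does. A cofibrant replacement of $A\in\mathtt{DGA}_S^+$ is an acyclic fibration $\pi:X\to A$ in $\mathtt{DGA}_S^+$ such that the structure map $S\to X$ is a cofibration. Given a representation $\rho:S\to \mathrm{End}(V)$ on a finite-dimensional space $V=\mathbb{C}^n$, the functor $(-)_V:\mathtt{DGA}_S^+\to\mathtt{CDGA}^+$ is the left adjoint of $B\mapsto \mathrm{End}(V)\otimes B$; concretely $A_V$ is generated by the matrix entries $a_{ij}$ ($a\in A$) of the universal representation of $A$. $\boldsymbol{L}(-)_V:\mathtt{Ho}(\mathtt{DGA}_S^+)\to\mathtt{Ho}(\mathtt{CDGA}^+)$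 denotes its total left derived functor (with respect to quasi-isomorphisms; $\mathtt{Ho}$ is the localization at quasi-isomorphisms). With $\mathtt{DGAff}=(\mathtt{CDGA}^+)^{op}$, $\mathtt{Ho}(\mathtt{DGAff})=\mathtt{Ho}(\mathtt{CDGA}^+)^{op}$, and $\mathrm{Spec}$ the tautological anti-equivalence, put $\mathrm{Rep}_V(A)=\mathrm{Spec}(A_V)$ and $\mathrm{DRep}_V(A)=\mathrm{Spec}(\boldsymbol{L}(A)_V)\in\mathtt{Ho}(\mathtt{DGAff})$. Let $Q=(Q_0,Q_1)$ be a finite quiver. The framed doubled quiver $\overline{Q^{\mathrm{fr}}}$ has vertices $a$ and $\bar a$ for $a\in Q_0$, and arrows $x_\gamma:s(\gamma)\to t(\gamma)$ and $y_\gamma:t(\gamma)\to s(\gamma)$ for $\gamma\in Q_1$, $i_a:\bar a\to a$ and $j_a:a\to\bar a$ for $a\in Q_0$. In path algebras the product $pq$ means "first $q$, then $p$". Put $$\mu_a=\sum_{t(\gamma)=a}x_\gamma y_\gamma-\sum_{s(\gamma)=a}y_\gamma x_\gamma+i_aj_a\in\mathbb{C}\overline{Q^{\mathrm{fr}}}\quad(a\in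 Q_0),\qquad A=\mathbb{C}\overline{Q^{\mathrm{fr}}}/\langle\mu_a: a\in Q_0\rangle ,$$ an algebra under $S=\bigoplus_p\mathbb{C}e_p$, the algebra spanned by the idempotents $e_p$ of all the vertices $p$ of $\overline{Q^{\mathrm{fr}}}$. Let $Q^\vartheta$ be obtained from $\overline{Q^{\mathrm{fr}}}$ by adding one loop $\vartheta_a$ at each original vertex $a\in Q_0$, and let $A_{\mathrm{cof}}=(\mathbb{C}Q^\vartheta,d)\in\mathtt{DGA}_S^+$ be its path algebra with $\vartheta_a$ in degree $1$, all the other arrows in degree $0$, and $d\vartheta_a=\mu_a$. Let $\pi:A_{\mathrm{cof}}\to A$ be the projection that kills all $\vartheta_a$. For $\mathbf{v},\mathbf{w}\in\mathbb{N}^{Q_0}$ let $S$ act on $\mathbb{C}^{\mathbf v}\oplus\mathbb{C}^{\mathbf w}=\bigoplus_{a}\mathbb{C}^{v_a}\oplus\bigoplus_{a}\mathbb{C}^{w_a}$ by letting $e_a$, $e_{\bar a}$ act as the projections on $\mathbb{C}^{v_a}$, $\mathbb{C}^{w_a}$; the resulting functors are written with index $\mathbf{v},\mathbf{w}$. Let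 $M(Q,\mathbf v,\mathbf w)$ be the vector space of representations $(X,Y,I,J)$ of $\overline{Q^{\mathrm{fr}}}$ with these dimensions, $\mathfrak g_{\mathbf v}=\bigoplus_{a}\mathfrak{gl}_{v_a}(\mathbb{C})$, and $\mu=(\mu_a)_a:M(Q,\mathbf v,\mathbf w)\to\mathfrak g_{\mathbf v}$, $\mu_a=\sum_{t(\gamma)=a}X_\gamma Y_\gamma-\sum_{s(\gamma)=a}Y_\gamma X_\gamma+I_aJ_a$, the moment map. The Koszul complex on $\mu$ is the object $\mathcal O(M(Q,\mathbf v,\mathbf w))\otimes\Lambda^\bullet\mathfrak g_{\mathbf v}$ of $\mathtt{CDGA}^+$, with $\mathcal O(M(Q,\mathbf v,\mathbf w))$ in degree $0$, $\mathfrak g_{\mathbf v}$ in degree $1$, and the differential determined by $d\xi=\langle\mu,\xi\rangle=\sum_a\mathrm{tr}(\mu_a\xi_a)$ for $\xi\in\mathfrak g_{\mathbf v}$. **Theorem 3.9** (with Theorem 3.5). For every finite quiver $Q$: 1. $\pi:A_{\mathrm{cof}}\to A$ is a cofibrant replacement of $A$ in $\mathtt{DGA}_S^+$. 2. For all $\mathbf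 v,\mathbf w\in\mathbb N^{Q_0}$ the total left derived functor $\boldsymbol L(-)_{\mathbf v,\mathbf w}$ exists, and $$\mathrm{DRep}_{\mathbf v,\mathbf w}(A)\;\cong\;\mathrm{Rep}_{\mathbf v,\mathbf w}(A_{\mathrm{cof}})\;\cong\;\mathrm{Spec}\big(\mathcal O(M(Q,\mathbf v,\mathbf w))\otimes\Lambda^\bullet\mathfrak g_{\mathbf v}\big).$$ Here the first isomorphism is in $\mathtt{Ho}(\mathtt{DGAff})$ and is the one induced by $\pi$: it corresponds to an isomorphism $\phi:(A_{\mathrm{cof}})_{\mathbf v,\mathbf w}\to\boldsymbol L(A)_{\mathbf v,\mathbf w}$ in $\mathtt{Ho}(\mathtt{CDGA}^+)$ with $\phi\circ\epsilon=\boldsymbol L(\pi)_{\mathbf v,\mathbf w}$, where $\epsilon:\boldsymbol L(A_{\mathrm{cof}})_{\mathbf v,\mathbf w}\to(A_{\mathrm{cof}})_{\mathbf v,\mathbf w}$ is the canonical map. The second isomorphism is already one in $\mathtt{DGAff}$, i.e. it comes from an isomorphism of commutative dg-algebras $(A_{\mathrm{cof}})_{\mathbf v,\mathbf w}\cong\mathcal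 O(M(Q,\mathbf v,\mathbf w))\otimes\Lambda^\bullet\mathfrak g_{\mathbf v}$; this sends the matrix entries of the arrows $x_\gamma,y_\gamma,i_a,j_a$ to the corresponding coordinate functions on $M(Q,\mathbf v,\mathbf w)$, and the entry $(\vartheta_a)_{ij}$ to the elementary matrix $E_{ji}\in\mathfrak{gl}_{v_a}(\mathbb C)\subset\mathfrak g_{\mathbf v}$, i.e. to the linear form $\Theta\mapsto(\Theta_a)_{ij}$ under the identification $\mathfrak g_{\mathbf v}\cong\mathfrak g_{\mathbf v}^*$ given by the trace. -/

import Mathlib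

open CategoryTheory DirectSum TensorProduct

set_option linter.unusedSectionVars false
set_option linter.unusedVariables false

noncomputable section

namespace DRepKoszul

/-! ### Differential graded algebras over `ℂ` in non-negative homological degrees -/

/-- A unital associative dg-algebra over `ℂ`, graded by `ℕ`, with a differential of degree `-1`
satisfying the graded Leibniz rule. -/
structure DGAlg where
  carrier : Type
  [ring : Ring carrier]
  [algebra : Algebra ℂ carrier]
  deg : ℕ → Submodule ℂ carrier
  [graded : GradedAlgebra deg]
  d : carrier →ₗ[ℂ] carrier
  d_zero : ∀ a ∈ deg 0, d a = 0
  d_mem : ∀ (p : ℕ), ∀ a ∈ deg (p + 1), d a ∈ deg p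
  d_d : ∀ a, d (d a) = 0
  leibniz : ∀ (p : ℕ), ∀ a ∈ deg p, ∀ b, d (a * b) = d a * b + (-1 : ℂ) ^ p • (a * d b)

attribute [instance] DGAlg.ring DGAlg.algebra DGAlg.graded

/-- Morphisms of dg-algebras: unital algebra maps preserving degrees and differentials. -/
@[ext]
structure DGAlg.Hom (A B : DGAlg) where
  alg : A.carrier →ₐ[ℂ] B.carrier
  map_deg : ∀ (p : ℕ), ∀ a ∈ A.deg p, alg a ∈ B.deg p
  map_d : ∀ a, alg (A.d a) = B.d (alg a)

instance : Category DGAlg where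
  Hom := DGAlg.Hom
  id A := ⟨AlgHom.id ℂ _, fun _ _ h => h, fun _ => rfl⟩
  comp f g := ⟨g.alg.comp f.alg, fun p a h => g.map_deg p _ (f.map_deg p a h),
    fun a => by simp [f.map_d, g.map_d]⟩

@[simp] lemma DGAlg.id_alg (A : DGAlg) : DGAlg.Hom.alg (𝟙 A) = AlgHom.id ℂ _ := rfl
@[simp] lemma DGAlg.comp_alg {A B C : DGAlg} (f : A ⟶ B) (g : B ⟶ C) :
    DGAlg.Hom.alg (f ≫ g) = (DGAlg.Hom.alg g).comp (DGAlg.Hom.alg f) := rfl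

lemma DGAlg.hom_ext {A B : DGAlg} {f g : A ⟶ B}
    (h : ∀ a, DGAlg.Hom.alg f a = DGAlg.Hom.alg g a) : f = g :=
  DGAlg.Hom.ext (AlgHom.ext h)

/-- `n`-cycles. -/
def DGAlg.cycles (A : DGAlg) (n : ℕ) : Submodule ℂ A.carrier := A.deg n ⊓ LinearMap.ker A.d

/-- `n`-boundaries. -/
def DGAlg.boundaries (A : DGAlg) (n : ℕ) : Submodule ℂ A.carrier := (A.deg (n + 1)).map A.d

/-- The homology `H_n(A)`: cycles modulo boundaries. -/
abbrev DGAlg.homology (A : DGAlg) (n : ℕ) : Type :=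
  A.cycles n ⧸ (A.boundaries n).submoduleOf (A.cycles n)

/-- The map induced on cycles. -/
def DGAlg.Hom.cyclesMap {A B : DGAlg} (f : DGAlg.Hom A B) (n : ℕ) :
    A.cycles n →ₗ[ℂ] B.cycles n :=
  f.alg.toLinearMap.restrict fun a ha => ⟨f.map_deg n a ha.1, by
    have h : A.d a = 0 := ha.2
    simp [← f.map_d, h]⟩

/-- The map induced on homology. -/
def DGAlg.Hom.homologyMap {A B : DGAlg} (f : DGAlg.Hom A B) (n : ℕ) :
    A.homology n →ₗ[ℂ] B.homology n :=
  Submodule.mapQ _ _ (f.cyclesMap n) (by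
    rintro ⟨a, ha⟩ ⟨b, hb, hab⟩
    exact ⟨f.alg b, f.map_deg _ _ hb, by rw [← f.map_d, hab]; rfl⟩)

/-! ### The projective model structure: its three classes of maps -/

/-- Weak equivalences of dg-algebras: quasi-isomorphisms. -/
def quasiIso : MorphismProperty DGAlg :=
  fun _ _ f => ∀ n, Function.Bijective (DGAlg.Hom.homologyMap f n)

/-- Fibrations of dg-algebras: maps that are surjective in all strictly positive degrees. -/
def fibration : MorphismProperty DGAlg :=
  fun A B f => ∀ n : ℕ, ∀ b ∈ B.deg (n + 1), ∃ a ∈ A.deg (n + 1), DGAlg.Hom.alg f a = b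

/-- Cofibrations of dg-algebras: the left lifting property with respect to all acyclic
fibrations. -/
def cofibration : MorphismProperty DGAlg := (quasiIso ⊓ fibration).llp

/-- An algebra, viewed as a dg-algebra concentrated in degree `0`. -/
def trivialDeg (A : Type) [Ring A] [Algebra ℂ A] (n : ℕ) : Submodule ℂ A :=
  if n = 0 then ⊤ else ⊥

instance (A : Type) [Ring A] [Algebra ℂ A] : SetLike.GradedMonoid (trivialDeg A) where
  one_mem := by simp [trivialDeg]
  mul_mem := by
    intro i j a b ha hb
    rcases Nat.eq_zero_or_pos i with rfl | hi
    · rcases Nat.eq_zero_or_pos j with rfl | hj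
      · simp [trivialDeg]
      · simp only [trivialDeg, hj.ne', if_false, Submodule.mem_bot] at hb
        simp [hb]
    · simp only [trivialDeg, hi.ne', if_false, Submodule.mem_bot] at ha
      simp [ha]

instance (A : Type) [Ring A] [Algebra ℂ A] : GradedAlgebra (trivialDeg A) where
  toDecomposition := Decomposition.ofLinearMap _
    ((DirectSum.lof ℂ ℕ (fun i => trivialDeg A i) 0).comp
      (LinearMap.codRestrict (trivialDeg A 0) LinearMap.id (by simp [trivialDeg])))
    (by ext a; simp)
    (by
      ext n ⟨a, ha⟩ : 2
      rcases Nat.eq_zero_or_pos n with rfl | hn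
      · simp; rfl
      · have ha' : a = 0 := by simpa [trivialDeg, hn.ne'] using ha
        subst ha'
        have h0 : (⟨0, ha⟩ : trivialDeg A n) = 0 := rfl
        rw [h0]; simp only [map_zero])

/-- An algebra, viewed as a dg-algebra concentrated in degree `0`. -/
def DGAlg.ofAlg (A : Type) [Ring A] [Algebra ℂ A] : DGAlg where
  carrier := A
  deg := trivialDeg A
  d := 0
  d_zero := by simp
  d_mem := by simp
  d_d := by simp
  leibniz := by simp

/-- An algebra map `A → B` with image in degree `0` is a map of dg-algebras from `A`, placed in
degree `0`. -/
def DGAlg.homOfAlg {A : Type} [Ring A] [Algebra ℂ A] (B : DGAlg) (f : A →ₐ[ℂ] B.carrier)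
    (hf : ∀ a, f a ∈ B.deg 0) : DGAlg.ofAlg A ⟶ B where
  alg := f
  map_deg p a ha := by
    rcases Nat.eq_zero_or_pos p with rfl | hp
    · exact hf a
    · have h0 : a = 0 := by
        have ha' : a ∈ trivialDeg A p := ha
        rw [trivialDeg, if_neg hp.ne'] at ha'
        exact (Submodule.mem_bot ℂ).1 ha'
      rw [h0]
      exact (map_zero f).symm ▸ zero_mem _
  map_d a := (map_zero f).trans (B.d_zero _ (hf a)).symm

/-- The category `DGA_S^+` of dg-algebras under the algebra `S` (placed in degree `0`). -/
abbrev DGAUnder (S : Type) [Ring S] [Algebra ℂ S] := Under (DGAlg.ofAlg S)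

section
variable (S : Type) [Ring S] [Algebra ℂ S]

/-- Weak equivalences of `DGA_S^+`: those of the underlying dg-algebras. -/
def quasiIsoUnder : MorphismProperty (DGAUnder S) := quasiIso.inverseImage (Under.forget _)

/-- Fibrations of `DGA_S^+`: those of the underlying dg-algebras. -/
def fibrationUnder : MorphismProperty (DGAUnder S) := fibration.inverseImage (Under.forget _)

/-- Cofibrations of `DGA_S^+`: those of the underlying dg-algebras. -/
def cofibrationUnder : MorphismProperty (DGAUnder S) :=
  cofibration.inverseImage (Under.forget _)
end

/-- `π : X ⟶ Y` exhibits `X` as a cofibrant replacement of `Y` in `DGA_S^+`: the map to `X` from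
the initial object `S` is a cofibration, and `π` is an acyclic fibration. -/
structure IsCofibrantReplacement {S : Type} [Ring S] [Algebra ℂ S] {X Y : DGAUnder S}
    (π : X ⟶ Y) : Prop where
  cofibrant : cofibrationUnder S (Under.mkIdInitial.to X)
  fibration : fibrationUnder S π
  weakEquivalence : quasiIsoUnder S π

/-- Graded commutativity: `a b = (-1)^{|a||b|} b a`. -/
def gradedComm : ObjectProperty DGAlg := fun B =>
  ∀ (p q : ℕ), ∀ a ∈ B.deg p, ∀ b ∈ B.deg q, a * b = (-1 : ℂ) ^ (p * q) • (b * a)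

/-- The category `CDGA^+` of (graded-)commutative dg-algebras. -/
abbrev CDGAlg := gradedComm.FullSubcategory

/-- Weak equivalences of `CDGA^+`: quasi-isomorphisms. -/
def quasiIsoComm : MorphismProperty CDGAlg := quasiIso.inverseImage gradedComm.ι

/-! ### The functor `End(ℂ^n) ⊗ -` -/

section MatrixAlgebra
variable (n : Type) [Fintype n] [DecidableEq n]

/-- Matrices with all entries of degree `p`. -/
def matrixDeg (B : DGAlg) (p : ℕ) : Submodule ℂ (Matrix n n B.carrier) where
  carrier := {M | ∀ i j, M i j ∈ B.deg p}
  add_mem' h h' i j := add_mem (h i j) (h' i j)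
  zero_mem' _ _ := zero_mem _
  smul_mem' c _ h i j := Submodule.smul_mem _ c (h i j)

instance (B : DGAlg) : SetLike.GradedMonoid (matrixDeg n B) where
  one_mem i j := by
    rw [Matrix.one_apply]
    split
    · exact SetLike.GradedOne.one_mem
    · exact zero_mem _
  mul_mem := by
    intro p q M N hM hN i j
    rw [Matrix.mul_apply]
    exact sum_mem fun k _ => SetLike.GradedMul.mul_mem (hM i k) (hN k j)

/-- The elementary matrix with a given entry of degree `p`. -/
def matrixDegSingle (B : DGAlg) (i j : n) (p : ℕ) : B.deg p →ₗ[ℂ] matrixDeg n B p :=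
  ((Matrix.singleLinearMap ℂ i j).comp (B.deg p).subtype).codRestrict _ (by
    intro x k l
    simp only [LinearMap.comp_apply, Submodule.subtype_apply, Matrix.singleLinearMap_apply,
      Matrix.single_apply]
    split
    · exact x.2
    · exact zero_mem _)

/-- The decomposition of a matrix into homogeneous components, entry by entry. -/
def matrixDecompose (B : DGAlg) : Matrix n n B.carrier →ₗ[ℂ] ⨁ p, matrixDeg n B p :=
  ∑ i, ∑ j, ((DirectSum.lmap (matrixDegSingle n B i j)).comp
    (decomposeLinearEquiv B.deg).toLinearMap).comp (Matrix.entryLinearMap ℂ B.carrier i j)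

instance (B : DGAlg) : GradedAlgebra (matrixDeg n B) where
  toDecomposition := Decomposition.ofLinearMap _ (matrixDecompose n B)
    (by
      have key : ∀ i j, (DirectSum.coeLinearMap (matrixDeg n B)).comp
          ((DirectSum.lmap (matrixDegSingle n B i j)).comp
            (decomposeLinearEquiv B.deg).toLinearMap) = Matrix.singleLinearMap ℂ i j := by
        intro i j
        apply DirectSum.decompose_lhom_ext B.deg
        intro p
        ext x : 1
        simp
        rfl
      refine LinearMap.ext fun M => ?_
      simp only [matrixDecompose, LinearMap.comp_apply, LinearMap.sum_apply, map_sum,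
        LinearMap.id_apply]
      conv_rhs => rw [Matrix.matrix_eq_sum_single M]
      refine Finset.sum_congr rfl fun i _ => Finset.sum_congr rfl fun j _ => ?_
      exact LinearMap.congr_fun (key i j) (M i j))
    (by
      ext p M : 2
      simp only [matrixDecompose, LinearMap.comp_apply, LinearMap.sum_apply, LinearMap.id_apply,
        DirectSum.coeLinearMap_lof, Matrix.entryLinearMap_apply, LinearEquiv.coe_coe]
      have : ∀ i j, (decomposeLinearEquiv B.deg) (M.1 i j) =
          DirectSum.lof ℂ ℕ (fun p => B.deg p) p ⟨M.1 i j, M.2 i j⟩ := fun i j =>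
        decompose_of_mem B.deg (M.2 i j)
      simp only [this, DirectSum.lmap_lof, ← map_sum]
      congr 1
      apply Subtype.ext
      simp only [AddSubmonoidClass.coe_finsetSum]
      exact (Matrix.matrix_eq_sum_single M.1).symm)

/-- The dg-algebra `End(ℂ^n) ⊗ B` of matrices over a dg-algebra `B`: here `End(ℂ^n)` sits in
degree `0`, so degrees and differential are computed entry by entry. -/
def matrixDG (B : DGAlg) : DGAlg where
  carrier := Matrix n n B.carrier
  deg := matrixDeg n B
  d := B.d.mapMatrix
  d_zero M hM := by ext i j; exact B.d_zero _ (hM i j)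
  d_mem p M hM i j := B.d_mem p _ (hM i j)
  d_d M := by ext i j; exact B.d_d _
  leibniz p M hM N := by
    ext i j
    simp only [LinearMap.mapMatrix_apply, Matrix.map_apply, Matrix.mul_apply, map_sum,
      Matrix.add_apply, Matrix.smul_apply, Finset.smul_sum, ← Finset.sum_add_distrib]
    exact Finset.sum_congr rfl fun k _ => B.leibniz p _ (hM i k) _

variable {n} {S : Type} [Ring S] [Algebra ℂ S] (ρ : S →ₐ[ℂ] Matrix n n ℂ)

/-- `End(ℂ^n) ⊗ B` as a dg-algebra under `S`, via a representation `ρ` of `S` on `ℂ^n`. -/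
def matrixUnder (B : DGAlg) : DGAUnder S :=
  Under.mk (Y := matrixDG n B) (X := DGAlg.ofAlg S)
    ((matrixDG n B).homOfAlg (((Algebra.ofId ℂ B.carrier).mapMatrix).comp ρ)
      fun s i j => SetLike.algebraMap_mem_graded B.deg (ρ s i j))

/-- The functor `End(ℂ^n) ⊗ - : CDGA^+ ⥤ DGA_S^+`. -/
def matrixFunctor : CDGAlg ⥤ DGAUnder S where
  obj B := matrixUnder ρ B.obj
  map {B C} f := Under.homMk (V := matrixUnder ρ C.obj) (U := matrixUnder ρ B.obj)
    { alg := (DGAlg.Hom.alg f.hom).mapMatrix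
      map_deg := fun p M hM i j => f.hom.map_deg p _ (hM i j)
      map_d := fun M => Matrix.ext fun i j => f.hom.map_d (M i j) }
    (by
      apply DGAlg.hom_ext
      intro s
      apply Matrix.ext
      intro i j
      exact (DGAlg.Hom.alg f.hom).commutes (ρ s i j))
  map_id B := by
    apply Under.UnderMorphism.ext
    apply DGAlg.hom_ext
    intro M
    apply Matrix.ext
    intro i j
    rfl
  map_comp f g := by
    apply Under.UnderMorphism.ext
    apply DGAlg.hom_ext
    intro M
    apply Matrix.ext
    intro i j
    rfl

end MatrixAlgebra

/-! ### The representation functor `(-)_V`, left adjoint to `End(V) ⊗ -` -/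

section Sign

/-- The parity involution `a ↦ (-1)^{|a|} a`, as a linear map. -/
def DGAlg.sign (A : DGAlg) : A.carrier →ₗ[ℂ] A.carrier :=
  (DirectSum.toModule ℂ ℕ A.carrier fun p => (-1 : ℂ) ^ p • (A.deg p).subtype).comp
    (decomposeLinearEquiv A.deg).toLinearMap

lemma DGAlg.sign_of_mem (A : DGAlg) {p : ℕ} {a : A.carrier} (ha : a ∈ A.deg p) :
    A.sign a = (-1 : ℂ) ^ p • a := by
  have : decomposeLinearEquiv A.deg a = DirectSum.lof ℂ ℕ (fun p => A.deg p) p ⟨a, ha⟩ :=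
    decompose_of_mem A.deg ha
  simp only [DGAlg.sign, LinearMap.comp_apply, LinearEquiv.coe_coe, this,
    DirectSum.toModule_lof]
  rfl

/-- Induction on homogeneous elements. -/
lemma DGAlg.induction (A : DGAlg) {P : A.carrier → Prop}
    (hom : ∀ p, ∀ a ∈ A.deg p, P a) (add : ∀ a b, P a → P b → P (a + b)) (a : A.carrier) : P a :=
  Decomposition.inductionOn A.deg (hom 0 0 (zero_mem _)) (fun a => hom _ a.1 a.2)
    (fun a b => add a b) a

lemma DGAlg.sign_mul (A : DGAlg) (a b : A.carrier) : A.sign (a * b) = A.sign a * A.sign b := by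
  refine A.induction (P := fun a => A.sign (a * b) = A.sign a * A.sign b) ?_ ?_ a
  · intro p a ha
    refine A.induction (P := fun b => A.sign (a * b) = A.sign a * A.sign b) ?_ ?_ b
    · intro q b hb
      rw [A.sign_of_mem ha, A.sign_of_mem hb, A.sign_of_mem (SetLike.GradedMul.mul_mem ha hb)]
      simp [smul_smul, pow_add, mul_comm]
    · intro b c hb hc
      simp only [mul_add, map_add, hb, hc]
  · intro b c hb hc
    simp only [add_mul, map_add, hb, hc]

lemma DGAlg.leibniz' (A : DGAlg) (a b : A.carrier) :
    A.d (a * b) = A.d a * b + A.sign a * A.d b := by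
  refine A.induction (P := fun a => A.d (a * b) = A.d a * b + A.sign a * A.d b) ?_ ?_ a
  · intro p a ha
    rw [A.leibniz p a ha, A.sign_of_mem ha, smul_mul_assoc]
  · intro a c ha hc
    simp only [add_mul, map_add, ha, hc]
    abel

end Sign

section Rep
variable {n : Type} [Fintype n] [DecidableEq n] {S : Type} [Ring S] [Algebra ℂ S]
  (ρ : S →ₐ[ℂ] Matrix n n ℂ) (A : DGAUnder S)

/-- The structure map `S → A` of an object of `DGA_S^+`. -/
abbrev structMap : S →ₐ[ℂ] A.right.carrier := DGAlg.Hom.alg A.hom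

lemma structMap_mem (s : S) : structMap A s ∈ A.right.deg 0 :=
  A.hom.map_deg 0 s (by
    change s ∈ trivialDeg S 0
    rw [trivialDeg, if_pos rfl]; trivial)

open FreeAlgebra in
/-- The relations between the matrix entries `a_{ij}` of a universal representation
`a ↦ (a_{ij})` of `A` on `ℂ^n`, compatible with `ρ` and with values in a graded-commutative
algebra. -/
inductive RepRel : FreeAlgebra ℂ (A.right.carrier × n × n) →
    FreeAlgebra ℂ (A.right.carrier × n × n) → Prop
  | add (a b : A.right.carrier) (i j : n) :
      RepRel (ι ℂ (a + b, i, j)) (ι ℂ (a, i, j) + ι ℂ (b, i, j))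
  | smul (c : ℂ) (a : A.right.carrier) (i j : n) :
      RepRel (ι ℂ (c • a, i, j)) (c • ι ℂ (a, i, j))
  | mul (a b : A.right.carrier) (i j : n) :
      RepRel (ι ℂ (a * b, i, j)) (∑ k, ι ℂ (a, i, k) * ι ℂ (b, k, j))
  | base (s : S) (i j : n) :
      RepRel (ι ℂ (structMap A s, i, j)) (algebraMap ℂ _ (ρ s i j))
  | comm (p q : ℕ) (a b : A.right.carrier) (ha : a ∈ A.right.deg p) (hb : b ∈ A.right.deg q)
      (i j k l : n) :
      RepRel (ι ℂ (a, i, j) * ι ℂ (b, k, l))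
        ((-1 : ℂ) ^ (p * q) • (ι ℂ (b, k, l) * ι ℂ (a, i, j)))

/-- The underlying algebra of `A_V`: the graded-commutative algebra generated by the matrix
entries `a_{ij}` of a universal representation of `A`. -/
def RepAlg : Type := RingQuot (RepRel ρ A)

instance : Ring (RepAlg ρ A) := inferInstanceAs (Ring (RingQuot (RepRel ρ A)))
instance : Algebra ℂ (RepAlg ρ A) := inferInstanceAs (Algebra ℂ (RingQuot (RepRel ρ A)))

/-- The quotient map defining `A_V`. -/
def repMk : FreeAlgebra ℂ (A.right.carrier × n × n) →ₐ[ℂ] RepAlg ρ A :=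
  RingQuot.mkAlgHom ℂ (RepRel ρ A)

variable {A} in
lemma repMk_rel {x y} (h : RepRel ρ A x y) : repMk ρ A x = repMk ρ A y :=
  RingQuot.mkAlgHom_rel ℂ h

/-- The generator `a_{ij}`, linear in `a`. -/
def repGen (i j : n) : A.right.carrier →ₗ[ℂ] RepAlg ρ A where
  toFun a := repMk ρ A (FreeAlgebra.ι ℂ (a, i, j))
  map_add' a b := by rw [repMk_rel ρ (.add a b i j), map_add]
  map_smul' c a := by rw [repMk_rel ρ (.smul c a i j), map_smul]; rfl

lemma repGen_mul (a b : A.right.carrier) (i j : n) :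
    repGen ρ A i j (a * b) = ∑ k, repGen ρ A i k a * repGen ρ A k j b := by
  refine (repMk_rel ρ (.mul a b i j)).trans ?_
  rw [map_sum]
  exact Finset.sum_congr rfl fun k _ => map_mul _ _ _

lemma repGen_base (s : S) (i j : n) :
    repGen ρ A i j (structMap A s) = algebraMap ℂ _ (ρ s i j) :=
  (repMk_rel ρ (.base s i j)).trans (AlgHom.commutes _ _)

lemma repGen_one (i j : n) : repGen ρ A i j 1 = (1 : Matrix n n (RepAlg ρ A)) i j := by
  rw [← map_one (structMap A), repGen_base, map_one, Matrix.one_apply, Matrix.one_apply]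
  split <;> simp

lemma repGen_comm {p q : ℕ} {a b : A.right.carrier} (ha : a ∈ A.right.deg p)
    (hb : b ∈ A.right.deg q) (i j k l : n) :
    repGen ρ A i j a * repGen ρ A k l b =
      (-1 : ℂ) ^ (p * q) • (repGen ρ A k l b * repGen ρ A i j a) := by
  have h := repMk_rel ρ (.comm p q a b ha hb i j k l)
  rw [map_mul, map_smul, map_mul] at h
  exact h

/-- The universal representation `a ↦ (a_{ij})`. -/
def repUniv : A.right.carrier →ₐ[ℂ] Matrix n n (RepAlg ρ A) :=
  AlgHom.ofLinearMap
    { toFun := fun a => Matrix.of fun i j => repGen ρ A i j a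
      map_add' := fun a b => by ext i j; simp
      map_smul' := fun c a => by ext i j; simp }
    (by ext i j; exact repGen_one ρ A i j)
    (fun a b => by ext i j; simpa [Matrix.mul_apply] using repGen_mul ρ A a b i j)

/-- The universal property of `A_V` as an algebra. -/
def repLift {C : Type} [Ring C] [Algebra ℂ C] (f : A.right.carrier →ₐ[ℂ] Matrix n n C)
    (hbase : ∀ s i j, f (structMap A s) i j = algebraMap ℂ C (ρ s i j))
    (hcomm : ∀ (p q : ℕ), ∀ a ∈ A.right.deg p, ∀ b ∈ A.right.deg q, ∀ i j k l,
      f a i j * f b k l = (-1 : ℂ) ^ (p * q) • (f b k l * f a i j)) :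
    RepAlg ρ A →ₐ[ℂ] C :=
  RingQuot.liftAlgHom ℂ ⟨FreeAlgebra.lift ℂ fun x => f x.1 x.2.1 x.2.2, by
    intro x y h
    cases h with
    | add a b i j => simp
    | smul c a i j => simp
    | mul a b i j => simp [Matrix.mul_apply]
    | base s i j => simpa using hbase s i j
    | comm p q a b ha hb i j k l => simpa using hcomm p q a ha b hb i j k l⟩

@[simp] lemma repLift_gen {C : Type} [Ring C] [Algebra ℂ C]
    (f : A.right.carrier →ₐ[ℂ] Matrix n n C) (h1) (h2) (i j : n) (a : A.right.carrier) :
    repLift ρ A f h1 h2 (repGen ρ A i j a) = f a i j := by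
  refine (RingQuot.liftAlgHom_mkAlgHom_apply ..).trans ?_
  rw [FreeAlgebra.lift_ι_apply]

/-- Monomials of degree `m` in homogeneous generators. -/
inductive RepMono : ℕ → RepAlg ρ A → Prop
  | one : RepMono 0 1
  | mul {p m : ℕ} {a : A.right.carrier} {r : RepAlg ρ A} (ha : a ∈ A.right.deg p) (i j : n)
      (hr : RepMono m r) : RepMono (p + m) (repGen ρ A i j a * r)

variable {ρ A} in
lemma RepMono.mul_mono {m l : ℕ} {r s : RepAlg ρ A} (hr : RepMono ρ A m r)
    (hs : RepMono ρ A l s) : RepMono ρ A (m + l) (r * s) := by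
  induction hr with
  | one => simpa using hs
  | mul ha i j _ ih => rw [mul_assoc, add_assoc]; exact .mul ha i j ih

/-- The degree-`m` part of `A_V`, spanned by the monomials of degree `m`. -/
def repDeg (m : ℕ) : Submodule ℂ (RepAlg ρ A) := Submodule.span ℂ {r | RepMono ρ A m r}

variable {A} in
lemma repGen_mem {p : ℕ} {a : A.right.carrier} (ha : a ∈ A.right.deg p) (i j : n) :
    repGen ρ A i j a ∈ repDeg ρ A p := by
  have := Submodule.subset_span (R := ℂ) (show _ ∈ {r | RepMono ρ A (p + 0) r} from
    RepMono.mul ha i j .one)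
  simpa [repDeg] using this

instance : SetLike.GradedMonoid (repDeg ρ A) where
  one_mem := Submodule.subset_span .one
  mul_mem := by
    intro m l r s hr hs
    have h : repDeg ρ A m * repDeg ρ A l ≤ repDeg ρ A (m + l) := by
      rw [repDeg, repDeg, Submodule.span_mul_span, Submodule.span_le]
      rintro _ ⟨x, hx, y, hy, rfl⟩
      exact Submodule.subset_span (hx.mul_mono hy)
    exact h (Submodule.mul_mem_mul hr hs)

lemma repMono_induction {P : RepAlg ρ A → Prop} (mono : ∀ m r, RepMono ρ A m r → P r)
    (add : ∀ r s, P r → P s → P (r + s)) (smul : ∀ (c : ℂ) r, P r → P (c • r))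
    (r : RepAlg ρ A) : P r := by
  have key : ∀ r, r ∈ Submodule.span ℂ {r | ∃ m, RepMono ρ A m r} := by
    intro r
    obtain ⟨x, rfl⟩ : ∃ x, repMk ρ A x = r := RingQuot.mkAlgHom_surjective ℂ (RepRel ρ A) r
    have hmul : ∀ r s, r ∈ Submodule.span ℂ {r | ∃ m, RepMono ρ A m r} →
        s ∈ Submodule.span ℂ {r | ∃ m, RepMono ρ A m r} →
        r * s ∈ Submodule.span ℂ {r | ∃ m, RepMono ρ A m r} := by
      intro r s hr hs
      have h : Submodule.span ℂ {r | ∃ m, RepMono ρ A m r} *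
          Submodule.span ℂ {r | ∃ m, RepMono ρ A m r} ≤
          Submodule.span ℂ {r | ∃ m, RepMono ρ A m r} := by
        rw [Submodule.span_mul_span, Submodule.span_le]
        rintro _ ⟨x, ⟨m, hx⟩, y, ⟨l, hy⟩, rfl⟩
        exact Submodule.subset_span ⟨_, hx.mul_mono hy⟩
      exact h (Submodule.mul_mem_mul hr hs)
    induction x using FreeAlgebra.induction with
    | grade0 c =>
      rw [AlgHom.commutes, Algebra.algebraMap_eq_smul_one]
      exact Submodule.smul_mem _ _ (Submodule.subset_span ⟨0, .one⟩)
    | grade1 x =>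
      obtain ⟨a, i, j⟩ := x
      change repGen ρ A i j a ∈ _
      refine A.right.induction (P := fun a => repGen ρ A i j a ∈
        Submodule.span ℂ {r | ∃ m, RepMono ρ A m r}) ?_ ?_ a
      · intro p a ha
        refine Submodule.subset_span ⟨p + 0, ?_⟩
        simpa using RepMono.mul (ρ := ρ) ha i j .one
      · intro a b ha hb
        rw [map_add]
        exact add_mem ha hb
    | mul x y hx hy => rw [map_mul]; exact hmul _ _ hx hy
    | add x y hx hy => rw [map_add]; exact add_mem hx hy
  refine Submodule.span_induction (p := fun r _ => P r) ?_ ?_ ?_ ?_ (key r)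
  · rintro r ⟨m, hr⟩
    exact mono m r hr
  · simpa using smul 0 1 (mono 0 1 .one)
  · exact fun r s _ _ => add r s
  · exact fun c r _ => smul c r

/-- Two algebra maps out of `A_V` agreeing on generators are equal. -/
lemma rep_algHom_ext {C : Type} [Semiring C] [Algebra ℂ C] {f g : RepAlg ρ A →ₐ[ℂ] C}
    (h : ∀ i j a, f (repGen ρ A i j a) = g (repGen ρ A i j a)) : f = g := by
  refine RingQuot.ringQuot_ext' ℂ _ _ ?_
  ext ⟨a, i, j⟩
  exact h i j a

lemma of_congr {R : Type} [AddCommMonoid R] [Module ℂ R] {𝒜 : ℕ → Submodule ℂ R} {p q : ℕ}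
    (h : p = q) (x : 𝒜 p) (y : 𝒜 q) (hxy : (x : R) = y) :
    DirectSum.of (fun i => 𝒜 i) p x = DirectSum.of (fun i => 𝒜 i) q y := by
  subst h
  rw [Subtype.ext hxy]

/-- The generator `a_{ij}` for `a` of degree `p`, in degree `p`. -/
def repGenDeg (i j : n) (p : ℕ) : A.right.deg p →ₗ[ℂ] repDeg ρ A p :=
  ((repGen ρ A i j).comp (A.right.deg p).subtype).codRestrict _ fun a => repGen_mem ρ a.2 i j

/-- The homogeneous components of `a_{ij}`. -/
def repGenSum (i j : n) : A.right.carrier →ₗ[ℂ] ⨁ p, repDeg ρ A p :=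
  (DirectSum.lmap (repGenDeg ρ A i j)).comp (decomposeLinearEquiv A.right.deg).toLinearMap

lemma repGenSum_of_mem {p : ℕ} {a : A.right.carrier} (ha : a ∈ A.right.deg p) (i j : n) :
    repGenSum ρ A i j a =
      DirectSum.of (fun p => repDeg ρ A p) p ⟨repGen ρ A i j a, repGen_mem ρ ha i j⟩ := by
  have : decomposeLinearEquiv A.right.deg a =
      DirectSum.lof ℂ ℕ (fun p => A.right.deg p) p ⟨a, ha⟩ := decompose_of_mem A.right.deg ha
  simp only [repGenSum, LinearMap.comp_apply, LinearEquiv.coe_coe, this, DirectSum.lmap_lof]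
  rfl

lemma repGenSum_mul (a b : A.right.carrier) (i j : n) :
    repGenSum ρ A i j (a * b) = ∑ k, repGenSum ρ A i k a * repGenSum ρ A k j b := by
  refine A.right.induction (P := fun a => repGenSum ρ A i j (a * b) =
    ∑ k, repGenSum ρ A i k a * repGenSum ρ A k j b) ?_ ?_ a
  · intro p a ha
    refine A.right.induction (P := fun b => repGenSum ρ A i j (a * b) =
      ∑ k, repGenSum ρ A i k a * repGenSum ρ A k j b) ?_ ?_ b
    · intro q b hb
      rw [repGenSum_of_mem ρ A (SetLike.GradedMul.mul_mem ha hb)]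
      simp only [repGenSum_of_mem ρ A ha, repGenSum_of_mem ρ A hb, DirectSum.of_mul_of]
      rw [← map_sum]
      refine of_congr rfl _ _ ?_
      rw [AddSubmonoidClass.coe_finsetSum]
      exact repGen_mul ρ A a b i j
    · intro b c hb hc
      simp only [mul_add, map_add, hb, hc, Finset.sum_add_distrib]
  · intro b c hb hc
    simp only [add_mul, map_add, hb, hc, Finset.sum_add_distrib]

lemma repGenSum_base (s : S) (i j : n) :
    repGenSum ρ A i j (structMap A s) = algebraMap ℂ _ (ρ s i j) := by
  rw [repGenSum_of_mem ρ A (structMap_mem A s), DirectSum.algebraMap_apply]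
  exact of_congr rfl _ _ (repGen_base ρ A s i j)

lemma repGenSum_one (i j : n) :
    repGenSum ρ A i j 1 = (1 : Matrix n n (⨁ p, repDeg ρ A p)) i j := by
  rw [← map_one (structMap A), repGenSum_base, map_one, Matrix.one_apply, Matrix.one_apply]
  split
  · exact map_one _
  · exact map_zero _

/-- The decomposition of `A_V` into homogeneous components. -/
def repDecompose : RepAlg ρ A →ₐ[ℂ] ⨁ p, repDeg ρ A p :=
  repLift ρ A
    (AlgHom.ofLinearMap
      { toFun := fun a => Matrix.of fun i j => repGenSum ρ A i j a
        map_add' := fun a b => by ext1 i j; simp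
        map_smul' := fun c a => by ext1 i j; simp }
      (by
        ext1 i j
        exact repGenSum_one ρ A i j)
      (fun a b => by ext1 i j; simpa [Matrix.mul_apply] using repGenSum_mul ρ A a b i j))
    (fun s i j => repGenSum_base ρ A s i j)
    (by
      intro p q a ha b hb i j k l
      change repGenSum ρ A i j a * repGenSum ρ A k l b =
        (-1 : ℂ) ^ (p * q) • (repGenSum ρ A k l b * repGenSum ρ A i j a)
      simp only [repGenSum_of_mem ρ A ha, repGenSum_of_mem ρ A hb, DirectSum.of_mul_of]
      refine (of_congr (add_comm p q) _ ((-1 : ℂ) ^ (p * q) •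
        (⟨repGen ρ A k l b * repGen ρ A i j a, SetLike.GradedMul.mul_mem
          (repGen_mem ρ hb k l) (repGen_mem ρ ha i j)⟩ : repDeg ρ A (q + p))) ?_).trans ?_
      · exact repGen_comm ρ A ha hb i j k l
      · exact map_smul (DirectSum.lof ℂ ℕ (fun p => repDeg ρ A p) (q + p)) _ _)

lemma repDecompose_gen {p : ℕ} {a : A.right.carrier} (ha : a ∈ A.right.deg p) (i j : n) :
    repDecompose ρ A (repGen ρ A i j a) =
      DirectSum.of (fun p => repDeg ρ A p) p ⟨repGen ρ A i j a, repGen_mem ρ ha i j⟩ :=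
  (repLift_gen ..).trans (repGenSum_of_mem ρ A ha i j)

lemma repDecompose_mono {m : ℕ} {r : RepAlg ρ A} (hr : RepMono ρ A m r) :
    repDecompose ρ A r =
      DirectSum.of (fun p => repDeg ρ A p) m ⟨r, Submodule.subset_span hr⟩ := by
  induction hr with
  | one => rw [map_one]; rfl
  | mul ha i j _ ih =>
    rw [map_mul, ih, repDecompose_gen ρ A ha, DirectSum.of_mul_of]
    rfl

instance : GradedAlgebra (repDeg ρ A) :=
  GradedAlgebra.ofAlgHom _ (repDecompose ρ A)
    (by
      refine rep_algHom_ext ρ A fun i j a => ?_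
      refine A.right.induction (P := fun a => (DirectSum.coeAlgHom (repDeg ρ A)).comp
        (repDecompose ρ A) (repGen ρ A i j a) = repGen ρ A i j a) ?_ ?_ a
      · intro p a ha
        rw [AlgHom.comp_apply, repDecompose_gen ρ A ha, DirectSum.coeAlgHom_of]
      · intro a b ha hb
        rw [map_add, map_add, ha, hb])
    (by
      rintro m ⟨r, hr⟩
      refine Submodule.span_induction (p := fun r hr => repDecompose ρ A r =
        DirectSum.of (fun p => repDeg ρ A p) m ⟨r, hr⟩) ?_ ?_ ?_ ?_ hr
      · intro r hr
        exact repDecompose_mono ρ A hr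
      · rw [map_zero]
        exact (map_zero (DirectSum.of (fun p => repDeg ρ A p) m)).symm
      · intro r s hr hs h1 h2
        rw [map_add, h1, h2, ← map_add]
        rfl
      · intro c r hr h
        rw [map_smul, h, ← DirectSum.of_smul]
        rfl)

end Rep

section Rep
variable {n : Type} [Fintype n] [DecidableEq n] {S : Type} [Ring S] [Algebra ℂ S]
  (ρ : S →ₐ[ℂ] Matrix n n ℂ) (A : DGAUnder S)

lemma d_repGen_mem {p : ℕ} {a : A.right.carrier} (ha : a ∈ A.right.deg (p + 1)) (i j : n) :
    repGen ρ A i j (A.right.d a) ∈ repDeg ρ A p :=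
  repGen_mem ρ (A.right.d_mem p a ha) i j

/-- `x * y = ± y * x` for homogeneous elements of `A_V`. -/
lemma repAlg_comm (p q : ℕ) (x : RepAlg ρ A) (hx : x ∈ repDeg ρ A p) (y : RepAlg ρ A)
    (hy : y ∈ repDeg ρ A q) : x * y = (-1 : ℂ) ^ (p * q) • (y * x) := by
  have key : ∀ (q : ℕ) (y : RepAlg ρ A), RepMono ρ A q y → ∀ (p : ℕ) (x : RepAlg ρ A),
      RepMono ρ A p x → x * y = (-1 : ℂ) ^ (p * q) • (y * x) := by
    have one : ∀ (p : ℕ) (x : RepAlg ρ A), RepMono ρ A p x → ∀ (q : ℕ) (b : A.right.carrier),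
        b ∈ A.right.deg q → ∀ k l,
        x * repGen ρ A k l b = (-1 : ℂ) ^ (p * q) • (repGen ρ A k l b * x) := by
      intro p x hx q b hb k l
      induction hx with
      | one => simp
      | mul ha i j _ ih =>
        rw [mul_assoc, ih, mul_smul_comm, ← mul_assoc, repGen_comm ρ A ha hb, smul_mul_assoc,
          smul_smul, mul_assoc, add_mul, pow_add, mul_comm]
    intro q y hy p x hx
    induction hy with
    | one => simp
    | @mul q m b r hb k l _ ih =>
      rw [← mul_assoc, one p x hx _ _ hb, smul_mul_assoc, mul_assoc, ih, mul_smul_comm,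
        smul_smul, ← mul_assoc, mul_add, pow_add]
  refine Submodule.span_induction (p := fun x _ => x * y = (-1 : ℂ) ^ (p * q) • (y * x))
    ?_ ?_ ?_ ?_ hx
  · intro x hx
    refine Submodule.span_induction (p := fun y _ => x * y = (-1 : ℂ) ^ (p * q) • (y * x))
      ?_ ?_ ?_ ?_ hy
    · exact fun y hy => key q y hy p x hx
    · simp
    · intro y z _ _ h1 h2
      rw [mul_add, add_mul, h1, h2, smul_add]
    · intro c y _ h
      rw [mul_smul_comm, smul_mul_assoc, h, smul_comm]
  · simp
  · intro x z _ _ h1 h2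
    rw [mul_add, add_mul, h1, h2, smul_add]
  · intro c x _ h
    rw [mul_smul_comm, smul_mul_assoc, h, smul_comm]

/-- The triangular matrix `(x, y; 0, z)`. -/
def tri {R : Type} [Ring R] (x y z : R) : Matrix (Fin 2) (Fin 2) R := !![x, y; 0, z]

section Tri
variable {R : Type} [Ring R]

lemma tri_mul (x y z x' y' z' : R) :
    tri x y z * tri x' y' z' = tri (x * x') (x * y' + y * z') (z * z') := by
  simp [tri]

lemma tri_add (x y z x' y' z' : R) :
    tri x y z + tri x' y' z' = tri (x + x') (y + y') (z + z') := by
  simp [tri]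

lemma tri_smul [Algebra ℂ R] (c : ℂ) (x y z : R) : c • tri x y z = tri (c • x) (c • y) (c • z) := by
  simp [tri]

lemma tri_sum {κ : Type} (s : Finset κ) (x y z : κ → R) :
    ∑ k ∈ s, tri (x k) (y k) (z k) = tri (∑ k ∈ s, x k) (∑ k ∈ s, y k) (∑ k ∈ s, z k) := by
  classical
  induction s using Finset.induction_on with
  | empty => ext i j; fin_cases i <;> fin_cases j <;> rfl
  | insert a s ha ih => simp only [Finset.sum_insert ha, ih, tri_add]

lemma tri_algebraMap [Algebra ℂ R] (c : ℂ) :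
    algebraMap ℂ (Matrix (Fin 2) (Fin 2) R) c = tri (algebraMap ℂ R c) 0 (algebraMap ℂ R c) := by
  ext i j
  fin_cases i <;> fin_cases j <;> simp [tri, Matrix.algebraMap_matrix_apply]
end Tri

lemma repTri_base (s : S) (i j : n) :
    tri (repGen ρ A i j (A.right.sign (structMap A s)))
      (repGen ρ A i j (A.right.d (structMap A s))) (repGen ρ A i j (structMap A s)) =
      algebraMap ℂ _ (ρ s i j) := by
  have hs := structMap_mem A s
  rw [A.right.sign_of_mem hs, A.right.d_zero _ hs, pow_zero, one_smul, map_zero, repGen_base,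
    tri_algebraMap]

/-- The algebra map `A → M_n(M_2(A_V))` sending `a` to the matrices
`(± a_{ij}, (da)_{ij}; 0, a_{ij})`. -/
def repTriHom : A.right.carrier →ₐ[ℂ] Matrix n n (Matrix (Fin 2) (Fin 2) (RepAlg ρ A)) :=
  AlgHom.ofLinearMap
    { toFun := fun a => Matrix.of fun i j =>
        tri (repGen ρ A i j (A.right.sign a)) (repGen ρ A i j (A.right.d a)) (repGen ρ A i j a)
      map_add' := fun a b => by
        ext1 i j
        simp only [Matrix.of_apply, Matrix.add_apply, map_add, tri_add]
      map_smul' := fun c a => by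
        ext1 i j
        simp only [Matrix.of_apply, Matrix.smul_apply, map_smul, tri_smul, RingHom.id_apply] }
    (by
      ext1 i j
      have h := repTri_base ρ A 1 i j
      simp only [map_one] at h
      refine h.trans ?_
      rw [Matrix.one_apply, Matrix.one_apply]
      split
      · exact map_one _
      · exact map_zero _)
    (by
      intro a b
      ext1 i j
      simp only [LinearMap.coe_mk, AddHom.coe_mk, Matrix.of_apply, Matrix.mul_apply, tri_mul,
        tri_sum, A.right.sign_mul, A.right.leibniz', map_add, repGen_mul,
        Finset.sum_add_distrib]
      rw [add_comm])

lemma repTriHom_apply (a : A.right.carrier) (i j : n) : repTriHom ρ A a i j =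
    tri (repGen ρ A i j (A.right.sign a)) (repGen ρ A i j (A.right.d a)) (repGen ρ A i j a) := rfl

/-- The algebra map `A_V → M_2(A_V)`, `r ↦ (± r, dr; 0, r)`, from which the differential of
`A_V` is read off. -/
def repTri : RepAlg ρ A →ₐ[ℂ] Matrix (Fin 2) (Fin 2) (RepAlg ρ A) :=
  repLift ρ A (repTriHom ρ A) (fun s i j => repTri_base ρ A s i j)
    (by
      intro p q a ha b hb i j k l
      have h0 := repGen_comm ρ A ha hb i j k l
      have hd : (-1 : ℂ) ^ p • (repGen ρ A i j a * repGen ρ A k l (A.right.d b)) =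
          (-1 : ℂ) ^ (p * q) • (repGen ρ A k l (A.right.d b) * repGen ρ A i j a) := by
        rcases q with _ | q
        · simp [A.right.d_zero b hb]
        · rw [repGen_comm ρ A ha (A.right.d_mem q b hb), smul_smul, mul_add, mul_one, pow_add,
            mul_comm]
      have hd' : repGen ρ A i j (A.right.d a) * repGen ρ A k l b =
          (-1 : ℂ) ^ (p * q) • ((-1 : ℂ) ^ q •
            (repGen ρ A k l b * repGen ρ A i j (A.right.d a))) := by
        rcases p with _ | p
        · simp [A.right.d_zero a ha]
        · rw [repGen_comm ρ A (A.right.d_mem p a ha) hb, smul_smul, add_mul, one_mul, pow_add,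
            mul_assoc, ← mul_pow]
          simp
      simp only [repTriHom_apply, A.right.sign_of_mem ha, A.right.sign_of_mem hb, tri_mul,
        tri_smul, map_smul, smul_mul_assoc, mul_smul_comm]
      congr 1
      · rw [h0, smul_comm ((-1 : ℂ) ^ q), smul_comm ((-1 : ℂ) ^ q),
          smul_comm ((-1 : ℂ) ^ p) ((-1 : ℂ) ^ (p * q))]
      · rw [hd, hd', smul_add, add_comm])

@[simp] lemma repTri_gen (a : A.right.carrier) (i j : n) : repTri ρ A (repGen ρ A i j a) =
    !![repGen ρ A i j (A.right.sign a), repGen ρ A i j (A.right.d a); 0, repGen ρ A i j a] :=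
  repLift_gen ρ A (repTriHom ρ A) _ _ i j a

/-- The differential of `A_V`, determined by `d(a_{ij}) = (da)_{ij}` and the Leibniz rule. -/
def repD : RepAlg ρ A →ₗ[ℂ] RepAlg ρ A :=
  (Matrix.entryLinearMap ℂ (RepAlg ρ A) (0 : Fin 2) (1 : Fin 2)).comp (repTri ρ A).toLinearMap

lemma repD_apply (r : RepAlg ρ A) : repD ρ A r = repTri ρ A r 0 1 := rfl

lemma repD_gen (a : A.right.carrier) (i j : n) :
    repD ρ A (repGen ρ A i j a) = repGen ρ A i j (A.right.d a) := by
  simp [repD_apply]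

lemma repD_one : repD ρ A 1 = 0 := by simp [repD_apply]

lemma repTri_mono {m : ℕ} {r : RepAlg ρ A} (hr : RepMono ρ A m r) :
    repTri ρ A r 0 0 = (-1 : ℂ) ^ m • r ∧ repTri ρ A r 1 0 = 0 ∧ repTri ρ A r 1 1 = r := by
  induction hr with
  | one => simp
  | @mul p m a r ha i j _ ih =>
    obtain ⟨h1, h2, h3⟩ := ih
    simp [Matrix.mul_apply, Fin.sum_univ_two, h1, h2, h3, A.right.sign_of_mem ha, pow_add,
      smul_smul, mul_comm]

lemma repTri_lower (r : RepAlg ρ A) : repTri ρ A r 1 0 = 0 ∧ repTri ρ A r 1 1 = r := by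
  refine repMono_induction ρ A (P := fun r => repTri ρ A r 1 0 = 0 ∧ repTri ρ A r 1 1 = r)
    (fun m r hr => (repTri_mono ρ A hr).2) ?_ ?_ r
  · rintro r s ⟨h1, h2⟩ ⟨h3, h4⟩
    simp [h1, h2, h3, h4]
  · rintro c r ⟨h1, h2⟩
    simp [h1, h2]

lemma repTri_sign {m : ℕ} {r : RepAlg ρ A} (hr : r ∈ repDeg ρ A m) :
    repTri ρ A r 0 0 = (-1 : ℂ) ^ m • r := by
  refine Submodule.span_induction (p := fun r _ => repTri ρ A r 0 0 = (-1 : ℂ) ^ m • r)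
    (fun r hr => (repTri_mono ρ A hr).1) ?_ ?_ ?_ hr
  · simp
  · intro r s _ _ h1 h2
    simp [h1, h2]
  · intro c r _ h
    simp [h, smul_comm c]

lemma repD_leibniz (p : ℕ) (r : RepAlg ρ A) (hr : r ∈ repDeg ρ A p) (s : RepAlg ρ A) :
    repD ρ A (r * s) = repD ρ A r * s + (-1 : ℂ) ^ p • (r * repD ρ A s) := by
  simp only [repD_apply, map_mul, Matrix.mul_apply, Fin.sum_univ_two, repTri_sign ρ A hr,
    (repTri_lower ρ A s).2, smul_mul_assoc]
  exact add_comm _ _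

lemma repD_mono_zero {m : ℕ} {r : RepAlg ρ A} (hr : RepMono ρ A m r) :
    (m = 0 → repD ρ A r = 0) ∧ (∀ k, m = k + 1 → repD ρ A r ∈ repDeg ρ A k) := by
  induction hr with
  | one => exact ⟨fun _ => repD_one ρ A, fun k h => absurd h (by omega)⟩
  | @mul p m a r ha i j hr ih =>
    have hr' : r ∈ repDeg ρ A m := Submodule.subset_span hr
    rw [repD_leibniz ρ A p _ (repGen_mem ρ ha i j), repD_gen]
    constructor
    · intro h
      obtain ⟨rfl, rfl⟩ : p = 0 ∧ m = 0 := by omega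
      simp [A.right.d_zero a ha, ih.1 rfl]
    · intro k hk
      refine add_mem ?_ (Submodule.smul_mem _ _ ?_)
      · rcases p with _ | p
        · simp [A.right.d_zero a ha]
        · obtain rfl : k = p + m := by omega
          exact SetLike.GradedMul.mul_mem (d_repGen_mem ρ A ha i j) hr'
      · rcases m with _ | m
        · simp [ih.1 rfl]
        · obtain rfl : k = p + m := by omega
          exact SetLike.GradedMul.mul_mem (repGen_mem ρ ha i j) (ih.2 m rfl)

lemma repD_repD_mono {m : ℕ} {r : RepAlg ρ A} (hr : RepMono ρ A m r) :
    repD ρ A (repD ρ A r) = 0 := by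
  induction hr with
  | one => simp [repD_one]
  | @mul p m a r ha i j hr ih =>
    rw [repD_leibniz ρ A p _ (repGen_mem ρ ha i j), repD_gen, map_add, map_smul,
      repD_leibniz ρ A p _ (repGen_mem ρ ha i j), ih, repD_gen]
    rcases p with _ | p
    · simp [A.right.d_zero a ha]
    · rw [repD_leibniz ρ A p _ (d_repGen_mem ρ A ha i j), repD_gen, A.right.d_d]
      simp [pow_succ]

/-- The dg-algebra `A_V`. -/
def repDG : DGAlg where
  carrier := RepAlg ρ A
  deg := repDeg ρ A
  d := repD ρ A
  d_zero r hr := by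
    refine Submodule.span_induction (p := fun r _ => repD ρ A r = 0)
      (fun r hr => (repD_mono_zero ρ A hr).1 rfl) (map_zero _) ?_ ?_ hr
    · intro r s _ _ h1 h2; rw [map_add, h1, h2, add_zero]
    · intro c r _ h; rw [map_smul, h, smul_zero]
  d_mem p r hr := by
    refine Submodule.span_induction (p := fun r _ => repD ρ A r ∈ repDeg ρ A p)
      (fun r hr => (repD_mono_zero ρ A hr).2 p rfl) ?_ ?_ ?_ hr
    · rw [map_zero]; exact zero_mem _
    · intro r s _ _ h1 h2; rw [map_add]; exact add_mem h1 h2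
    · intro c r _ h; rw [map_smul]; exact Submodule.smul_mem _ _ h
  d_d r := by
    refine repMono_induction ρ A (P := fun r => repD ρ A (repD ρ A r) = 0)
      (fun m r hr => repD_repD_mono ρ A hr) ?_ ?_ r
    · intro r s h1 h2; rw [map_add, map_add, h1, h2, add_zero]
    · intro c r h; rw [map_smul, map_smul, h, smul_zero]
  leibniz := repD_leibniz ρ A

/-- The commutative dg-algebra `A_V`. -/
def repObj : CDGAlg := ⟨repDG ρ A, repAlg_comm ρ A⟩

/-- The universal representation as a morphism `A → End(V) ⊗ A_V` of dg-algebras under `S`. -/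
def repUnit : A ⟶ (matrixFunctor ρ).obj (repObj ρ A) :=
  Under.homMk (V := matrixUnder ρ (repDG ρ A))
    { alg := repUniv ρ A
      map_deg := fun p a ha i j => repGen_mem ρ ha i j
      map_d := fun a => Matrix.ext fun i j => (repD_gen ρ A a i j).symm }
    (DGAlg.hom_ext fun s => Matrix.ext fun i j => repGen_base ρ A s i j)

variable {A} in
lemma repDesc_mem (B : CDGAlg) (f : A ⟶ (matrixFunctor ρ).obj B) {p : ℕ} {a : A.right.carrier}
    (ha : a ∈ A.right.deg p) (i j : n) : DGAlg.Hom.alg f.right a i j ∈ B.obj.deg p :=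
  f.right.map_deg p a ha i j

variable {A} in
/-- The algebra map `A_V → B` classifying a morphism `A → End(V) ⊗ B`. -/
def repDescAlg (B : CDGAlg) (f : A ⟶ (matrixFunctor ρ).obj B) :
    RepAlg ρ A →ₐ[ℂ] B.obj.carrier :=
  repLift ρ A (DGAlg.Hom.alg f.right)
    (fun s i j => by
      have h := congrArg (fun g => DGAlg.Hom.alg g s) (Under.w f)
      exact congrFun (congrFun h i) j)
    (fun p q _ ha _ hb i j k l =>
      B.property p q _ (repDesc_mem ρ B f ha i j) _ (repDesc_mem ρ B f hb k l))

variable {A} in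
lemma repDescAlg_gen (B : CDGAlg) (f : A ⟶ (matrixFunctor ρ).obj B) (i j : n)
    (a : A.right.carrier) :
    repDescAlg ρ B f (repGen ρ A i j a) = DGAlg.Hom.alg f.right a i j := by
  rw [repDescAlg]
  exact repLift_gen ..

variable {A} in
/-- The morphism `A_V → B` of commutative dg-algebras classifying a morphism
`A → End(V) ⊗ B`. -/
def repDesc (B : CDGAlg) (f : A ⟶ (matrixFunctor ρ).obj B) : repObj ρ A ⟶ B :=
  let g := repDescAlg ρ B f
  have hg : ∀ (i j : n) (a : A.right.carrier), g (repGen ρ A i j a) =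
      DGAlg.Hom.alg f.right a i j := repDescAlg_gen ρ B f
  have hgdeg : ∀ (m : ℕ) (r : RepAlg ρ A), RepMono ρ A m r → g r ∈ B.obj.deg m := by
    intro m r hr
    induction hr with
    | one => rw [map_one]; exact SetLike.GradedOne.one_mem
    | mul ha i j _ ih =>
      rw [map_mul, hg]
      exact SetLike.GradedMul.mul_mem (repDesc_mem ρ B f ha i j) ih
  have hgd : ∀ (m : ℕ) (r : RepAlg ρ A), RepMono ρ A m r → g (repD ρ A r) = B.obj.d (g r) := by
    intro m r hr
    induction hr with
    | one =>
      rw [repD_one, map_zero, map_one]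
      exact (B.obj.d_zero _ SetLike.GradedOne.one_mem).symm
    | @mul p m a r ha i j hr ih =>
      have hd : DGAlg.Hom.alg f.right (A.right.d a) i j =
          B.obj.d (DGAlg.Hom.alg f.right a i j) :=
        congrFun (congrFun (f.right.map_d a) i) j
      rw [repD_leibniz ρ A p _ (repGen_mem ρ ha i j), map_add, map_smul, map_mul, map_mul,
        map_mul, ih, repD_gen, hg, hg, B.obj.leibniz p _ (repDesc_mem ρ B f ha i j), hd]
  ⟨{ alg := g
     map_deg := fun m r hr => by
      refine Submodule.span_induction (p := fun r _ => g r ∈ B.obj.deg m)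
        (fun r hr => hgdeg m r hr) ?_ ?_ ?_ hr
      · rw [map_zero]; exact zero_mem _
      · intro r s _ _ h1 h2; rw [map_add]; exact add_mem h1 h2
      · intro c r _ h; rw [map_smul]; exact Submodule.smul_mem _ _ h
     map_d := fun r => by
      refine repMono_induction ρ A (P := fun r => g (repD ρ A r) = B.obj.d (g r))
        hgd ?_ ?_ r
      · intro r s h1 h2; rw [map_add, map_add, map_add, map_add, h1, h2]
      · intro c r h; rw [map_smul, map_smul, map_smul, map_smul, h] }⟩

variable {A} in
@[simp] lemma repDesc_gen (B : CDGAlg) (f : A ⟶ (matrixFunctor ρ).obj B) (i j : n)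
    (a : A.right.carrier) : DGAlg.Hom.alg (repDesc ρ B f).hom (repGen ρ A i j a) =
      DGAlg.Hom.alg f.right a i j :=
  repDescAlg_gen ρ B f i j a

/-- The natural bijection `Hom_{CDGA^+}(A_V, B) ≃ Hom_{DGA_S^+}(A, End(V) ⊗ B)`. -/
def repHomEquiv (A : DGAUnder S) (B : CDGAlg) :
    (repObj ρ A ⟶ B) ≃ (A ⟶ (matrixFunctor ρ).obj B) where
  toFun g := repUnit ρ A ≫ (matrixFunctor ρ).map g
  invFun f := repDesc ρ B f
  left_inv g := by
    apply ObjectProperty.hom_ext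
    apply DGAlg.Hom.ext
    refine rep_algHom_ext ρ A fun i j a => ?_
    exact repDesc_gen ρ B _ i j a
  right_inv f := by
    apply Under.UnderMorphism.ext
    refine DGAlg.hom_ext fun a => Matrix.ext fun i j => ?_
    exact repDesc_gen ρ B f i j a

/-- The representation functor `(-)_V : DGA_S^+ ⥤ CDGA^+`, `A ↦ A_V`. -/
def repFunctor : DGAUnder S ⥤ CDGAlg :=
  Adjunction.leftAdjointOfEquiv (G := matrixFunctor ρ) (repHomEquiv ρ)
    (fun _ _ _ g h => by simp [repHomEquiv])

/-- The representation functor is left adjoint to `End(V) ⊗ -`. -/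
def repAdjunction : repFunctor ρ ⊣ matrixFunctor ρ :=
  Adjunction.adjunctionOfEquivLeft (G := matrixFunctor ρ) (repHomEquiv ρ)
    (fun _ _ _ g h => by simp [repHomEquiv])

end Rep

/-! ### Path algebras -/

section PathAlgebra
variable (W : Type) [Quiver.{0} W]

/-- The path algebra: the free vector space on the paths of the quiver. -/
def PathAlg : Type := (Σ a b : W, Quiver.Path a b) →₀ ℂ

instance PathAlg.addCommGroup : AddCommGroup (PathAlg W) :=
  inferInstanceAs (AddCommGroup ((Σ a b : W, Quiver.Path a b) →₀ ℂ))
instance : Module ℂ (PathAlg W) :=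
  inferInstanceAs (Module ℂ ((Σ a b : W, Quiver.Path a b) →₀ ℂ))

variable {W}

/-- The basis element of a path. -/
def PathAlg.of {a b : W} (p : Quiver.Path a b) : PathAlg W := Finsupp.single ⟨a, b, p⟩ (1 : ℂ)

/-- The linear extension of a function on paths. -/
def PathAlg.extend {N : Type} [AddCommMonoid N] [Module ℂ N]
    (f : ∀ {a b : W}, Quiver.Path a b → N) : PathAlg W →ₗ[ℂ] N :=
  Finsupp.linearCombination ℂ fun x : Σ a b : W, Quiver.Path a b => f x.2.2

@[simp] lemma PathAlg.extend_of {N : Type} [AddCommMonoid N] [Module ℂ N]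
    (f : ∀ {a b : W}, Quiver.Path a b → N) {a b : W} (p : Quiver.Path a b) :
    PathAlg.extend f (.of p) = f p := by
  refine (Finsupp.linearCombination_single ..).trans ?_
  rw [one_smul]

lemma PathAlg.hom_ext {N : Type} [AddCommMonoid N] [Module ℂ N] {f g : PathAlg W →ₗ[ℂ] N}
    (h : ∀ (a b : W) (p : Quiver.Path a b), f (.of p) = g (.of p)) : f = g := by
  refine Finsupp.lhom_ext' fun x => LinearMap.ext_ring ?_
  exact h x.1 x.2.1 x.2.2

variable [DecidableEq W]

/-- The product of two paths, as an element of the path algebra: `p * q` is the concatenation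
`q` followed by `p` if `q` ends where `p` starts, and `0` otherwise. -/
def PathAlg.mulPath {a b c d : W} (p : Quiver.Path a b) (q : Quiver.Path c d) : PathAlg W :=
  if h : d = a then .of (q.comp (p.cast h.symm rfl)) else 0

/-- The multiplication of the path algebra. -/
def PathAlg.mulLin : PathAlg W →ₗ[ℂ] PathAlg W →ₗ[ℂ] PathAlg W :=
  PathAlg.extend fun p => PathAlg.extend fun q => PathAlg.mulPath p q

instance : Mul (PathAlg W) := ⟨fun x y => PathAlg.mulLin x y⟩

lemma PathAlg.mul_def (x y : PathAlg W) : x * y = PathAlg.mulLin x y := rfl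

lemma PathAlg.of_mul_of {a b c : W} (p : Quiver.Path b c) (q : Quiver.Path a b) :
    PathAlg.of p * PathAlg.of q = .of (q.comp p) := by
  simp [PathAlg.mul_def, PathAlg.mulLin, PathAlg.mulPath]

lemma PathAlg.of_mul_of_ne {a b c d : W} (p : Quiver.Path a b) (q : Quiver.Path c d)
    (h : d ≠ a) : PathAlg.of p * PathAlg.of q = 0 := by
  simp [PathAlg.mul_def, PathAlg.mulLin, PathAlg.mulPath, h]

lemma PathAlg.mul_assoc' (x y z : PathAlg W) : x * y * z = x * (y * z) := by
  have h : (LinearMap.compr₂ PathAlg.mulLin PathAlg.mulLin :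
      PathAlg W →ₗ[ℂ] PathAlg W →ₗ[ℂ] PathAlg W →ₗ[ℂ] PathAlg W) =
      ((LinearMap.llcomp ℂ _ _ _).flip PathAlg.mulLin).comp
        ((LinearMap.llcomp ℂ (PathAlg W) (PathAlg W) (PathAlg W)).comp PathAlg.mulLin) := by
    refine PathAlg.hom_ext fun a b p => PathAlg.hom_ext fun c d q =>
      PathAlg.hom_ext fun e f r => ?_
    change (PathAlg.of p * PathAlg.of q) * PathAlg.of r =
      PathAlg.of p * (PathAlg.of q * PathAlg.of r)
    by_cases h1 : d = a
    · subst h1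
      by_cases h2 : f = c
      · subst h2
        simp [PathAlg.of_mul_of]
      · rw [PathAlg.of_mul_of, PathAlg.of_mul_of_ne _ _ h2, PathAlg.of_mul_of_ne _ _ h2,
          PathAlg.mul_def, map_zero]
    · by_cases h2 : f = c
      · subst h2
        rw [PathAlg.of_mul_of, PathAlg.of_mul_of_ne _ _ h1, PathAlg.of_mul_of_ne _ _ h1,
          PathAlg.mul_def, map_zero, LinearMap.zero_apply]
      · rw [PathAlg.of_mul_of_ne _ _ h1, PathAlg.of_mul_of_ne _ _ h2, PathAlg.mul_def,
          PathAlg.mul_def, map_zero, map_zero, LinearMap.zero_apply]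
  exact LinearMap.congr_fun (LinearMap.congr_fun (LinearMap.congr_fun h x) y) z

variable [Fintype W]

/-- The unit of the path algebra is the sum of the empty paths. -/
instance : One (PathAlg W) := ⟨∑ a : W, .of (Quiver.Path.nil : Quiver.Path a a)⟩

lemma PathAlg.one_def : (1 : PathAlg W) = ∑ a : W, .of (Quiver.Path.nil : Quiver.Path a a) := rfl

lemma PathAlg.one_mul' (x : PathAlg W) : 1 * x = x := by
  have h : PathAlg.mulLin (1 : PathAlg W) = LinearMap.id := by
    refine PathAlg.hom_ext fun a b p => ?_
    rw [PathAlg.one_def, map_sum, LinearMap.sum_apply, Finset.sum_eq_single b]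
    · exact PathAlg.of_mul_of _ _
    · exact fun c _ hc => PathAlg.of_mul_of_ne _ _ hc.symm
    · exact fun h => absurd (Finset.mem_univ b) h
  exact LinearMap.congr_fun h x

lemma PathAlg.mul_one' (x : PathAlg W) : x * 1 = x := by
  have h : PathAlg.mulLin.flip (1 : PathAlg W) = LinearMap.id := by
    refine PathAlg.hom_ext fun a b p => ?_
    rw [LinearMap.flip_apply, PathAlg.one_def, map_sum, Finset.sum_eq_single a]
    · refine (PathAlg.of_mul_of _ _).trans ?_
      rw [Quiver.Path.nil_comp]; rfl
    · exact fun c _ hc => PathAlg.of_mul_of_ne _ _ hc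
    · exact fun h => absurd (Finset.mem_univ a) h
  exact LinearMap.congr_fun h x

instance : Ring (PathAlg W) :=
  { PathAlg.addCommGroup W with
    mul_assoc := PathAlg.mul_assoc'
    one_mul := PathAlg.one_mul'
    mul_one := PathAlg.mul_one'
    zero_mul := fun x => by rw [PathAlg.mul_def, map_zero, LinearMap.zero_apply]
    mul_zero := fun x => by rw [PathAlg.mul_def, map_zero]
    left_distrib := fun x y z => by rw [PathAlg.mul_def, map_add]; rfl
    right_distrib := fun x y z => by
      rw [PathAlg.mul_def, map_add, LinearMap.add_apply]; rfl }

instance : Algebra ℂ (PathAlg W) :=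
  Algebra.ofModule
    (fun c x y => by rw [PathAlg.mul_def, map_smul, LinearMap.smul_apply]; rfl)
    (fun c x y => by rw [PathAlg.mul_def, map_smul]; rfl)

/-- The idempotent `e_a`, i.e. the empty path at the vertex `a`. -/
def PathAlg.e (a : W) : PathAlg W := .of (Quiver.Path.nil : Quiver.Path a a)

/-- The element of the path algebra given by an arrow. -/
def PathAlg.arrow {a b : W} (f : a ⟶ b) : PathAlg W := .of f.toPath

lemma PathAlg.e_mul_e (a b : W) : PathAlg.e a * PathAlg.e b = if a = b then PathAlg.e a else 0 := by
  split_ifs with h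
  · subst h; exact PathAlg.of_mul_of _ _
  · exact PathAlg.of_mul_of_ne _ _ (Ne.symm h)

lemma PathAlg.arrow_mul_of {a b c : W} (f : b ⟶ c) (p : Quiver.Path a b) :
    PathAlg.arrow f * .of p = .of (p.cons f) := PathAlg.of_mul_of _ _

lemma PathAlg.e_mul_of {a b : W} (p : Quiver.Path a b) : PathAlg.e b * .of p = .of p :=
  PathAlg.of_mul_of _ _

lemma PathAlg.of_mul_e {a b : W} (p : Quiver.Path a b) : PathAlg.of p * PathAlg.e a = .of p :=
  (PathAlg.of_mul_of _ _).trans (by rw [Quiver.Path.nil_comp])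

/-- The algebra `S = ⊕_a ℂ e_a` of the vertices, mapping to the path algebra by
`(s_a)_a ↦ ∑_a s_a e_a`. -/
def PathAlg.vertexMap : (W → ℂ) →ₐ[ℂ] PathAlg W :=
  AlgHom.ofLinearMap
    { toFun := fun s => ∑ a, s a • PathAlg.e a
      map_add' := fun s t => by simp [add_smul, Finset.sum_add_distrib]
      map_smul' := fun c s => by simp [Finset.smul_sum, smul_smul] }
    (by simp [PathAlg.one_def, PathAlg.e])
    (fun s t => by
      simp only [LinearMap.coe_mk, AddHom.coe_mk, Pi.mul_apply, Finset.sum_mul_sum,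
        smul_mul_smul_comm, PathAlg.e_mul_e, smul_ite, smul_zero, Finset.sum_ite_eq,
        Finset.mem_univ, if_true])

/-- The universal property of the path algebra: a map out of it is given by orthogonal
idempotents `E a` with sum `1` for the vertices, and compatible elements for the arrows. -/
def PathAlg.liftPath {B : Type} [Ring B] (E : W → B) (F : ∀ {a b : W}, (a ⟶ b) → B) {a : W} :
    ∀ {b : W}, Quiver.Path a b → B
  | _, .nil => E a
  | _, .cons p f => F f * PathAlg.liftPath E F p

lemma PathAlg.liftPath_right {B : Type} [Ring B] (E : W → B) (F : ∀ {a b : W}, (a ⟶ b) → B)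
    (hE : ∀ a, E a * E a = E a) {a b : W} (p : Quiver.Path a b) :
    PathAlg.liftPath E F p * E a = PathAlg.liftPath E F p := by
  induction p with
  | nil => exact hE a
  | cons p f ih => rw [PathAlg.liftPath, mul_assoc, ih]

lemma PathAlg.liftPath_left {B : Type} [Ring B] (E : W → B) (F : ∀ {a b : W}, (a ⟶ b) → B)
    (hE : ∀ a, E a * E a = E a) (hF : ∀ (a b : W) (f : a ⟶ b), E b * F f = F f)
    {a b : W} (p : Quiver.Path a b) :
    E b * PathAlg.liftPath E F p = PathAlg.liftPath E F p := by
  cases p with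
  | nil => exact hE a
  | cons p f => rw [PathAlg.liftPath, ← mul_assoc, hF]

lemma PathAlg.liftPath_comp {B : Type} [Ring B] (E : W → B) (F : ∀ {a b : W}, (a ⟶ b) → B)
    (hE : ∀ a, E a * E a = E a) (hF : ∀ (a b : W) (f : a ⟶ b), E b * F f = F f)
    {a b c : W} (p : Quiver.Path a b) (q : Quiver.Path b c) :
    PathAlg.liftPath E F (p.comp q) = PathAlg.liftPath E F q * PathAlg.liftPath E F p := by
  induction q with
  | nil => exact (PathAlg.liftPath_left E F hE hF p).symm
  | cons q f ih => rw [Quiver.Path.comp_cons, PathAlg.liftPath, ih, PathAlg.liftPath, mul_assoc]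

/-- The algebra map out of the path algebra given by the images of the vertices and arrows. -/
def PathAlg.lift {B : Type} [Ring B] [Algebra ℂ B] (E : W → B)
    (F : ∀ {a b : W}, (a ⟶ b) → B) (hE : ∀ a b, E a * E b = if a = b then E a else 0)
    (hE1 : ∑ a, E a = 1) (hF : ∀ (a b : W) (f : a ⟶ b), E b * F f = F f) :
    PathAlg W →ₐ[ℂ] B :=
  have hEE : ∀ a, E a * E a = E a := fun a => by rw [hE, if_pos rfl]
  AlgHom.ofLinearMap (PathAlg.extend fun p => PathAlg.liftPath E F p)
    (by
      rw [PathAlg.one_def, map_sum, ← hE1]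
      exact Finset.sum_congr rfl fun a _ => PathAlg.extend_of _ _)
    (by
      intro x y
      have h : (LinearMap.compr₂ PathAlg.mulLin (PathAlg.extend fun p => PathAlg.liftPath E F p) :
          PathAlg W →ₗ[ℂ] PathAlg W →ₗ[ℂ] B) =
          (LinearMap.mul ℂ B).compl₁₂ (PathAlg.extend fun p => PathAlg.liftPath E F p)
            (PathAlg.extend fun p => PathAlg.liftPath E F p) := by
        refine PathAlg.hom_ext fun a b p => PathAlg.hom_ext fun c d q => ?_
        change (PathAlg.extend fun p => PathAlg.liftPath E F p) (PathAlg.of p * PathAlg.of q) =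
          (PathAlg.extend fun p => PathAlg.liftPath E F p) (PathAlg.of p) *
            (PathAlg.extend fun p => PathAlg.liftPath E F p) (PathAlg.of q)
        rw [PathAlg.extend_of, PathAlg.extend_of]
        by_cases hd : d = a
        · subst hd
          rw [PathAlg.of_mul_of, PathAlg.extend_of, PathAlg.liftPath_comp E F hEE hF]
        · rw [PathAlg.of_mul_of_ne _ _ hd, map_zero, ← PathAlg.liftPath_right E F hEE p,
            ← PathAlg.liftPath_left E F hEE hF q, mul_assoc, ← mul_assoc (E a), hE,
            if_neg (Ne.symm hd), zero_mul, mul_zero]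
      exact LinearMap.congr_fun (LinearMap.congr_fun h x) y)

lemma PathAlg.lift_of {B : Type} [Ring B] [Algebra ℂ B] (E : W → B)
    (F : ∀ {a b : W}, (a ⟶ b) → B) (hE) (hE1) (hF) {a b : W} (p : Quiver.Path a b) :
    PathAlg.lift E F hE hE1 hF (.of p) = PathAlg.liftPath E F p := PathAlg.extend_of _ _

end PathAlgebra

section PathGrading
variable {W : Type} [Quiver.{0} W] (ω : ∀ {a b : W}, (a ⟶ b) → ℕ)

/-- The degree of a path: the sum of the degrees of its arrows. -/
def pathDeg {a : W} : ∀ {b : W}, Quiver.Path a b → ℕ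
  | _, .nil => 0
  | _, .cons p f => ω f + pathDeg p

lemma pathDeg_comp {a b c : W} (p : Quiver.Path a b) (q : Quiver.Path b c) :
    pathDeg ω (p.comp q) = pathDeg ω q + pathDeg ω p := by
  induction q with
  | nil => simp [pathDeg]
  | cons q f ih => rw [Quiver.Path.comp_cons, pathDeg, ih, pathDeg, add_assoc]

/-- The span of the paths of degree `m`. -/
def PathAlg.deg (m : ℕ) : Submodule ℂ (PathAlg W) :=
  Submodule.span ℂ {x | ∃ (a b : W) (p : Quiver.Path a b), pathDeg ω p = m ∧ .of p = x}

variable {ω} in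
lemma PathAlg.of_mem_deg {a b : W} {p : Quiver.Path a b} {m : ℕ} (h : pathDeg ω p = m) :
    PathAlg.of p ∈ PathAlg.deg ω m := Submodule.subset_span ⟨a, b, p, h, rfl⟩

/-- The decomposition of the path algebra by degree. -/
instance : DirectSum.Decomposition (PathAlg.deg ω) :=
  Decomposition.ofLinearMap _
    (PathAlg.extend fun p => DirectSum.lof ℂ ℕ (fun m => PathAlg.deg ω m) (pathDeg ω p)
      ⟨.of p, PathAlg.of_mem_deg rfl⟩)
    (PathAlg.hom_ext fun a b p => by simp)
    (by
      ext m ⟨x, hx⟩ : 2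
      simp only [LinearMap.comp_apply, LinearMap.id_apply, DirectSum.coeLinearMap_lof]
      refine Submodule.span_induction (p := fun x hx => PathAlg.extend _ x =
        DirectSum.lof ℂ ℕ (fun m => PathAlg.deg ω m) m ⟨x, hx⟩) ?_ ?_ ?_ ?_ hx
      · rintro _ ⟨a, b, p, rfl, rfl⟩
        exact PathAlg.extend_of _ _
      · rw [map_zero]
        exact (map_zero (DirectSum.lof ℂ ℕ (fun m => PathAlg.deg ω m) m)).symm
      · intro x y hx hy h1 h2
        rw [map_add, h1, h2, ← map_add]; rfl
      · intro c x hx h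
        rw [map_smul, h, ← map_smul]; rfl)

variable [DecidableEq W] [Fintype W]

instance : SetLike.GradedMonoid (PathAlg.deg ω) where
  one_mem := by
    rw [PathAlg.one_def]
    exact sum_mem fun a _ => PathAlg.of_mem_deg rfl
  mul_mem := by
    intro m l x y hx hy
    have h : PathAlg.deg ω m * PathAlg.deg ω l ≤ PathAlg.deg ω (m + l) := by
      rw [PathAlg.deg, PathAlg.deg, Submodule.span_mul_span, Submodule.span_le]
      rintro _ ⟨_, ⟨a, b, p, rfl, rfl⟩, _, ⟨c, d, q, rfl, rfl⟩, rfl⟩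
      by_cases hd : d = a
      · subst hd
        simp only [PathAlg.of_mul_of]
        exact PathAlg.of_mem_deg (pathDeg_comp ω q p)
      · simp only [PathAlg.of_mul_of_ne _ _ hd]
        exact zero_mem _
    exact h (Submodule.mul_mem_mul hx hy)

instance : GradedAlgebra (PathAlg.deg ω) where

/-- The value on a path of the differential with given values `δ` on the arrows. -/
def pathD (δ : ∀ {a b : W}, (a ⟶ b) → PathAlg W) {a : W} :
    ∀ {b : W}, Quiver.Path a b → PathAlg W
  | _, .nil => 0
  | _, .cons p f => δ f * .of p + (-1 : ℂ) ^ ω f • (PathAlg.arrow f * pathD δ p)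

variable (δ : ∀ {a b : W}, (a ⟶ b) → PathAlg W)

lemma pathD_left (hl : ∀ (a b : W) (f : a ⟶ b), PathAlg.e b * δ f = δ f)
    {a b : W} (p : Quiver.Path a b) : PathAlg.e b * pathD ω δ p = pathD ω δ p := by
  cases p with
  | nil => simp [pathD]
  | cons p f =>
    rw [pathD, mul_add, ← mul_assoc, hl, mul_smul_comm, ← mul_assoc, PathAlg.arrow,
      PathAlg.e_mul_of]

lemma pathD_right {a b : W} (p : Quiver.Path a b) :
    pathD ω δ p * PathAlg.e a = pathD ω δ p := by
  induction p with
  | nil => simp [pathD]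
  | cons p f ih =>
    rw [pathD, add_mul, mul_assoc, PathAlg.of_mul_e, smul_mul_assoc, mul_assoc, ih]

lemma pathD_comp (hl : ∀ (a b : W) (f : a ⟶ b), PathAlg.e b * δ f = δ f)
    {a b c : W} (p : Quiver.Path a b) (q : Quiver.Path b c) : pathD ω δ (p.comp q) =
      pathD ω δ q * .of p + (-1 : ℂ) ^ pathDeg ω q • (.of q * pathD ω δ p) := by
  induction q with
  | nil =>
    simp only [Quiver.Path.comp_nil, pathD, zero_mul, pathDeg, pow_zero, one_smul, zero_add]
    exact (pathD_left ω δ hl p).symm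
  | cons q f ih =>
    rw [Quiver.Path.comp_cons, pathD, ih, pathD, pathDeg, ← PathAlg.of_mul_of,
      ← PathAlg.arrow_mul_of f q, mul_add, add_mul, smul_add, pow_add]
    simp only [mul_smul_comm, smul_mul_assoc, mul_assoc, smul_smul, add_assoc]

/-- The dg-algebra structure on the path algebra of a quiver with graded arrows determined by the
differentials `δ f` of the arrows `f`. -/
def pathDG (hl : ∀ (a b : W) (f : a ⟶ b), PathAlg.e b * δ f = δ f)
    (hr : ∀ (a b : W) (f : a ⟶ b), δ f * PathAlg.e a = δ f)
    (h0 : ∀ (a b : W) (f : a ⟶ b), ω f = 0 → δ f = 0)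
    (hdeg : ∀ (a b : W) (f : a ⟶ b) (m : ℕ), ω f = m + 1 → δ f ∈ PathAlg.deg ω m)
    (hd : ∀ (a b : W) (f : a ⟶ b), PathAlg.extend (pathD ω δ) (δ f) = 0) : DGAlg :=
  have hleib : ∀ (m : ℕ), ∀ x ∈ PathAlg.deg ω m, ∀ y, PathAlg.extend (pathD ω δ) (x * y) =
      PathAlg.extend (pathD ω δ) x * y + (-1 : ℂ) ^ m • (x * PathAlg.extend (pathD ω δ) y) := by
    intro m x hx y
    refine Submodule.span_induction (p := fun x _ => PathAlg.extend (pathD ω δ) (x * y) =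
      PathAlg.extend (pathD ω δ) x * y + (-1 : ℂ) ^ m • (x * PathAlg.extend (pathD ω δ) y))
      ?_ ?_ ?_ ?_ hx
    · rintro _ ⟨a, b, p, rfl, rfl⟩
      have h : (PathAlg.extend (pathD ω δ)).comp (LinearMap.mulLeft ℂ (.of p)) =
          LinearMap.mulLeft ℂ (PathAlg.extend (pathD ω δ) (.of p)) +
            (-1 : ℂ) ^ pathDeg ω p •
              (LinearMap.mulLeft ℂ (.of p)).comp (PathAlg.extend (pathD ω δ)) := by
        refine PathAlg.hom_ext fun c d q => ?_
        simp only [LinearMap.comp_apply, LinearMap.mulLeft_apply, LinearMap.add_apply,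
          LinearMap.smul_apply, PathAlg.extend_of]
        by_cases hda : d = a
        · subst hda
          rw [PathAlg.of_mul_of, PathAlg.extend_of, pathD_comp ω δ hl]
        · have h1 : pathD ω δ p * PathAlg.of q = 0 := by
            rw [← pathD_right, mul_assoc]
            refine (congrArg _ (PathAlg.of_mul_of_ne _ _ hda)).trans (mul_zero _)
          have h2 : PathAlg.of p * pathD ω δ q = 0 := by
            rw [← pathD_left ω δ hl, ← mul_assoc]
            refine (congrArg (· * _) (PathAlg.of_mul_of_ne _ _ hda)).trans (zero_mul _)
          rw [PathAlg.of_mul_of_ne _ _ hda, map_zero, h1, h2, smul_zero, add_zero]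
      exact LinearMap.congr_fun h y
    · simp
    · intro x z _ _ h1 h2
      simp only [add_mul, map_add, h1, h2, smul_add]
      abel
    · intro c x _ h
      simp only [smul_mul_assoc, map_smul, h, smul_add]
      rw [smul_comm c]
  have hof : ∀ {a b : W} (f : a ⟶ b), (PathAlg.extend (pathD ω δ)) (PathAlg.arrow f) = δ f := by
    intro a b f
    rw [PathAlg.arrow, PathAlg.extend_of]
    simp only [Quiver.Hom.toPath, pathD, mul_zero, smul_zero, add_zero]
    exact hr a b f
  have hmem : ∀ {a b : W} (p : Quiver.Path a b), (pathDeg ω p = 0 → pathD ω δ p = 0) ∧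
      ∀ m, pathDeg ω p = m + 1 → pathD ω δ p ∈ PathAlg.deg ω m := by
    intro a b p
    induction p with
    | nil => exact ⟨fun _ => rfl, fun m h => absurd h (by simp [pathDeg])⟩
    | @cons b c p f ih =>
      have hf : PathAlg.arrow f ∈ PathAlg.deg ω (ω f) := PathAlg.of_mem_deg (by
        simp [Quiver.Hom.toPath, pathDeg])
      simp only [pathDeg, pathD]
      constructor
      · intro h
        rw [h0 _ _ f (by omega), ih.1 (by omega)]
        simp
      · intro m hm
        refine add_mem ?_ (Submodule.smul_mem _ _ ?_)
        · rcases hω : ω f with _ | k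
          · rw [h0 _ _ f hω, zero_mul]; exact zero_mem _
          · obtain rfl : m = k + pathDeg ω p := by omega
            exact SetLike.GradedMul.mul_mem (hdeg _ _ f k hω) (PathAlg.of_mem_deg rfl)
        · rcases hω : pathDeg ω p with _ | k
          · rw [ih.1 hω, mul_zero]; exact zero_mem _
          · obtain rfl : m = ω f + k := by omega
            exact SetLike.GradedMul.mul_mem hf (ih.2 k hω)
  { carrier := PathAlg W
    deg := PathAlg.deg ω
    d := PathAlg.extend (pathD ω δ)
    d_zero := fun x hx => by
      refine Submodule.span_induction (p := fun x _ => PathAlg.extend (pathD ω δ) x = 0)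
        ?_ (map_zero _) ?_ ?_ hx
      · rintro _ ⟨a, b, p, hp, rfl⟩
        rw [PathAlg.extend_of, (hmem p).1 hp]
      · intro x y _ _ h1 h2; rw [map_add, h1, h2, add_zero]
      · intro c x _ h; rw [map_smul, h, smul_zero]
    d_mem := fun m x hx => by
      refine Submodule.span_induction
        (p := fun x _ => PathAlg.extend (pathD ω δ) x ∈ PathAlg.deg ω m) ?_ ?_ ?_ ?_ hx
      · rintro _ ⟨a, b, p, hp, rfl⟩
        rw [PathAlg.extend_of]
        exact (hmem p).2 m hp
      · rw [map_zero]; exact zero_mem _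
      · intro x y _ _ h1 h2; rw [map_add]; exact add_mem h1 h2
      · intro c x _ h; rw [map_smul]; exact Submodule.smul_mem _ _ h
    d_d := fun x => by
      have h : (PathAlg.extend (pathD ω δ)).comp (PathAlg.extend (pathD ω δ)) = 0 := by
        refine PathAlg.hom_ext fun a b p => ?_
        rw [LinearMap.comp_apply, PathAlg.extend_of, LinearMap.zero_apply]
        induction p with
        | nil => exact map_zero _
        | @cons b c p f ih =>
          have hf : PathAlg.arrow f ∈ PathAlg.deg ω (ω f) := PathAlg.of_mem_deg (by
            simp [Quiver.Hom.toPath, pathDeg])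
          rw [pathD, map_add, map_smul, hleib _ _ hf, ih, hof, mul_zero, smul_zero, add_zero]
          rcases hω : ω f with _ | k
          · simp [h0 _ _ f hω]
          · rw [hleib k _ (hdeg _ _ f k hω), hd, PathAlg.extend_of, zero_mul, zero_add,
              ← add_smul, pow_succ]
            simp
      exact LinearMap.congr_fun h x
    leibniz := hleib }

end PathGrading

/-! ### Koszul complexes -/

section Koszul
variable {E : Type} [AddCommGroup E] [Module ℂ E]

lemma contract_leibniz (c : Module.Dual ℂ E) (p : ℕ) (ω : ExteriorAlgebra ℂ E)
    (hω : ω ∈ ⋀[ℂ]^p E) (η : ExteriorAlgebra ℂ E) :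
    CliffordAlgebra.contractLeft c (ω * η) = CliffordAlgebra.contractLeft c ω * η +
      (-1 : ℂ) ^ p • (ω * CliffordAlgebra.contractLeft c η) := by
  refine Submodule.pow_induction_on_left' _ (C := fun p ω _ =>
    CliffordAlgebra.contractLeft c (ω * η) = CliffordAlgebra.contractLeft c ω * η +
      (-1 : ℂ) ^ p • (ω * CliffordAlgebra.contractLeft c η)) ?_ ?_ ?_ hω
  · intro r
    rw [CliffordAlgebra.contractLeft_algebraMap_mul, CliffordAlgebra.contractLeft_algebraMap]
    simp
  · intro x y i _ _ h1 h2
    rw [add_mul, map_add, h1, h2, map_add, add_mul, add_mul, smul_add]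
    abel
  · rintro _ ⟨m, rfl⟩ i x _ h
    rw [mul_assoc, ExteriorAlgebra.ι, CliffordAlgebra.contractLeft_ι_mul, h,
      CliffordAlgebra.contractLeft_ι_mul, pow_succ]
    simp only [mul_add, sub_mul, smul_mul_assoc, mul_smul_comm, mul_assoc, mul_neg, mul_one,
      neg_smul]
    abel

lemma contract_mem (c : Module.Dual ℂ E) (p : ℕ) (ω : ExteriorAlgebra ℂ E)
    (hω : ω ∈ ⋀[ℂ]^(p + 1) E) : CliffordAlgebra.contractLeft c ω ∈ ⋀[ℂ]^p E := by
  have key : ∀ (q : ℕ) (ω : ExteriorAlgebra ℂ E), ω ∈ ⋀[ℂ]^q E → ∀ p, q = p + 1 →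
      CliffordAlgebra.contractLeft c ω ∈ ⋀[ℂ]^p E := by
    intro q ω hω
    refine Submodule.pow_induction_on_left' _ (C := fun q ω _ => ∀ p, q = p + 1 →
      CliffordAlgebra.contractLeft c ω ∈ ⋀[ℂ]^p E) ?_ ?_ ?_ hω
    · intro r p h; omega
    · intro x y i _ _ h1 h2 p hp
      rw [map_add]
      exact add_mem (h1 p hp) (h2 p hp)
    · rintro _ ⟨m, rfl⟩ i x hx h p hp
      obtain rfl : i = p := by omega
      rw [ExteriorAlgebra.ι, CliffordAlgebra.contractLeft_ι_mul]
      refine sub_mem (Submodule.smul_mem _ _ hx) ?_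
      rcases i with _ | i
      · obtain ⟨r, rfl⟩ := Submodule.mem_one.1 (by simpa using hx)
        rw [CliffordAlgebra.contractLeft_algebraMap, mul_zero]
        exact zero_mem _
      · have hm : CliffordAlgebra.ι (0 : QuadraticForm ℂ E) m ∈ ⋀[ℂ]^1 E := by
          rw [ExteriorAlgebra.exteriorPower, pow_one]; exact ⟨m, rfl⟩
        rw [add_comm i 1]
        exact SetLike.GradedMul.mul_mem hm (h i rfl)
  exact key _ ω hω p rfl

lemma exterior_comm (p q : ℕ) (ω : ExteriorAlgebra ℂ E) (hω : ω ∈ ⋀[ℂ]^p E)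
    (η : ExteriorAlgebra ℂ E) (hη : η ∈ ⋀[ℂ]^q E) :
    ω * η = (-1 : ℂ) ^ (p * q) • (η * ω) := by
  have one : ∀ (m : E), ExteriorAlgebra.ι ℂ m * η = (-1 : ℂ) ^ q • (η * ExteriorAlgebra.ι ℂ m) := by
    intro m
    refine Submodule.pow_induction_on_left' _ (C := fun q η _ => ExteriorAlgebra.ι ℂ m * η =
      (-1 : ℂ) ^ q • (η * ExteriorAlgebra.ι ℂ m)) ?_ ?_ ?_ hη
    · intro r
      rw [pow_zero, one_smul, Algebra.commutes]
    · intro x y i _ _ h1 h2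
      rw [mul_add, add_mul, h1, h2, smul_add]
    · rintro _ ⟨m', rfl⟩ i x _ h
      rw [← mul_assoc, eq_neg_of_add_eq_zero_left (ExteriorAlgebra.ι_add_mul_swap m m'),
        neg_mul, mul_assoc, h, mul_smul_comm, pow_succ, mul_assoc]
      simp
  refine Submodule.pow_induction_on_left' _ (C := fun p ω _ => ω * η =
      (-1 : ℂ) ^ (p * q) • (η * ω)) ?_ ?_ ?_ hω
  · intro r
    rw [zero_mul, pow_zero, one_smul, Algebra.commutes]
  · intro x y i _ _ h1 h2
    rw [mul_add, add_mul, h1, h2, smul_add]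
  · rintro _ ⟨m, rfl⟩ i x _ h
    rw [mul_assoc, h, mul_smul_comm, ← mul_assoc, one, smul_mul_assoc, smul_smul, mul_assoc,
      Nat.succ_mul, pow_add]

variable (R : Type) [CommRing R] [Algebra ℂ R] (E)

/-- The degree-`p` part `R ⊗ Λ^p E` of `R ⊗ Λ^• E`. -/
def koszulDeg (p : ℕ) : Submodule ℂ (R ⊗[ℂ] ExteriorAlgebra ℂ E) :=
  Submodule.span ℂ {x | ∃ r : R, ∃ ω ∈ ⋀[ℂ]^p E, r ⊗ₜ[ℂ] ω = x}

variable {R E} in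
lemma tmul_mem_koszulDeg {p : ℕ} (r : R) {ω : ExteriorAlgebra ℂ E} (hω : ω ∈ ⋀[ℂ]^p E) :
    r ⊗ₜ[ℂ] ω ∈ koszulDeg E R p := Submodule.subset_span ⟨r, ω, hω, rfl⟩

instance : SetLike.GradedMonoid (koszulDeg E R) where
  one_mem := tmul_mem_koszulDeg 1 SetLike.GradedOne.one_mem
  mul_mem := by
    intro m l x y hx hy
    have h : koszulDeg E R m * koszulDeg E R l ≤ koszulDeg E R (m + l) := by
      rw [koszulDeg, koszulDeg, Submodule.span_mul_span, Submodule.span_le]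
      rintro _ ⟨_, ⟨r, ω, hω, rfl⟩, _, ⟨s, η, hη, rfl⟩, rfl⟩
      simp only [Algebra.TensorProduct.tmul_mul_tmul]
      exact tmul_mem_koszulDeg _ (SetLike.GradedMul.mul_mem hω hη)
    exact h (Submodule.mul_mem_mul hx hy)

/-- The inclusion `ω ↦ r ⊗ ω` of `Λ^p E` in the degree-`p` part. -/
def koszulIns (r : R) (p : ℕ) : ⋀[ℂ]^p E →ₗ[ℂ] koszulDeg E R p :=
  ((TensorProduct.mk ℂ R (ExteriorAlgebra ℂ E) r).comp (⋀[ℂ]^p E).subtype).codRestrict _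
    fun ω => tmul_mem_koszulDeg r ω.2

lemma koszulIns_coe (r : R) (p : ℕ) (ω : ⋀[ℂ]^p E) :
    (koszulIns E R r p ω : R ⊗[ℂ] ExteriorAlgebra ℂ E) = r ⊗ₜ[ℂ] (ω : ExteriorAlgebra ℂ E) := rfl

/-- The decomposition of `R ⊗ Λ^• E` into homogeneous components. -/
def koszulDecompose : R ⊗[ℂ] ExteriorAlgebra ℂ E →ₗ[ℂ] ⨁ p, koszulDeg E R p :=
  TensorProduct.lift
    { toFun := fun r => (DirectSum.lmap (koszulIns E R r)).comp
        (decomposeLinearEquiv fun p : ℕ => ⋀[ℂ]^p E).toLinearMap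
      map_add' := fun r s => by
        apply DirectSum.decompose_lhom_ext fun p : ℕ => ⋀[ℂ]^p E
        intro p
        ext1 ω
        simp only [LinearMap.comp_apply, LinearMap.add_apply, Submodule.subtype_apply,
          LinearEquiv.coe_coe, decomposeLinearEquiv_apply_coe, DirectSum.lmap_lof, ← map_add]
        congr 1
        exact Subtype.ext (TensorProduct.add_tmul r s _)
      map_smul' := fun c r => by
        apply DirectSum.decompose_lhom_ext fun p : ℕ => ⋀[ℂ]^p E
        intro p
        ext1 ω
        simp only [LinearMap.comp_apply, LinearMap.smul_apply, Submodule.subtype_apply,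
          LinearEquiv.coe_coe, decomposeLinearEquiv_apply_coe, DirectSum.lmap_lof, ← map_smul,
          RingHom.id_apply]
        congr 1
        exact Subtype.ext (TensorProduct.smul_tmul c r _) }

lemma koszulDecompose_tmul (r : R) {p : ℕ} {ω : ExteriorAlgebra ℂ E} (hω : ω ∈ ⋀[ℂ]^p E) :
    koszulDecompose E R (r ⊗ₜ[ℂ] ω) =
      DirectSum.lof ℂ ℕ (fun p => koszulDeg E R p) p ⟨r ⊗ₜ[ℂ] ω, tmul_mem_koszulDeg r hω⟩ := by
  have : decomposeLinearEquiv (fun p : ℕ => ⋀[ℂ]^p E) ω =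
      DirectSum.lof ℂ ℕ (fun p : ℕ => ⋀[ℂ]^p E) p ⟨ω, hω⟩ :=
    decompose_of_mem (fun p : ℕ => ⋀[ℂ]^p E) hω
  rw [koszulDecompose, TensorProduct.lift.tmul]
  simp only [LinearMap.coe_mk, AddHom.coe_mk, LinearMap.comp_apply, LinearEquiv.coe_coe, this,
    DirectSum.lmap_lof]
  rfl

lemma koszul_hom_ext {N : Type} [AddCommMonoid N] [Module ℂ N]
    {f g : R ⊗[ℂ] ExteriorAlgebra ℂ E →ₗ[ℂ] N}
    (h : ∀ (r : R) (p : ℕ), ∀ ω ∈ ⋀[ℂ]^p E, f (r ⊗ₜ[ℂ] ω) = g (r ⊗ₜ[ℂ] ω)) : f = g := by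
  refine TensorProduct.ext (LinearMap.ext fun r => ?_)
  apply DirectSum.decompose_lhom_ext fun p : ℕ => ⋀[ℂ]^p E
  intro p
  ext1 ω
  exact h r p ω.1 ω.2

instance : GradedAlgebra (koszulDeg E R) where
  toDecomposition := Decomposition.ofLinearMap _ (koszulDecompose E R)
    (koszul_hom_ext E R fun r p ω hω => by
      rw [LinearMap.comp_apply, koszulDecompose_tmul E R r hω, DirectSum.coeLinearMap_lof]
      rfl)
    (by
      ext m ⟨x, hx⟩ : 2
      simp only [LinearMap.comp_apply, LinearMap.id_apply, DirectSum.coeLinearMap_lof]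
      refine Submodule.span_induction (p := fun x hx => koszulDecompose E R x =
        DirectSum.lof ℂ ℕ (fun m => koszulDeg E R m) m ⟨x, hx⟩) ?_ ?_ ?_ ?_ hx
      · rintro _ ⟨r, ω, hω, rfl⟩
        exact koszulDecompose_tmul E R r hω
      · rw [map_zero]
        exact (map_zero (DirectSum.lof ℂ ℕ (fun m => koszulDeg E R m) m)).symm
      · intro x y hx hy h1 h2
        rw [map_add, h1, h2, ← map_add]; rfl
      · intro c x hx h
        rw [map_smul, h, ← map_smul]; rfl)

variable {R E} {κ : Type} [Fintype κ] (f : κ → R) (c : κ → Module.Dual ℂ E)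

/-- The Koszul differential on `R ⊗ Λ^• E` attached to the linear map
`E → R`, `ξ ↦ ∑_k c_k(ξ) f_k`: it is `∑_k f_k ⊗ (contraction with c_k)`. -/
def koszulD : R ⊗[ℂ] ExteriorAlgebra ℂ E →ₗ[ℂ] R ⊗[ℂ] ExteriorAlgebra ℂ E :=
  ∑ k, TensorProduct.map (LinearMap.mulLeft ℂ (f k)) (CliffordAlgebra.contractLeft (c k))

lemma koszulD_tmul (r : R) (ω : ExteriorAlgebra ℂ E) : koszulD f c (r ⊗ₜ[ℂ] ω) =
    ∑ k, (f k * r) ⊗ₜ[ℂ] (CliffordAlgebra.contractLeft (c k) ω) := by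
  simp [koszulD, LinearMap.sum_apply]

/-- On the generators, the Koszul differential is the given linear map `E → R`. -/
lemma koszulD_ι (ξ : E) : koszulD f c (1 ⊗ₜ[ℂ] ExteriorAlgebra.ι ℂ ξ) =
    (∑ k, c k ξ • f k) ⊗ₜ[ℂ] 1 := by
  rw [koszulD_tmul, TensorProduct.sum_tmul]
  refine Finset.sum_congr rfl fun k _ => ?_
  rw [ExteriorAlgebra.ι, CliffordAlgebra.contractLeft_ι, mul_one, Algebra.algebraMap_eq_smul_one,
    TensorProduct.tmul_smul, TensorProduct.smul_tmul']

lemma koszulD_zero (x : R ⊗[ℂ] ExteriorAlgebra ℂ E) (hx : x ∈ koszulDeg E R 0) :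
    koszulD f c x = 0 := by
  refine Submodule.span_induction (p := fun x _ => koszulD f c x = 0)
    ?_ (map_zero _) ?_ ?_ hx
  · rintro _ ⟨r, ω, hω, rfl⟩
    obtain ⟨z, rfl⟩ := Submodule.mem_one.1 (by simpa using hω)
    rw [koszulD_tmul]
    exact Finset.sum_eq_zero fun k _ => by
      rw [CliffordAlgebra.contractLeft_algebraMap, TensorProduct.tmul_zero]
  · intro x y _ _ h1 h2; rw [map_add, h1, h2, add_zero]
  · intro c x _ h; rw [map_smul, h, smul_zero]

lemma koszulD_mem (p : ℕ) (x : R ⊗[ℂ] ExteriorAlgebra ℂ E) (hx : x ∈ koszulDeg E R (p + 1)) :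
    koszulD f c x ∈ koszulDeg E R p := by
  refine Submodule.span_induction (p := fun x _ => koszulD f c x ∈ koszulDeg E R p)
    ?_ ?_ ?_ ?_ hx
  · rintro _ ⟨r, ω, hω, rfl⟩
    rw [koszulD_tmul]
    exact sum_mem fun k _ => tmul_mem_koszulDeg _ (contract_mem (c k) p ω hω)
  · rw [map_zero]; exact zero_mem _
  · intro x y _ _ h1 h2; rw [map_add]; exact add_mem h1 h2
  · intro c x _ h; rw [map_smul]; exact Submodule.smul_mem _ _ h

lemma koszulD_koszulD (x : R ⊗[ℂ] ExteriorAlgebra ℂ E) : koszulD f c (koszulD f c x) = 0 := by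
  have h : (koszulD f c).comp (koszulD f c) = 0 := by
    refine koszul_hom_ext E R fun r p ω _ => ?_
    rw [LinearMap.comp_apply, koszulD_tmul, map_sum, LinearMap.zero_apply]
    simp only [koszulD_tmul]
    have hanti : ∑ k, ∑ l, (f l * (f k * r)) ⊗ₜ[ℂ] (CliffordAlgebra.contractLeft (c l)
        (CliffordAlgebra.contractLeft (c k) ω)) =
        -∑ k, ∑ l, (f l * (f k * r)) ⊗ₜ[ℂ] (CliffordAlgebra.contractLeft (c l)
        (CliffordAlgebra.contractLeft (c k) ω)) := by
      conv_lhs => rw [Finset.sum_comm]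
      simp only [← Finset.sum_neg_distrib]
      refine Finset.sum_congr rfl fun k _ => Finset.sum_congr rfl fun l _ => ?_
      rw [CliffordAlgebra.contractLeft_comm, TensorProduct.tmul_neg, mul_left_comm]
    have h2 : (2 : ℂ) • ∑ k, ∑ l, (f l * (f k * r)) ⊗ₜ[ℂ] (CliffordAlgebra.contractLeft (c l)
        (CliffordAlgebra.contractLeft (c k) ω)) = 0 := by
      rw [two_smul]
      exact eq_neg_iff_add_eq_zero.1 hanti
    exact (IsUnit.smul_eq_zero (IsUnit.mk0 (2 : ℂ) two_ne_zero)).1 h2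
  exact LinearMap.congr_fun h x

lemma koszulD_leibniz (p : ℕ) (x : R ⊗[ℂ] ExteriorAlgebra ℂ E) (hx : x ∈ koszulDeg E R p)
    (y : R ⊗[ℂ] ExteriorAlgebra ℂ E) : koszulD f c (x * y) =
      koszulD f c x * y + (-1 : ℂ) ^ p • (x * koszulD f c y) := by
  refine Submodule.span_induction (p := fun x _ => koszulD f c (x * y) =
    koszulD f c x * y + (-1 : ℂ) ^ p • (x * koszulD f c y)) ?_ ?_ ?_ ?_ hx
  · rintro _ ⟨r, ω, hω, rfl⟩
    induction y using TensorProduct.induction_on with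
    | zero => rw [mul_zero, map_zero, mul_zero, mul_zero, smul_zero, add_zero]
    | add y z h1 h2 => rw [mul_add, map_add, h1, h2, mul_add, map_add, mul_add, smul_add]; abel
    | tmul s η =>
      rw [Algebra.TensorProduct.tmul_mul_tmul, koszulD_tmul, koszulD_tmul, koszulD_tmul,
        Finset.sum_mul, Finset.mul_sum, Finset.smul_sum, ← Finset.sum_add_distrib]
      refine Finset.sum_congr rfl fun k _ => ?_
      rw [contract_leibniz (c k) p ω hω, TensorProduct.tmul_add, TensorProduct.tmul_smul,
        Algebra.TensorProduct.tmul_mul_tmul, Algebra.TensorProduct.tmul_mul_tmul,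
        mul_assoc, mul_left_comm r]
  · rw [zero_mul, map_zero, zero_mul, zero_mul, smul_zero, add_zero]
  · intro x z _ _ h1 h2
    rw [add_mul, map_add, h1, h2, map_add, add_mul, add_mul, smul_add]
    abel
  · intro a x _ h
    rw [smul_mul_assoc, map_smul, h, map_smul, smul_mul_assoc, smul_mul_assoc, smul_add,
      smul_comm a]

lemma koszul_comm (p q : ℕ) (x : R ⊗[ℂ] ExteriorAlgebra ℂ E) (hx : x ∈ koszulDeg E R p)
    (y : R ⊗[ℂ] ExteriorAlgebra ℂ E) (hy : y ∈ koszulDeg E R q) :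
    x * y = (-1 : ℂ) ^ (p * q) • (y * x) := by
  refine Submodule.span_induction (p := fun x _ => x * y = (-1 : ℂ) ^ (p * q) • (y * x))
    ?_ ?_ ?_ ?_ hx
  · rintro _ ⟨r, ω, hω, rfl⟩
    refine Submodule.span_induction (p := fun y _ => (r ⊗ₜ[ℂ] ω) * y =
      (-1 : ℂ) ^ (p * q) • (y * (r ⊗ₜ[ℂ] ω))) ?_ ?_ ?_ ?_ hy
    · rintro _ ⟨s, η, hη, rfl⟩
      rw [Algebra.TensorProduct.tmul_mul_tmul, Algebra.TensorProduct.tmul_mul_tmul,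
        exterior_comm p q ω hω η hη, TensorProduct.tmul_smul, mul_comm r]
    · rw [mul_zero, zero_mul, smul_zero]
    · intro y z _ _ h1 h2
      rw [mul_add, add_mul, h1, h2, smul_add]
    · intro a y _ h
      rw [mul_smul_comm, smul_mul_assoc, h, smul_comm]
  · rw [mul_zero, zero_mul, smul_zero]
  · intro x z _ _ h1 h2
    rw [mul_add, add_mul, h1, h2, smul_add]
  · intro a x _ h
    rw [mul_smul_comm, smul_mul_assoc, h, smul_comm]

/-- The Koszul complex `(R ⊗ Λ^• E, d)`, as a commutative dg-algebra with `R` in degree `0` and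
`E` in degree `1`. -/
def koszul : CDGAlg where
  obj :=
    { carrier := R ⊗[ℂ] ExteriorAlgebra ℂ E
      deg := koszulDeg E R
      d := koszulD f c
      d_zero := koszulD_zero f c
      d_mem := koszulD_mem f c
      d_d := koszulD_koszulD f c
      leibniz := koszulD_leibniz f c }
  property := koszul_comm

end Koszul

/-! ### The framed doubled quiver, the moment map elements, and the algebras `A` and `A_cof` -/

section Nakajima

/-- The arrows of the framed doubled quiver of a quiver with vertex set `V`. The vertices are
`V ⊕ V`: `inl a` is the original vertex `a`, and `inr a` is its framing vertex. -/
inductive DFrHom {V : Type} [Quiver.{0} V] : V ⊕ V → V ⊕ V → Type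
  /-- The original arrows. -/
  | x {a b : V} (γ : a ⟶ b) : DFrHom (.inl a) (.inl b)
  /-- The doubles of the original arrows. -/
  | y {a b : V} (γ : a ⟶ b) : DFrHom (.inl b) (.inl a)
  /-- The framing arrows. -/
  | i (a : V) : DFrHom (.inr a) (.inl a)
  /-- The doubles of the framing arrows. -/
  | j (a : V) : DFrHom (.inl a) (.inr a)

/-- The arrows of the quiver `Q^ϑ`: those of the framed doubled quiver, and one loop on every
original vertex. -/
inductive ThetaHom {V : Type} [Quiver.{0} V] : V ⊕ V → V ⊕ V → Type
  | old {p q : V ⊕ V} (e : DFrHom p q) : ThetaHom p q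
  | loop (a : V) : ThetaHom (.inl a) (.inl a)

/-- The vertices of the framed doubled quiver. -/
def DFr (V : Type) : Type := V ⊕ V

/-- The vertices of the quiver `Q^ϑ`. -/
def Theta (V : Type) : Type := V ⊕ V

variable (V : Type)

instance [Quiver.{0} V] : Quiver.{0} (DFr V) := ⟨fun p q => DFrHom (V := V) p q⟩
instance [Quiver.{0} V] : Quiver.{0} (Theta V) := ⟨fun p q => ThetaHom (V := V) p q⟩
instance [Fintype V] : Fintype (DFr V) := inferInstanceAs (Fintype (V ⊕ V))
instance [Fintype V] : Fintype (Theta V) := inferInstanceAs (Fintype (V ⊕ V))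
instance [DecidableEq V] : DecidableEq (DFr V) := inferInstanceAs (DecidableEq (V ⊕ V))
instance [DecidableEq V] : DecidableEq (Theta V) := inferInstanceAs (DecidableEq (V ⊕ V))

variable {V} [Fintype V] [Quiver.{0} V] [∀ a b : V, Fintype (a ⟶ b)]

/-- The element `∑_{t(γ) = a} x_γ y_γ - ∑_{s(γ) = a} y_γ x_γ + i_a j_a` in a ring with given
elements for the arrows of the framed doubled quiver. -/
def momentElt {B : Type} [Ring B] (F : ∀ {p q : V ⊕ V}, DFrHom p q → B) (a : V) : B :=
  (∑ b : V, ∑ γ : b ⟶ a, F (.x γ) * F (.y γ)) - (∑ b : V, ∑ γ : a ⟶ b, F (.y γ) * F (.x γ)) +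
    F (.i a) * F (.j a)

variable [DecidableEq V]

/-- The element `μ_a` of the path algebra of the framed doubled quiver. -/
def mu (a : V) : PathAlg (DFr V) := momentElt (fun {p q} e => PathAlg.arrow (W := DFr V)
  (a := p) (b := q) e) a

/-- The element `μ_a` of the path algebra of `Q^ϑ`. -/
def muTheta (a : V) : PathAlg (Theta V) := momentElt (fun {p q} e => PathAlg.arrow (W := Theta V)
  (a := p) (b := q) (ThetaHom.old e)) a

variable (V) in
/-- The two-sided ideal generated by the elements `μ_a`. -/
def momentIdeal : TwoSidedIdeal (PathAlg (DFr V)) := TwoSidedIdeal.span (Set.range mu)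

variable (V) in
/-- The algebra `A`: the path algebra of the framed doubled quiver modulo the ideal generated by
the elements `μ_a`. -/
abbrev NakAlg : Type := (momentIdeal V).ringCon.Quotient

variable (V) in
/-- The quotient map onto `A`. -/
def nakMk : PathAlg (DFr V) →ₐ[ℂ] NakAlg V := (momentIdeal V).ringCon.mkₐ (α := ℂ)

lemma nakMk_mu (a : V) : nakMk V (mu a) = 0 := by
  have h : mu a ∈ momentIdeal V := TwoSidedIdeal.subset_span ⟨a, rfl⟩
  exact (RingCon.eq _).2 ((TwoSidedIdeal.mem_iff _ _).1 h)

variable (V) in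
/-- `A` as an object of `DGA_S^+`, placed in degree `0`. -/
def nakUnder : DGAUnder (V ⊕ V → ℂ) :=
  Under.mk (Y := DGAlg.ofAlg (NakAlg V)) (X := DGAlg.ofAlg (V ⊕ V → ℂ))
    ((DGAlg.ofAlg (NakAlg V)).homOfAlg ((nakMk V).comp (PathAlg.vertexMap (W := DFr V)))
      fun _ => by
        change _ ∈ trivialDeg (NakAlg V) 0
        rw [trivialDeg, if_pos rfl]
        exact Submodule.mem_top)

/-- Degrees of the arrows of `Q^ϑ`: the loops have degree `1`, all other arrows degree `0`. -/
def thetaDeg : ∀ {p q : Theta V}, (p ⟶ q) → ℕ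
  | _, _, .old _ => 0
  | _, _, .loop _ => 1

/-- Differentials of the arrows of `Q^ϑ`: `d ϑ_a = μ_a`, and `d = 0` on all other arrows. -/
def thetaD : ∀ {p q : Theta V}, (p ⟶ q) → PathAlg (Theta V)
  | _, _, .old _ => 0
  | _, _, .loop a => muTheta a

lemma theta_cases {P : ∀ {p q : Theta V}, (p ⟶ q) → Prop}
    (old : ∀ {p q : Theta V} (e : DFrHom (V := V) p q), P (p := p) (q := q) (ThetaHom.old e))
    (loop : ∀ a : V, P (p := (Sum.inl a : V ⊕ V)) (q := (Sum.inl a : V ⊕ V)) (ThetaHom.loop a))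
    {p q : Theta V} (f : p ⟶ q) : P f :=
  match p, q, f with
  | _, _, .old e => old e
  | _, _, .loop a => loop a

lemma mul_momentElt {B : Type} [Ring B] (F : ∀ {p q : V ⊕ V}, DFrHom p q → B) (a : V) (z : B)
    (h : ∀ {p : V ⊕ V} (e : DFrHom p (.inl a)), z * F e = F e) :
    z * momentElt F a = momentElt F a := by
  simp only [momentElt, mul_add, mul_sub, Finset.mul_sum, ← mul_assoc, h]

lemma momentElt_mul {B : Type} [Ring B] (F : ∀ {p q : V ⊕ V}, DFrHom p q → B) (a : V) (z : B)
    (h : ∀ {q : V ⊕ V} (e : DFrHom (.inl a) q), F e * z = F e) :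
    momentElt F a * z = momentElt F a := by
  simp only [momentElt, add_mul, sub_mul, Finset.sum_mul, mul_assoc, h]

lemma map_momentElt {B C : Type} [Ring B] [Ring C] [Algebra ℂ B] [Algebra ℂ C] (g : B →ₐ[ℂ] C)
    (F : ∀ {p q : V ⊕ V}, DFrHom p q → B) (F' : ∀ {p q : V ⊕ V}, DFrHom p q → C)
    (h : ∀ {p q : V ⊕ V} (e : DFrHom p q), g (F e) = F' e) (a : V) :
    g (momentElt F a) = momentElt F' a := by
  simp only [momentElt, map_add, map_sub, map_sum, map_mul, h]

lemma e_mul_muTheta (a : V) :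
    PathAlg.e (W := Theta V) (Sum.inl a : V ⊕ V) * muTheta a = muTheta a :=
  mul_momentElt _ a _ fun _ => PathAlg.e_mul_of (W := Theta V) _

lemma muTheta_mul_e (a : V) :
    muTheta a * PathAlg.e (W := Theta V) (Sum.inl a : V ⊕ V) = muTheta a :=
  momentElt_mul _ a _ fun _ => PathAlg.of_mul_e (W := Theta V) _

lemma arrow_old_mem {p q : Theta V} (e : DFrHom (V := V) p q) :
    PathAlg.arrow (W := Theta V) (a := p) (b := q) (ThetaHom.old e) ∈
      PathAlg.deg (W := Theta V) thetaDeg 0 :=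
  PathAlg.of_mem_deg rfl

lemma muTheta_mem (a : V) : muTheta a ∈ PathAlg.deg (W := Theta V) thetaDeg 0 := by
  have h : ∀ {p q p' q' : Theta V} (e : DFrHom (V := V) p q) (e' : DFrHom (V := V) p' q'),
      PathAlg.arrow (W := Theta V) (a := p) (b := q) (ThetaHom.old e) *
        PathAlg.arrow (W := Theta V) (a := p') (b := q') (ThetaHom.old e') ∈
      PathAlg.deg (W := Theta V) thetaDeg 0 := fun e e' =>
    SetLike.GradedMul.mul_mem (i := 0) (j := 0) (arrow_old_mem e) (arrow_old_mem e')
  exact add_mem (sub_mem (sum_mem fun b _ => sum_mem fun γ _ => h _ _)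
    (sum_mem fun b _ => sum_mem fun γ _ => h _ _)) (h _ _)

lemma e_mul_thetaD (p q : Theta V) (f : p ⟶ q) : PathAlg.e q * thetaD f = thetaD f :=
  theta_cases (P := fun {p q} f => PathAlg.e q * thetaD f = thetaD f)
    (fun _ => mul_zero _) e_mul_muTheta f

lemma thetaD_mul_e (p q : Theta V) (f : p ⟶ q) : thetaD f * PathAlg.e p = thetaD f :=
  theta_cases (P := fun {p q} f => thetaD f * PathAlg.e p = thetaD f)
    (fun _ => zero_mul _) muTheta_mul_e f

lemma thetaD_eq_zero {p q : Theta V} (f : p ⟶ q) : thetaDeg f = 0 → thetaD f = 0 :=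
  theta_cases (P := fun {p q} f => thetaDeg f = 0 → thetaD f = 0)
    (fun _ _ => rfl) (fun _ h => absurd h one_ne_zero) f

lemma thetaD_mem (p q : Theta V) (f : p ⟶ q) (m : ℕ) :
    thetaDeg f = m + 1 → thetaD f ∈ PathAlg.deg (W := Theta V) thetaDeg m :=
  theta_cases (P := fun {p q} f => thetaDeg f = m + 1 →
      thetaD f ∈ PathAlg.deg (W := Theta V) thetaDeg m)
    (fun _ h => absurd h.symm (Nat.succ_ne_zero m))
    (fun a h => by
      obtain rfl : m = 0 := (Nat.succ.inj h).symm
      exact muTheta_mem a) f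

lemma pathD_eq_zero {a b : Theta V} (p : Quiver.Path a b) (hp : pathDeg thetaDeg p = 0) :
    pathD thetaDeg thetaD p = 0 := by
  induction p with
  | nil => rfl
  | cons p f ih =>
    rw [pathDeg] at hp
    rw [pathD, ih (by omega), mul_zero, smul_zero, add_zero, thetaD_eq_zero f (by omega), zero_mul]

lemma extend_muTheta (a : V) :
    PathAlg.extend (pathD (W := Theta V) thetaDeg thetaD) (muTheta a) = 0 := by
  refine Submodule.span_induction
    (p := fun x _ => PathAlg.extend (pathD (W := Theta V) thetaDeg thetaD) x = 0)
    ?_ (map_zero _) ?_ ?_ (muTheta_mem a)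
  · rintro _ ⟨b, c, p, hp, rfl⟩
    rw [PathAlg.extend_of, pathD_eq_zero p hp]
  · intro x y _ _ h1 h2; rw [map_add, h1, h2, add_zero]
  · intro c x _ h; rw [map_smul, h, smul_zero]

lemma extend_thetaD (p q : Theta V) (f : p ⟶ q) :
    PathAlg.extend (pathD (W := Theta V) thetaDeg thetaD) (thetaD f) = 0 :=
  theta_cases (P := fun {p q} f =>
      PathAlg.extend (pathD (W := Theta V) thetaDeg thetaD) (thetaD f) = 0)
    (fun _ => map_zero _) extend_muTheta f

variable (V) in
/-- The dg-algebra `A_cof`: the path algebra of `Q^ϑ` with the loops `ϑ_a` in degree `1`, all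
other arrows in degree `0`, and `d ϑ_a = μ_a`. -/
def cofDG : DGAlg :=
  pathDG (W := Theta V) thetaDeg thetaD e_mul_thetaD thetaD_mul_e
    (fun _ _ f => thetaD_eq_zero f) thetaD_mem extend_thetaD

lemma cofDG_d_of {a b : Theta V} (p : Quiver.Path a b) :
    (cofDG V).d (PathAlg.of p) = pathD (W := Theta V) thetaDeg thetaD p :=
  PathAlg.extend_of (N := PathAlg (Theta V)) (pathD (W := Theta V) thetaDeg thetaD) p

/-- The differential of `A_cof` on the loops is `d ϑ_a = μ_a`. -/
lemma cofDG_d_loop (a : V) :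
    (cofDG V).d (PathAlg.arrow (W := Theta V) (a := (Sum.inl a : V ⊕ V))
      (b := (Sum.inl a : V ⊕ V)) (ThetaHom.loop a)) = muTheta a := by
  refine (cofDG_d_of _).trans ?_
  simp only [Quiver.Hom.toPath, pathD, mul_zero, smul_zero, add_zero]
  exact muTheta_mul_e a

variable (V) in
/-- `A_cof` as an object of `DGA_S^+`. -/
def cofUnder : DGAUnder (V ⊕ V → ℂ) :=
  Under.mk (Y := cofDG V) (X := DGAlg.ofAlg (V ⊕ V → ℂ))
    ((cofDG V).homOfAlg (PathAlg.vertexMap (W := Theta V)) fun s => by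
      change ∑ p : Theta V, s p • PathAlg.e p ∈ PathAlg.deg (W := Theta V) thetaDeg 0
      exact sum_mem fun p _ => Submodule.smul_mem _ _ (PathAlg.of_mem_deg rfl))

/-- The image in `A` of an arrow of `Q^ϑ`: the loops `ϑ_a` map to `0`. -/
def thetaToNak : ∀ {p q : Theta V}, (p ⟶ q) → NakAlg V
  | p, q, .old e => nakMk V (PathAlg.arrow (W := DFr V) (a := p) (b := q) e)
  | _, _, .loop _ => 0

variable (V) in
/-- The projection `A_cof → A` as an algebra map. -/
def cofToNak : PathAlg (Theta V) →ₐ[ℂ] NakAlg V :=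
  PathAlg.lift (W := Theta V) (fun p => nakMk V (PathAlg.e (W := DFr V) p)) thetaToNak
    (fun p q => by
      refine (map_mul (nakMk V) _ _).symm.trans
        ((congrArg (nakMk V) (PathAlg.e_mul_e (W := DFr V) p q)).trans ?_)
      rw [apply_ite (nakMk V), map_zero]
      rfl)
    (by
      rw [← map_one (nakMk V), PathAlg.one_def, map_sum]
      rfl)
    (fun p q f => theta_cases
      (P := fun {p q} f => nakMk V (PathAlg.e (W := DFr V) q) * thetaToNak f = thetaToNak f)
      (fun _ => (map_mul (nakMk V) _ _).symm.trans
          (congrArg (nakMk V) (PathAlg.e_mul_of (W := DFr V) _)))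
      (fun _ => mul_zero _) f)

lemma cofToNak_old {p q : Theta V} (e : DFrHom (V := V) p q) :
    cofToNak V (PathAlg.arrow (W := Theta V) (a := p) (b := q) (ThetaHom.old e)) =
      nakMk V (PathAlg.arrow (W := DFr V) (a := p) (b := q) e) := by
  refine (PathAlg.lift_of ..).trans ?_
  exact (map_mul (nakMk V) _ _).symm.trans
    (congrArg (nakMk V) (PathAlg.of_mul_e (W := DFr V) _))

lemma cofToNak_muTheta (a : V) : cofToNak V (muTheta a) = 0 :=
  ((map_momentElt (cofToNak V) _ _ (fun e => cofToNak_old e) a).trans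
    (map_momentElt (nakMk V) _ _ (fun _ => rfl) a).symm).trans (nakMk_mu a)

lemma thetaToNak_eq_zero {p q : Theta V} (f : p ⟶ q) : thetaDeg f ≠ 0 → thetaToNak f = 0 :=
  theta_cases (P := fun {p q} f => thetaDeg f ≠ 0 → thetaToNak f = 0)
    (fun _ h => absurd rfl h) (fun _ _ => rfl) f

lemma cofToNak_thetaD {p q : Theta V} (f : p ⟶ q) : cofToNak V (thetaD f) = 0 :=
  theta_cases (P := fun {p q} f => cofToNak V (thetaD f) = 0)
    (fun _ => map_zero _) cofToNak_muTheta f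

lemma cofToNak_of {a b : Theta V} (p : Quiver.Path a b) (hp : pathDeg thetaDeg p ≠ 0) :
    cofToNak V (PathAlg.of p) = 0 := by
  rw [cofToNak, PathAlg.lift_of]
  induction p with
  | nil => exact absurd rfl hp
  | cons p f ih =>
    rw [pathDeg] at hp
    rw [PathAlg.liftPath]
    by_cases hf : thetaDeg f = 0
    · rw [ih (by omega), mul_zero]
    · rw [thetaToNak_eq_zero f hf, zero_mul]

lemma cofToNak_pathD {a b : Theta V} (p : Quiver.Path a b) :
    cofToNak V (pathD thetaDeg thetaD p) = 0 := by
  induction p with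
  | nil => exact map_zero _
  | cons p f ih =>
    rw [pathD, map_add, map_mul, map_smul, map_mul, ih, mul_zero, smul_zero, add_zero,
      cofToNak_thetaD, zero_mul]

variable (V) in
/-- The projection `π : A_cof → A` in `DGA_S^+`: it is the obvious projection on the arrows of
the framed doubled quiver, and `0` on the loops `ϑ_a`. -/
def cofProj : cofUnder V ⟶ nakUnder V :=
  Under.homMk (U := cofUnder V) (V := nakUnder V)
    { alg := cofToNak V
      map_deg := fun m x hx => by
        rcases Nat.eq_zero_or_pos m with rfl | hm
        · change _ ∈ trivialDeg (NakAlg V) 0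
          rw [trivialDeg, if_pos rfl]
          exact Submodule.mem_top
        · have h0 : cofToNak V x = 0 := by
            refine Submodule.span_induction (p := fun x _ => cofToNak V x = 0) ?_ (map_zero _)
              ?_ ?_ hx
            · rintro _ ⟨b, c, p, rfl, rfl⟩
              exact cofToNak_of p hm.ne'
            · intro x y _ _ h1 h2; rw [map_add, h1, h2, add_zero]
            · intro c x _ h; rw [map_smul, h, smul_zero]
          exact (congrArg (· ∈ (DGAlg.ofAlg (NakAlg V)).deg m) h0).mpr (zero_mem _)
      map_d := fun x => by
        have h : (cofToNak V).toLinearMap.comp (cofDG V).d = 0 :=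
          PathAlg.hom_ext fun a b p =>
            (congrArg (cofToNak V) (cofDG_d_of p)).trans (cofToNak_pathD p)
        exact LinearMap.congr_fun h x }
    (by
      apply DGAlg.hom_ext
      intro s
      change cofToNak V (∑ p : Theta V, s p • PathAlg.e p) =
        nakMk V (∑ p : DFr V, s p • PathAlg.e p)
      rw [map_sum, map_sum]
      simp only [map_smul]
      refine Finset.sum_congr rfl fun p _ => congrArg (s p • ·) ?_
      exact PathAlg.lift_of ..)

end Nakajima

/-! ### Dimension vectors, the representation of `S`, and the moment map -/

section Moment
variable {V : Type} (v w : V → ℕ)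

/-- The dimension vector on the vertices of the framed doubled quiver. -/
def dimVec : V ⊕ V → ℕ := Sum.elim v w

/-- Indices of the standard basis of `ℂ^v ⊕ ℂ^w`. -/
abbrev BasisIdx : Type := Σ p : V ⊕ V, Fin (dimVec v w p)

variable [Fintype V] [DecidableEq V]

/-- The representation of `S` on `ℂ^v ⊕ ℂ^w` in which the idempotent of a vertex acts as the
projection on the summand at this vertex. -/
def rhoVW : (V ⊕ V → ℂ) →ₐ[ℂ] Matrix (BasisIdx v w) (BasisIdx v w) ℂ :=
  (Matrix.diagonalAlgHom ℂ).comp (AlgHom.pi fun x => Pi.evalAlgHom ℂ (fun _ => ℂ) x.1)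

variable [Quiver.{0} V] [∀ a b : V, Fintype (a ⟶ b)]

/-- A representation with entries in `B` of the framed doubled quiver, with dimension vectors
`v` and `w`: a matrix for every arrow. For `B = ℂ` this is the linear space `M(Q, v, w)`. -/
def RepSpace (B : Type) : Type :=
  ∀ {p q : V ⊕ V}, DFrHom p q → Matrix (Fin (dimVec v w q)) (Fin (dimVec v w p)) B

variable {v w} in
/-- The component at `a` of the moment map: `[X, Y] + IJ`, that is
`∑_{t(γ) = a} X_γ Y_γ - ∑_{s(γ) = a} Y_γ X_γ + I_a J_a`. -/
def momentMap {B : Type} [CommRing B] (X : RepSpace v w B) (a : V) :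
    Matrix (Fin (v a)) (Fin (v a)) B :=
  (∑ b : V, ∑ γ : b ⟶ a, X (.x γ) * X (.y γ)) - (∑ b : V, ∑ γ : a ⟶ b, X (.y γ) * X (.x γ)) +
    X (.i a) * X (.j a)

/-- The linear coordinates on `M(Q, v, w)`: the matrix entries of the arrows. -/
abbrev CoordIdx : Type :=
  Σ (p : V ⊕ V) (q : V ⊕ V) (_ : DFrHom p q), Fin (dimVec v w q) × Fin (dimVec v w p)

/-- The ring `O(M(Q, v, w))` of polynomial functions on `M(Q, v, w)`. -/
abbrev FunRing : Type := MvPolynomial (CoordIdx v w) ℂ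

/-- The universal point of `M(Q, v, w)`: the matrices whose entries are the coordinate
functions. -/
def genericPoint : RepSpace v w (FunRing v w) :=
  fun {p q} e => Matrix.of fun i j => MvPolynomial.X ⟨p, q, e, i, j⟩

/-- The Lie algebra `g_v = ⊕_a gl_{v_a}(ℂ)`. -/
abbrev LieG : Type := ∀ a : V, Matrix (Fin (v a)) (Fin (v a)) ℂ

/-- The linear form `ξ ↦ (ξ_a)_{ij}` on `g_v`. -/
def entryForm (a : V) (i j : Fin (v a)) : Module.Dual ℂ (LieG v) :=
  (Matrix.entryLinearMap ℂ ℂ i j).comp (LinearMap.proj a)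

/-- The Koszul complex `O(M(Q, v, w)) ⊗ Λ^• g_v` on the moment map: its differential sends `ξ` in
`g_v` to the function `⟨μ, ξ⟩ = ∑_a tr(μ_a ξ_a) = ∑_{a, i, j} (μ_a)_{ij} (ξ_a)_{ji}`. -/
def koszulMoment : CDGAlg :=
  koszul (κ := Σ a : V, Fin (v a) × Fin (v a)) (E := LieG v) (R := FunRing v w)
    (fun k => momentMap (genericPoint v w) k.1 k.2.1 k.2.2)
    (fun k => entryForm v k.1 k.2.2 k.2.1)

/-- The differential of the Koszul complex on `g_v` is the pairing with the moment map. -/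
lemma koszulMoment_d_ι (ξ : LieG v) :
    (koszulMoment v w).obj.d ((1 : FunRing v w) ⊗ₜ[ℂ] ExteriorAlgebra.ι ℂ ξ) =
      (∑ a, Matrix.trace (momentMap (genericPoint v w) a *
        (ξ a).map (algebraMap ℂ (FunRing v w)))) ⊗ₜ[ℂ] (1 : ExteriorAlgebra ℂ (LieG v)) := by
  refine (koszulD_ι _ _ ξ).trans ?_
  congr 1
  rw [Fintype.sum_sigma]
  refine Finset.sum_congr rfl fun a _ => ?_
  rw [Fintype.sum_prod_type, Matrix.trace]
  refine Finset.sum_congr rfl fun i _ => ?_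
  rw [Matrix.diag_apply, Matrix.mul_apply]
  refine Finset.sum_congr rfl fun j _ => ?_
  rw [Matrix.map_apply, mul_comm, ← Algebra.smul_def]
  rfl

end Moment

/-! ### Derived affine schemes and derived representation schemes -/

/-- The category `DGAff` of derived affine schemes over `ℂ`, dual to `CDGA^+`. -/
abbrev DGAff : Type 1 := CDGAlgᵒᵖ

/-- The spectrum of a commutative dg-algebra. -/
abbrev Spec (B : CDGAlg) : DGAff := Opposite.op B

/-- The homotopy category `Ho(CDGA^+)`: the localization of `CDGA^+` at the quasi-isomorphisms. -/
abbrev HoCDGAlg : Type 1 := quasiIsoComm.Localization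

/-- The homotopy category `Ho(DGAff)`, dual to `Ho(CDGA^+)`. -/
abbrev HoDGAff : Type 1 := HoCDGAlgᵒᵖ

/-- The localization functor `DGAff ⥤ Ho(DGAff)`. -/
abbrev toHoDGAff : DGAff ⥤ HoDGAff := quasiIsoComm.Q.op

section DRep
variable {S : Type} [Ring S] [Algebra ℂ S]

/-- The homotopy category `Ho(DGA_S^+)`: the localization of `DGA_S^+` at the
quasi-isomorphisms. -/
abbrev HoDGAUnder (S : Type) [Ring S] [Algebra ℂ S] : Type 1 := (quasiIsoUnder S).Localization

/-- The localization functor `DGA_S^+ ⥤ Ho(DGA_S^+)`. -/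
abbrev toHoDGAUnder (S : Type) [Ring S] [Algebra ℂ S] : DGAUnder S ⥤ HoDGAUnder S :=
  (quasiIsoUnder S).Q

variable {n : Type} [Fintype n] [DecidableEq n] (ρ : S →ₐ[ℂ] Matrix n n ℂ)

/-- The representation functor followed by the localization, `DGA_S^+ ⥤ CDGA^+ ⥤ Ho(CDGA^+)`. -/
abbrev repToHo : DGAUnder S ⥤ HoCDGAlg := repFunctor ρ ⋙ quasiIsoComm.Q

/-- The representation scheme `Rep_V(A) = Spec(A_V)`. -/
abbrev RepScheme (A : DGAUnder S) : DGAff := Spec ((repFunctor ρ).obj A)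

variable [(repToHo ρ).HasLeftDerivedFunctor (quasiIsoUnder S)]

/-- The derived representation functor `L(-)_V : Ho(DGA_S^+) ⥤ Ho(CDGA^+)`: the total left
derived functor of the representation functor. -/
abbrev derivedRep : HoDGAUnder S ⥤ HoCDGAlg :=
  (repToHo ρ).totalLeftDerived (toHoDGAUnder S) (quasiIsoUnder S)

/-- The comparison `L(A)_V ⟶ A_V` from the derived representation functor to the representation
functor, which is part of the structure of a total left derived functor. -/
abbrev derivedRepCounit : toHoDGAUnder S ⋙ derivedRep ρ ⟶ repToHo ρ :=
  (repToHo ρ).totalLeftDerivedCounit (toHoDGAUnder S) (quasiIsoUnder S)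

/-- The derived representation scheme `DRep_V(A) = Spec(L(A)_V)`, an object of `Ho(DGAff)`. -/
abbrev DRepScheme (A : DGAUnder S) : HoDGAff :=
  Opposite.op ((derivedRep ρ).obj ((toHoDGAUnder S).obj A))

end DRep

end DRepKoszul

end

open DRepKoszul

/-!
# The derived representation scheme of a Nakajima quiver algebra is a Koszul complex

The theorem has three independent ingredients.

*Acyclicity of `A_cof`.* Let `h` be the linear operator on the paths of `Q^ϑ` that reads a path
from its last arrow on, passes the arrows `x`, `y`, `j`, and replaces the first piece `i_a j_a` that
it meets by `ϑ_a`; it gives `0` when it meets a loop before. The only arrows into a framing vertex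
are the `j_a`, so an arrow `i_a` is either preceded by `j_a` or the first arrow of its path. Hence
`dh + hd - 1` strictly lowers, in positive degrees, the number of arrows `i` and `ϑ` in a path: the
leading terms of `d ϑ_a = μ_a` are the `i_a j_a` (`deviation_of_mem`). By induction on this number
all cycles of positive degree bound (`cofDG_acyclic`), while `H_0` is `A` by definition. So `π` is
an acyclic fibration, whatever the quiver `Q` is. The algebra `A_cof` is cofibrant because a path
algebra maps freely: the images of the old arrows lift along an acyclic fibration by surjectivity in
degree `0`, and those of the loops by acyclicity of the kernel (`cofUnder_cofibrant`).

*Existence of the derived functor.* The model structure on `DGA_S^+` is not needed. It suffices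
that the representation functor inverts, in the homotopy category, quasi-isomorphisms between
cofibrant objects (`repToHo_isIso`), and that there is a functorial cofibrant replacement
(`cofRep`): composing the two gives the derived functor (`isLeftDerivedFunctor_of_replacement`), and
every cofibrant replacement computes it (`exists_derivedRep_iso`). For the first point, a
quasi-isomorphism `f : A → B` has a mapping path object `P_f`, made of pairs `(a, γ)` with `γ` a
polynomial path in `B` that starts at `f a`; evaluation at the end point is an acyclic fibration
`P_f → B`, which has a section when `B` is cofibrant. The matrix entries of polynomial paths in `B`
are polynomial paths in `B_V`, so homotopic maps remain homotopic after `(-)_V`, and `f` obtains a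
right inverse up to homotopy, which is again a quasi-isomorphism. For the second point, the
replacement of `A` is the algebra under `S` freely generated by a linear copy `σ(A)` of `A` and a
linear operator `h`, with `dh + hd = 1 - σ π`. Freeness allows lifts along an acyclic fibration,
which is a deformation retraction of complexes (`exists_deformationRetract`).

*The Koszul complex.* A map from `(A_cof)_{v,w}` to a commutative dg-algebra `C` is a representation
of `A_cof` over `C`, that is, a matrix over `C_0` for every arrow of the framed doubled quiver, and
a matrix over `C_1` for every loop `ϑ_a` whose differential is the component at `a` of the moment
map. A map from `O(M(Q, v, w)) ⊗ Λ^• g_v` to `C` is given by the same data. The maps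
`repToKoszul` and `koszulToRep` make this explicit in both directions.
-/

open CategoryTheory DirectSum TensorProduct
set_option linter.unusedSectionVars false
set_option linter.unusedVariables false
noncomputable section
namespace DRepKoszul

/-! ### Quasi-isomorphisms and acyclic fibrations, elementwise -/

lemma DGAlg.homology_mk_eq_zero_iff (A : DGAlg) {n : ℕ} (z : A.cycles n) :
    (Submodule.Quotient.mk z : A.homology n) = 0 ↔ ∃ a ∈ A.deg (n + 1), A.d a = z := by
  rw [Submodule.Quotient.mk_eq_zero]
  rfl

lemma quasiIso_iff {A B : DGAlg} (f : A ⟶ B) : quasiIso f ↔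
    (∀ n, ∀ z ∈ A.deg n, A.d z = 0 → ∀ b ∈ B.deg (n + 1), B.d b = DGAlg.Hom.alg f z →
      ∃ a ∈ A.deg (n + 1), A.d a = z) ∧
    (∀ n, ∀ y ∈ B.deg n, B.d y = 0 → ∃ z ∈ A.deg n, A.d z = 0 ∧
      ∃ b ∈ B.deg (n + 1), B.d b = DGAlg.Hom.alg f z - y) := by
  have hinj : ∀ n, Function.Injective (DGAlg.Hom.homologyMap f n) ↔
      (∀ z ∈ A.deg n, A.d z = 0 → ∀ b ∈ B.deg (n + 1), B.d b = DGAlg.Hom.alg f z →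
        ∃ a ∈ A.deg (n + 1), A.d a = z) := by
    intro n
    rw [injective_iff_map_eq_zero]
    constructor
    · intro h z hz hdz b hb hbz
      have h1 := h (Submodule.Quotient.mk ⟨z, hz, hdz⟩)
        ((B.homology_mk_eq_zero_iff (DGAlg.Hom.cyclesMap f n ⟨z, hz, hdz⟩)).2 ⟨b, hb, hbz⟩)
      exact (A.homology_mk_eq_zero_iff _).1 h1
    · intro h x hx
      obtain ⟨⟨z, hz, hdz⟩, rfl⟩ := Submodule.Quotient.mk_surjective _ x
      obtain ⟨b, hb, hbz⟩ :=
        (B.homology_mk_eq_zero_iff (DGAlg.Hom.cyclesMap f n ⟨z, hz, hdz⟩)).1 hx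
      exact (A.homology_mk_eq_zero_iff _).2 (h z hz hdz b hb hbz)
  have hsurj : ∀ n, Function.Surjective (DGAlg.Hom.homologyMap f n) ↔
      (∀ y ∈ B.deg n, B.d y = 0 → ∃ z ∈ A.deg n, A.d z = 0 ∧
        ∃ b ∈ B.deg (n + 1), B.d b = DGAlg.Hom.alg f z - y) := by
    intro n
    have key : ∀ (z : A.cycles n) (y : B.cycles n), DGAlg.Hom.homologyMap f n
        (Submodule.Quotient.mk z) = Submodule.Quotient.mk y ↔
        ∃ b ∈ B.deg (n + 1), B.d b = DGAlg.Hom.alg f z - y := by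
      intro z y
      rw [← sub_eq_zero]
      exact B.homology_mk_eq_zero_iff (DGAlg.Hom.cyclesMap f n z - y)
    constructor
    · intro h y hy hdy
      obtain ⟨x, hx⟩ := h (Submodule.Quotient.mk ⟨y, hy, hdy⟩)
      obtain ⟨z, rfl⟩ := Submodule.Quotient.mk_surjective _ x
      exact ⟨z.1, z.2.1, z.2.2, (key _ _).1 hx⟩
    · intro h x
      obtain ⟨y, rfl⟩ := Submodule.Quotient.mk_surjective _ x
      obtain ⟨z, hz, hdz, hb⟩ := h y.1 y.2.1 y.2.2
      exact ⟨Submodule.Quotient.mk ⟨z, hz, hdz⟩, (key _ _).2 hb⟩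
  constructor
  · exact fun h => ⟨fun n => (hinj n).1 (h n).1, fun n => (hsurj n).1 (h n).2⟩
  · exact fun h n => ⟨(hinj n).2 (h.1 n), (hsurj n).2 (h.2 n)⟩

lemma DGAlg.homologyMap_comp {A B C : DGAlg} (f : A ⟶ B) (g : B ⟶ C) (n : ℕ) :
    ⇑(DGAlg.Hom.homologyMap (f ≫ g) n) =
      DGAlg.Hom.homologyMap g n ∘ DGAlg.Hom.homologyMap f n := by
  funext x
  obtain ⟨z, rfl⟩ := Submodule.Quotient.mk_surjective _ x
  rfl

lemma DGAlg.homologyMap_id (A : DGAlg) (n : ℕ) :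
    ⇑(DGAlg.Hom.homologyMap (𝟙 A) n) = id := by
  funext x
  obtain ⟨z, rfl⟩ := Submodule.Quotient.mk_surjective _ x
  rfl

instance : quasiIso.HasTwoOutOfThreeProperty where
  comp_mem f g hf hg n := by
    rw [DGAlg.homologyMap_comp]; exact (hg n).comp (hf n)
  of_postcomp f g hg hfg n := by
    have h := hfg n
    rw [DGAlg.homologyMap_comp] at h
    exact (Function.Bijective.of_comp_iff' (hg n) _).1 h
  of_precomp f g hf hfg n := by
    have h := hfg n
    rw [DGAlg.homologyMap_comp] at h
    exact (Function.Bijective.of_comp_iff _ (hf n)).1 h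

instance : quasiIso.IsMultiplicative where
  id_mem A n := by rw [DGAlg.homologyMap_id]; exact Function.bijective_id

/-- An acyclic fibration is surjective in every degree, including degree `0`. -/
lemma acyclicFibration_surjective {E B : DGAlg} {p : E ⟶ B} (hq : quasiIso p)
    (hf : fibration p) (n : ℕ) (b : B.carrier) (hb : b ∈ B.deg n) :
    ∃ e ∈ E.deg n, DGAlg.Hom.alg p e = b := by
  rcases n with _ | n
  · obtain ⟨z, hz, -, c, hc, hcz⟩ := ((quasiIso_iff p).1 hq).2 0 b hb (B.d_zero b hb)
    obtain ⟨c', hc', rfl⟩ := hf 0 c hc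
    refine ⟨z - E.d c', sub_mem hz (E.d_mem 0 _ hc'), ?_⟩
    rw [map_sub, DGAlg.Hom.map_d, hcz]
    abel
  · exact hf n b hb

/-- The kernel of an acyclic fibration is acyclic. -/
lemma acyclicFibration_kernel {E B : DGAlg} {p : E ⟶ B} (hq : quasiIso p)
    (hf : fibration p) (n : ℕ) (e : E.carrier) (he : e ∈ E.deg n) (hd : E.d e = 0)
    (hp : DGAlg.Hom.alg p e = 0) :
    ∃ c ∈ E.deg (n + 1), DGAlg.Hom.alg p c = 0 ∧ E.d c = e := by
  obtain ⟨c, hc, hce⟩ := ((quasiIso_iff p).1 hq).1 n e he hd 0 (zero_mem _) (by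
    rw [map_zero, hp])
  obtain ⟨z, hz, hdz, b, hb, hbz⟩ := ((quasiIso_iff p).1 hq).2 (n + 1) (DGAlg.Hom.alg p c)
    (DGAlg.Hom.map_deg p _ _ hc) (by rw [← DGAlg.Hom.map_d, hce, hp])
  obtain ⟨b', hb', rfl⟩ := hf (n + 1) b hb
  refine ⟨c - z + E.d b', add_mem (sub_mem hc hz) (E.d_mem _ _ hb'), ?_, ?_⟩
  · rw [map_add, map_sub, DGAlg.Hom.map_d, hbz]
    abel
  · rw [map_add, map_sub, hce, hdz, E.d_d]
    abel

lemma exists_linear_section {M N : Type} [AddCommGroup M] [Module ℂ M] [AddCommGroup N]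
    [Module ℂ N] (f : M →ₗ[ℂ] N) (W : Submodule ℂ M) (Y : Submodule ℂ N)
    (h : ∀ y ∈ Y, ∃ w ∈ W, f w = y) :
    ∃ g : N →ₗ[ℂ] M, (∀ x, g x ∈ W) ∧ ∀ y ∈ Y, f (g y) = y := by
  obtain ⟨r, hr⟩ := (f.comp W.subtype).rangeRestrict.exists_rightInverse_of_surjective
    (LinearMap.range_rangeRestrict _)
  obtain ⟨g, hg⟩ := r.exists_extend
  refine ⟨W.subtype.comp g, fun x => (g x).2, fun y hy => ?_⟩
  obtain ⟨w, hw, hwy⟩ := h y hy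
  let y' : LinearMap.range (f.comp W.subtype) := ⟨y, ⟨w, hw⟩, hwy⟩
  have h1 : g y = r y' := LinearMap.congr_fun hg y'
  have h2 := congrArg Subtype.val (LinearMap.congr_fun hr y')
  rw [LinearMap.comp_apply, h1]
  exact h2

/-- Sections of a linear map chosen in every degree assemble to a linear map. -/
lemma exists_graded_section (C E : DGAlg) (f : E.carrier →ₗ[ℂ] C.carrier)
    (W : ℕ → Submodule ℂ E.carrier) (Y : ℕ → Submodule ℂ C.carrier)
    (h : ∀ n, ∀ y ∈ Y n, ∃ w ∈ W n, f w = y) :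
    ∃ g : C.carrier →ₗ[ℂ] E.carrier, (∀ n, ∀ c ∈ C.deg n, g c ∈ W n) ∧
      ∀ n, ∀ y ∈ C.deg n, y ∈ Y n → f (g y) = y := by
  choose g hgW hgY using fun n => exists_linear_section f (W n) (Y n) (h n)
  let G : C.carrier →ₗ[ℂ] E.carrier := (DirectSum.toModule ℂ ℕ E.carrier fun n =>
    (g n).comp (C.deg n).subtype).comp (decomposeLinearEquiv C.deg).toLinearMap
  have key : ∀ n, ∀ c ∈ C.deg n, G c = g n c := by
    intro n c hc
    have h1 : decomposeLinearEquiv C.deg c = DirectSum.lof ℂ ℕ (fun n => C.deg n) n ⟨c, hc⟩ :=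
      decompose_of_mem C.deg hc
    simp only [G, LinearMap.comp_apply, LinearEquiv.coe_coe, h1, DirectSum.toModule_lof]
    rfl
  refine ⟨G, fun n c hc => ?_, fun n y hy hyY => ?_⟩
  · rw [key n c hc]; exact hgW n c
  · rw [key n y hy]; exact hgY n y hyY

/-- Equality of linear maps on a dg-algebra can be checked on homogeneous elements. -/
lemma DGAlg.linearMap_ext {A : DGAlg} {N : Type} [AddCommMonoid N] [Module ℂ N]
    {f g : A.carrier →ₗ[ℂ] N} (h : ∀ n, ∀ a ∈ A.deg n, f a = g a) (a : A.carrier) :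
    f a = g a :=
  A.induction (P := fun a => f a = g a) h (fun a b ha hb => by rw [map_add, map_add, ha, hb]) a

/-- An acyclic fibration `p : E → B` is a deformation retraction of complexes: it has a section
`s` which is a chain map, and there is a homotopy `k` from `s p` to the identity with values in
the kernel of `p`. -/
lemma exists_deformationRetract {E B : DGAlg} {p : E ⟶ B} (hq : quasiIso p) (hf : fibration p) :
    ∃ (s : B.carrier →ₗ[ℂ] E.carrier) (k : E.carrier →ₗ[ℂ] E.carrier),
      (∀ n, ∀ b ∈ B.deg n, s b ∈ E.deg n) ∧ (∀ n, ∀ e ∈ E.deg n, k e ∈ E.deg (n + 1)) ∧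
      (∀ b, DGAlg.Hom.alg p (s b) = b) ∧ (∀ e, DGAlg.Hom.alg p (k e) = 0) ∧
      (∀ b, E.d (s b) = s (B.d b)) ∧
      (∀ e, E.d (k e) + k (E.d e) = e - s (DGAlg.Hom.alg p e)) := by
  obtain ⟨s₀, hs₀W, hs₀⟩ := exists_graded_section B E (DGAlg.Hom.alg p).toLinearMap E.deg B.deg
    (fun n b hb => acyclicFibration_surjective hq hf n b hb)
  obtain ⟨r, hrW, hr⟩ := exists_graded_section E E E.d
    (fun n => E.deg (n + 1) ⊓ LinearMap.ker (DGAlg.Hom.alg p).toLinearMap)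
    (fun n => E.deg n ⊓ (LinearMap.ker E.d ⊓ LinearMap.ker (DGAlg.Hom.alg p).toLinearMap))
    (fun n e he => by
      obtain ⟨c, hc, hpc, hdc⟩ := acyclicFibration_kernel hq hf n e he.1 he.2.1 he.2.2
      exact ⟨c, ⟨hc, hpc⟩, hdc⟩)
  have ps₀ : ∀ b, DGAlg.Hom.alg p (s₀ b) = b := DGAlg.linearMap_ext
    (f := (DGAlg.Hom.alg p).toLinearMap.comp s₀) (g := LinearMap.id)
    (fun n b hb => hs₀ n b hb hb)
  have pr : ∀ e, DGAlg.Hom.alg p (r e) = 0 := DGAlg.linearMap_ext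
    (f := (DGAlg.Hom.alg p).toLinearMap.comp r) (g := 0) (fun n e he => (hrW n e he).2)
  have hpd : ∀ e, DGAlg.Hom.alg p (E.d e) = B.d (DGAlg.Hom.alg p e) := DGAlg.Hom.map_d p
  -- the contraction of the kernel of `p`
  let k₀ : E.carrier →ₗ[ℂ] E.carrier := r.comp (LinearMap.id - r.comp E.d)
  have k₀_apply : ∀ e, k₀ e = r (e - r (E.d e)) := fun e => rfl
  have hd0 : ∀ n, ∀ e ∈ E.deg n, DGAlg.Hom.alg p e = 0 → r (E.d e) ∈ E.deg n ∧
      E.d (r (E.d e)) = E.d e := by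
    intro n e he hpe
    rcases n with _ | n
    · rw [E.d_zero e he, map_zero, map_zero]; exact ⟨zero_mem _, rfl⟩
    · have hd := E.d_mem n e he
      exact ⟨(hrW n _ hd).1, hr n _ hd ⟨hd, E.d_d e, by
        change DGAlg.Hom.alg p _ = 0
        rw [hpd, hpe, map_zero]⟩⟩
  have dk₀ : ∀ n, ∀ e ∈ E.deg n, DGAlg.Hom.alg p e = 0 → E.d (k₀ e) + k₀ (E.d e) = e := by
    intro n e he hpe
    obtain ⟨h1, h2⟩ := hd0 n e he hpe
    rw [k₀_apply, k₀_apply, E.d_d, map_zero, sub_zero, hr n (e - r (E.d e)) (sub_mem he h1)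
      ⟨sub_mem he h1, by
        change E.d _ = 0
        rw [map_sub, h2, sub_self], by
        change DGAlg.Hom.alg p _ = 0
        rw [map_sub, hpe, pr, sub_self]⟩]
    abel
  have k₀deg : ∀ n, ∀ e ∈ E.deg n, DGAlg.Hom.alg p e = 0 → k₀ e ∈ E.deg (n + 1) := by
    intro n e he hpe
    exact (hrW n _ (sub_mem he (hd0 n e he hpe).1)).1
  -- the section, corrected to a chain map
  let s : B.carrier →ₗ[ℂ] E.carrier := s₀ - k₀.comp (E.d.comp s₀ - s₀.comp B.d)
  have s_apply : ∀ b, s b = s₀ b - k₀ (E.d (s₀ b) - s₀ (B.d b)) := fun b => rfl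
  have hker : ∀ b, DGAlg.Hom.alg p (E.d (s₀ b) - s₀ (B.d b)) = 0 := by
    intro b
    rw [map_sub, hpd, ps₀, ps₀, sub_self]
  have ps : ∀ b, DGAlg.Hom.alg p (s b) = b := by
    intro b
    rw [s_apply, map_sub, ps₀, k₀_apply, pr, sub_zero]
  have hsdeg : ∀ n, ∀ b ∈ B.deg n, s b ∈ E.deg n := by
    intro n b hb
    rw [s_apply]
    refine sub_mem (hs₀W n b hb) ?_
    rcases n with _ | n
    · rw [E.d_zero _ (hs₀W 0 b hb), B.d_zero b hb, map_zero, sub_zero, map_zero]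
      exact zero_mem _
    · exact k₀deg n _ (sub_mem (E.d_mem n _ (hs₀W _ b hb)) (hs₀W n _ (B.d_mem n b hb))) (hker b)
  have sd : ∀ b, E.d (s b) = s (B.d b) := by
    refine DGAlg.linearMap_ext (f := E.d.comp s) (g := s.comp B.d) fun n b hb => ?_
    rw [LinearMap.comp_apply, LinearMap.comp_apply, s_apply, s_apply]
    rcases n with _ | n
    · rw [E.d_zero _ (hs₀W 0 b hb), B.d_zero b hb]
      simp [E.d_zero _ (hs₀W 0 b hb)]
    · have h := dk₀ n _ (sub_mem (E.d_mem n _ (hs₀W _ b hb)) (hs₀W n _ (B.d_mem n b hb)))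
        (hker b)
      have h' := eq_sub_of_add_eq h
      rw [map_sub, h', map_sub E.d, E.d_d, B.d_d, map_zero s₀]
      simp only [zero_sub, sub_zero, map_neg]
      abel
  let q : E.carrier →ₗ[ℂ] E.carrier := LinearMap.id - s.comp (DGAlg.Hom.alg p).toLinearMap
  have q_apply : ∀ e, q e = e - s (DGAlg.Hom.alg p e) := fun e => rfl
  have pq : ∀ e, DGAlg.Hom.alg p (q e) = 0 := by
    intro e
    rw [q_apply, map_sub, ps, sub_self]
  have qdeg : ∀ n, ∀ e ∈ E.deg n, q e ∈ E.deg n := fun n e he =>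
    sub_mem he (hsdeg n _ (DGAlg.Hom.map_deg p n e he))
  refine ⟨s, k₀.comp q, hsdeg, fun n e he => k₀deg n _ (qdeg n e he) (pq e), ps,
    fun e => pr _, sd, DGAlg.linearMap_ext
      (f := E.d.comp (k₀.comp q) + (k₀.comp q).comp E.d) (g := q) fun n e he => ?_⟩
  have h := dk₀ n _ (qdeg n e he) (pq e)
  have hqd : E.d (q e) = q (E.d e) := by
    rw [q_apply, q_apply, map_sub, sd, hpd]
  rw [hqd] at h
  exact h

/-! ### Dg-algebras assembled from a graded family of subspaces of a ring -/

/-- A family of subspaces `D n` of a ring `R`, closed under products, with a linear operator `δ` on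
`R` that restricts to a differential `D (n + 1) → D n`. The subspaces need not be independent
in `R`. -/
structure DGFamily (R : Type) [Ring R] [Algebra ℂ R] where
  D : ℕ → Submodule ℂ R
  [gradedMonoid : SetLike.GradedMonoid D]
  δ : R →ₗ[ℂ] R
  δ_zero : ∀ x ∈ D 0, δ x = 0
  δ_mem : ∀ n, ∀ x ∈ D (n + 1), δ x ∈ D n
  δ_δ : ∀ n, ∀ x ∈ D n, δ (δ x) = 0
  leibniz : ∀ p q, ∀ x ∈ D p, ∀ y ∈ D q, δ (x * y) = δ x * y + (-1 : ℂ) ^ p • (x * δ y)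

attribute [instance] DGFamily.gradedMonoid

namespace DGFamily
variable {R : Type} [Ring R] [Algebra ℂ R] (F : DGFamily R)

/-- The underlying algebra: the external direct sum of the subspaces. -/
abbrev Carrier : Type := ⨁ n, F.D n

/-- An element of `D n`, placed in degree `n`. -/
def of (n : ℕ) (x : R) (hx : x ∈ F.D n) : F.Carrier := DirectSum.of (fun n => F.D n) n ⟨x, hx⟩

variable {F} in
lemma of_eq {m n : ℕ} {x y : R} (hx : x ∈ F.D m) (hy : y ∈ F.D n) (h : m = n) (hxy : x = y) :
    F.of m x hx = F.of n y hy := by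
  subst h; subst hxy; rfl

lemma of_zero (n : ℕ) : F.of n 0 (zero_mem _) = 0 :=
  map_zero (DirectSum.of (fun n => F.D n) n)

lemma of_add {n : ℕ} {x y : R} (hx : x ∈ F.D n) (hy : y ∈ F.D n) :
    F.of n (x + y) (add_mem hx hy) = F.of n x hx + F.of n y hy :=
  map_add (DirectSum.of (fun n => F.D n) n) ⟨x, hx⟩ ⟨y, hy⟩

lemma of_smul {n : ℕ} {x : R} (c : ℂ) (hx : x ∈ F.D n) :
    F.of n (c • x) (Submodule.smul_mem _ c hx) = c • F.of n x hx :=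
  map_smul (DirectSum.lof ℂ ℕ (fun n => F.D n) n) c ⟨x, hx⟩

lemma of_sum {n : ℕ} {κ : Type} (s : Finset κ) (x : κ → R) (hx : ∀ k, x k ∈ F.D n) :
    F.of n (∑ k ∈ s, x k) (sum_mem fun k _ => hx k) = ∑ k ∈ s, F.of n (x k) (hx k) := by
  refine Eq.trans ?_ (map_sum (DirectSum.of (fun n => F.D n) n) (fun k => ⟨x k, hx k⟩) s)
  refine congrArg (DirectSum.of (fun n => F.D n) n) (Subtype.ext ?_)
  rw [AddSubmonoidClass.coe_finsetSum]

lemma of_mul {m n : ℕ} {x y : R} (hx : x ∈ F.D m) (hy : y ∈ F.D n) :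
    F.of m x hx * F.of n y hy = F.of (m + n) (x * y) (SetLike.GradedMul.mul_mem hx hy) :=
  DirectSum.of_mul_of (A := fun n => F.D n) _ _

lemma of_one : F.of 0 1 SetLike.GradedOne.one_mem = 1 := rfl

lemma induction {P : F.Carrier → Prop} (hof : ∀ n x hx, P (F.of n x hx))
    (hadd : ∀ x y, P x → P y → P (x + y)) (x : F.Carrier) : P x := by
  refine DirectSum.induction_on x ?_ (fun n x => hof n x.1 x.2) hadd
  have := hof 0 0 (zero_mem _)
  rwa [of_zero] at this

lemma linearMap_ext {N : Type} [AddCommMonoid N] [Module ℂ N] {f g : F.Carrier →ₗ[ℂ] N}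
    (h : ∀ n x hx, f (F.of n x hx) = g (F.of n x hx)) (x : F.Carrier) : f x = g x :=
  F.induction (P := fun x => f x = g x) h (fun x y hx hy => by rw [map_add, map_add, hx, hy]) x

/-- The differential, on the summand of degree `n`. -/
def dLin : ∀ n, F.D n →ₗ[ℂ] F.Carrier
  | 0 => 0
  | n + 1 => (DirectSum.lof ℂ ℕ (fun n => F.D n) n).comp
      (F.δ.restrict (F.δ_mem n))

/-- The differential. -/
def d : F.Carrier →ₗ[ℂ] F.Carrier := DirectSum.toModule ℂ ℕ F.Carrier F.dLin

lemma d_of_zero {x : R} (hx : x ∈ F.D 0) : F.d (F.of 0 x hx) = 0 :=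
  DirectSum.toModule_lof ℂ (φ := F.dLin) 0 (⟨x, hx⟩ : F.D 0)

lemma d_of_succ {n : ℕ} {x : R} (hx : x ∈ F.D (n + 1)) :
    F.d (F.of (n + 1) x hx) = F.of n (F.δ x) (F.δ_mem n x hx) :=
  DirectSum.toModule_lof ℂ (φ := F.dLin) (n + 1) (⟨x, hx⟩ : F.D (n + 1))

lemma d_of {m n : ℕ} {x : R} (hx : x ∈ F.D m) (h : m = n + 1) (h' : F.δ x ∈ F.D n) :
    F.d (F.of m x hx) = F.of n (F.δ x) h' := by
  subst h
  exact F.d_of_succ hx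

/-- The degree-`n` part. -/
def deg (n : ℕ) : Submodule ℂ F.Carrier := LinearMap.range (DirectSum.lof ℂ ℕ (fun n => F.D n) n)

lemma of_mem {n : ℕ} {x : R} (hx : x ∈ F.D n) : F.of n x hx ∈ F.deg n := ⟨⟨x, hx⟩, rfl⟩

variable {F} in
lemma exists_of_mem {n : ℕ} {z : F.Carrier} (hz : z ∈ F.deg n) :
    ∃ x, ∃ hx : x ∈ F.D n, F.of n x hx = z := by
  obtain ⟨⟨x, hx⟩, rfl⟩ := hz
  exact ⟨x, hx, rfl⟩

instance : SetLike.GradedMonoid F.deg where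
  one_mem := F.of_mem SetLike.GradedOne.one_mem
  mul_mem := by
    intro m n _ _ hx hy
    obtain ⟨x, hx, rfl⟩ := exists_of_mem hx
    obtain ⟨y, hy, rfl⟩ := exists_of_mem hy
    rw [of_mul]
    exact F.of_mem _

instance : GradedAlgebra F.deg where
  toDecomposition := Decomposition.ofLinearMap _
    (DirectSum.toModule ℂ ℕ (⨁ n, F.deg n) fun n =>
      (DirectSum.lof ℂ ℕ (fun n => F.deg n) n).comp
        ((DirectSum.lof ℂ ℕ (fun n => F.D n) n).codRestrict (F.deg n) fun x => ⟨x, rfl⟩))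
    (LinearMap.ext <| F.linearMap_ext fun n x hx => by
      simp only [LinearMap.comp_apply, of]
      erw [DirectSum.toModule_lof]
      simp only [LinearMap.comp_apply, DirectSum.coeLinearMap_lof]
      rfl)
    (by
      ext n ⟨_, ⟨x, rfl⟩⟩ : 2
      simp only [LinearMap.comp_apply, LinearMap.id_apply, DirectSum.coeLinearMap_lof,
        DirectSum.toModule_lof]
      rfl)

/-- The dg-algebra assembled from the family. -/
def toDGAlg : DGAlg where
  carrier := F.Carrier
  deg := F.deg
  d := F.d
  d_zero z hz := by
    obtain ⟨x, hx, rfl⟩ := exists_of_mem hz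
    exact F.d_of_zero hx
  d_mem n z hz := by
    obtain ⟨x, hx, rfl⟩ := exists_of_mem hz
    rw [d_of_succ]
    exact F.of_mem _
  d_d := by
    refine F.linearMap_ext (f := F.d.comp F.d) (g := 0) fun n x hx => ?_
    rw [LinearMap.comp_apply]
    rcases n with _ | _ | n
    · rw [d_of_zero, map_zero]; rfl
    · rw [d_of_succ, d_of_zero]; rfl
    · rw [d_of_succ, d_of_succ, of_eq _ (zero_mem (F.D n)) rfl (F.δ_δ _ x hx), of_zero]; rfl
  leibniz p z hz w := by
    obtain ⟨x, hx, rfl⟩ := exists_of_mem hz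
    refine F.induction (P := fun w => F.d (F.of p x hx * w) =
      F.d (F.of p x hx) * w + (-1 : ℂ) ^ p • (F.of p x hx * F.d w)) ?_ ?_ w
    · intro q y hy
      have hl := F.leibniz p q x hx y hy
      rw [of_mul]
      rcases p with _ | p
      · rcases q with _ | q
        · rw [d_of_zero, d_of_zero, d_of_zero, zero_mul, mul_zero, smul_zero, add_zero]
        · have hxy : x * F.δ y ∈ F.D (0 + q) := SetLike.GradedMul.mul_mem hx (F.δ_mem q y hy)
          have hl' : F.δ (x * y) = x * F.δ y := by
            rw [hl, F.δ_zero x hx, zero_mul, zero_add, pow_zero, one_smul]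
          rw [d_of_zero, zero_mul, @zero_add F.Carrier, pow_zero, one_smul, d_of_succ, of_mul,
            F.d_of (m := 0 + (q + 1)) _ (n := 0 + q) rfl (by rw [hl']; exact hxy)]
          exact of_eq _ _ rfl hl'
      · rcases q with _ | q
        · have hxy : F.δ x * y ∈ F.D (p + 0) := SetLike.GradedMul.mul_mem (F.δ_mem p x hx) hy
          have hl' : F.δ (x * y) = F.δ x * y := by
            rw [hl, F.δ_zero y hy, mul_zero, smul_zero, add_zero]
          rw [d_of_zero, mul_zero, smul_zero, @add_zero F.Carrier, F.d_of_succ hx, of_mul,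
            F.d_of (m := p + 1 + 0) _ (n := p + 0) rfl (by rw [hl']; exact hxy)]
          exact of_eq _ _ rfl hl'
        · have h1 : F.δ x * y ∈ F.D (p + q + 1) := SetLike.GradedMul.mul_mem (j := q + 1) (F.δ_mem p x hx) hy
          have h2 : x * F.δ y ∈ F.D (p + q + 1) := by
            have := SetLike.GradedMul.mul_mem hx (F.δ_mem q y hy)
            rwa [show p + 1 + q = p + q + 1 by omega] at this
          rw [d_of_succ, d_of_succ, of_mul, of_mul,
            F.d_of _ (n := p + q + 1) (by omega) (by
              rw [hl]; exact add_mem h1 (Submodule.smul_mem _ _ h2)),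
            of_eq (F := F) _ h1 (by omega) rfl,
            of_eq (F := F) (n := p + q + 1) (y := x * F.δ y) _ h2 (by omega) rfl,
            ← of_smul, ← of_add]
          exact of_eq _ _ rfl hl
    · intro u v hu hv
      simp only [mul_add, map_add, hu, hv, smul_add]
      abel

lemma of_injective {n : ℕ} {x : R} (hx : x ∈ F.D n) (h : F.of n x hx = 0) : x = 0 :=
  congrArg Subtype.val
    (DirectSum.of_injective n (h.trans (map_zero (DirectSum.of (fun n => F.D n) n)).symm))

lemma δ_eq_zero {n : ℕ} {x : R} (hx : x ∈ F.D n) (h : F.d (F.of n x hx) = 0) : F.δ x = 0 := by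
  rcases n with _ | n
  · exact F.δ_zero x hx
  · rw [d_of_succ] at h
    exact F.of_injective _ h

/-- A map out of the assembled dg-algebra, induced by a linear map on the ambient ring which is
multiplicative on the members of the family. -/
def homOut (C : DGAlg) (ψ : R →ₗ[ℂ] C.carrier) (hψ : ∀ n, ∀ x ∈ F.D n, ψ x ∈ C.deg n)
    (h1 : ψ 1 = 1) (hmul : ∀ m n, ∀ x ∈ F.D m, ∀ y ∈ F.D n, ψ (x * y) = ψ x * ψ y)
    (hd : ∀ n, ∀ x ∈ F.D n, ψ (F.δ x) = C.d (ψ x)) : F.toDGAlg ⟶ C :=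
  let φ : F.Carrier →ₗ[ℂ] C.carrier := ψ.comp (DirectSum.coeLinearMap F.D)
  have key : ∀ n x hx, φ (F.of n x hx) = ψ x :=
    fun n x hx => congrArg ψ (DirectSum.coeLinearMap_lof F.D n ⟨x, hx⟩)
  { alg := AlgHom.ofLinearMap φ ((key 0 1 SetLike.GradedOne.one_mem).trans h1) (by
      intro z w
      change F.Carrier at z w
      refine F.induction (P := fun z => φ (z * w) = φ z * φ w) (fun m x hx => ?_) ?_ z
      · refine F.induction (P := fun w => φ (F.of m x hx * w) = φ (F.of m x hx) * φ w)
          (fun n y hy => ?_) ?_ w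
        · rw [of_mul, key, key, key, hmul m n x hx y hy]
        · intro u v hu hv
          rw [mul_add, map_add, map_add, hu, hv, mul_add]
      · intro u v hu hv
        rw [add_mul, map_add, map_add, hu, hv, add_mul])
    map_deg := fun n z hz => by
      obtain ⟨x, hx, rfl⟩ := exists_of_mem hz
      exact (congrArg (· ∈ C.deg n) (key n x hx)).mpr (hψ n x hx)
    map_d := by
      refine F.linearMap_ext (f := φ.comp F.d) (g := C.d.comp φ) fun n x hx => ?_
      change φ (F.d (F.of n x hx)) = C.d (φ (F.of n x hx))
      rw [key, ← hd n x hx]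
      rcases n with _ | n
      · rw [d_of_zero, map_zero, F.δ_zero x hx, map_zero]
      · rw [d_of_succ, key] }

lemma homOut_of (C : DGAlg) (ψ : R →ₗ[ℂ] C.carrier) (hψ) (h1) (hmul) (hd) {n : ℕ} {x : R}
    (hx : x ∈ F.D n) : DGAlg.Hom.alg (F.homOut C ψ hψ h1 hmul hd) (F.of n x hx) = ψ x :=
  congrArg ψ (DirectSum.coeLinearMap_lof F.D n ⟨x, hx⟩)

section Into
variable {F} {C : DGAlg}

/-- The graded linear map into the assembled dg-algebra induced by a linear map to the ambient
ring. -/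
def linIn (u : C.carrier →ₗ[ℂ] R) (hu : ∀ n, ∀ c ∈ C.deg n, u c ∈ F.D n) :
    C.carrier →ₗ[ℂ] F.Carrier :=
  (DirectSum.lmap fun n => u.restrict (hu n)).comp (decomposeLinearEquiv C.deg).toLinearMap

lemma linIn_of_mem (u : C.carrier →ₗ[ℂ] R) (hu : ∀ n, ∀ c ∈ C.deg n, u c ∈ F.D n) {n : ℕ}
    {c : C.carrier} (hc : c ∈ C.deg n) : linIn u hu c = F.of n (u c) (hu n c hc) := by
  have h : decomposeLinearEquiv C.deg c = DirectSum.lof ℂ ℕ (fun n => C.deg n) n ⟨c, hc⟩ :=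
    decompose_of_mem C.deg hc
  simp only [linIn, LinearMap.comp_apply, LinearEquiv.coe_coe, h, DirectSum.lmap_lof]
  rfl

lemma linIn_mem (u : C.carrier →ₗ[ℂ] R) (hu : ∀ n, ∀ c ∈ C.deg n, u c ∈ F.D n) (n : ℕ)
    (c : C.carrier) (hc : c ∈ C.deg n) : linIn u hu c ∈ F.deg n := by
  rw [linIn_of_mem u hu hc]
  exact F.of_mem _

lemma linIn_d (u : C.carrier →ₗ[ℂ] R) (hu : ∀ n, ∀ c ∈ C.deg n, u c ∈ F.D n)
    (hd : ∀ n, ∀ c ∈ C.deg n, u (C.d c) = F.δ (u c)) (c : C.carrier) :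
    linIn u hu (C.d c) = F.d (linIn u hu c) := by
  refine DGAlg.linearMap_ext (f := (linIn u hu).comp C.d) (g := F.d.comp (linIn u hu))
    (fun n c hc => ?_) c
  rw [LinearMap.comp_apply, LinearMap.comp_apply, linIn_of_mem u hu hc]
  rcases n with _ | n
  · rw [d_of_zero, C.d_zero c hc, map_zero]
  · rw [d_of_succ, linIn_of_mem u hu (C.d_mem n c hc)]
    exact of_eq _ _ rfl (hd _ c hc)

lemma linIn_mul {κ : Type} (s : Finset κ) (w : C.carrier →ₗ[ℂ] R)
    (hw : ∀ n, ∀ c ∈ C.deg n, w c ∈ F.D n) (u v : κ → C.carrier →ₗ[ℂ] R)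
    (hu : ∀ k n, ∀ c ∈ C.deg n, u k c ∈ F.D n) (hv : ∀ k n, ∀ c ∈ C.deg n, v k c ∈ F.D n)
    (h : ∀ a b, w (a * b) = ∑ k ∈ s, u k a * v k b) (a b : C.carrier) :
    linIn w hw (a * b) = ∑ k ∈ s, linIn (u k) (hu k) a * linIn (v k) (hv k) b := by
  refine C.induction (P := fun a => linIn w hw (a * b) =
    ∑ k ∈ s, linIn (u k) (hu k) a * linIn (v k) (hv k) b) ?_ ?_ a
  · intro p a ha
    refine C.induction (P := fun b => linIn w hw (a * b) =
      ∑ k ∈ s, linIn (u k) (hu k) a * linIn (v k) (hv k) b) ?_ ?_ b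
    · intro q b hb
      rw [linIn_of_mem w hw (SetLike.GradedMul.mul_mem ha hb)]
      simp only [linIn_of_mem _ _ ha, linIn_of_mem _ _ hb, of_mul]
      rw [← of_sum F s (fun k => u k a * v k b)
        (fun k => SetLike.GradedMul.mul_mem (hu k p a ha) (hv k q b hb))]
      exact of_eq _ _ rfl (h a b)
    · intro b c hb hc
      simp only [mul_add, map_add, hb, hc, Finset.sum_add_distrib]
  · intro b c hb hc
    simp only [add_mul, map_add, hb, hc, Finset.sum_add_distrib]

lemma linIn_eq_one (u : C.carrier →ₗ[ℂ] R) (hu : ∀ n, ∀ c ∈ C.deg n, u c ∈ F.D n)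
    (h : u 1 = 1) : linIn u hu 1 = 1 := by
  rw [linIn_of_mem u hu SetLike.GradedOne.one_mem, ← of_one]
  exact of_eq _ _ rfl h

/-- A map into the assembled dg-algebra, induced by an algebra map to the ambient ring. -/
def homIn (χ : C.carrier →ₐ[ℂ] R) (hχ : ∀ n, ∀ c ∈ C.deg n, χ c ∈ F.D n)
    (hd : ∀ n, ∀ c ∈ C.deg n, χ (C.d c) = F.δ (χ c)) : C ⟶ F.toDGAlg where
  alg := AlgHom.ofLinearMap (linIn χ.toLinearMap hχ) (linIn_eq_one _ _ (map_one χ))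
    (fun a b => by
      have := linIn_mul (F := F) (Finset.univ : Finset Unit) χ.toLinearMap hχ
        (fun _ => χ.toLinearMap) (fun _ => χ.toLinearMap) (fun _ => hχ) (fun _ => hχ)
        (fun a b => by simp) a b
      exact this.trans (Finset.sum_singleton _ _))
  map_deg := linIn_mem χ.toLinearMap hχ
  map_d := linIn_d χ.toLinearMap hχ hd

lemma homIn_of_mem (χ : C.carrier →ₐ[ℂ] R) (hχ) (hd) {n : ℕ} {c : C.carrier} (hc : c ∈ C.deg n) :
    DGAlg.Hom.alg (homIn (F := F) χ hχ hd) c = F.of n (χ c) (hχ n c hc) :=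
  linIn_of_mem χ.toLinearMap hχ hc

variable {n : Type} [Fintype n] [DecidableEq n]

/-- A map into matrices over the assembled dg-algebra, given by the matrix entries. -/
def homInMatrix (u : n → n → C.carrier →ₗ[ℂ] R) (hu : ∀ i j p, ∀ c ∈ C.deg p, u i j c ∈ F.D p)
    (h1 : ∀ i j, u i j 1 = (1 : Matrix n n R) i j)
    (hmul : ∀ i j a b, u i j (a * b) = ∑ k, u i k a * u k j b)
    (hd : ∀ i j p, ∀ c ∈ C.deg p, u i j (C.d c) = F.δ (u i j c)) :
    C ⟶ matrixDG n F.toDGAlg where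
  alg := AlgHom.ofLinearMap
    { toFun := fun c => (Matrix.of fun i j => linIn (u i j) (hu i j) c :
        Matrix n n F.Carrier)
      map_add' := fun a b => Matrix.ext fun i j => map_add (linIn (u i j) (hu i j)) a b
      map_smul' := fun c a => Matrix.ext fun i j => map_smul (linIn (u i j) (hu i j)) c a }
    (by
      refine Matrix.ext fun i j => ?_
      change linIn (u i j) (hu i j) 1 = (1 : Matrix n n F.Carrier) i j
      rw [linIn_of_mem _ _ SetLike.GradedOne.one_mem]
      by_cases hij : i = j
      · subst hij
        rw [Matrix.one_apply_eq, ← of_one]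
        exact of_eq _ _ rfl (by rw [h1, Matrix.one_apply_eq])
      · rw [Matrix.one_apply_ne hij, ← F.of_zero 0]
        exact of_eq _ _ rfl (by rw [h1, Matrix.one_apply_ne hij]))
    (fun a b => by
      refine Matrix.ext fun i j => ?_
      exact (linIn_mul Finset.univ (u i j) (hu i j) (fun k => u i k) (fun k => u k j)
        (fun k => hu i k) (fun k => hu k j) (hmul i j) a b).trans
        (Matrix.mul_apply (M := (Matrix.of fun i j => linIn (u i j) (hu i j) a :
          Matrix n n F.Carrier)) (N := Matrix.of fun i j => linIn (u i j) (hu i j) b)).symm)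
  map_deg p c hc i j := linIn_mem (u i j) (hu i j) p c hc
  map_d c := Matrix.ext fun i j => linIn_d (u i j) (hu i j) (hd i j) c

lemma homInMatrix_of_mem (u : n → n → C.carrier →ₗ[ℂ] R) (hu) (h1) (hmul) (hd) {p : ℕ}
    {c : C.carrier} (hc : c ∈ C.deg p) (i j : n) :
    DGAlg.Hom.alg (homInMatrix (F := F) u hu h1 hmul hd) c i j =
      F.of p (u i j c) (hu i j p c hc) :=
  linIn_of_mem (u i j) (hu i j) hc

end Into

end DGFamily

/-! ### Polynomial paths in a dg-algebra -/

open Polynomial in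
/-- Formal integration from `0` of polynomials. -/
def polyInt : ℂ[X] →ₗ[ℂ] ℂ[X] :=
  Polynomial.lsum fun n => ((n : ℂ) + 1)⁻¹ • Polynomial.monomial (n + 1)

section
open Polynomial

lemma polyInt_monomial (n : ℕ) (a : ℂ) :
    polyInt (monomial n a) = monomial (n + 1) (((n : ℂ) + 1)⁻¹ * a) := by
  simp [polyInt, Polynomial.lsum, Polynomial.sum_monomial_index, ← smul_eq_mul]

lemma derivative_polyInt (p : ℂ[X]) : derivative (polyInt p) = p := by
  induction p using Polynomial.induction_on' with
  | add p q hp hq => rw [map_add, map_add, hp, hq]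
  | monomial n a =>
    have h : (n : ℂ) + 1 ≠ 0 := Nat.cast_add_one_ne_zero n
    rw [polyInt_monomial, derivative_monomial, Nat.add_sub_cancel]
    congr 1
    push_cast
    field_simp

lemma polyInt_derivative (p : ℂ[X]) : polyInt (derivative p) = p - C (p.eval 0) := by
  induction p using Polynomial.induction_on' with
  | add p q hp hq => rw [map_add, map_add, hp, hq, eval_add, map_add]; ring
  | monomial n a =>
    rcases n with _ | n
    · simp
    · have h : (n : ℂ) + 1 ≠ 0 := Nat.cast_add_one_ne_zero n
      rw [derivative_monomial, Nat.add_sub_cancel, polyInt_monomial]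
      simp
      congr 1
      field_simp

lemma eval_zero_polyInt (p : ℂ[X]) : (polyInt p).eval 0 = 0 := by
  induction p using Polynomial.induction_on' with
  | add p q hp hq => rw [map_add, eval_add, hp, hq, add_zero]
  | monomial n a => rw [polyInt_monomial]; simp

end

section Paths
open Polynomial
variable (B : DGAlg)

/-- Polynomials in one variable with coefficients in `B`. -/
def PolyAlg : Type := ℂ[X] ⊗[ℂ] B.carrier

instance : Ring (PolyAlg B) := inferInstanceAs (Ring (ℂ[X] ⊗[ℂ] B.carrier))
instance : Algebra ℂ (PolyAlg B) := inferInstanceAs (Algebra ℂ (ℂ[X] ⊗[ℂ] B.carrier))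

/-- The differential of `B`, applied to the coefficients. -/
def polyD : PolyAlg B →ₗ[ℂ] PolyAlg B := B.d.lTensor ℂ[X]

/-- The derivative with respect to the variable. -/
def polyDer : PolyAlg B →ₗ[ℂ] PolyAlg B := (derivative (R := ℂ)).rTensor B.carrier

/-- Integration from `0` with respect to the variable. -/
def polyIntegral : PolyAlg B →ₗ[ℂ] PolyAlg B := polyInt.rTensor B.carrier

/-- Evaluation of the variable at a complex number. -/
def polyEval (r : ℂ) : PolyAlg B →ₐ[ℂ] B.carrier :=
  Algebra.TensorProduct.lift ((Algebra.ofId ℂ B.carrier).comp (aeval r)) (AlgHom.id ℂ _)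
    fun _ _ => Algebra.commutes _ _

/-- A linear map applied to the coefficients. -/
def polyMap {C : DGAlg} (f : B.carrier →ₗ[ℂ] C.carrier) : PolyAlg B →ₗ[ℂ] PolyAlg C :=
  f.lTensor ℂ[X]

variable {B}

/-- The product of a polynomial with an element of `B`. -/
def PolyAlg.of (p : ℂ[X]) (b : B.carrier) : PolyAlg B := p ⊗ₜ[ℂ] b

namespace PolyAlg

lemma of_add (p : ℂ[X]) (b c : B.carrier) : of p (b + c) = of p b + of p c :=
  TensorProduct.tmul_add ..
lemma add_of (p q : ℂ[X]) (b : B.carrier) : of (p + q) b = of p b + of q b :=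
  TensorProduct.add_tmul ..
lemma of_smul (c : ℂ) (p : ℂ[X]) (b : B.carrier) : of p (c • b) = c • of p b :=
  TensorProduct.tmul_smul ..
lemma smul_of (c : ℂ) (p : ℂ[X]) (b : B.carrier) : of (c • p) b = c • of p b :=
  (TensorProduct.smul_tmul' ..).symm
@[simp] lemma of_zero (p : ℂ[X]) : of p (0 : B.carrier) = 0 := TensorProduct.tmul_zero ..
@[simp] lemma zero_of (b : B.carrier) : of 0 b = 0 := TensorProduct.zero_tmul ..
lemma of_neg (p : ℂ[X]) (b : B.carrier) : of p (-b) = -of p b := by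
  rw [← neg_one_smul ℂ, of_smul, neg_one_smul]
lemma of_mul (p q : ℂ[X]) (b c : B.carrier) : of p b * of q c = of (p * q) (b * c) :=
  Algebra.TensorProduct.tmul_mul_tmul ..
lemma of_one_one : of (1 : ℂ[X]) (1 : B.carrier) = 1 := rfl

lemma induction {P : PolyAlg B → Prop} (of : ∀ p b, P (of p b))
    (add : ∀ x y, P x → P y → P (x + y)) (x : PolyAlg B) : P x :=
  TensorProduct.induction_on (motive := P) x ((congrArg P (of_zero 0)).mp (of 0 0)) of add

lemma linearMap_ext {N : Type} [AddCommMonoid N] [Module ℂ N] {f g : PolyAlg B →ₗ[ℂ] N}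
    (h : ∀ p b, f (of p b) = g (of p b)) (x : PolyAlg B) : f x = g x :=
  induction (P := fun x => f x = g x) h (fun x y hx hy => by rw [map_add, map_add, hx, hy]) x

end PolyAlg

variable (B) in
/-- Polynomials with coefficients of degree `n`. -/
def polyDeg (n : ℕ) : Submodule ℂ (PolyAlg B) :=
  Submodule.span ℂ {x | ∃ p : ℂ[X], ∃ b ∈ B.deg n, PolyAlg.of p b = x}

@[simp] lemma polyD_of (p : ℂ[X]) (b : B.carrier) : polyD B (.of p b) = .of p (B.d b) := rfl
@[simp] lemma polyDer_of (p : ℂ[X]) (b : B.carrier) :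
    polyDer B (.of p b) = .of (derivative p) b := rfl
@[simp] lemma polyIntegral_of (p : ℂ[X]) (b : B.carrier) :
    polyIntegral B (.of p b) = .of (polyInt p) b := rfl
@[simp] lemma polyMap_of {C : DGAlg} (f : B.carrier →ₗ[ℂ] C.carrier) (p : ℂ[X])
    (b : B.carrier) : polyMap B f (.of p b) = .of p (f b) := rfl
@[simp] lemma polyEval_of (r : ℂ) (p : ℂ[X]) (b : B.carrier) :
    polyEval B r (.of p b) = p.eval r • b := by
  refine (Algebra.TensorProduct.lift_tmul ..).trans ?_
  rw [AlgHom.comp_apply, coe_aeval_eq_eval, Algebra.smul_def]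
  rfl

lemma of_mem_polyDeg (p : ℂ[X]) {n : ℕ} {b : B.carrier} (hb : b ∈ B.deg n) :
    PolyAlg.of p b ∈ polyDeg B n := Submodule.subset_span ⟨p, b, hb, rfl⟩

lemma polyDeg_induction {n : ℕ} {P : PolyAlg B → Prop}
    (of : ∀ (p : ℂ[X]), ∀ b ∈ B.deg n, P (.of p b)) (add : ∀ x y, P x → P y → P (x + y))
    {x : PolyAlg B} (hx : x ∈ polyDeg B n) : P x := by
  have h : ∀ c : ℂ, P (c • x) := by
    refine Submodule.span_induction (p := fun x _ => ∀ c : ℂ, P (c • x)) ?_ ?_ ?_ ?_ hx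
    · rintro _ ⟨p, b, hb, rfl⟩ c
      rw [← PolyAlg.smul_of]
      exact of _ b hb
    · intro c
      have := of 0 0 (zero_mem _)
      rwa [PolyAlg.zero_of, ← smul_zero c] at this
    · intro x y _ _ h1 h2 c
      rw [smul_add]
      exact add _ _ (h1 c) (h2 c)
    · intro a x _ h c
      rw [smul_smul]
      exact h _
  simpa using h 1

lemma polyMap_mem {C : DGAlg} {f : B.carrier →ₗ[ℂ] C.carrier} {n m : ℕ}
    (h : ∀ b ∈ B.deg n, f b ∈ C.deg m) {x : PolyAlg B} (hx : x ∈ polyDeg B n) :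
    polyMap B f x ∈ polyDeg C m :=
  polyDeg_induction (P := fun x => polyMap B f x ∈ polyDeg C m)
    (fun p b hb => of_mem_polyDeg p (h b hb))
    (fun x y hx hy => by rw [map_add]; exact add_mem hx hy) hx

lemma polyD_mem {n : ℕ} {x : PolyAlg B} (hx : x ∈ polyDeg B (n + 1)) : polyD B x ∈ polyDeg B n :=
  polyMap_mem (B.d_mem n) hx

lemma polyD_zero {x : PolyAlg B} (hx : x ∈ polyDeg B 0) : polyD B x = 0 :=
  polyDeg_induction (P := fun x => polyD B x = 0)
    (fun p b hb => by rw [polyD_of, B.d_zero b hb, PolyAlg.of_zero])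
    (fun x y hx hy => by rw [map_add, hx, hy, add_zero]) hx

lemma polyDer_mem {n : ℕ} {x : PolyAlg B} (hx : x ∈ polyDeg B n) : polyDer B x ∈ polyDeg B n :=
  polyDeg_induction (P := fun x => polyDer B x ∈ polyDeg B n)
    (fun p b hb => of_mem_polyDeg (derivative p) hb)
    (fun x y hx hy => by rw [map_add]; exact add_mem hx hy) hx

lemma polyIntegral_mem {n : ℕ} {x : PolyAlg B} (hx : x ∈ polyDeg B n) :
    polyIntegral B x ∈ polyDeg B n :=
  polyDeg_induction (P := fun x => polyIntegral B x ∈ polyDeg B n)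
    (fun p b hb => of_mem_polyDeg (polyInt p) hb)
    (fun x y hx hy => by rw [map_add]; exact add_mem hx hy) hx

lemma polyEval_mem (r : ℂ) {n : ℕ} {x : PolyAlg B} (hx : x ∈ polyDeg B n) :
    polyEval B r x ∈ B.deg n :=
  polyDeg_induction (P := fun x => polyEval B r x ∈ B.deg n)
    (fun p b hb => by rw [polyEval_of]; exact Submodule.smul_mem _ _ hb)
    (fun x y hx hy => by rw [map_add]; exact add_mem hx hy) hx

lemma polyDeg_mul {m n : ℕ} {x y : PolyAlg B} (hx : x ∈ polyDeg B m) (hy : y ∈ polyDeg B n) :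
    x * y ∈ polyDeg B (m + n) := by
  have h : polyDeg B m * polyDeg B n ≤ polyDeg B (m + n) := by
    rw [polyDeg, polyDeg, Submodule.span_mul_span, Submodule.span_le]
    rintro _ ⟨_, ⟨p, b, hb, rfl⟩, _, ⟨q, c, hc, rfl⟩, rfl⟩
    simp only [PolyAlg.of_mul]
    exact of_mem_polyDeg _ (SetLike.GradedMul.mul_mem hb hc)
  exact h (Submodule.mul_mem_mul hx hy)

lemma polyD_polyD (x : PolyAlg B) : polyD B (polyD B x) = 0 :=
  PolyAlg.linearMap_ext (f := (polyD B).comp (polyD B)) (g := 0) (fun p b => by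
    simp [B.d_d]) x

lemma polyDer_polyD (x : PolyAlg B) : polyDer B (polyD B x) = polyD B (polyDer B x) :=
  PolyAlg.linearMap_ext (f := (polyDer B).comp (polyD B)) (g := (polyD B).comp (polyDer B))
    (fun p b => by simp) x

lemma polyIntegral_polyD (x : PolyAlg B) :
    polyIntegral B (polyD B x) = polyD B (polyIntegral B x) :=
  PolyAlg.linearMap_ext (f := (polyIntegral B).comp (polyD B))
    (g := (polyD B).comp (polyIntegral B)) (fun p b => by simp) x

lemma polyDer_polyIntegral (x : PolyAlg B) : polyDer B (polyIntegral B x) = x :=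
  PolyAlg.linearMap_ext (f := (polyDer B).comp (polyIntegral B)) (g := LinearMap.id)
    (fun p b => by simp [derivative_polyInt]) x

lemma polyIntegral_polyDer (x : PolyAlg B) :
    polyIntegral B (polyDer B x) = x - .of 1 (polyEval B 0 x) := by
  refine PolyAlg.induction (P := fun x => polyIntegral B (polyDer B x) =
    x - .of 1 (polyEval B 0 x)) (fun p b => ?_) (fun x y hx hy => ?_) x
  · rw [polyDer_of, polyIntegral_of, polyInt_derivative, polyEval_of, PolyAlg.of_smul,
      ← PolyAlg.smul_of, eq_sub_iff_add_eq, ← PolyAlg.add_of, ← Algebra.algebraMap_eq_smul_one,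
      ← C_eq_algebraMap, sub_add_cancel]
  · simp only [map_add, hx, hy, PolyAlg.of_add]
    abel

lemma polyEval_zero_polyIntegral (x : PolyAlg B) : polyEval B 0 (polyIntegral B x) = 0 :=
  PolyAlg.linearMap_ext (f := (polyEval B 0).toLinearMap.comp (polyIntegral B)) (g := 0)
    (fun p b => by simp [eval_zero_polyInt]) x

lemma polyEval_polyMap {C : DGAlg} (f : B.carrier →ₗ[ℂ] C.carrier) (r : ℂ) (x : PolyAlg B) :
    polyEval C r (polyMap B f x) = f (polyEval B r x) :=
  PolyAlg.linearMap_ext (f := (polyEval C r).toLinearMap.comp (polyMap B f))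
    (g := f.comp (polyEval B r).toLinearMap) (fun p b => by simp) x

lemma polyEval_polyD (r : ℂ) (x : PolyAlg B) : polyEval B r (polyD B x) = B.d (polyEval B r x) :=
  polyEval_polyMap B.d r x

lemma polyD_mul {n : ℕ} {x : PolyAlg B} (hx : x ∈ polyDeg B n) (y : PolyAlg B) :
    polyD B (x * y) = polyD B x * y + (-1 : ℂ) ^ n • (x * polyD B y) := by
  refine polyDeg_induction (P := fun x => polyD B (x * y) =
    polyD B x * y + (-1 : ℂ) ^ n • (x * polyD B y)) ?_ ?_ hx
  · intro p b hb
    refine PolyAlg.induction (P := fun y => polyD B (.of p b * y) =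
      polyD B (.of p b) * y + (-1 : ℂ) ^ n • (.of p b * polyD B y)) (fun q c => ?_)
      (fun x y hx hy => ?_) y
    · simp only [PolyAlg.of_mul, polyD_of, B.leibniz n b hb, PolyAlg.of_add, PolyAlg.of_smul]
    · simp only [mul_add, map_add, hx, hy, smul_add]
      abel
  · intro x z h1 h2
    simp only [add_mul, map_add, h1, h2, smul_add]
    abel

lemma polyDer_mul (x y : PolyAlg B) :
    polyDer B (x * y) = polyDer B x * y + x * polyDer B y := by
  refine PolyAlg.induction (P := fun x => polyDer B (x * y) = polyDer B x * y + x * polyDer B y)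
    (fun p b => ?_) (fun x z h1 h2 => ?_) x
  · refine PolyAlg.induction (P := fun y => polyDer B (.of p b * y) =
      polyDer B (.of p b) * y + .of p b * polyDer B y) (fun q c => ?_) (fun x y hx hy => ?_) y
    · simp only [PolyAlg.of_mul, polyDer_of, derivative_mul, PolyAlg.add_of]
    · simp only [mul_add, map_add, hx, hy]
      abel
  · simp only [add_mul, map_add, h1, h2]
    abel

lemma polyMap_mul {C : DGAlg} {κ : Type} (s : Finset κ) (f : B.carrier →ₗ[ℂ] C.carrier)
    (g h : κ → B.carrier →ₗ[ℂ] C.carrier)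
    (H : ∀ a b, f (a * b) = ∑ k ∈ s, g k a * h k b) (x y : PolyAlg B) :
    polyMap B f (x * y) = ∑ k ∈ s, polyMap B (g k) x * polyMap B (h k) y := by
  refine PolyAlg.induction (P := fun x => polyMap B f (x * y) =
    ∑ k ∈ s, polyMap B (g k) x * polyMap B (h k) y) (fun p b => ?_) (fun x z h1 h2 => ?_) x
  · refine PolyAlg.induction (P := fun y => polyMap B f (.of p b * y) =
      ∑ k ∈ s, polyMap B (g k) (.of p b) * polyMap B (h k) y) (fun q c => ?_)
      (fun x y hx hy => ?_) y
    · simp only [PolyAlg.of_mul, polyMap_of, H]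
      exact TensorProduct.tmul_sum ..
    · simp only [mul_add, map_add, hx, hy, Finset.sum_add_distrib]
  · simp only [add_mul, map_add, h1, h2, Finset.sum_add_distrib]

lemma polyDer_polyMap {C : DGAlg} (f : B.carrier →ₗ[ℂ] C.carrier) (x : PolyAlg B) :
    polyDer C (polyMap B f x) = polyMap B f (polyDer B x) :=
  PolyAlg.linearMap_ext (f := (polyDer C).comp (polyMap B f))
    (g := (polyMap B f).comp (polyDer B)) (fun p b => by simp) x

lemma polyD_polyMap {C : DGAlg} (f : B.carrier →ₗ[ℂ] C.carrier)
    (hf : ∀ b, f (B.d b) = C.d (f b)) (x : PolyAlg B) :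
    polyD C (polyMap B f x) = polyMap B f (polyD B x) :=
  PolyAlg.linearMap_ext (f := (polyD C).comp (polyMap B f))
    (g := (polyMap B f).comp (polyD B)) (fun p b => by simp [hf]) x

lemma polyAlg_comm (hB : gradedComm B) {m n : ℕ} {x y : PolyAlg B} (hx : x ∈ polyDeg B m)
    (hy : y ∈ polyDeg B n) : x * y = (-1 : ℂ) ^ (m * n) • (y * x) := by
  refine polyDeg_induction (P := fun x => x * y = (-1 : ℂ) ^ (m * n) • (y * x)) ?_ ?_ hx
  · intro p b hb
    refine polyDeg_induction (P := fun y => .of p b * y =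
      (-1 : ℂ) ^ (m * n) • (y * .of p b)) ?_ ?_ hy
    · intro q c hc
      rw [PolyAlg.of_mul, PolyAlg.of_mul, hB m n b hb c hc, PolyAlg.of_smul, mul_comm p]
    · intro y z h1 h2
      rw [mul_add, add_mul, h1, h2, smul_add]
  · intro x z h1 h2
    rw [mul_add, add_mul, h1, h2, smul_add]

end Paths

/-! ### Mapping path objects -/

lemma DGAlg.sign_d (A : DGAlg) (a : A.carrier) : A.sign (A.d a) = -A.d (A.sign a) := by
  refine DGAlg.linearMap_ext (f := A.sign.comp A.d) (g := -A.d.comp A.sign) (fun n a ha => ?_) a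
  rw [LinearMap.comp_apply, LinearMap.neg_apply, LinearMap.comp_apply, A.sign_of_mem ha, map_smul]
  rcases n with _ | n
  · simp [A.d_zero a ha]
  · rw [A.sign_of_mem (A.d_mem n a ha), pow_succ]
    simp

lemma DGAlg.sign_one (A : DGAlg) : A.sign 1 = 1 := by
  rw [A.sign_of_mem SetLike.GradedOne.one_mem, pow_zero, one_smul]

lemma tri_injective {R : Type} [Ring R] {x y z x' y' z' : R} (h : tri x y z = tri x' y' z') :
    x = x' ∧ y = y' ∧ z = z' :=
  ⟨congrFun (congrFun h 0) 0, congrFun (congrFun h 0) 1, congrFun (congrFun h 1) 1⟩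

lemma tri_zero {R : Type} [Ring R] : tri (0 : R) 0 0 = 0 := by
  ext i j; fin_cases i <;> fin_cases j <;> rfl

lemma tri_one {R : Type} [Ring R] : tri (1 : R) 0 1 = 1 := by
  ext i j; fin_cases i <;> fin_cases j <;> rfl

section MappingPath
open Polynomial
variable {A B : DGAlg}

/-- The ring in which the mapping path object of `A → B` lives. The triangular matrix
`(b, c; 0, ± b)` stands for `b + c dt`, where `dt` has degree `-1`. -/
abbrev PathAmbient (A B : DGAlg) : Type := A.carrier × Matrix (Fin 2) (Fin 2) (PolyAlg B)

/-- The element `(a, b + c dt)` of degree `n`. -/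
def pathPt (n : ℕ) (a : A.carrier) (b c : PolyAlg B) : PathAmbient A B :=
  (a, tri b c ((-1 : ℂ) ^ n • b))

/-- The differential `(a, b + c dt) ↦ (da, db + (dc ± b') dt)`. -/
def pathδ (A B : DGAlg) : PathAmbient A B →ₗ[ℂ] PathAmbient A B where
  toFun x := (A.d x.1, tri (polyD B (x.2 0 0)) (polyD B (x.2 0 1) + polyDer B (x.2 1 1))
    (-polyD B (x.2 1 1)))
  map_add' x y := by
    refine Prod.ext (map_add A.d _ _) ?_
    simp only [Prod.snd_add, Prod.mk_add_mk, Matrix.add_apply, map_add, tri_add]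
    congr 1 <;> abel
  map_smul' c x := by
    refine Prod.ext (map_smul A.d _ _) ?_
    simp only [Prod.smul_snd, Prod.smul_mk, Matrix.smul_apply, map_smul, tri_smul, smul_add,
      smul_neg, RingHom.id_apply]

lemma pathδ_apply (a : A.carrier) (x y z : PolyAlg B) : pathδ A B (a, tri x y z) =
    (A.d a, tri (polyD B x) (polyD B y + polyDer B z) (-polyD B z)) := rfl

lemma neg_one_pow_mul_self (n : ℕ) : (-1 : ℂ) ^ n * (-1 : ℂ) ^ n = 1 := by
  rw [← mul_pow]; simp

/-- The family of subspaces defining the mapping path object of `f : A → B`: in degree `n` it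
consists of the `(a, b + c dt)` with `b(0) = f(a)`. Because dg-algebras live in non-negative
degrees, the part in degree `0` has to be restricted to the elements on which the `dt`-component
of the differential, which would have degree `-1`, vanishes. -/
def pathSub (f : A ⟶ B) (n : ℕ) : Submodule ℂ (PathAmbient A B) where
  carrier := {x | ∃ a ∈ A.deg n, ∃ b ∈ polyDeg B n, ∃ c ∈ polyDeg B (n + 1),
    x = pathPt n a b c ∧ polyEval B 0 b = DGAlg.Hom.alg f a ∧
      (n = 0 → polyD B c + polyDer B b = 0)}
  add_mem' := by
    rintro _ _ ⟨a, ha, b, hb, c, hc, rfl, he, h0⟩ ⟨a', ha', b', hb', c', hc', rfl, he', h0'⟩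
    refine ⟨a + a', add_mem ha ha', b + b', add_mem hb hb', c + c', add_mem hc hc', ?_, ?_, ?_⟩
    · simp only [pathPt, Prod.mk_add_mk, tri_add, smul_add]
    · rw [map_add, map_add, he, he']
    · intro hn
      rw [map_add, map_add, add_add_add_comm, h0 hn, h0' hn, add_zero]
  zero_mem' := by
    refine ⟨0, zero_mem _, 0, zero_mem _, 0, zero_mem _, ?_, by simp, by simp⟩
    simp only [pathPt, smul_zero, tri_zero]
    rfl
  smul_mem' := by
    rintro r _ ⟨a, ha, b, hb, c, hc, rfl, he, h0⟩
    refine ⟨r • a, Submodule.smul_mem _ r ha, r • b, Submodule.smul_mem _ r hb, r • c,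
      Submodule.smul_mem _ r hc, ?_, ?_, ?_⟩
    · simp only [pathPt, Prod.smul_mk, tri_smul, smul_comm r]
    · rw [map_smul, map_smul, he]
    · intro hn
      rw [map_smul, map_smul, ← smul_add, h0 hn, smul_zero]

lemma pathPt_mem (f : A ⟶ B) {n : ℕ} {a : A.carrier} {b c : PolyAlg B} (ha : a ∈ A.deg n)
    (hb : b ∈ polyDeg B n) (hc : c ∈ polyDeg B (n + 1))
    (he : polyEval B 0 b = DGAlg.Hom.alg f a) (h0 : n = 0 → polyD B c + polyDer B b = 0) :
    pathPt n a b c ∈ pathSub f n := ⟨a, ha, b, hb, c, hc, rfl, he, h0⟩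

lemma pathPt_mul (m n : ℕ) (a a' : A.carrier) (b c b' c' : PolyAlg B) :
    pathPt m a b c * pathPt n a' b' c' =
      pathPt (m + n) (a * a') (b * b') (b * c' + (-1 : ℂ) ^ n • (c * b')) := by
  simp only [pathPt, Prod.mk_mul_mk, tri_mul, mul_smul_comm, smul_mul_assoc, smul_smul, pow_add]
  rw [mul_comm]

instance (f : A ⟶ B) : SetLike.GradedMonoid (pathSub f) where
  one_mem := by
    refine ⟨1, SetLike.GradedOne.one_mem, 1, of_mem_polyDeg 1 SetLike.GradedOne.one_mem, 0,
      zero_mem _, ?_, by rw [map_one, map_one], fun _ => ?_⟩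
    · rw [pathPt, pow_zero, one_smul, tri_one]; rfl
    · rw [map_zero, zero_add, ← PolyAlg.of_one_one, polyDer_of, derivative_one,
        PolyAlg.zero_of]
  mul_mem := by
    rintro m n _ _ ⟨a, ha, b, hb, c, hc, rfl, he, h0⟩ ⟨a', ha', b', hb', c', hc', rfl, he', h0'⟩
    rw [pathPt_mul]
    refine pathPt_mem f (SetLike.GradedMul.mul_mem ha ha') (polyDeg_mul hb hb')
      (add_mem (polyDeg_mul (n := n + 1) hb hc') (Submodule.smul_mem _ _ ?_)) ?_ ?_
    · have := polyDeg_mul hc hb'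
      rwa [show m + 1 + n = m + n + 1 by omega] at this
    · rw [map_mul, map_mul, he, he']
    · intro hmn
      obtain ⟨rfl, rfl⟩ : m = 0 ∧ n = 0 := by omega
      have e := h0 rfl
      have e' := h0' rfl
      have h1 := polyD_mul hb c'
      have h2 := polyD_mul hc b'
      rw [polyD_zero hb, zero_mul, zero_add, pow_zero, one_smul] at h1
      rw [polyD_zero hb', mul_zero, smul_zero, add_zero] at h2
      rw [pow_zero, one_smul, map_add, h1, h2, polyDer_mul,
        eq_neg_of_add_eq_zero_left e, eq_neg_of_add_eq_zero_left e']
      simp only [neg_mul, mul_neg]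
      abel

/-- The family of subspaces defining the mapping path object of `f : A → B`. -/
def pathFamily (f : A ⟶ B) : DGFamily (PathAmbient A B) where
  D := pathSub f
  δ := pathδ A B
  δ_zero := by
    rintro _ ⟨a, ha, b, hb, c, hc, rfl, he, h0⟩
    rw [pathPt, pow_zero, one_smul, pathδ_apply, A.d_zero a ha, polyD_zero hb, h0 rfl, neg_zero,
      tri_zero]
    rfl
  δ_mem := by
    rintro n _ ⟨a, ha, b, hb, c, hc, rfl, he, h0⟩
    refine ⟨A.d a, A.d_mem n a ha, polyD B b, polyD_mem hb,
      polyD B c + (-1 : ℂ) ^ (n + 1) • polyDer B b,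
      add_mem (polyD_mem hc) (Submodule.smul_mem _ _ (polyDer_mem hb)), ?_, ?_, ?_⟩
    · rw [pathPt, pathPt, pathδ_apply, map_smul, map_smul, pow_succ]
      simp
    · rw [polyEval_polyD, he, DGAlg.Hom.map_d]
    · rintro rfl
      rw [map_add, polyD_polyD, map_smul, polyDer_polyD]
      simp
  δ_δ := by
    rintro n _ ⟨a, ha, b, hb, c, hc, rfl, he, h0⟩
    rw [pathPt, pathδ_apply, pathδ_apply, A.d_d]
    simp only [map_add, map_smul, map_neg, polyD_polyD, polyDer_polyD]
    simp only [smul_zero, neg_zero, zero_add, add_neg_cancel, tri_zero]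
    rfl
  leibniz := by
    rintro p q _ ⟨a, ha, b, hb, c, hc, rfl, he, h0⟩ _ ⟨a', ha', b', hb', c', hc', rfl, he', h0'⟩
    rw [pathPt_mul]
    simp only [pathPt, pathδ_apply, Prod.mk_mul_mk, Prod.smul_mk, Prod.mk_add_mk, tri_mul,
      tri_smul, tri_add]
    refine Prod.ext (A.leibniz p a ha a') ?_
    simp only [map_add, map_smul, polyD_mul hb, polyD_mul hc, polyDer_mul]
    congr 1
    · simp only [smul_mul_assoc, mul_smul_comm, mul_add, add_mul, mul_neg, smul_add, smul_smul,
        pow_succ, pow_add]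
      module
    · simp only [smul_mul_assoc, mul_smul_comm, mul_neg, neg_mul, smul_add, smul_smul, pow_add]
      module

/-- The mapping path object of `f : A → B`. -/
abbrev pathDGAlg (f : A ⟶ B) : DGAlg := (pathFamily f).toDGAlg

/-- The projection of the mapping path object of `A → B` to `A`. -/
def pathFst (f : A ⟶ B) : pathDGAlg f ⟶ A :=
  (pathFamily f).homOut A (LinearMap.fst ℂ _ _)
    (by rintro n _ ⟨a, ha, b, hb, c, hc, rfl, he, h0⟩; exact ha) rfl (fun _ _ _ _ _ _ => rfl)
    (fun _ _ _ => rfl)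

/-- Evaluation at the end point of paths. -/
def pathEv (f : A ⟶ B) : pathDGAlg f ⟶ B :=
  (pathFamily f).homOut B ((polyEval B 1).toLinearMap.comp
      ((Matrix.entryLinearMap ℂ (PolyAlg B) (0 : Fin 2) (0 : Fin 2)).comp (LinearMap.snd ℂ _ _)))
    (by rintro n _ ⟨a, ha, b, hb, c, hc, rfl, he, h0⟩; exact polyEval_mem 1 hb)
    (map_one (polyEval B 1))
    (by
      rintro m n _ ⟨a, ha, b, hb, c, hc, rfl, he, h0⟩ _ ⟨a', ha', b', hb', c', hc', rfl, he', h0'⟩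
      rw [pathPt_mul]
      exact map_mul (polyEval B 1) b b')
    (by
      rintro n _ ⟨a, ha, b, hb, c, hc, rfl, he, h0⟩
      exact polyEval_polyD 1 b)

lemma pathFst_of (f : A ⟶ B) {n : ℕ} {a : A.carrier} {b c : PolyAlg B}
    (h : pathPt n a b c ∈ pathSub f n) :
    DGAlg.Hom.alg (pathFst f) ((pathFamily f).of n _ h) = a := DGFamily.homOut_of ..

lemma pathEv_of (f : A ⟶ B) {n : ℕ} {a : A.carrier} {b c : PolyAlg B}
    (h : pathPt n a b c ∈ pathSub f n) :
    DGAlg.Hom.alg (pathEv f) ((pathFamily f).of n _ h) = polyEval B 1 b := DGFamily.homOut_of ..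

/-- The constant paths, as elements of the ambient ring. -/
def pathConstAlg (f : A ⟶ B) : A.carrier →ₐ[ℂ] PathAmbient A B :=
  AlgHom.ofLinearMap
    { toFun := fun a => (a, tri (PolyAlg.of 1 (DGAlg.Hom.alg f a)) 0 (PolyAlg.of 1 (B.sign (DGAlg.Hom.alg f a))))
      map_add' := fun a b => by
        simp only [map_add, PolyAlg.of_add, Prod.mk_add_mk, tri_add, add_zero]
      map_smul' := fun c a => by
        simp only [map_smul, PolyAlg.of_smul, Prod.smul_mk, tri_smul, smul_zero,
          RingHom.id_apply] }
    (by
      refine Prod.ext rfl ?_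
      simp only [LinearMap.coe_mk, AddHom.coe_mk, map_one, B.sign_one]
      exact tri_one)
    (fun a b => by
      simp only [LinearMap.coe_mk, AddHom.coe_mk, Prod.mk_mul_mk, tri_mul, map_mul, B.sign_mul,
        PolyAlg.of_mul, mul_one, mul_zero, zero_mul, add_zero])

lemma pathConstAlg_apply (f : A ⟶ B) (a : A.carrier) : pathConstAlg f a =
    (a, tri (.of 1 (DGAlg.Hom.alg f a)) 0 (.of 1 (B.sign (DGAlg.Hom.alg f a)))) := rfl

lemma pathConstAlg_of_mem (f : A ⟶ B) {n : ℕ} {a : A.carrier} (ha : a ∈ A.deg n) :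
    pathConstAlg f a = pathPt n a (.of 1 (DGAlg.Hom.alg f a)) 0 := by
  rw [pathConstAlg_apply, pathPt, B.sign_of_mem (DGAlg.Hom.map_deg f n a ha), PolyAlg.of_smul]

lemma pathConstAlg_d (f : A ⟶ B) (a : A.carrier) :
    pathConstAlg f (A.d a) = pathδ A B (pathConstAlg f a) := by
  rw [pathConstAlg_apply, pathConstAlg_apply, pathδ_apply, DGAlg.Hom.map_d, B.sign_d, polyD_of,
    polyD_of, polyDer_of, derivative_one, PolyAlg.zero_of, map_zero, add_zero, PolyAlg.of_neg]

lemma constPt_mem (f : A ⟶ B) {n : ℕ} {a : A.carrier} (ha : a ∈ A.deg n) :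
    pathPt n a (.of 1 (DGAlg.Hom.alg f a)) 0 ∈ pathSub f n :=
  pathPt_mem f ha (of_mem_polyDeg 1 (DGAlg.Hom.map_deg f n a ha)) (zero_mem _)
        (by simp) (fun _ => by simp)

/-- The constant paths `A → P_f`. -/
def pathConst (f : A ⟶ B) : A ⟶ pathDGAlg f :=
  DGFamily.homIn (F := pathFamily f) (pathConstAlg f)
    (fun n a ha => (pathConstAlg_of_mem f ha).symm ▸ constPt_mem f ha)
    (fun n a ha => pathConstAlg_d f a)

lemma pathConst_of_mem (f : A ⟶ B) {n : ℕ} {a : A.carrier} (ha : a ∈ A.deg n)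
    (h : pathPt n a (.of 1 (DGAlg.Hom.alg f a)) 0 ∈ pathSub f n) :
    DGAlg.Hom.alg (pathConst f) a = (pathFamily f).of n (pathPt n a (.of 1 (DGAlg.Hom.alg f a)) 0) h :=
  (DGFamily.homIn_of_mem _ _ _ ha).trans (DGFamily.of_eq _ _ rfl (pathConstAlg_of_mem f ha))

lemma pathConst_fst (f : A ⟶ B) : pathConst f ≫ pathFst f = 𝟙 A :=
  DGAlg.hom_ext <| DGAlg.linearMap_ext
    (f := (DGAlg.Hom.alg (pathConst f ≫ pathFst f)).toLinearMap) (g := LinearMap.id)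
    fun n a ha => (congrArg (DGAlg.Hom.alg (pathFst f))
      (pathConst_of_mem f ha (constPt_mem f ha))).trans (pathFst_of f _)

lemma pathConst_ev (f : A ⟶ B) : pathConst f ≫ pathEv f = f :=
  DGAlg.hom_ext <| DGAlg.linearMap_ext
    (f := (DGAlg.Hom.alg (pathConst f ≫ pathEv f)).toLinearMap)
    (g := (DGAlg.Hom.alg f).toLinearMap)
    fun n a ha => (congrArg (DGAlg.Hom.alg (pathEv f))
      (pathConst_of_mem f ha (constPt_mem f ha))).trans ((pathEv_of f _).trans (by simp))

lemma pathEv_fibration (f : A ⟶ B) : fibration (pathEv f) := fun n b hb =>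
  ⟨(pathFamily f).of (n + 1) (pathPt (n + 1) 0 (PolyAlg.of X b) 0)
    (pathPt_mem f (zero_mem _) (of_mem_polyDeg _ hb) (zero_mem _) (by simp)
      (fun h => absurd h n.succ_ne_zero)),
    (pathFamily f).of_mem _, (pathEv_of f _).trans (by simp)⟩

/-- Contracting the paths to their starting point shows that `P_f → A` is a
quasi-isomorphism. -/
lemma pathFst_quasiIso (f : A ⟶ B) : quasiIso (pathFst f) := by
  rw [quasiIso_iff]
  constructor
  · intro n z hz hdz α hα hdα
    obtain ⟨_, ⟨a, ha, b, hb, c, hc, rfl, he, h0⟩, rfl⟩ := DGFamily.exists_of_mem hz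
    have hδ := (pathFamily f).δ_eq_zero _ hdz
    obtain ⟨-, hδ2⟩ := Prod.ext_iff.1 hδ
    obtain ⟨-, h2, -⟩ := tri_injective (hδ2.trans tri_zero.symm)
    replace h2 : polyD B c + polyDer B ((-1 : ℂ) ^ n • b) = 0 := h2
    rw [map_smul] at h2
    replace hdα : A.d α = a := hdα.trans (pathFst_of f _)
    -- the path from `f α` whose derivative cancels `c dt`
    let b' : PolyAlg B := PolyAlg.of 1 (DGAlg.Hom.alg f α) - (-1 : ℂ) ^ n • polyIntegral B c
    have hb' : b' ∈ polyDeg B (n + 1) := sub_mem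
      (of_mem_polyDeg 1 (DGAlg.Hom.map_deg f _ _ hα)) (Submodule.smul_mem _ _ (polyIntegral_mem hc))
    have hDb' : polyD B b' = b := by
      simp only [b', map_sub, map_smul, polyD_of]
      rw [← polyIntegral_polyD, eq_neg_of_add_eq_zero_left h2, map_neg, map_smul,
        polyIntegral_polyDer, he, ← DGAlg.Hom.map_d, hdα, smul_neg, smul_smul,
        neg_one_pow_mul_self, one_smul]
      abel
    have hmem : pathPt (n + 1) α b' 0 ∈ pathSub f (n + 1) := pathPt_mem f hα hb' (zero_mem _)
      (by simp [b', polyEval_zero_polyIntegral]) (fun h => absurd h n.succ_ne_zero)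
    refine ⟨(pathFamily f).of (n + 1) _ hmem, (pathFamily f).of_mem _, ?_⟩
    refine ((pathFamily f).d_of_succ hmem).trans (DGFamily.of_eq _ _ rfl ?_)
    change pathδ A B (pathPt _ _ _ _) = _
    rw [pathPt, pathδ_apply, pathPt, hdα, hDb', map_smul, map_smul, hDb', pow_succ]
    refine Prod.ext rfl ?_
    change tri _ _ _ = tri _ _ _
    congr 1
    · simp only [b', map_sub, map_smul, polyDer_of, polyDer_polyIntegral, map_zero]
      simp only [derivative_one, PolyAlg.zero_of, zero_sub, zero_add, smul_neg, smul_smul,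
        mul_neg, mul_one, neg_mul, neg_smul, neg_neg, neg_one_pow_mul_self, one_smul]
    · simp
  · intro n y hy hdy
    refine ⟨DGAlg.Hom.alg (pathConst f) y, DGAlg.Hom.map_deg _ n y hy, ?_, 0, zero_mem _, ?_⟩
    · rw [← DGAlg.Hom.map_d, hdy, map_zero]
    · have h : DGAlg.Hom.alg (pathFst f) (DGAlg.Hom.alg (pathConst f) y) = y :=
        congrArg (fun g => DGAlg.Hom.alg g y) (pathConst_fst f)
      rw [h, sub_self, map_zero]

lemma pathConst_quasiIso (f : A ⟶ B) : quasiIso (pathConst f) :=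
  quasiIso.of_postcomp _ _ (pathFst_quasiIso f) (by
    rw [pathConst_fst]; exact quasiIso.id_mem A)

lemma pathEv_quasiIso (f : A ⟶ B) (hf : quasiIso f) : quasiIso (pathEv f) :=
  quasiIso.of_precomp _ _ (pathConst_quasiIso f) (by rwa [pathConst_ev])

/-- The path object of a commutative dg-algebra is commutative. -/
lemma pathDGAlg_comm {B : DGAlg} (hB : gradedComm B) : gradedComm (pathDGAlg (𝟙 B)) := by
  intro m n x hx y hy
  obtain ⟨_, ⟨a, ha, b, hb, c, hc, rfl, he, h0⟩, rfl⟩ := DGFamily.exists_of_mem hx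
  obtain ⟨_, ⟨a', ha', b', hb', c', hc', rfl, he', h0'⟩, rfl⟩ := DGFamily.exists_of_mem hy
  have hx' : pathPt m a b c ∈ (pathFamily (𝟙 B)).D m := pathPt_mem _ ha hb hc he h0
  have hy' : pathPt n a' b' c' ∈ (pathFamily (𝟙 B)).D n := pathPt_mem _ ha' hb' hc' he' h0'
  refine (DGFamily.of_mul _ hx' hy').trans (Eq.trans (DGFamily.of_eq _
    (Submodule.smul_mem _ _ (SetLike.GradedMul.mul_mem hy' hx')) (add_comm m n) ?_)
    ((DGFamily.of_smul _ _ _).trans (congrArg _ (DGFamily.of_mul _ hy' hx').symm)))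
  rw [pathPt_mul, pathPt_mul]
  simp only [pathPt, Prod.smul_mk, tri_smul]
  refine Prod.ext (hB m n a ha a' ha') ?_
  have h1 := polyAlg_comm hB hb hb'
  have h2 := polyAlg_comm hB hb hc'
  have h3 := polyAlg_comm hB hc hb'
  change tri _ _ _ = tri _ _ _
  rw [h1, h2, h3]
  congr 1
  · simp only [smul_add, smul_smul, mul_add, add_mul, mul_one, one_mul, pow_add]
    rw [mul_left_comm, neg_one_pow_mul_self, mul_one, add_comm]
  · rw [smul_comm, add_comm m n]

end MappingPath

namespace DGFamily
variable {R : Type} [Ring R] [Algebra ℂ R] (F : DGFamily R)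

/-- The sum of the homogeneous components, in the ambient ring. -/
def val : F.toDGAlg.carrier →ₐ[ℂ] R := DirectSum.coeAlgHom F.D

lemma val_of {n : ℕ} {x : R} (hx : x ∈ F.D n) : F.val (F.of n x hx) = x :=
  DirectSum.coeAlgHom_of F.D n ⟨x, hx⟩

lemma val_d (z : F.toDGAlg.carrier) : F.val (F.toDGAlg.d z) = F.δ (F.val z) := by
  refine DGAlg.linearMap_ext (f := F.val.toLinearMap.comp F.toDGAlg.d)
    (g := F.δ.comp F.val.toLinearMap) (fun n c hc => ?_) z
  obtain ⟨x, hx, rfl⟩ := exists_of_mem hc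
  refine Eq.trans ?_ (congrArg F.δ (F.val_of hx)).symm
  rcases n with _ | n
  · exact (congrArg F.val (F.d_of_zero hx)).trans ((map_zero F.val).trans (F.δ_zero x hx).symm)
  · exact (congrArg F.val (F.d_of_succ hx)).trans (F.val_of _)

end DGFamily

/-! ### Homotopies and the representation functor -/

section
open Polynomial
variable {S : Type} [Ring S] [Algebra ℂ S] {A B : DGAUnder S}

/-- The mapping path object of a map of dg-algebras under `S`. -/
def pathUnder (f : A ⟶ B) : DGAUnder S := Under.mk (A.hom ≫ pathConst f.right)

/-- The projection to `A` of the mapping path object of `A → B`. -/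
def pathUnderFst (f : A ⟶ B) : pathUnder f ⟶ A :=
  Under.homMk (U := pathUnder f) (pathFst f.right) (by
    change (A.hom ≫ pathConst f.right) ≫ pathFst f.right = A.hom
    rw [Category.assoc, pathConst_fst, Category.comp_id])

/-- Evaluation at the end point of paths. -/
def pathUnderEv (f : A ⟶ B) : pathUnder f ⟶ B :=
  Under.homMk (U := pathUnder f) (pathEv f.right) (by
    change (A.hom ≫ pathConst f.right) ≫ pathEv f.right = B.hom
    rw [Category.assoc, pathConst_ev, Under.w])

variable {n : Type} [Fintype n] [DecidableEq n] (ρ : S →ₐ[ℂ] Matrix n n ℂ)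

lemma repFunctor_map_gen (f : A ⟶ B) (i j : n) (a : A.right.carrier) :
    DGAlg.Hom.alg ((repFunctor ρ).map f).hom (repGen ρ A i j a) =
      repGen ρ B i j (DGAlg.Hom.alg f.right a) :=
  repDescAlg_gen ρ (repObj ρ B) (f ≫ repHomEquiv ρ B (repObj ρ B) (𝟙 _)) i j a

lemma repObj_hom_ext {B : CDGAlg} {f g : (repFunctor ρ).obj A ⟶ B}
    (h : ∀ i j a, DGAlg.Hom.alg f.hom (repGen ρ A i j a) =
      DGAlg.Hom.alg g.hom (repGen ρ A i j a)) : f = g :=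
  ObjectProperty.hom_ext _ (DGAlg.Hom.ext (rep_algHom_ext ρ A h))

end

section
open Polynomial
variable {n : Type} [Fintype n] [DecidableEq n] {A B E : DGAlg}

/-- The entries of a map of dg-algebras to a matrix algebra. -/
def entryMap (γ : B ⟶ matrixDG n E) (i j : n) : B.carrier →ₗ[ℂ] E.carrier :=
  (Matrix.entryLinearMap ℂ E.carrier i j).comp (DGAlg.Hom.alg γ).toLinearMap

lemma entryMap_mem (γ : B ⟶ matrixDG n E) (i j : n) (m : ℕ) (b : B.carrier) (hb : b ∈ B.deg m) :
    entryMap γ i j b ∈ E.deg m := γ.map_deg m b hb i j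

lemma entryMap_d (γ : B ⟶ matrixDG n E) (i j : n) (b : B.carrier) :
    entryMap γ i j (B.d b) = E.d (entryMap γ i j b) := congrFun (congrFun (γ.map_d b) i) j

lemma entryMap_one (γ : B ⟶ matrixDG n E) (i j : n) :
    entryMap γ i j 1 = (1 : Matrix n n E.carrier) i j :=
  congrFun (congrFun (map_one (DGAlg.Hom.alg γ)) i) j

lemma entryMap_mul (γ : B ⟶ matrixDG n E) (i j : n) (a b : B.carrier) :
    entryMap γ i j (a * b) = ∑ k, entryMap γ i k a * entryMap γ k j b :=
  (congrFun (congrFun (map_mul (DGAlg.Hom.alg γ) a b) i) j).trans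
    (Matrix.mul_apply (M := (DGAlg.Hom.alg γ a : Matrix n n E.carrier)))

/-- The matrix entries of a path, which are paths in the algebra of matrix entries. -/
def pathEntry (f : A ⟶ B) (γ : B ⟶ matrixDG n E) (i j : n) :
    PathAmbient A B →ₗ[ℂ] PathAmbient E E where
  toFun x := (entryMap γ i j (DGAlg.Hom.alg f x.1), x.2.map (polyMap B (entryMap γ i j)))
  map_add' x y := Prod.ext (by simp only [Prod.fst_add, map_add])
    (Matrix.ext fun k l => map_add (polyMap B (entryMap γ i j)) _ _)
  map_smul' c x := Prod.ext (by simp only [Prod.smul_fst, map_smul, RingHom.id_apply])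
    (Matrix.ext fun k l => map_smul (polyMap B (entryMap γ i j)) _ _)

lemma pathEntry_tri (f : A ⟶ B) (γ : B ⟶ matrixDG n E) (i j : n) (a : A.carrier)
    (x y z : PolyAlg B) : pathEntry f γ i j (a, tri x y z) =
      (entryMap γ i j (DGAlg.Hom.alg f a), tri (polyMap B (entryMap γ i j) x)
        (polyMap B (entryMap γ i j) y) (polyMap B (entryMap γ i j) z)) := by
  refine Prod.ext rfl (Matrix.ext fun k l => ?_)
  fin_cases k <;> fin_cases l
  · rfl
  · rfl
  · exact map_zero (polyMap B (entryMap γ i j))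
  · rfl

lemma pathEntry_pathPt (f : A ⟶ B) (γ : B ⟶ matrixDG n E) (i j : n) (m : ℕ) (a : A.carrier)
    (b c : PolyAlg B) : pathEntry f γ i j (pathPt m a b c) =
      pathPt m (entryMap γ i j (DGAlg.Hom.alg f a)) (polyMap B (entryMap γ i j) b)
        (polyMap B (entryMap γ i j) c) := by
  rw [pathPt, pathEntry_tri, map_smul, pathPt]

lemma pathEntry_mem (f : A ⟶ B) (γ : B ⟶ matrixDG n E) (i j : n) (m : ℕ) {x : PathAmbient A B}
    (hx : x ∈ pathSub f m) : pathEntry f γ i j x ∈ pathSub (𝟙 E) m := by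
  obtain ⟨a, ha, b, hb, c, hc, rfl, he, h0⟩ := hx
  rw [pathEntry_pathPt]
  refine pathPt_mem _ (entryMap_mem γ i j _ _ (DGAlg.Hom.map_deg f _ _ ha))
    (polyMap_mem (entryMap_mem γ i j _) hb) (polyMap_mem (entryMap_mem γ i j _) hc) ?_
    (fun h => ?_)
  · rw [polyEval_polyMap, he]; rfl
  · rw [polyD_polyMap _ (entryMap_d γ i j), polyDer_polyMap, ← map_add, h0 h, map_zero]

lemma pathEntry_mul (f : A ⟶ B) (γ : B ⟶ matrixDG n E) (i j : n) (x y : PathAmbient A B) :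
    pathEntry f γ i j (x * y) = ∑ k, pathEntry f γ i k x * pathEntry f γ k j y := by
  refine Prod.ext ?_ (Matrix.ext fun k l => ?_)
  · rw [Prod.fst_sum]
    change entryMap γ i j (DGAlg.Hom.alg f (x.1 * y.1)) = _
    rw [map_mul, entryMap_mul]
    rfl
  · rw [Prod.snd_sum, Matrix.sum_apply]
    change polyMap B (entryMap γ i j) ((x.2 * y.2) k l) = ∑ r, (Matrix.map x.2 _ *
      Matrix.map y.2 _ : Matrix (Fin 2) (Fin 2) (PolyAlg E)) k l
    simp only [Matrix.mul_apply, map_sum, Matrix.map_apply]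
    rw [Finset.sum_comm]
    exact Finset.sum_congr rfl fun r _ => polyMap_mul Finset.univ _ (fun k => entryMap γ i k)
      (fun k => entryMap γ k j) (entryMap_mul γ i j) _ _

lemma polyMap_entryMap_one (γ : B ⟶ matrixDG n E) (i j : n) :
    polyMap B (entryMap γ i j) 1 = (1 : Matrix n n (PolyAlg E)) i j := by
  rw [← PolyAlg.of_one_one]
  refine (congrArg (PolyAlg.of 1) (entryMap_one γ i j)).trans ?_
  rw [Matrix.one_apply, Matrix.one_apply]
  split
  · rfl
  · exact PolyAlg.of_zero 1

lemma pathEntry_one (f : A ⟶ B) (γ : B ⟶ matrixDG n E) (i j : n) : pathEntry f γ i j 1 =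
    (1 : Matrix n n (PathAmbient E E)) i j := by
  have h : (1 : PathAmbient A B) = (1, tri 1 0 1) := by rw [tri_one]; rfl
  rw [h, pathEntry_tri, map_one, map_zero, polyMap_entryMap_one, entryMap_one]
  by_cases hij : i = j
  · subst hij
    rw [Matrix.one_apply_eq, Matrix.one_apply_eq, Matrix.one_apply_eq, tri_one]; rfl
  · rw [Matrix.one_apply_ne hij, Matrix.one_apply_ne hij, Matrix.one_apply_ne hij, tri_zero]; rfl

lemma pathEntry_δ (f : A ⟶ B) (γ : B ⟶ matrixDG n E) (i j : n) {m : ℕ} {x : PathAmbient A B}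
    (hx : x ∈ pathSub f m) :
    pathEntry f γ i j (pathδ _ _ x) = pathδ _ _ (pathEntry f γ i j x) := by
  obtain ⟨a, ha, b, hb, c, hc, rfl, -, -⟩ := hx
  rw [pathPt, pathδ_apply, pathEntry_tri, pathEntry_tri, pathδ_apply]
  simp only [DGAlg.Hom.map_d, entryMap_d, polyD_polyMap _ (entryMap_d γ i j), polyDer_polyMap,
    map_add, map_neg]

/-- Taking matrix entries of paths, as a map of dg-algebras. -/
def pathMatrix (f : A ⟶ B) (γ : B ⟶ matrixDG n E) :
    pathDGAlg f ⟶ matrixDG n (pathDGAlg (𝟙 E)) :=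
  DGFamily.homInMatrix (C := pathDGAlg f) (F := pathFamily (𝟙 E))
    (fun i j => (pathEntry f γ i j).comp (pathFamily f).val.toLinearMap)
    (fun i j p c hc => by
      obtain ⟨x, hx, rfl⟩ := DGFamily.exists_of_mem hc
      exact (congrArg (· ∈ pathSub (𝟙 E) p) (congrArg (pathEntry f γ i j)
        (DGFamily.val_of _ hx))).mpr (pathEntry_mem f γ i j p hx))
    (fun i j => (congrArg (pathEntry f γ i j) (map_one (pathFamily f).val)).trans
      (pathEntry_one f γ i j))
    (fun i j a b => (congrArg (pathEntry f γ i j) (map_mul (pathFamily f).val a b)).trans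
      (pathEntry_mul f γ i j _ _))
    (fun i j p c hc => by
      obtain ⟨x, hx, rfl⟩ := DGFamily.exists_of_mem hc
      exact (congrArg (pathEntry f γ i j) (((pathFamily f).val_d _).trans
        (congrArg _ (DGFamily.val_of _ hx)))).trans ((pathEntry_δ f γ i j hx).trans
        (congrArg (fun y => pathδ E E (pathEntry f γ i j y)) (DGFamily.val_of _ hx).symm)))

lemma pathMatrix_of (f : A ⟶ B) (γ : B ⟶ matrixDG n E) {m : ℕ} {x : PathAmbient A B}
    (hx : x ∈ pathSub f m) (i j : n) :
    DGAlg.Hom.alg (pathMatrix f γ) ((pathFamily f).of m x hx) i j =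
      (pathFamily (𝟙 E)).of m (pathEntry f γ i j x) (pathEntry_mem f γ i j m hx) :=
  (DGFamily.homInMatrix_of_mem (C := pathDGAlg f) _ _ _ _ _
    ((pathFamily f).of_mem hx) i j).trans
    (DGFamily.of_eq _ _ rfl (congrArg (pathEntry f γ i j) (DGFamily.val_of _ hx)))

/-- Constant paths have constant matrix entries. -/
lemma pathMatrix_const (f : A ⟶ B) (γ : B ⟶ matrixDG n E) (c : Matrix n n ℂ) {a : A.carrier}
    (ha : a ∈ A.deg 0)
    (h : ∀ i j, entryMap γ i j (DGAlg.Hom.alg f a) = algebraMap ℂ E.carrier (c i j)) (i j : n) :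
    DGAlg.Hom.alg (pathMatrix f γ) (DGAlg.Hom.alg (pathConst f) a) i j =
      algebraMap ℂ (pathDGAlg (𝟙 E)).carrier (c i j) := by
  have h1 := pathConst_of_mem f ha (constPt_mem f ha)
  refine (congrArg (fun z => DGAlg.Hom.alg (pathMatrix f γ) z i j) h1).trans ?_
  refine (pathMatrix_of f γ (constPt_mem f ha) i j).trans ?_
  refine Eq.trans ?_ (Algebra.algebraMap_eq_smul_one (A := (pathFamily (𝟙 E)).Carrier) _).symm
  rw [← DGFamily.of_one]
  refine Eq.trans (DGFamily.of_eq _ (Submodule.smul_mem _ _ SetLike.GradedOne.one_mem) rfl ?_)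
    ((pathFamily (𝟙 E)).of_smul (c i j) SetLike.GradedOne.one_mem)
  have h3 : polyMap B (entryMap γ i j) (.of 1 (DGAlg.Hom.alg f a)) =
      c i j • (1 : PolyAlg E) := by
    refine (congrArg (PolyAlg.of 1) (h i j)).trans ?_
    rw [Algebra.algebraMap_eq_smul_one, PolyAlg.of_smul, PolyAlg.of_one_one]
  rw [pathEntry_pathPt, h3, map_zero, h, Algebra.algebraMap_eq_smul_one, pathPt, pow_zero,
    one_smul]
  refine Prod.ext rfl ?_
  refine Eq.trans ?_ (congrArg (c i j • ·) (tri_one (R := PolyAlg E)))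
  rw [tri_smul, smul_zero]

lemma pathMatrix_fst (f : A ⟶ B) (γ : B ⟶ matrixDG n E) (z : (pathDGAlg f).carrier) (i j : n) :
    DGAlg.Hom.alg (pathFst (𝟙 E)) (DGAlg.Hom.alg (pathMatrix f γ) z i j) =
      entryMap γ i j (DGAlg.Hom.alg f (DGAlg.Hom.alg (pathFst f) z)) := by
  refine DGAlg.linearMap_ext
    (f := (DGAlg.Hom.alg (pathFst (𝟙 E))).toLinearMap.comp (entryMap (pathMatrix f γ) i j))
    (g := (entryMap γ i j).comp ((DGAlg.Hom.alg f).toLinearMap.comp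
      (DGAlg.Hom.alg (pathFst f)).toLinearMap)) (fun m y hy => ?_) z
  obtain ⟨x, ⟨a, ha, b, hb, c, hc, rfl, he, h0⟩, rfl⟩ := DGFamily.exists_of_mem hy
  have hx := pathPt_mem f ha hb hc he h0
  refine (congrArg (DGAlg.Hom.alg (pathFst (𝟙 E))) (pathMatrix_of f γ hx i j)).trans ?_
  refine Eq.trans ?_ (congrArg (fun y => entryMap γ i j (DGAlg.Hom.alg f y))
    (pathFst_of f hx)).symm
  refine (congrArg (DGAlg.Hom.alg (pathFst (𝟙 E))) (DGFamily.of_eq _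
    (pathEntry_pathPt f γ i j m a b c ▸ pathEntry_mem f γ i j m hx) rfl
    (pathEntry_pathPt f γ i j m a b c))).trans ?_
  exact pathFst_of (𝟙 E) _

lemma pathMatrix_ev (f : A ⟶ B) (γ : B ⟶ matrixDG n E) (z : (pathDGAlg f).carrier) (i j : n) :
    DGAlg.Hom.alg (pathEv (𝟙 E)) (DGAlg.Hom.alg (pathMatrix f γ) z i j) =
      entryMap γ i j (DGAlg.Hom.alg (pathEv f) z) := by
  refine DGAlg.linearMap_ext
    (f := (DGAlg.Hom.alg (pathEv (𝟙 E))).toLinearMap.comp (entryMap (pathMatrix f γ) i j))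
    (g := (entryMap γ i j).comp (DGAlg.Hom.alg (pathEv f)).toLinearMap) (fun m y hy => ?_) z
  obtain ⟨x, ⟨a, ha, b, hb, c, hc, rfl, he, h0⟩, rfl⟩ := DGFamily.exists_of_mem hy
  have hx := pathPt_mem f ha hb hc he h0
  refine (congrArg (DGAlg.Hom.alg (pathEv (𝟙 E))) (pathMatrix_of f γ hx i j)).trans ?_
  refine Eq.trans ?_ (congrArg (entryMap γ i j) (pathEv_of f hx)).symm
  refine (congrArg (DGAlg.Hom.alg (pathEv (𝟙 E))) (DGFamily.of_eq _
    (pathEntry_pathPt f γ i j m a b c ▸ pathEntry_mem f γ i j m hx) rfl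
    (pathEntry_pathPt f γ i j m a b c))).trans ?_
  exact (pathEv_of (𝟙 E) _).trans (polyEval_polyMap (entryMap γ i j) 1 b)

end

section
variable {S : Type} [Ring S] [Algebra ℂ S] {A B : DGAUnder S}
variable {n : Type} [Fintype n] [DecidableEq n] (ρ : S →ₐ[ℂ] Matrix n n ℂ)

/-- The path object of `B_V`, as a commutative dg-algebra. -/
def repPathObj (B : DGAUnder S) : CDGAlg :=
  ⟨pathDGAlg (𝟙 (repDG ρ B)), pathDGAlg_comm (repAlg_comm ρ B)⟩

/-- Taking matrix entries of paths, as a map under `S`. -/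
def repPath (f : A ⟶ B) : pathUnder f ⟶ (matrixFunctor ρ).obj (repPathObj ρ B) :=
  Under.homMk (U := pathUnder f) (V := matrixUnder ρ (pathDGAlg (𝟙 (repDG ρ B))))
    (pathMatrix f.right (repUnit ρ B).right)
    (DGAlg.hom_ext fun s => Matrix.ext fun i j =>
      pathMatrix_const f.right (repUnit ρ B).right (ρ s) (structMap_mem A s) (fun i j => by
        have h2 : DGAlg.Hom.alg f.right (structMap A s) = structMap B s :=
          congrArg (fun g => DGAlg.Hom.alg g s) (Under.w f)
        exact (congrArg (repGen ρ B i j) h2).trans (repGen_base ρ B s i j)) i j)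

/-- The map from the representation algebra of a mapping path object to the path object of the
representation algebra: the representation functor preserves homotopies. -/
def repHomotopy (f : A ⟶ B) : (repFunctor ρ).obj (pathUnder f) ⟶ repPathObj ρ B :=
  repDesc ρ _ (repPath ρ f)

/-- Evaluation of paths in `B_V` at their starting point. -/
def repPathFst (B : DGAUnder S) : repPathObj ρ B ⟶ (repFunctor ρ).obj B :=
  ObjectProperty.homMk (pathFst (𝟙 (repDG ρ B)))

/-- Evaluation of paths in `B_V` at their end point. -/
def repPathEv (B : DGAUnder S) : repPathObj ρ B ⟶ (repFunctor ρ).obj B :=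
  ObjectProperty.homMk (pathEv (𝟙 (repDG ρ B)))

/-- The constant paths in `B_V`. -/
def repPathConst (B : DGAUnder S) : (repFunctor ρ).obj B ⟶ repPathObj ρ B :=
  ObjectProperty.homMk (pathConst (𝟙 (repDG ρ B)))

lemma repHomotopy_fst (f : A ⟶ B) : repHomotopy ρ f ≫ repPathFst ρ B =
    (repFunctor ρ).map (pathUnderFst f) ≫ (repFunctor ρ).map f := by
  refine repObj_hom_ext ρ fun i j z => ?_
  refine (congrArg (DGAlg.Hom.alg (pathFst (𝟙 (repDG ρ B))))
    (repDesc_gen ρ (repPathObj ρ B) (repPath ρ f) i j z)).trans ?_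
  refine (pathMatrix_fst f.right (repUnit ρ B).right z i j).trans (Eq.symm ?_)
  exact (congrArg (DGAlg.Hom.alg ((repFunctor ρ).map f).hom)
    (repFunctor_map_gen ρ (pathUnderFst f) i j z)).trans (repFunctor_map_gen ρ f i j _)

lemma repHomotopy_ev (f : A ⟶ B) : repHomotopy ρ f ≫ repPathEv ρ B =
    (repFunctor ρ).map (pathUnderEv f) := by
  refine repObj_hom_ext ρ fun i j z => ?_
  refine (congrArg (DGAlg.Hom.alg (pathEv (𝟙 (repDG ρ B))))
    (repDesc_gen ρ (repPathObj ρ B) (repPath ρ f) i j z)).trans ?_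
  exact (pathMatrix_ev f.right (repUnit ρ B).right z i j).trans
    (repFunctor_map_gen ρ (pathUnderEv f) i j z).symm

lemma repPathConst_fst (B : DGAUnder S) : repPathConst ρ B ≫ repPathFst ρ B = 𝟙 _ :=
  ObjectProperty.hom_ext _ (pathConst_fst (𝟙 (repDG ρ B)))

lemma repPathConst_ev (B : DGAUnder S) : repPathConst ρ B ≫ repPathEv ρ B = 𝟙 _ :=
  ObjectProperty.hom_ext _ (pathConst_ev (𝟙 (repDG ρ B)))

/-- In the homotopy category, the two end points of the universal path in `B_V` agree. -/
lemma repPath_Q_eq (B : DGAUnder S) :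
    quasiIsoComm.Q.map (repPathFst ρ B) = quasiIsoComm.Q.map (repPathEv ρ B) := by
  have hc : quasiIsoComm (repPathConst ρ B) := pathConst_quasiIso (𝟙 (repDG ρ B))
  have : IsIso (quasiIsoComm.Q.map (repPathConst ρ B)) :=
    Localization.inverts quasiIsoComm.Q quasiIsoComm _ hc
  rw [← cancel_epi (quasiIsoComm.Q.map (repPathConst ρ B)), ← Functor.map_comp,
    ← Functor.map_comp, repPathConst_fst, repPathConst_ev]

lemma repToHo_pathEv (f : A ⟶ B) : (repToHo ρ).map (pathUnderEv f) =
    (repToHo ρ).map (pathUnderFst f) ≫ (repToHo ρ).map f := by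
  change quasiIsoComm.Q.map _ = quasiIsoComm.Q.map _ ≫ quasiIsoComm.Q.map _
  rw [← Functor.map_comp, ← repHomotopy_ev, ← repHomotopy_fst, Functor.map_comp,
    Functor.map_comp, repPath_Q_eq]

/-- An object of `DGA_S^+` is cofibrant if its structure map is a cofibration. -/
def Cofibrant (A : DGAUnder S) : Prop := cofibration A.hom

lemma Cofibrant.lift {A X Y : DGAUnder S} (hA : Cofibrant A) (p : X ⟶ Y)
    (hq : quasiIso p.right) (hf : fibration p.right) (g : A ⟶ Y) :
    ∃ t : A ⟶ X, t ≫ p = g := by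
  have sq : CommSq X.hom A.hom p.right g.right := ⟨by rw [Under.w, Under.w]⟩
  have := hA p.right ⟨hq, hf⟩
  refine ⟨Under.homMk sq.lift sq.fac_left, Under.UnderMorphism.ext ?_⟩
  exact sq.fac_right

/-- A quasi-isomorphism to a cofibrant object has a right inverse after applying the
representation functor, up to homotopy. -/
lemma exists_homotopy_section (f : A ⟶ B) (hf : quasiIso f.right) (hB : Cofibrant B) :
    ∃ g : B ⟶ A, quasiIso g.right ∧
      (repToHo ρ).map g ≫ (repToHo ρ).map f = 𝟙 _ := by
  obtain ⟨t, ht⟩ := hB.lift (pathUnderEv f) (pathEv_quasiIso f.right hf)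
    (pathEv_fibration f.right) (𝟙 B)
  refine ⟨t ≫ pathUnderFst f, ?_, ?_⟩
  · have h1 : quasiIso t.right := by
      refine quasiIso.of_postcomp _ _ (pathEv_quasiIso f.right hf) ?_
      have : t.right ≫ pathEv f.right = 𝟙 _ := congrArg CommaMorphism.right ht
      rw [this]
      exact quasiIso.id_mem _
    exact quasiIso.comp_mem _ _ h1 (pathFst_quasiIso f.right)
  · rw [Functor.map_comp, Category.assoc, ← repToHo_pathEv, ← Functor.map_comp, ht,
      CategoryTheory.Functor.map_id]

/-- The representation functor sends quasi-isomorphisms between cofibrant objects to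
isomorphisms of the homotopy category. -/
lemma repToHo_isIso (f : A ⟶ B) (hf : quasiIso f.right) (hA : Cofibrant A) (hB : Cofibrant B) :
    IsIso ((repToHo ρ).map f) := by
  obtain ⟨g, hg, h1⟩ := exists_homotopy_section ρ f hf hB
  obtain ⟨k, -, h2⟩ := exists_homotopy_section ρ g hg hA
  have h3 : (repToHo ρ).map k = (repToHo ρ).map f := by
    rw [← Category.comp_id ((repToHo ρ).map k), ← h1, ← Category.assoc, h2, Category.id_comp]
  exact ⟨_, by rw [← h3, h2], h1⟩

end

/-! ### Free algebras with a linear operator -/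

section FreeH
variable (S M : Type) [Ring S] [Algebra ℂ S] [AddCommGroup M] [Module ℂ M]

/-- An algebra under `S` with a linear map from `M` and a linear endomorphism. -/
structure HModel where
  R : Type
  [ring : Ring R]
  [algebra : Algebra ℂ R]
  base : S →ₐ[ℂ] R
  sig : M →ₗ[ℂ] R
  h : R →ₗ[ℂ] R

attribute [instance] HModel.ring HModel.algebra

/-- Terms in the operations of an `HModel`. -/
inductive HTerm
  | base (s : S)
  | sig (m : M)
  | h (t : HTerm)
  | add (t u : HTerm)
  | mul (t u : HTerm)

variable {S M} in
/-- The value of a term in all models at once. -/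
def HTerm.eval : HTerm S M → ∀ K : HModel S M, K.R
  | base s => fun K => K.base s
  | sig m => fun K => K.sig m
  | h t => fun K => K.h (t.eval K)
  | add t u => t.eval + u.eval
  | mul t u => t.eval * u.eval

/-- The algebra of the values of all terms. -/
def freeHSub : Subalgebra ℂ (∀ K : HModel S M, K.R) where
  carrier := Set.range HTerm.eval
  mul_mem' := by
    rintro _ _ ⟨t, rfl⟩ ⟨u, rfl⟩
    exact ⟨.mul t u, rfl⟩
  add_mem' := by
    rintro _ _ ⟨t, rfl⟩ ⟨u, rfl⟩
    exact ⟨.add t u, rfl⟩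
  algebraMap_mem' r := ⟨.base (algebraMap ℂ S r), funext fun K => K.base.commutes r⟩

instance : Small.{0} (freeHSub S M) := small_range (HTerm.eval (S := S) (M := M))

/-- The free algebra under `S` with a linear map from `M` and a linear endomorphism: the terms,
two of them being equal if they have the same value in every model. -/
def FreeH : Type := Shrink.{0} (freeHSub S M)

instance : Ring (FreeH S M) := inferInstanceAs (Ring (Shrink.{0} (freeHSub S M)))
instance : Algebra ℂ (FreeH S M) := inferInstanceAs (Algebra ℂ (Shrink.{0} (freeHSub S M)))

namespace FreeH

/-- The defining isomorphism. -/
def toSub : FreeH S M ≃ₐ[ℂ] freeHSub S M := Shrink.algEquiv ℂ (freeHSub S M)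

/-- The structure map. -/
def base : S →ₐ[ℂ] FreeH S M :=
  (toSub S M).symm.toAlgHom.comp
    (AlgHom.codRestrict (AlgHom.pi fun K : HModel S M => K.base) _ fun s => ⟨.base s, rfl⟩)

/-- The linear map from `M`. -/
def sig : M →ₗ[ℂ] FreeH S M :=
  (toSub S M).symm.toLinearMap.comp
    (LinearMap.codRestrict (Subalgebra.toSubmodule (freeHSub S M))
      (LinearMap.pi fun K : HModel S M => K.sig) fun m => ⟨.sig m, rfl⟩)

/-- The linear endomorphism. -/
def h : FreeH S M →ₗ[ℂ] FreeH S M :=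
  (toSub S M).symm.toLinearMap.comp
    ((LinearMap.codRestrict (Subalgebra.toSubmodule (freeHSub S M))
      ((LinearMap.pi fun K : HModel S M => K.h.comp (LinearMap.proj K)).comp
        (freeHSub S M).val.toLinearMap) (by
          rintro ⟨_, t, rfl⟩
          exact ⟨.h t, rfl⟩)).comp (toSub S M).toLinearMap)

variable {S M}

/-- The map to a model. -/
def lift (K : HModel S M) : FreeH S M →ₐ[ℂ] K.R :=
  (Pi.evalAlgHom ℂ (fun K : HModel S M => K.R) K).comp
    ((freeHSub S M).val.comp (toSub S M).toAlgHom)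

@[simp] lemma lift_base (K : HModel S M) (s : S) : lift K (base S M s) = K.base s :=
  congrArg (fun x : freeHSub S M => x.1 K) ((toSub S M).apply_symm_apply _)

@[simp] lemma lift_sig (K : HModel S M) (m : M) : lift K (sig S M m) = K.sig m :=
  congrArg (fun x : freeHSub S M => x.1 K) ((toSub S M).apply_symm_apply _)

@[simp] lemma lift_h (K : HModel S M) (x : FreeH S M) : lift K (h S M x) = K.h (lift K x) :=
  congrArg (fun x : freeHSub S M => x.1 K) ((toSub S M).apply_symm_apply _)

lemma induction {P : FreeH S M → Prop} (base : ∀ s, P (base S M s)) (sig : ∀ m, P (sig S M m))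
    (h : ∀ x, P x → P (h S M x)) (add : ∀ x y, P x → P y → P (x + y))
    (mul : ∀ x y, P x → P y → P (x * y)) (x : FreeH S M) : P x := by
  have key : ∀ t : HTerm S M, P ((toSub S M).symm ⟨t.eval, t, rfl⟩) := by
    intro t
    induction t with
    | base s => exact base s
    | sig m => exact sig m
    | h t ih =>
      refine (congrArg P ?_).mp (h _ ih)
      refine congrArg (toSub S M).symm (Subtype.ext (funext fun K => ?_))
      exact congrArg (fun x : freeHSub S M => K.h (x.1 K)) ((toSub S M).apply_symm_apply _)
    | add t u h1 h2 =>
      refine (congrArg P ?_).mp (add _ _ h1 h2)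
      rw [← map_add]; rfl
    | mul t u h1 h2 =>
      refine (congrArg P ?_).mp (mul _ _ h1 h2)
      rw [← map_mul]; rfl
  obtain ⟨t, ht⟩ := ((toSub S M) x).2
  have h1 : (⟨t.eval, t, rfl⟩ : freeHSub S M) = toSub S M x := Subtype.ext ht
  have h2 := key t
  rwa [h1, AlgEquiv.symm_apply_apply] at h2

end FreeH
end FreeH

/-! ### Functorial cofibrant replacement -/

section CofRep
variable {S : Type} [Ring S] [Algebra ℂ S]

/-- The underlying algebra of the cofibrant replacement of `A`: free on a linear copy `σ(A)` of
`A` and a contracting homotopy `h`. -/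
abbrev CofAlg (A : DGAUnder S) : Type := FreeH S A.right.carrier

namespace CofAlg
variable (A : DGAUnder S)

/-- The contraction. -/
abbrev h : CofAlg A →ₗ[ℂ] CofAlg A := FreeH.h S A.right.carrier
/-- The linear section of the projection. -/
abbrev sig : A.right.carrier →ₗ[ℂ] CofAlg A := FreeH.sig S A.right.carrier
/-- The structure map. -/
abbrev base : S →ₐ[ℂ] CofAlg A := FreeH.base S A.right.carrier

/-- The projection to `A`: the identity on `σ(A)`, and zero on the image of `h`. -/
def proj : CofAlg A →ₐ[ℂ] A.right.carrier :=
  FreeH.lift { R := A.right.carrier, base := structMap A, sig := LinearMap.id, h := 0 }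

@[simp] lemma proj_base (s : S) : proj A (base A s) = structMap A s := FreeH.lift_base ..
@[simp] lemma proj_sig (a : A.right.carrier) : proj A (sig A a) = a := FreeH.lift_sig ..
@[simp] lemma proj_h (x : CofAlg A) : proj A (h A x) = 0 := FreeH.lift_h ..

/-- Homogeneous elements. -/
inductive Homog : ℕ → CofAlg A → Prop
  | base (s : S) : Homog 0 (base A s)
  | sig {n : ℕ} {a : A.right.carrier} (ha : a ∈ A.right.deg n) : Homog n (sig A a)
  | h {n : ℕ} {x : CofAlg A} (hx : Homog n x) : Homog (n + 1) (h A x)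
  | mul {m n : ℕ} {x y : CofAlg A} (hx : Homog m x) (hy : Homog n y) : Homog (m + n) (x * y)
  | add {n : ℕ} {x y : CofAlg A} (hx : Homog n x) (hy : Homog n y) : Homog n (x + y)
  | smul {n : ℕ} (c : ℂ) {x : CofAlg A} (hx : Homog n x) : Homog n (c • x)

/-- The degree-`n` part. -/
def deg (n : ℕ) : Submodule ℂ (CofAlg A) where
  carrier := {x | Homog A n x}
  add_mem' hx hy := .add hx hy
  zero_mem' := by
    have := Homog.sig (A := A) (zero_mem (A.right.deg n))
    rwa [map_zero] at this
  smul_mem' c _ hx := .smul c hx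

lemma one_mem_deg : (1 : CofAlg A) ∈ deg A 0 := by
  have := Homog.base (A := A) 1
  rwa [map_one] at this

instance : SetLike.GradedMonoid (deg A) where
  one_mem := one_mem_deg A
  mul_mem _ _ _ _ hx hy := .mul hx hy

/-- The homogeneous components of `σ(a)`. -/
def sigSum : A.right.carrier →ₗ[ℂ] ⨁ n, deg A n :=
  (DirectSum.lmap fun n => (sig A).restrict (p := A.right.deg n) (q := deg A n)
    fun _ ha => Homog.sig ha).comp (decomposeLinearEquiv A.right.deg).toLinearMap

lemma sigSum_of_mem {n : ℕ} {a : A.right.carrier} (ha : a ∈ A.right.deg n) :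
    sigSum A a = DirectSum.lof ℂ ℕ (fun n => deg A n) n ⟨sig A a, Homog.sig ha⟩ := by
  have : decomposeLinearEquiv A.right.deg a =
      DirectSum.lof ℂ ℕ (fun p => A.right.deg p) n ⟨a, ha⟩ := decompose_of_mem A.right.deg ha
  simp only [sigSum, LinearMap.comp_apply, LinearEquiv.coe_coe, this, DirectSum.lmap_lof]
  rfl

/-- The contraction on the external direct sum. -/
def hSum : (⨁ n, deg A n) →ₗ[ℂ] ⨁ n, deg A n :=
  DirectSum.toModule ℂ ℕ _ fun n => (DirectSum.lof ℂ ℕ (fun n => deg A n) (n + 1)).comp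
    ((h A).restrict (p := deg A n) (q := deg A (n + 1)) fun _ hx => Homog.h hx)

lemma hSum_lof {n : ℕ} {x : CofAlg A} (hx : x ∈ deg A n) :
    hSum A (DirectSum.lof ℂ ℕ (fun n => deg A n) n ⟨x, hx⟩) =
      DirectSum.lof ℂ ℕ (fun n => deg A n) (n + 1) ⟨h A x, Homog.h hx⟩ :=
  DirectSum.toModule_lof ..

/-- The decomposition into homogeneous components. -/
def decomp : CofAlg A →ₐ[ℂ] ⨁ n, deg A n :=
  FreeH.lift
    { R := ⨁ n, deg A n
      base := AlgHom.ofLinearMap ((DirectSum.lof ℂ ℕ (fun n => deg A n) 0).comp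
          ((base A).toLinearMap.codRestrict (deg A 0) fun s => Homog.base s))
        (congrArg (DirectSum.of (fun n => deg A n) 0) (Subtype.ext (map_one (base A))))
        (fun s t => by
          refine Eq.trans ?_ (DirectSum.of_mul_of (A := fun n => deg A n)
            (⟨base A s, Homog.base s⟩ : deg A 0) (⟨base A t, Homog.base t⟩ : deg A 0)).symm
          exact of_congr rfl _ _ (map_mul (base A) s t))
      sig := sigSum A
      h := hSum A }

lemma decomp_base (s : S) : decomp A (base A s) =
    DirectSum.of (fun n => deg A n) 0 ⟨base A s, Homog.base s⟩ := FreeH.lift_base ..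
lemma decomp_sig (a : A.right.carrier) : decomp A (sig A a) = sigSum A a := FreeH.lift_sig ..
lemma decomp_h (x : CofAlg A) : decomp A (h A x) = hSum A (decomp A x) := FreeH.lift_h ..

lemma coe_decomp (x : CofAlg A) : DirectSum.coeAlgHom (deg A) (decomp A x) = x := by
  induction x using FreeH.induction with
  | base s =>
    refine (congrArg _ (decomp_base A s)).trans ?_
    exact DirectSum.coeAlgHom_of (deg A) 0 _
  | sig a =>
    refine (congrArg _ (decomp_sig A a)).trans ?_
    refine DGAlg.linearMap_ext (f := (DirectSum.coeAlgHom (deg A)).toLinearMap.comp (sigSum A))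
      (g := sig A) (fun n a ha => ?_) a
    rw [LinearMap.comp_apply, sigSum_of_mem A ha]
    exact DirectSum.coeAlgHom_of (deg A) n _
  | h x ih =>
    refine (congrArg _ (decomp_h A x)).trans ?_
    have key : ∀ z, DirectSum.coeAlgHom (deg A) (hSum A z) =
        h A (DirectSum.coeAlgHom (deg A) z) := by
      intro z
      refine DirectSum.induction_on z (by rw [map_zero, map_zero, map_zero]) ?_ ?_
      · rintro n ⟨x, hx⟩
        refine (congrArg _ (hSum_lof A hx)).trans ?_
        refine (DirectSum.coeAlgHom_of (deg A) (n + 1) _).trans ?_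
        exact congrArg (h A) (DirectSum.coeAlgHom_of (deg A) n ⟨x, hx⟩).symm
      · intro x y hx hy
        rw [map_add, map_add, hx, hy, map_add, map_add]
    exact (key _).trans (congrArg (h A) ih)
  | add x y hx hy => rw [map_add, map_add, hx, hy]
  | mul x y hx hy => rw [map_mul, map_mul, hx, hy]

lemma decomp_of_mem {n : ℕ} {x : CofAlg A} (hx : x ∈ deg A n) :
    decomp A x = DirectSum.of (fun n => deg A n) n ⟨x, hx⟩ := by
  have hx' : Homog A n x := hx
  induction hx' with
  | base s => exact decomp_base A s
  | sig ha => exact (decomp_sig A _).trans (sigSum_of_mem A ha)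
  | h hx' ih => exact (decomp_h A _).trans ((congrArg (hSum A) (ih hx')).trans (hSum_lof A hx'))
  | mul hx' hy' h1 h2 =>
    rw [map_mul, h1 hx', h2 hy']
    exact DirectSum.of_mul_of (A := fun n => deg A n) _ _
  | add hx' hy' h1 h2 =>
    rw [map_add, h1 hx', h2 hy', ← map_add]
    rfl
  | smul c hx' h1 =>
    rw [map_smul, h1 hx', ← DirectSum.of_smul]
    rfl

instance : GradedAlgebra (deg A) :=
  GradedAlgebra.ofAlgHom _ (decomp A) (AlgHom.ext (coe_decomp A))
    (fun n x => decomp_of_mem A x.2)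

/-- The algebra map `x ↦ (± x, dx; 0, x)`, from which the differential is read off. -/
def triHom : CofAlg A →ₐ[ℂ] Matrix (Fin 2) (Fin 2) (CofAlg A) :=
  FreeH.lift
    { R := Matrix (Fin 2) (Fin 2) (CofAlg A)
      base := AlgHom.ofLinearMap
        { toFun := fun s => tri (base A s) 0 (base A s)
          map_add' := fun s t => by rw [map_add, tri_add, add_zero]
          map_smul' := fun c s => by rw [map_smul, RingHom.id_apply, tri_smul, smul_zero] }
        (by
          change tri (base A 1) 0 (base A 1) = 1
          rw [map_one, tri_one])
        (fun s t => by
          change tri (base A (s * t)) 0 (base A (s * t)) =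
            tri (base A s) 0 (base A s) * tri (base A t) 0 (base A t)
          rw [tri_mul, map_mul, mul_zero, zero_mul, add_zero])
      sig :=
        { toFun := fun a => tri (sig A (A.right.sign a)) (sig A (A.right.d a)) (sig A a)
          map_add' := fun a b => by simp only [map_add, tri_add]
          map_smul' := fun c a => by simp only [map_smul, tri_smul, RingHom.id_apply] }
      h :=
        { toFun := fun M => tri (-h A (M 0 0)) (M 1 1 - sig A (proj A (M 1 1)) - h A (M 0 1))
            (h A (M 1 1))
          map_add' := fun M N => by
            simp only [Matrix.add_apply, map_add, tri_add]
            congr 1 <;> abel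
          map_smul' := fun c M => by
            simp only [Matrix.smul_apply, map_smul, tri_smul, RingHom.id_apply, smul_neg,
              smul_sub] } }

lemma triHom_base (s : S) : triHom A (base A s) = tri (base A s) 0 (base A s) :=
  FreeH.lift_base ..
lemma triHom_sig (a : A.right.carrier) : triHom A (sig A a) =
    tri (sig A (A.right.sign a)) (sig A (A.right.d a)) (sig A a) := FreeH.lift_sig ..
lemma triHom_h (x : CofAlg A) : triHom A (h A x) = tri (-h A (triHom A x 0 0))
    (triHom A x 1 1 - sig A (proj A (triHom A x 1 1)) - h A (triHom A x 0 1))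
    (h A (triHom A x 1 1)) := FreeH.lift_h ..

lemma triHom_lower (x : CofAlg A) : triHom A x 1 0 = 0 ∧ triHom A x 1 1 = x := by
  induction x using FreeH.induction with
  | base s => rw [triHom_base]; exact ⟨rfl, rfl⟩
  | sig a => rw [triHom_sig]; exact ⟨rfl, rfl⟩
  | h x ih => rw [triHom_h, ih.2]; exact ⟨rfl, rfl⟩
  | add x y hx hy => simp [hx, hy]
  | mul x y hx hy => simp [Matrix.mul_apply, Fin.sum_univ_two, hx, hy]

/-- The differential of the cofibrant replacement: `d(hx) = x - σ(π(x)) - h(dx)`. -/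
def d : CofAlg A →ₗ[ℂ] CofAlg A :=
  (Matrix.entryLinearMap ℂ (CofAlg A) (0 : Fin 2) (1 : Fin 2)).comp (triHom A).toLinearMap

lemma d_apply (x : CofAlg A) : d A x = triHom A x 0 1 := rfl

lemma d_base (s : S) : d A (base A s) = 0 := by rw [d_apply, triHom_base]; rfl
lemma d_sig (a : A.right.carrier) : d A (sig A a) = sig A (A.right.d a) := by
  rw [d_apply, triHom_sig]; rfl
lemma d_h (x : CofAlg A) : d A (h A x) = x - sig A (proj A x) - h A (d A x) := by
  rw [d_apply, triHom_h, (triHom_lower A x).2]; rfl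

lemma triHom_sign {n : ℕ} {x : CofAlg A} (hx : x ∈ deg A n) :
    triHom A x 0 0 = (-1 : ℂ) ^ n • x := by
  replace hx : Homog A n x := hx
  induction hx with
  | base s => rw [triHom_base, pow_zero, one_smul]; rfl
  | sig ha => rw [triHom_sig, A.right.sign_of_mem ha, map_smul]; rfl
  | h hx ih =>
    rw [triHom_h, ih, map_smul, pow_succ, mul_neg_one, neg_smul]
    rfl
  | mul hx hy h1 h2 =>
    rw [map_mul, Matrix.mul_apply, Fin.sum_univ_two, h1, h2, (triHom_lower A _).1,
      mul_zero, add_zero, smul_mul_smul_comm, pow_add]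
  | add hx hy h1 h2 => rw [map_add, Matrix.add_apply, h1, h2, smul_add]
  | smul c hx h1 => rw [map_smul, Matrix.smul_apply, h1, smul_comm]

lemma leibniz {n : ℕ} {x : CofAlg A} (hx : x ∈ deg A n) (y : CofAlg A) :
    d A (x * y) = d A x * y + (-1 : ℂ) ^ n • (x * d A y) := by
  simp only [d_apply, map_mul, Matrix.mul_apply, Fin.sum_univ_two, triHom_sign A hx,
    (triHom_lower A y).2, smul_mul_assoc]
  exact add_comm _ _

lemma proj_mem {n : ℕ} {x : CofAlg A} (hx : x ∈ deg A n) : proj A x ∈ A.right.deg n := by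
  replace hx : Homog A n x := hx
  induction hx with
  | base s => rw [proj_base]; exact structMap_mem A s
  | sig ha => rwa [proj_sig]
  | h hx ih => rw [proj_h]; exact zero_mem _
  | mul hx hy h1 h2 => rw [map_mul]; exact SetLike.GradedMul.mul_mem h1 h2
  | add hx hy h1 h2 => rw [map_add]; exact add_mem h1 h2
  | smul c hx h1 => rw [map_smul]; exact Submodule.smul_mem _ c h1

lemma d_homog {n : ℕ} {x : CofAlg A} (hx : x ∈ deg A n) :
    (n = 0 → d A x = 0) ∧ ∀ k, n = k + 1 → d A x ∈ deg A k := by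
  replace hx : Homog A n x := hx
  induction hx with
  | base s => rw [d_base]; exact ⟨fun _ => rfl, fun _ _ => zero_mem _⟩
  | @sig n a ha =>
    rw [d_sig]
    refine ⟨?_, ?_⟩
    · rintro rfl
      rw [A.right.d_zero _ ha, map_zero]
    · rintro k rfl
      exact Homog.sig (A.right.d_mem k _ ha)
  | @h n x hx ih =>
    refine ⟨fun h => absurd h (by omega), ?_⟩
    rintro k hk
    obtain rfl : n = k := by omega
    rw [d_h]
    refine sub_mem (sub_mem hx (Homog.sig (proj_mem A hx))) ?_
    rcases n with _ | n
    · rw [ih.1 rfl, map_zero]; exact zero_mem _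
    · exact Homog.h (ih.2 n rfl)
  | @mul m n x y hx hy h1 h2 =>
    rw [leibniz A hx]
    refine ⟨fun h => ?_, fun k hk => ?_⟩
    · rw [h1.1 (by omega), h2.1 (by omega), zero_mul, mul_zero, smul_zero, add_zero]
    · refine add_mem ?_ (Submodule.smul_mem _ _ ?_)
      · rcases m with _ | m
        · rw [h1.1 rfl, zero_mul]; exact zero_mem _
        · obtain rfl : k = m + n := by omega
          exact Homog.mul (h1.2 m rfl) hy
      · rcases n with _ | n
        · rw [h2.1 rfl, mul_zero]; exact zero_mem _
        · obtain rfl : k = m + n := by omega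
          exact Homog.mul hx (h2.2 n rfl)
  | add hx hy h1 h2 =>
    rw [map_add]
    exact ⟨fun h => by rw [h1.1 h, h2.1 h, add_zero],
      fun k hk => add_mem (h1.2 k hk) (h2.2 k hk)⟩
  | smul c hx h1 =>
    rw [map_smul]
    exact ⟨fun h => by rw [h1.1 h, smul_zero],
      fun k hk => Submodule.smul_mem _ _ (h1.2 k hk)⟩

lemma homog_induction {P : CofAlg A → Prop} (hom : ∀ n, ∀ x ∈ deg A n, P x)
    (add : ∀ x y, P x → P y → P (x + y)) (x : CofAlg A) : P x :=
  Decomposition.inductionOn (deg A) (hom 0 0 (zero_mem _)) (fun a => hom _ a.1 a.2)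
    (fun a b => add a b) x

lemma proj_d (x : CofAlg A) : proj A (d A x) = A.right.d (proj A x) := by
  refine homog_induction A (P := fun x => proj A (d A x) = A.right.d (proj A x)) ?_ ?_ x
  · intro n x hx
    replace hx : Homog A n x := hx
    induction hx with
    | base s => rw [d_base, map_zero, proj_base, A.right.d_zero _ (structMap_mem A s)]
    | sig ha => rw [d_sig, proj_sig, proj_sig]
    | h hx ih => rw [d_h, proj_h, map_zero, map_sub, map_sub, proj_sig, proj_h]; abel
    | mul hx hy h1 h2 =>
      rw [leibniz A hx, map_add, map_smul, map_mul, map_mul, map_mul, h1, h2,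
        A.right.leibniz _ _ (proj_mem A hx)]
    | add hx hy h1 h2 => simp only [map_add, h1, h2]
    | smul c hx h1 => simp only [map_smul, h1]
  · intro x y hx hy
    simp only [map_add, hx, hy]

lemma d_d (x : CofAlg A) : d A (d A x) = 0 := by
  refine homog_induction A (P := fun x => d A (d A x) = 0) ?_ ?_ x
  · intro n x hx
    replace hx : Homog A n x := hx
    induction hx with
    | base s => rw [d_base, map_zero]
    | sig ha => rw [d_sig, d_sig, A.right.d_d, map_zero]
    | h hx ih =>
      rw [d_h, map_sub, map_sub, d_sig, d_h, ih, proj_d, map_zero, sub_zero, sub_self]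
    | @mul m n x y hx hy h1 h2 =>
      rw [leibniz A hx, map_add, map_smul, leibniz A hx, h2, mul_zero, smul_zero, add_zero]
      rcases m with _ | m
      · rw [(d_homog A hx).1 rfl]; simp
      · rw [leibniz A ((d_homog A hx).2 m rfl), h1, zero_mul, zero_add, pow_succ]
        simp
    | add hx hy h1 h2 => simp only [map_add, h1, h2, add_zero]
    | smul c hx h1 => simp only [map_smul, h1, smul_zero]
  · intro x y hx hy
    rw [map_add, map_add, hx, hy, add_zero]

end CofAlg

/-- The cofibrant replacement, as a dg-algebra. -/
def cofRepDG (A : DGAUnder S) : DGAlg where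
  carrier := CofAlg A
  deg := CofAlg.deg A
  d := CofAlg.d A
  d_zero x hx := (CofAlg.d_homog A hx).1 rfl
  d_mem n x hx := (CofAlg.d_homog A hx).2 n rfl
  d_d := CofAlg.d_d A
  leibniz n x hx y := CofAlg.leibniz A hx y

/-- The cofibrant replacement of `A` in `DGA_S^+`. -/
def cofRepUnder (A : DGAUnder S) : DGAUnder S :=
  Under.mk (Y := cofRepDG A) (X := DGAlg.ofAlg S)
    ((cofRepDG A).homOfAlg (CofAlg.base A) fun s => CofAlg.Homog.base s)

/-- The projection of the cofibrant replacement of `A` to `A`. -/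
def cofRepProj (A : DGAUnder S) : cofRepUnder A ⟶ A :=
  Under.homMk (U := cofRepUnder A)
    { alg := CofAlg.proj A
      map_deg := fun _ _ hx => CofAlg.proj_mem A hx
      map_d := CofAlg.proj_d A }
    (DGAlg.hom_ext (CofAlg.proj_base A))

lemma cofRepProj_quasiIso (A : DGAUnder S) : quasiIso (cofRepProj A).right := by
  rw [quasiIso_iff]
  refine ⟨fun n z hz hdz b hb hbz => ?_, fun n y hy hdy => ?_⟩
  · refine ⟨CofAlg.h A z + CofAlg.sig A b, CofAlg.Homog.add (.h hz) (.sig hb), ?_⟩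
    change CofAlg A at z
    change CofAlg.d A (CofAlg.h A z + CofAlg.sig A b) = z
    replace hdz : CofAlg.d A z = 0 := hdz
    replace hbz : A.right.d b = CofAlg.proj A z := hbz
    rw [map_add, CofAlg.d_h, CofAlg.d_sig, hdz, hbz, map_zero]
    abel
  · refine ⟨CofAlg.sig A y, CofAlg.Homog.sig hy, ?_, 0, zero_mem _, ?_⟩
    · exact (CofAlg.d_sig A y).trans ((congrArg (CofAlg.sig A) hdy).trans (map_zero (CofAlg.sig A)))
    · rw [map_zero]
      exact (sub_eq_zero.2 (CofAlg.proj_sig A y)).symm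

/-- A map `φ` to the base of an acyclic fibration is lifted on `h(x)` by means of a section and
a contracting homotopy of the fibration. -/
lemma cofRepUnder_cofibrant (A : DGAUnder S) : Cofibrant (cofRepUnder A) := by
  intro E B p hp
  obtain ⟨s, k, hs, hk, hps, hpk, hds, hdk⟩ := exists_deformationRetract hp.1 hp.2
  refine ⟨fun {top} {φ} sq => ?_⟩
  have hcomm : ∀ c : S, DGAlg.Hom.alg p (DGAlg.Hom.alg top c) =
      DGAlg.Hom.alg φ (CofAlg.base A c) := fun c => congrArg (fun g => DGAlg.Hom.alg g c) sq.w
  have hφd : ∀ x : CofAlg A, DGAlg.Hom.alg φ (CofAlg.d A x) = B.d (DGAlg.Hom.alg φ x) :=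
    DGAlg.Hom.map_d φ
  have hφdeg : ∀ n, ∀ x ∈ CofAlg.deg A n, DGAlg.Hom.alg φ x ∈ B.deg n := DGAlg.Hom.map_deg φ
  let φ' : CofAlg A →ₐ[ℂ] B.carrier := DGAlg.Hom.alg φ
  -- the graph of the lift is constructed inside the product of the two algebras
  let K : HModel S A.right.carrier :=
    { R := CofAlg A × E.carrier
      base := (CofAlg.base A).prod (DGAlg.Hom.alg top)
      sig := (CofAlg.sig A).prod (s.comp (φ'.toLinearMap.comp (CofAlg.sig A)))
      h := ((CofAlg.h A).comp (LinearMap.fst ℂ _ _)).prod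
        (s.comp (φ'.toLinearMap.comp ((CofAlg.h A).comp (LinearMap.fst ℂ _ _))) +
          k.comp (LinearMap.snd ℂ _ _)) }
  have hK1 : ∀ x, (FreeH.lift K x).1 = x := by
    intro x
    induction x using FreeH.induction with
    | base c => exact congrArg Prod.fst (FreeH.lift_base K c)
    | sig a => exact congrArg Prod.fst (FreeH.lift_sig K a)
    | h x ih =>
      exact (congrArg Prod.fst (FreeH.lift_h K x)).trans (congrArg (CofAlg.h A) ih)
    | add x y hx hy => rw [map_add, Prod.fst_add, hx, hy]
    | mul x y hx hy => rw [map_mul, Prod.fst_mul, hx, hy]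
  let u : CofAlg A →ₐ[ℂ] E.carrier := (AlgHom.snd ℂ (CofAlg A) E.carrier).comp (FreeH.lift K)
  have hub : ∀ c, u (CofAlg.base A c) = DGAlg.Hom.alg top c :=
    fun c => congrArg Prod.snd (FreeH.lift_base K c)
  have hus : ∀ a, u (CofAlg.sig A a) = s (φ' (CofAlg.sig A a)) :=
    fun a => congrArg Prod.snd (FreeH.lift_sig K a)
  have huh : ∀ x, u (CofAlg.h A x) = s (φ' (CofAlg.h A x)) + k (u x) := fun x =>
    (congrArg Prod.snd (FreeH.lift_h K x)).trans
      (congrArg (fun y => s (φ' (CofAlg.h A y)) + k (u x)) (hK1 x))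
  have hpu : ∀ x, DGAlg.Hom.alg p (u x) = φ' x := by
    intro x
    induction x using FreeH.induction with
    | base c => rw [hub]; exact hcomm c
    | sig a => rw [hus, hps]
    | h x ih => rw [huh, map_add, hps, hpk, add_zero]
    | add x y hx hy => rw [map_add, map_add, map_add, hx, hy]
    | mul x y hx hy => rw [map_mul, map_mul, map_mul, hx, hy]
  have hudeg : ∀ n, ∀ x ∈ CofAlg.deg A n, u x ∈ E.deg n := by
    intro n x hx
    replace hx : CofAlg.Homog A n x := hx
    induction hx with
    | base c =>
      rw [hub]
      refine DGAlg.Hom.map_deg top 0 c ?_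
      change c ∈ trivialDeg S 0
      rw [trivialDeg, if_pos rfl]
      trivial
    | sig ha => rw [hus]; exact hs _ _ (hφdeg _ _ (.sig ha))
    | h hx ih => rw [huh]; exact add_mem (hs _ _ (hφdeg _ _ (.h hx))) (hk _ _ ih)
    | mul hx hy h1 h2 => rw [map_mul]; exact SetLike.GradedMul.mul_mem h1 h2
    | add hx hy h1 h2 => rw [map_add]; exact add_mem h1 h2
    | smul c hx h1 => rw [map_smul]; exact Submodule.smul_mem _ c h1
  have hud : ∀ x, u (CofAlg.d A x) = E.d (u x) := by
    refine CofAlg.homog_induction A ?_ ?_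
    · intro n x hx
      replace hx : CofAlg.Homog A n x := hx
      induction hx with
      | base c =>
        have h0 := hudeg 0 _ (CofAlg.Homog.base c)
        rw [CofAlg.d_base, map_zero, E.d_zero _ h0]
      | sig ha =>
        rw [CofAlg.d_sig, hus, hus, hds, ← CofAlg.d_sig]
        exact congrArg s (hφd _)
      | @h n x hx ih =>
        rw [CofAlg.d_h, map_sub, map_sub, hus, huh, huh, map_add, hds, ih,
          eq_sub_of_add_eq (hdk (u x)), hpu]
        have h1 : B.d (φ' (CofAlg.h A x)) = φ' x - φ' (CofAlg.sig A (CofAlg.proj A x)) -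
            φ' (CofAlg.h A (CofAlg.d A x)) := by
          rw [← map_sub, ← map_sub, ← CofAlg.d_h]
          exact (hφd _).symm
        rw [h1, map_sub, map_sub]
        abel
      | mul hx hy h1 h2 =>
        rw [CofAlg.leibniz A hx, map_add, map_smul, map_mul, map_mul, map_mul, h1, h2,
          E.leibniz _ _ (hudeg _ _ hx)]
      | add hx hy h1 h2 => simp only [map_add, h1, h2]
      | smul c hx h1 => simp only [map_smul, h1]
    · intro x y hx hy
      simp only [map_add, hx, hy]
  exact ⟨⟨{ l := { alg := u, map_deg := hudeg, map_d := hud }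
            fac_left := DGAlg.hom_ext hub
            fac_right := DGAlg.hom_ext hpu }⟩⟩

section Functor
variable {A B C : DGAUnder S}

/-- Functoriality of the underlying algebra. -/
def CofAlg.map (f : A ⟶ B) : CofAlg A →ₐ[ℂ] CofAlg B :=
  FreeH.lift
    { R := CofAlg B
      base := CofAlg.base B
      sig := (CofAlg.sig B).comp (DGAlg.Hom.alg f.right).toLinearMap
      h := CofAlg.h B }

lemma CofAlg.map_base (f : A ⟶ B) (s : S) : map f (base A s) = base B s := FreeH.lift_base ..
lemma CofAlg.map_sig (f : A ⟶ B) (a : A.right.carrier) :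
    map f (sig A a) = sig B (DGAlg.Hom.alg f.right a) := FreeH.lift_sig ..
lemma CofAlg.map_h (f : A ⟶ B) (x : CofAlg A) : map f (h A x) = h B (map f x) :=
  FreeH.lift_h ..

lemma CofAlg.proj_map (f : A ⟶ B) (x : CofAlg A) :
    proj B (map f x) = DGAlg.Hom.alg f.right (proj A x) := by
  induction x using FreeH.induction with
  | base s =>
    rw [map_base, proj_base, proj_base]
    exact (congrArg (fun g => DGAlg.Hom.alg g s) (Under.w f)).symm
  | sig a => rw [map_sig, proj_sig, proj_sig]
  | h x ih => rw [map_h, proj_h, proj_h, map_zero]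
  | add x y hx hy => simp only [map_add, hx, hy]
  | mul x y hx hy => simp only [map_mul, hx, hy]

lemma CofAlg.map_mem (f : A ⟶ B) {n : ℕ} {x : CofAlg A} (hx : x ∈ deg A n) :
    map f x ∈ deg B n := by
  replace hx : Homog A n x := hx
  induction hx with
  | base s => rw [map_base]; exact .base s
  | sig ha => rw [map_sig]; exact .sig (DGAlg.Hom.map_deg f.right _ _ ha)
  | h hx ih => rw [map_h]; exact .h ih
  | mul hx hy h1 h2 => rw [map_mul]; exact .mul h1 h2
  | add hx hy h1 h2 => rw [map_add]; exact .add h1 h2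
  | smul c hx h1 => rw [map_smul]; exact .smul c h1

lemma CofAlg.map_d (f : A ⟶ B) (x : CofAlg A) : map f (d A x) = d B (map f x) := by
  refine homog_induction A (P := fun x => map f (d A x) = d B (map f x)) ?_ ?_ x
  · intro n x hx
    replace hx : Homog A n x := hx
    induction hx with
    | base s => rw [d_base, map_zero, map_base, d_base]
    | sig ha => rw [d_sig, map_sig, map_sig, d_sig, DGAlg.Hom.map_d]
    | h hx ih => rw [d_h, map_sub, map_sub, map_sig, map_h, map_h, d_h, ih, proj_map]
    | mul hx hy h1 h2 =>
      rw [leibniz A hx, map_add, map_smul, map_mul, map_mul, map_mul, h1, h2,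
        leibniz B (map_mem f hx)]
    | add hx hy h1 h2 => simp only [map_add, h1, h2]
    | smul c hx h1 => simp only [map_smul, h1]
  · intro x y hx hy
    simp only [map_add, hx, hy]

variable (S) in
/-- Cofibrant replacement, as a functor. -/
def cofRep : DGAUnder S ⥤ DGAUnder S where
  obj := cofRepUnder
  map {A B} f := Under.homMk (U := cofRepUnder A) (V := cofRepUnder B)
    { alg := CofAlg.map f
      map_deg := fun _ _ hx => CofAlg.map_mem f hx
      map_d := CofAlg.map_d f }
    (DGAlg.hom_ext (CofAlg.map_base f))
  map_id A := by
    refine Under.UnderMorphism.ext (DGAlg.hom_ext fun x => ?_)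
    change CofAlg.map (𝟙 A) x = x
    change CofAlg A at x
    induction x using FreeH.induction with
    | base s => exact CofAlg.map_base _ s
    | sig a => exact CofAlg.map_sig _ a
    | h x ih => rw [CofAlg.map_h, ih]
    | add x y hx hy => rw [map_add, hx, hy]
    | mul x y hx hy => rw [map_mul, hx, hy]
  map_comp {A B C} f g := by
    refine Under.UnderMorphism.ext (DGAlg.hom_ext fun x => ?_)
    change CofAlg.map (f ≫ g) x = CofAlg.map g (CofAlg.map f x)
    change CofAlg A at x
    induction x using FreeH.induction with
    | base s => rw [CofAlg.map_base, CofAlg.map_base, CofAlg.map_base]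
    | sig a => rw [CofAlg.map_sig, CofAlg.map_sig, CofAlg.map_sig]; rfl
    | h x ih => rw [CofAlg.map_h, CofAlg.map_h, CofAlg.map_h, ih]
    | add x y hx hy => rw [map_add, map_add, map_add, hx, hy]
    | mul x y hx hy => rw [map_mul, map_mul, map_mul, hx, hy]

variable (S) in
/-- The natural projection from the cofibrant replacement. -/
def cofRepNat : cofRep S ⟶ 𝟭 (DGAUnder S) where
  app := cofRepProj
  naturality A B f := Under.UnderMorphism.ext (DGAlg.hom_ext (CofAlg.proj_map f))

end Functor
end CofRep

/-! ### Derived functors from functorial replacements -/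

section LeftDerived
variable {C D H : Type*} [Category* C] [Category* D] [Category* H] (L : C ⥤ D)
  (W : MorphismProperty C) [L.IsLocalization W] {R : C ⥤ C} {F : C ⥤ H} {G : D ⥤ H}

variable {L} in
/-- The comparison with `F` of a functor on the localization induced by `R ⋙ F`. -/
def replacementCounit (q : ∀ X, R.obj X ⟶ X)
    (hnat : ∀ {X Y : C} (f : X ⟶ Y), R.map f ≫ q Y = q X ≫ f) (e : L ⋙ G ≅ R ⋙ F) :
    L ⋙ G ⟶ F where
  app X := e.hom.app X ≫ F.map (q X)
  naturality X Y f := by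
    have h1 := e.hom.naturality f
    simp only [Functor.comp_map] at h1 ⊢
    rw [reassoc_of% h1, ← Functor.map_comp, hnat, Functor.map_comp, Category.assoc]

/-- Let `q : R X → X` be a natural replacement by objects between which `F` inverts weak
equivalences. If `G` is the functor on the localization induced by `R ⋙ F`, then it is the left
derived functor of `F`. -/
lemma isLeftDerivedFunctor_of_replacement (q : ∀ X, R.obj X ⟶ X)
    (hnat : ∀ {X Y : C} (f : X ⟶ Y), R.map f ≫ q Y = q X ≫ f) (hq : ∀ X, W (q X))
    (hR : ∀ X, IsIso (F.map (q (R.obj X)))) (e : L ⋙ G ≅ R ⋙ F) :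
    G.IsLeftDerivedFunctor (replacementCounit q hnat e) W := by
  obtain ⟨α, hα'⟩ : ∃ α, replacementCounit q hnat e = α := ⟨_, rfl⟩
  have hα : ∀ X, α.app X = e.hom.app X ≫ F.map (q X) := fun X => by rw [← hα']; rfl
  rw [hα']
  have hLq : ∀ (E : D ⥤ H) (X : C), IsIso (E.map (L.map (q X))) := fun E X => by
    have := Localization.inverts L W (q X) (hq X)
    infer_instance
  have hex : ∀ (E : D ⥤ H) (β : L ⋙ E ⟶ F), ∃ γ : E ⟶ G,
      Functor.whiskerLeft L γ ≫ α = β := by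
    intro E β
    let η : L ⋙ E ⟶ L ⋙ G :=
      { app := fun X => inv (E.map (L.map (q X))) ≫ β.app (R.obj X) ≫ e.inv.app X
        naturality := fun X Y f => by
          have h1 := β.naturality (R.map f)
          have h2 := e.inv.naturality f
          have h3 : E.map (L.map (R.map f)) ≫ E.map (L.map (q Y)) =
              E.map (L.map (q X)) ≫ E.map (L.map f) := by
            rw [← E.map_comp, ← E.map_comp, ← L.map_comp, ← L.map_comp, hnat]
          simp only [Functor.comp_map] at h1 h2
          simp only [Functor.comp_map]
          rw [Category.assoc, Category.assoc, ← h2, ← reassoc_of% h1, IsIso.eq_inv_comp]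
          rw [← reassoc_of% h3, IsIso.hom_inv_id_assoc] }
    obtain ⟨γ, hγ⟩ : ∃ γ : E ⟶ G, Functor.whiskerLeft L γ = η :=
      ⟨_, (Localization.fullyFaithfulWhiskeringLeft L W H).map_preimage η⟩
    refine ⟨γ, ?_⟩
    rw [hγ]
    ext X
    have h3 := β.naturality (q X)
    simp only [Functor.comp_map] at h3
    simp only [NatTrans.comp_app, hα, η, Category.assoc, Iso.inv_hom_id_app_assoc]
    rw [IsIso.inv_comp_eq, h3]
  have huniq : ∀ (E : D ⥤ H) (γ γ' : E ⟶ G),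
      Functor.whiskerLeft L γ ≫ α = Functor.whiskerLeft L γ' ≫ α → γ = γ' := by
    intro E γ γ' h
    refine Localization.natTrans_ext L W fun X => ?_
    have h1 := NatTrans.congr_app h (R.obj X)
    have hi : IsIso (α.app (R.obj X)) := by
      rw [hα]
      infer_instance
    rw [NatTrans.comp_app, NatTrans.comp_app, cancel_mono] at h1
    have h2 : γ.app (L.obj (R.obj X)) = γ'.app (L.obj (R.obj X)) := h1
    have h3 := γ.naturality (L.map (q X))
    have h4 := γ'.naturality (L.map (q X))
    rw [h2, ← h4] at h3
    exact (cancel_epi _).1 h3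
  refine ⟨⟨⟨Limits.IsTerminal.ofUniqueHom
    (fun X => CostructuredArrow.homMk (hex X.left X.hom).choose (hex X.left X.hom).choose_spec)
    (fun X m => ?_)⟩⟩⟩
  refine CostructuredArrow.hom_ext _ _ (huniq _ _ _ ?_)
  exact (CostructuredArrow.w m).trans (hex X.left X.hom).choose_spec.symm

end LeftDerived

section
variable {S : Type} [Ring S] [Algebra ℂ S] {n : Type} [Fintype n] [DecidableEq n]
  (ρ : S →ₐ[ℂ] Matrix n n ℂ)

lemma cofRep_invertedBy : (quasiIsoUnder S).IsInvertedBy (cofRep S ⋙ repToHo ρ) := by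
  intro A B f hf
  refine repToHo_isIso ρ ((cofRep S).map f) ?_ (cofRepUnder_cofibrant A) (cofRepUnder_cofibrant B)
  refine quasiIso.of_postcomp _ (cofRepProj B).right (cofRepProj_quasiIso B) ?_
  have h : ((cofRep S).map f).right ≫ (cofRepProj B).right = (cofRepProj A).right ≫ f.right :=
    congrArg CommaMorphism.right ((cofRepNat S).naturality f)
  rw [h]
  exact quasiIso.comp_mem _ _ (cofRepProj_quasiIso A) hf

/-- The functor on the homotopy category induced by the representation functor on cofibrant
replacements. -/
def cofRepDerived : HoDGAUnder S ⥤ HoCDGAlg :=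
  Localization.lift (cofRep S ⋙ repToHo ρ) (cofRep_invertedBy ρ) (toHoDGAUnder S)

/-- The defining isomorphism. -/
def cofRepDerivedIso : toHoDGAUnder S ⋙ cofRepDerived ρ ≅ cofRep S ⋙ repToHo ρ :=
  Localization.fac (cofRep S ⋙ repToHo ρ) (cofRep_invertedBy ρ) (toHoDGAUnder S)

/-- The comparison with the representation functor. -/
def cofRepDerivedCounit : toHoDGAUnder S ⋙ cofRepDerived ρ ⟶ repToHo ρ :=
  replacementCounit (R := cofRep S) cofRepProj (fun f => (cofRepNat S).naturality f)
    (cofRepDerivedIso ρ)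

instance : (cofRepDerived ρ).IsLeftDerivedFunctor (cofRepDerivedCounit ρ) (quasiIsoUnder S) :=
  isLeftDerivedFunctor_of_replacement (toHoDGAUnder S) (quasiIsoUnder S) (R := cofRep S)
    cofRepProj (fun f => (cofRepNat S).naturality f) cofRepProj_quasiIso
    (fun A => repToHo_isIso ρ _ (cofRepProj_quasiIso _) (cofRepUnder_cofibrant _)
      (cofRepUnder_cofibrant A))
    (cofRepDerivedIso ρ)

/-- The representation functor has a total left derived functor. -/
instance repToHo_hasLeftDerivedFunctor :
    (repToHo ρ).HasLeftDerivedFunctor (quasiIsoUnder S) :=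
  Functor.HasLeftDerivedFunctor.mk' (cofRepDerived ρ) (cofRepDerivedCounit ρ)

/-- The derived representation functor is computed by the representation functor on cofibrant
objects. -/
lemma derivedRepCounit_isIso {A : DGAUnder S} (hA : Cofibrant A) :
    IsIso ((derivedRepCounit ρ).app A) := by
  let e := Functor.leftDerivedUnique (cofRepDerived ρ) (derivedRep ρ) (derivedRepCounit ρ)
    (cofRepDerivedCounit ρ) (quasiIsoUnder S)
  have he : e.hom.app ((toHoDGAUnder S).obj A) ≫ (cofRepDerivedCounit ρ).app A =
      (derivedRepCounit ρ).app A :=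
    Functor.leftDerived_fac_app (cofRepDerived ρ) (cofRepDerivedCounit ρ) (quasiIsoUnder S)
      (derivedRep ρ) (derivedRepCounit ρ ≫ 𝟙 _) A |>.trans (by simp)
  have hi : IsIso ((repToHo ρ).map (cofRepProj A)) :=
    repToHo_isIso ρ _ (cofRepProj_quasiIso A) (cofRepUnder_cofibrant A) hA
  have hc : IsIso ((cofRepDerivedCounit ρ).app A) := by
    have hj : IsIso ((cofRepDerivedIso ρ).hom.app A) := inferInstance
    exact @IsIso.comp_isIso _ _ _ _ _ _ _ hj hi
  rw [← he]
  infer_instance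

/-- A cofibrant replacement computes the derived representation functor. -/
lemma exists_derivedRep_iso {X A : DGAUnder S} (π : X ⟶ A) (hπ : quasiIso π.right)
    (hX : Cofibrant X) :
    ∃ Φ : DRepScheme ρ A ≅ toHoDGAff.obj (RepScheme ρ X),
      (derivedRepCounit ρ).app X ≫ Φ.hom.unop =
        (derivedRep ρ).map ((toHoDGAUnder S).map π) := by
  have h1 := derivedRepCounit_isIso ρ hX
  have h2 : IsIso ((toHoDGAUnder S).map π) :=
    Localization.inverts (toHoDGAUnder S) (quasiIsoUnder S) π hπ
  let φ : (repToHo ρ).obj X ≅ (derivedRep ρ).obj ((toHoDGAUnder S).obj A) :=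
    (asIso ((derivedRepCounit ρ).app X)).symm ≪≫
      asIso ((derivedRep ρ).map ((toHoDGAUnder S).map π))
  refine ⟨φ.op, ?_⟩
  change (derivedRepCounit ρ).app X ≫ inv ((derivedRepCounit ρ).app X) ≫
    (derivedRep ρ).map ((toHoDGAUnder S).map π) = _
  rw [IsIso.hom_inv_id_assoc]

end

/-! ### The path algebra `A_cof` is acyclic in positive degrees -/

section Acyclic
variable {V : Type} [Fintype V] [DecidableEq V] [Quiver.{0} V] [∀ a b : V, Fintype (a ⟶ b)]

/-- An arrow of the framed doubled quiver, as an element of the path algebra of `Q^ϑ`. -/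
def oldArrow {p q : V ⊕ V} (e : DFrHom (V := V) p q) : PathAlg (Theta V) :=
  PathAlg.arrow (W := Theta V) (a := p) (b := q) (ThetaHom.old e)

/-- The loop `ϑ_a`, as an element of the path algebra of `Q^ϑ`. -/
def thetaArrow (a : V) : PathAlg (Theta V) :=
  PathAlg.arrow (W := Theta V) (a := (Sum.inl a : V ⊕ V)) (b := (Sum.inl a : V ⊕ V))
    (ThetaHom.loop a)

/-- The idempotent of an original vertex in the path algebra of `Q^ϑ`. -/
def vertexIdem (a : V) : PathAlg (Theta V) := PathAlg.e (W := Theta V) (Sum.inl a : V ⊕ V)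

/-- The part `∑ x_γ y_γ - ∑ y_γ x_γ` of `μ_a`, without the framing term `i_a j_a`. -/
def nuTheta (a : V) : PathAlg (Theta V) :=
  (∑ b : V, ∑ γ : b ⟶ a, oldArrow (.x γ) * oldArrow (.y γ)) -
    ∑ b : V, ∑ γ : a ⟶ b, oldArrow (.y γ) * oldArrow (.x γ)

lemma muTheta_eq (a : V) : muTheta a = nuTheta a + oldArrow (.i a) * oldArrow (.j a) := rfl

/-- Case distinction over the five types of arrows of `Q^ϑ`. -/
lemma theta_arrow_cases {P : ∀ {p q : Theta V}, (p ⟶ q) → Prop}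
    (x : ∀ {a b : V} (γ : a ⟶ b),
      P (p := (Sum.inl a : V ⊕ V)) (q := (Sum.inl b : V ⊕ V)) (ThetaHom.old (.x γ)))
    (y : ∀ {a b : V} (γ : a ⟶ b),
      P (p := (Sum.inl b : V ⊕ V)) (q := (Sum.inl a : V ⊕ V)) (ThetaHom.old (.y γ)))
    (i : ∀ a : V, P (p := (Sum.inr a : V ⊕ V)) (q := (Sum.inl a : V ⊕ V)) (ThetaHom.old (.i a)))
    (j : ∀ a : V, P (p := (Sum.inl a : V ⊕ V)) (q := (Sum.inr a : V ⊕ V)) (ThetaHom.old (.j a)))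
    (loop : ∀ a : V, P (p := (Sum.inl a : V ⊕ V)) (q := (Sum.inl a : V ⊕ V)) (ThetaHom.loop a))
    {p q : Theta V} (f : p ⟶ q) : P f :=
  match p, q, f with
  | _, _, .old (.x γ) => x γ
  | _, _, .old (.y γ) => y γ
  | _, _, .old (.i a) => i a
  | _, _, .old (.j a) => j a
  | _, _, .loop a => loop a

/-- The factor by which the contracting homotopy passes an arrow. -/
def passArrow : ∀ {p q : Theta V}, (p ⟶ q) → PathAlg (Theta V)
  | _, _, .old (.x γ) => oldArrow (.x γ)
  | _, _, .old (.y γ) => oldArrow (.y γ)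
  | _, _, .old (.i _) => 0
  | _, _, .old (.j a) => oldArrow (.j a)
  | _, _, .loop _ => 0

/-- The loop `ϑ_a` for the arrow `i_a`, and `0` for all other arrows. -/
def iToTheta : ∀ {p q : Theta V}, (p ⟶ q) → PathAlg (Theta V)
  | _, _, .old (.i a) => thetaArrow a
  | _, _, .old (.x _) => 0
  | _, _, .old (.y _) => 0
  | _, _, .old (.j _) => 0
  | _, _, .loop _ => 0

/-- The idempotent `e_a` for the arrow `j_a`, and `0` for all other arrows. -/
def jToIdem : ∀ {p q : Theta V}, (p ⟶ q) → PathAlg (Theta V)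
  | _, _, .old (.j a) => vertexIdem a
  | _, _, .old (.x _) => 0
  | _, _, .old (.y _) => 0
  | _, _, .old (.i _) => 0
  | _, _, .loop _ => 0

/-- Removal of the last arrow of a path if it is `j_a`; other paths map to `0`. -/
def removeJ {p : Theta V} : ∀ {q : Theta V}, Quiver.Path p q → PathAlg (Theta V)
  | _, .nil => 0
  | _, .cons s f => jToIdem f * .of s

/-- The homotopy on paths. It reads a path from its last arrow on, passes the arrows `x`, `y`, `j`,
and replaces the first piece `i_a j_a` that it meets by `ϑ_a`; if it meets a loop before, or no such
piece at all, its value is `0`. -/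
def contractPath {p : Theta V} : ∀ {q : Theta V}, Quiver.Path p q → PathAlg (Theta V)
  | _, .nil => 0
  | _, .cons s f => passArrow f * contractPath s + iToTheta f * removeJ s

variable (V) in
/-- The linear extension of `removeJ`. -/
def removeJLin : PathAlg (Theta V) →ₗ[ℂ] PathAlg (Theta V) := PathAlg.extend removeJ

variable (V) in
/-- The linear extension of `contractPath`. -/
def contractLin : PathAlg (Theta V) →ₗ[ℂ] PathAlg (Theta V) := PathAlg.extend contractPath

variable (V) in
/-- The differential of `A_cof`, as a linear endomorphism of the path algebra. -/
def dTheta : PathAlg (Theta V) →ₗ[ℂ] PathAlg (Theta V) := (cofDG V).d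

lemma e_mul_passArrow {p q : Theta V} (f : p ⟶ q) : PathAlg.e q * passArrow f = passArrow f :=
  theta_arrow_cases (P := fun {p q} f => PathAlg.e q * passArrow f = passArrow f)
    (fun _ => PathAlg.e_mul_of (W := Theta V) _) (fun _ => PathAlg.e_mul_of (W := Theta V) _)
    (fun _ => mul_zero _) (fun _ => PathAlg.e_mul_of (W := Theta V) _) (fun _ => mul_zero _) f

lemma passArrow_mul_e {p q : Theta V} (f : p ⟶ q) : passArrow f * PathAlg.e p = passArrow f :=
  theta_arrow_cases (P := fun {p q} f => passArrow f * PathAlg.e p = passArrow f)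
    (fun _ => PathAlg.of_mul_e (W := Theta V) _) (fun _ => PathAlg.of_mul_e (W := Theta V) _)
    (fun _ => zero_mul _) (fun _ => PathAlg.of_mul_e (W := Theta V) _) (fun _ => zero_mul _) f

lemma e_mul_iToTheta {p q : Theta V} (f : p ⟶ q) : PathAlg.e q * iToTheta f = iToTheta f :=
  theta_arrow_cases (P := fun {p q} f => PathAlg.e q * iToTheta f = iToTheta f)
    (fun _ => mul_zero _) (fun _ => mul_zero _)
    (fun _ => PathAlg.e_mul_of (W := Theta V) _) (fun _ => mul_zero _) (fun _ => mul_zero _) f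

lemma jToIdem_mul_e {p q : Theta V} (f : p ⟶ q) : jToIdem f * PathAlg.e p = jToIdem f :=
  theta_arrow_cases (P := fun {p q} f => jToIdem f * PathAlg.e p = jToIdem f)
    (fun _ => zero_mul _) (fun _ => zero_mul _) (fun _ => zero_mul _)
    (fun _ => PathAlg.e_mul_of (W := Theta V) _) (fun _ => zero_mul _) f

lemma thetaArrow_mem (a : V) : thetaArrow a ∈ PathAlg.deg (W := Theta V) thetaDeg 1 :=
  PathAlg.of_mem_deg (ω := fun {p q : Theta V} f => thetaDeg f) rfl

lemma thetaArrow_mul_idem (a : V) : thetaArrow a * vertexIdem a = thetaArrow a :=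
  PathAlg.of_mul_e (W := Theta V) _

lemma e_mul_contractPath {p q : Theta V} (s : Quiver.Path p q) :
    PathAlg.e q * contractPath s = contractPath s := by
  cases s with
  | nil => exact mul_zero _
  | cons s f => rw [contractPath, mul_add, ← mul_assoc, ← mul_assoc, e_mul_passArrow,
      e_mul_iToTheta]

/-- A product of the idempotents of two different vertices vanishes. -/
lemma mul_eq_zero_of_ne {p q : Theta V} (h : p ≠ q) {x y : PathAlg (Theta V)}
    (hx : x * PathAlg.e p = x) (hy : PathAlg.e q * y = y) : x * y = 0 := by
  rw [← hx, ← hy, mul_assoc, ← mul_assoc (PathAlg.e p), PathAlg.e_mul_e, if_neg h, zero_mul,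
    mul_zero]

lemma arrow_mul_e {p q : Theta V} (f : p ⟶ q) :
    PathAlg.arrow f * PathAlg.e p = PathAlg.arrow f := PathAlg.of_mul_e _

lemma removeJLin_arrow_mul {p q : Theta V} (f : p ⟶ q) (z : PathAlg (Theta V)) :
    removeJLin V (PathAlg.arrow f * z) = jToIdem f * z := by
  have h : (removeJLin V).comp (LinearMap.mulLeft ℂ (PathAlg.arrow f)) =
      LinearMap.mulLeft ℂ (jToIdem f) := by
    refine PathAlg.hom_ext fun a b s => ?_
    simp only [LinearMap.comp_apply, LinearMap.mulLeft_apply]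
    by_cases hb : b = p
    · subst hb
      rw [PathAlg.arrow_mul_of, removeJLin, PathAlg.extend_of, removeJ]
    · rw [mul_eq_zero_of_ne (Ne.symm hb) (arrow_mul_e f) (PathAlg.e_mul_of s), map_zero,
        mul_eq_zero_of_ne (Ne.symm hb) (jToIdem_mul_e f) (PathAlg.e_mul_of s)]
  exact LinearMap.congr_fun h z

/-- A path whose last arrow is `j_b` is not composable with `i_a` if `a ≠ b`. In this case the loop
`ϑ_a` in place of `i_a j_b` gives `0` as well. -/
lemma iToTheta_mul_jToIdem {p q r t : Theta V} (f : p ⟶ q) (g : r ⟶ t) (h : t ≠ p) :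
    iToTheta f * jToIdem g = 0 := by
  revert h
  refine theta_arrow_cases (P := fun {p q} f => t ≠ p → iToTheta f * jToIdem g = 0)
    (fun _ _ => zero_mul _) (fun _ _ => zero_mul _) (fun a => ?_)
    (fun _ _ => zero_mul _) (fun _ _ => zero_mul _) f
  refine theta_arrow_cases (P := fun {r t} g => t ≠ (Sum.inr a : V ⊕ V) →
      iToTheta (p := (Sum.inr a : V ⊕ V)) (q := (Sum.inl a : V ⊕ V)) (ThetaHom.old (.i a)) *
        jToIdem g = 0)
    (fun _ _ => mul_zero _) (fun _ _ => mul_zero _) (fun _ _ => mul_zero _) (fun b hb => ?_)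
    (fun _ _ => mul_zero _) g
  have hab : (Sum.inl a : V ⊕ V) ≠ Sum.inl b := fun h => hb (by
    obtain rfl := Sum.inl.inj h; rfl)
  exact mul_eq_zero_of_ne hab (thetaArrow_mul_idem a) (PathAlg.of_mul_of _ _)

lemma contractLin_arrow_mul {p q : Theta V} (f : p ⟶ q) (z : PathAlg (Theta V)) :
    contractLin V (PathAlg.arrow f * z) =
      passArrow f * contractLin V z + iToTheta f * removeJLin V z := by
  have h : (contractLin V).comp (LinearMap.mulLeft ℂ (PathAlg.arrow f)) =
      (LinearMap.mulLeft ℂ (passArrow f)).comp (contractLin V) +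
        (LinearMap.mulLeft ℂ (iToTheta f)).comp (removeJLin V) := by
    refine PathAlg.hom_ext fun a b s => ?_
    simp only [LinearMap.comp_apply, LinearMap.mulLeft_apply, LinearMap.add_apply]
    by_cases hb : b = p
    · subst hb
      rw [PathAlg.arrow_mul_of, contractLin, removeJLin, PathAlg.extend_of, PathAlg.extend_of,
        PathAlg.extend_of, contractPath]
    · rw [mul_eq_zero_of_ne (Ne.symm hb) (arrow_mul_e f) (PathAlg.e_mul_of s), map_zero,
        contractLin, removeJLin, PathAlg.extend_of, PathAlg.extend_of,
        mul_eq_zero_of_ne (Ne.symm hb) (passArrow_mul_e f) (e_mul_contractPath s), zero_add]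
      cases s with
      | nil => exact (mul_zero _).symm
      | cons s g => rw [removeJ, ← mul_assoc, iToTheta_mul_jToIdem f g hb, zero_mul]
  exact LinearMap.congr_fun h z

lemma dTheta_arrow_mul {p q : Theta V} (f : p ⟶ q) (z : PathAlg (Theta V)) :
    dTheta V (PathAlg.arrow f * z) =
      thetaD f * z + (-1 : ℂ) ^ thetaDeg f • (PathAlg.arrow f * dTheta V z) := by
  have h1 : PathAlg.arrow f ∈ (cofDG V).deg (thetaDeg f) :=
    PathAlg.of_mem_deg (by simp [Quiver.Hom.toPath, pathDeg])
  have h2 : dTheta V (PathAlg.arrow f) = thetaD f := by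
    refine (cofDG_d_of _).trans ?_
    simp only [Quiver.Hom.toPath, pathD, mul_zero, smul_zero, add_zero]
    exact thetaD_mul_e _ _ f
  exact ((cofDG V).leibniz _ _ h1 z).trans (congrArg (fun t => t * z + _) h2)

lemma dTheta_old_mul {p q : V ⊕ V} (e : DFrHom p q) (z : PathAlg (Theta V)) :
    dTheta V (oldArrow e * z) = oldArrow e * dTheta V z := by
  refine (dTheta_arrow_mul _ z).trans ?_
  change 0 * z + (-1 : ℂ) ^ 0 • (oldArrow e * dTheta V z) = _
  rw [zero_mul, zero_add, pow_zero, one_smul]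

lemma dTheta_theta_mul (a : V) (z : PathAlg (Theta V)) :
    dTheta V (thetaArrow a * z) = muTheta a * z - thetaArrow a * dTheta V z := by
  refine (dTheta_arrow_mul _ z).trans ?_
  change muTheta a * z + (-1 : ℂ) ^ 1 • (thetaArrow a * dTheta V z) = _
  rw [pow_one, neg_one_smul, sub_eq_add_neg]

lemma dTheta_idem_mul (a : V) (z : PathAlg (Theta V)) :
    dTheta V (vertexIdem a * z) = vertexIdem a * dTheta V z := by
  have h1 : vertexIdem a ∈ (cofDG V).deg 0 := PathAlg.of_mem_deg rfl
  refine ((cofDG V).leibniz 0 _ h1 z).trans ?_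
  rw [(cofDG V).d_zero _ h1]
  change 0 * z + (-1 : ℂ) ^ 0 • (vertexIdem a * dTheta V z) = _
  rw [zero_mul, zero_add, pow_zero, one_smul]

section Values
variable (z : PathAlg (Theta V))

lemma removeJLin_x {a b : V} (γ : a ⟶ b) : removeJLin V (oldArrow (.x γ) * z) = 0 :=
  (removeJLin_arrow_mul _ z).trans (zero_mul z)

lemma removeJLin_y {a b : V} (γ : a ⟶ b) : removeJLin V (oldArrow (.y γ) * z) = 0 :=
  (removeJLin_arrow_mul _ z).trans (zero_mul z)

lemma removeJLin_i (a : V) : removeJLin V (oldArrow (.i a) * z) = 0 :=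
  (removeJLin_arrow_mul _ z).trans (zero_mul z)

lemma removeJLin_theta (a : V) : removeJLin V (thetaArrow a * z) = 0 :=
  (removeJLin_arrow_mul _ z).trans (zero_mul z)

lemma removeJLin_j (a : V) : removeJLin V (oldArrow (.j a) * z) = vertexIdem a * z :=
  removeJLin_arrow_mul _ z

lemma contractLin_x {a b : V} (γ : a ⟶ b) :
    contractLin V (oldArrow (.x γ) * z) = oldArrow (.x γ) * contractLin V z :=
  (contractLin_arrow_mul _ z).trans (by
    change _ + 0 * _ = _
    rw [zero_mul, add_zero]; rfl)

lemma contractLin_y {a b : V} (γ : a ⟶ b) :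
    contractLin V (oldArrow (.y γ) * z) = oldArrow (.y γ) * contractLin V z :=
  (contractLin_arrow_mul _ z).trans (by
    change _ + 0 * _ = _
    rw [zero_mul, add_zero]; rfl)

lemma contractLin_j (a : V) :
    contractLin V (oldArrow (.j a) * z) = oldArrow (.j a) * contractLin V z :=
  (contractLin_arrow_mul _ z).trans (by
    change _ + 0 * _ = _
    rw [zero_mul, add_zero]; rfl)

lemma contractLin_i (a : V) :
    contractLin V (oldArrow (.i a) * z) = thetaArrow a * removeJLin V z :=
  (contractLin_arrow_mul _ z).trans (by
    change 0 * _ + _ = _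
    rw [zero_mul, zero_add]; rfl)

lemma contractLin_theta (a : V) : contractLin V (thetaArrow a * z) = 0 :=
  (contractLin_arrow_mul _ z).trans (by
    change 0 * _ + 0 * _ = _
    rw [zero_mul, zero_mul, zero_add])

lemma removeJLin_mu (a : V) : removeJLin V (muTheta a * z) = 0 := by
  simp only [muTheta_eq, nuTheta, add_mul, sub_mul, Finset.sum_mul, mul_assoc, map_add, map_sub,
    map_sum, removeJLin_x, removeJLin_y, removeJLin_i, Finset.sum_const_zero, sub_zero, add_zero]

lemma contractLin_mu (a : V) :
    contractLin V (muTheta a * z) = thetaArrow a * z + nuTheta a * contractLin V z := by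
  simp only [muTheta_eq, nuTheta, add_mul, sub_mul, Finset.sum_mul, mul_assoc, map_add, map_sub,
    map_sum, contractLin_x, contractLin_y, contractLin_i, removeJLin_j]
  rw [← mul_assoc (thetaArrow a), thetaArrow_mul_idem, add_comm]

end Values

/-- Removal of the arrow `j` commutes with the differential. -/
lemma dTheta_removeJLin (z : PathAlg (Theta V)) :
    dTheta V (removeJLin V z) = removeJLin V (dTheta V z) := by
  have h : (dTheta V).comp (removeJLin V) = (removeJLin V).comp (dTheta V) := by
    refine PathAlg.hom_ext fun a b s => ?_
    simp only [LinearMap.comp_apply]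
    cases s with
    | nil =>
      have h1 : dTheta V (PathAlg.of (Quiver.Path.nil : Quiver.Path a a)) = 0 := cofDG_d_of _
      rw [h1, map_zero, removeJLin, PathAlg.extend_of]
      exact map_zero _
    | cons s f =>
      rw [← PathAlg.arrow_mul_of]
      generalize PathAlg.of s = z
      refine theta_arrow_cases (P := fun {p q} f => dTheta V (removeJLin V (PathAlg.arrow f * z)) =
        removeJLin V (dTheta V (PathAlg.arrow f * z))) ?_ ?_ ?_ ?_ ?_ f
      · intro a b γ
        change dTheta V (removeJLin V (oldArrow _ * z)) = removeJLin V (dTheta V (oldArrow _ * z))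
        rw [dTheta_old_mul, removeJLin_x, removeJLin_x, map_zero]
      · intro a b γ
        change dTheta V (removeJLin V (oldArrow _ * z)) = removeJLin V (dTheta V (oldArrow _ * z))
        rw [dTheta_old_mul, removeJLin_y, removeJLin_y, map_zero]
      · intro a
        change dTheta V (removeJLin V (oldArrow _ * z)) = removeJLin V (dTheta V (oldArrow _ * z))
        rw [dTheta_old_mul, removeJLin_i, removeJLin_i, map_zero]
      · intro a
        change dTheta V (removeJLin V (oldArrow _ * z)) = removeJLin V (dTheta V (oldArrow _ * z))
        rw [dTheta_old_mul, removeJLin_j, removeJLin_j, dTheta_idem_mul]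
      · intro a
        change dTheta V (removeJLin V (thetaArrow _ * z)) =
          removeJLin V (dTheta V (thetaArrow _ * z))
        rw [dTheta_theta_mul, removeJLin_theta, map_sub, removeJLin_theta, removeJLin_mu,
          map_zero, sub_zero]
  exact LinearMap.congr_fun h z

variable (V) in
/-- The deviation `dh + hd - 1` of the contraction from being a null homotopy of the identity. -/
def deviation : PathAlg (Theta V) →ₗ[ℂ] PathAlg (Theta V) :=
  (dTheta V).comp (contractLin V) + (contractLin V).comp (dTheta V) - LinearMap.id

lemma deviation_apply (z : PathAlg (Theta V)) : deviation V z =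
    dTheta V (contractLin V z) + contractLin V (dTheta V z) - z := rfl

lemma deviation_x {a b : V} (γ : a ⟶ b) (z : PathAlg (Theta V)) :
    deviation V (oldArrow (.x γ) * z) = oldArrow (.x γ) * deviation V z := by
  simp only [deviation_apply, contractLin_x, dTheta_old_mul, mul_add, mul_sub]

lemma deviation_y {a b : V} (γ : a ⟶ b) (z : PathAlg (Theta V)) :
    deviation V (oldArrow (.y γ) * z) = oldArrow (.y γ) * deviation V z := by
  simp only [deviation_apply, contractLin_y, dTheta_old_mul, mul_add, mul_sub]

lemma deviation_j (a : V) (z : PathAlg (Theta V)) :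
    deviation V (oldArrow (.j a) * z) = oldArrow (.j a) * deviation V z := by
  simp only [deviation_apply, contractLin_j, dTheta_old_mul, mul_add, mul_sub]

lemma deviation_i (a : V) (z : PathAlg (Theta V)) :
    deviation V (oldArrow (.i a) * z) = muTheta a * removeJLin V z - oldArrow (.i a) * z := by
  rw [deviation_apply, contractLin_i, dTheta_old_mul, contractLin_i, dTheta_theta_mul,
    dTheta_removeJLin]
  abel

lemma deviation_theta (a : V) (z : PathAlg (Theta V)) :
    deviation V (thetaArrow a * z) = nuTheta a * contractLin V z := by
  rw [deviation_apply, contractLin_theta, dTheta_theta_mul, map_sub, contractLin_theta,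
    contractLin_mu, map_zero]
  abel

/-- The weights of the arrows of `Q^ϑ` that count the arrows `i_a` and `ϑ_a`. -/
def thetaWeight : ∀ {p q : Theta V}, (p ⟶ q) → ℕ
  | _, _, .old (.x _) => 0
  | _, _, .old (.y _) => 0
  | _, _, .old (.i _) => 1
  | _, _, .old (.j _) => 0
  | _, _, .loop _ => 1

variable (V) in
/-- The span of the paths of degree `n` and weight less than `w`. -/
def weightFiltration (n w : ℕ) : Submodule ℂ (PathAlg (Theta V)) :=
  Submodule.span ℂ {x | ∃ (a b : Theta V) (p : Quiver.Path a b),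
    (pathDeg thetaDeg p = n ∧ pathDeg thetaWeight p < w) ∧ .of p = x}

lemma of_mem_weightFiltration {a b : Theta V} {p : Quiver.Path a b} {n w : ℕ}
    (h : pathDeg thetaDeg p = n) (h' : pathDeg thetaWeight p < w) :
    PathAlg.of p ∈ weightFiltration V n w := Submodule.subset_span ⟨a, b, p, ⟨h, h'⟩, rfl⟩

lemma weightFiltration_le_deg (n w : ℕ) :
    weightFiltration V n w ≤ PathAlg.deg (W := Theta V) thetaDeg n := by
  refine Submodule.span_mono ?_
  rintro _ ⟨a, b, p, h, rfl⟩
  exact ⟨a, b, p, h.1, rfl⟩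

lemma weightFiltration_mono {n w w' : ℕ} (h : w ≤ w') :
    weightFiltration V n w ≤ weightFiltration V n w' := by
  refine Submodule.span_mono ?_
  rintro _ ⟨a, b, p, hp, rfl⟩
  exact ⟨a, b, p, ⟨hp.1, hp.2.trans_le h⟩, rfl⟩

lemma weightFiltration_zero {n : ℕ} {z : PathAlg (Theta V)} (h : z ∈ weightFiltration V n 0) :
    z = 0 := by
  refine Submodule.span_induction (p := fun z _ => z = 0) ?_ rfl ?_ ?_ h
  · rintro _ ⟨a, b, p, hp, rfl⟩
    exact absurd hp.2 (Nat.not_lt_zero _)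
  · rintro x y _ _ rfl rfl; exact add_zero _
  · rintro c x _ rfl; exact smul_zero c

lemma exists_weightFiltration {n : ℕ} {z : PathAlg (Theta V)}
    (h : z ∈ PathAlg.deg (W := Theta V) thetaDeg n) : ∃ w, z ∈ weightFiltration V n w := by
  refine Submodule.span_induction (p := fun z _ => ∃ w, z ∈ weightFiltration V n w) ?_
    ⟨0, zero_mem _⟩ ?_ ?_ h
  · rintro _ ⟨a, b, p, hp, rfl⟩
    exact ⟨_, of_mem_weightFiltration hp (Nat.lt_succ_self _)⟩
  · rintro x y _ _ ⟨w, hx⟩ ⟨w', hy⟩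
    exact ⟨max w w', add_mem (weightFiltration_mono (le_max_left _ _) hx)
      (weightFiltration_mono (le_max_right _ _) hy)⟩
  · rintro c x _ ⟨w, hx⟩
    exact ⟨w, Submodule.smul_mem _ _ hx⟩

lemma arrow_mul_mem {p q : Theta V} (f : p ⟶ q) {n w : ℕ} {z : PathAlg (Theta V)}
    (h : z ∈ weightFiltration V n w) :
    PathAlg.arrow f * z ∈ weightFiltration V (thetaDeg f + n) (thetaWeight f + w) := by
  refine Submodule.span_induction
    (p := fun z _ => PathAlg.arrow f * z ∈
      weightFiltration V (thetaDeg f + n) (thetaWeight f + w)) ?_ ?_ ?_ ?_ h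
  · rintro _ ⟨a, b, s, hs, rfl⟩
    by_cases hb : b = p
    · subst hb
      rw [PathAlg.arrow_mul_of]
      refine of_mem_weightFiltration ?_ ?_
      · rw [pathDeg, hs.1]
      · rw [pathDeg]; exact Nat.add_lt_add_left hs.2 _
    · rw [mul_eq_zero_of_ne (Ne.symm hb) (arrow_mul_e f) (PathAlg.e_mul_of s)]
      exact zero_mem _
  · rw [mul_zero]; exact zero_mem _
  · intro x y _ _ hx hy; rw [mul_add]; exact add_mem hx hy
  · intro c x _ hx; rw [mul_smul_comm]; exact Submodule.smul_mem _ _ hx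

lemma x_mul_mem {n w : ℕ} {z : PathAlg (Theta V)} (h : z ∈ weightFiltration V n w) {a b : V}
    (γ : a ⟶ b) : oldArrow (.x γ) * z ∈ weightFiltration V n w := by
  have := arrow_mul_mem (p := (Sum.inl a : V ⊕ V)) (q := (Sum.inl b : V ⊕ V))
    (ThetaHom.old (.x γ)) h
  simp only [thetaDeg, thetaWeight, Nat.zero_add] at this
  exact this

lemma y_mul_mem {n w : ℕ} {z : PathAlg (Theta V)} (h : z ∈ weightFiltration V n w) {a b : V}
    (γ : a ⟶ b) : oldArrow (.y γ) * z ∈ weightFiltration V n w := by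
  have := arrow_mul_mem (p := (Sum.inl b : V ⊕ V)) (q := (Sum.inl a : V ⊕ V))
    (ThetaHom.old (.y γ)) h
  simp only [thetaDeg, thetaWeight, Nat.zero_add] at this
  exact this

lemma j_mul_mem {n w : ℕ} {z : PathAlg (Theta V)} (h : z ∈ weightFiltration V n w) (a : V) :
    oldArrow (.j a) * z ∈ weightFiltration V n w := by
  have := arrow_mul_mem (p := (Sum.inl a : V ⊕ V)) (q := (Sum.inr a : V ⊕ V))
    (ThetaHom.old (.j a)) h
  simp only [thetaDeg, thetaWeight, Nat.zero_add] at this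
  exact this

lemma theta_mul_mem {n w : ℕ} {z : PathAlg (Theta V)} (h : z ∈ weightFiltration V n w) (a : V) :
    thetaArrow a * z ∈ weightFiltration V (n + 1) (w + 1) := by
  have := arrow_mul_mem (p := (Sum.inl a : V ⊕ V)) (q := (Sum.inl a : V ⊕ V))
    (ThetaHom.loop a) h
  simp only [thetaDeg, thetaWeight, Nat.add_comm 1] at this
  exact this

lemma nu_mul_mem {n w : ℕ} {z : PathAlg (Theta V)} (h : z ∈ weightFiltration V n w) (a : V) :
    nuTheta a * z ∈ weightFiltration V n w := by
  simp only [nuTheta, sub_mul, Finset.sum_mul, mul_assoc]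
  exact sub_mem (sum_mem fun b _ => sum_mem fun γ _ => x_mul_mem (y_mul_mem h _) _)
    (sum_mem fun b _ => sum_mem fun γ _ => y_mul_mem (x_mul_mem h _) _)

lemma removeJ_mem {a b : Theta V} (p : Quiver.Path a b) :
    removeJ p ∈ weightFiltration V (pathDeg thetaDeg p) (pathDeg thetaWeight p + 1) := by
  cases p with
  | nil => exact zero_mem _
  | cons s f =>
    rw [removeJ, pathDeg, pathDeg]
    revert s
    refine theta_arrow_cases (P := fun {p q} f => ∀ s : Quiver.Path a p, jToIdem f * PathAlg.of s ∈
      weightFiltration V (thetaDeg f + pathDeg thetaDeg s)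
        (thetaWeight f + pathDeg thetaWeight s + 1)) ?_ ?_ ?_ ?_ ?_ f
    · intro _ _ _ s
      exact (congrArg (· ∈ _) (zero_mul (PathAlg.of s))).mpr (zero_mem _)
    · intro _ _ _ s
      exact (congrArg (· ∈ _) (zero_mul (PathAlg.of s))).mpr (zero_mem _)
    · intro _ s
      exact (congrArg (· ∈ _) (zero_mul (PathAlg.of s))).mpr (zero_mem _)
    · intro c s
      refine (congrArg (· ∈ _) (PathAlg.e_mul_of s)).mpr ?_
      exact of_mem_weightFiltration (Nat.zero_add _).symm
        (by simp only [thetaWeight]; omega)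
    · intro _ s
      exact (congrArg (· ∈ _) (zero_mul (PathAlg.of s))).mpr (zero_mem _)

/-- The homotopy raises the degree by one, and does not raise the weight. -/
lemma contractPath_mem {a b : Theta V} (p : Quiver.Path a b) :
    contractPath p ∈ weightFiltration V (pathDeg thetaDeg p + 1) (pathDeg thetaWeight p + 1) := by
  induction p with
  | nil => exact zero_mem _
  | cons s f ih =>
    have hr := removeJ_mem s
    rw [contractPath, pathDeg, pathDeg]
    generalize contractPath s = z at ih
    generalize removeJ s = y at hr
    generalize pathDeg thetaDeg s = n at ih hr
    generalize pathDeg thetaWeight s = w at ih hr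
    refine theta_arrow_cases (P := fun {p q} f => passArrow f * z + iToTheta f * y ∈
      weightFiltration V (thetaDeg f + n + 1) (thetaWeight f + w + 1)) ?_ ?_ ?_ ?_ ?_ f
    · intro _ _ γ
      simp only [passArrow, iToTheta, thetaDeg, thetaWeight, Nat.zero_add, zero_mul, add_zero]
      exact x_mul_mem ih γ
    · intro _ _ γ
      simp only [passArrow, iToTheta, thetaDeg, thetaWeight, Nat.zero_add, zero_mul, add_zero]
      exact y_mul_mem ih γ
    · intro c
      simp only [passArrow, iToTheta, thetaDeg, thetaWeight, zero_mul, zero_add]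
      exact (Nat.add_comm 1 w) ▸ theta_mul_mem hr c
    · intro c
      simp only [passArrow, iToTheta, thetaDeg, thetaWeight, Nat.zero_add, zero_mul, add_zero]
      exact j_mul_mem ih c
    · intro c
      simp only [passArrow, iToTheta, zero_mul, add_zero]
      exact zero_mem _

/-- A path of positive degree is not empty, so it has `j_c` as its last arrow if it ends at the
framing vertex of `c`. -/
lemma j_mul_removeJ {a : Theta V} {c : V} (s : Quiver.Path a ((Sum.inr c : V ⊕ V) : Theta V))
    (hs : 0 < pathDeg thetaDeg s) :
    oldArrow (.j c) * removeJ s = .of s := by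
  have key : ∀ {q : Theta V} (s : Quiver.Path a q) (hq : q = (Sum.inr c : V ⊕ V)),
      0 < pathDeg thetaDeg s → oldArrow (.j c) * removeJ s = .of s := by
    intro q s hq hs
    cases s with
    | nil => exact absurd hs (lt_irrefl _)
    | cons s f =>
      clear hs
      rw [removeJ, ← PathAlg.arrow_mul_of]
      refine theta_arrow_cases (P := fun {p q} f => ∀ s : Quiver.Path a p, q = (Sum.inr c : V ⊕ V) →
        oldArrow (.j c) * (jToIdem f * PathAlg.of s) = PathAlg.arrow f * PathAlg.of s)
        ?_ ?_ ?_ ?_ ?_ f s hq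
      · intro _ _ _ _ h; exact absurd h Sum.inl_ne_inr
      · intro _ _ _ _ h; exact absurd h Sum.inl_ne_inr
      · intro _ _ h; exact absurd h Sum.inl_ne_inr
      · intro b t h
        obtain rfl := Sum.inr.inj h
        exact congrArg _ (PathAlg.e_mul_of t)
      · intro _ _ h; exact absurd h Sum.inl_ne_inr
  exact key s rfl hs

/-- The deviation lowers the weight of the paths `f s` of positive degree, provided that it does so
for `s`. -/
def LowersWeight {p q : Theta V} (f : p ⟶ q) : Prop :=
  ∀ (a : Theta V) (s : Quiver.Path a p),
    (0 < pathDeg thetaDeg s → deviation V (.of s) ∈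
      weightFiltration V (pathDeg thetaDeg s) (pathDeg thetaWeight s)) →
    0 < thetaDeg f + pathDeg thetaDeg s →
    deviation V (PathAlg.arrow f * .of s) ∈
      weightFiltration V (thetaDeg f + pathDeg thetaDeg s)
        (thetaWeight f + pathDeg thetaWeight s)

lemma lowersWeight {p q : Theta V} (f : p ⟶ q) : LowersWeight f := by
  refine theta_arrow_cases (P := LowersWeight) ?_ ?_ ?_ ?_ ?_ f
  · intro _ _ γ _ s ih hp
    simp only [thetaDeg, thetaWeight, Nat.zero_add] at hp ⊢
    exact (congrArg (· ∈ _) (deviation_x γ (PathAlg.of s))).mpr (x_mul_mem (ih hp) γ)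
  · intro _ _ γ _ s ih hp
    simp only [thetaDeg, thetaWeight, Nat.zero_add] at hp ⊢
    exact (congrArg (· ∈ _) (deviation_y γ (PathAlg.of s))).mpr (y_mul_mem (ih hp) γ)
  · intro c _ s _ hp
    simp only [thetaDeg, thetaWeight, Nat.zero_add, Nat.add_comm 1] at hp ⊢
    have h : deviation V (oldArrow (.i c) * .of s) = nuTheta c * removeJ s := by
      have h2 : removeJLin V (.of s) = removeJ s := PathAlg.extend_of _ _
      have h3 := j_mul_removeJ s hp
      generalize removeJ s = y at h2 h3
      rw [deviation_i, h2, muTheta_eq, add_mul, mul_assoc, h3, add_sub_cancel_right]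
    exact (congrArg (· ∈ _) h).mpr (nu_mul_mem (removeJ_mem s) c)
  · intro c _ s ih hp
    simp only [thetaDeg, thetaWeight, Nat.zero_add] at hp ⊢
    exact (congrArg (· ∈ _) (deviation_j c (PathAlg.of s))).mpr (j_mul_mem (ih hp) c)
  · intro c _ s _ hp
    simp only [thetaDeg, thetaWeight, Nat.add_comm 1] at hp ⊢
    have h2 : contractLin V (.of s) = contractPath s := PathAlg.extend_of _ _
    have h : deviation V (thetaArrow c * .of s) = nuTheta c * contractPath s := by
      rw [deviation_theta, h2]
    exact (congrArg (· ∈ _) h).mpr (nu_mul_mem (contractPath_mem s) c)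

/-- In positive degrees the deviation lowers the weight. -/
lemma deviation_of_mem {a b : Theta V} (p : Quiver.Path a b) (hp : 0 < pathDeg thetaDeg p) :
    deviation V (.of p) ∈ weightFiltration V (pathDeg thetaDeg p) (pathDeg thetaWeight p) := by
  induction p with
  | nil => exact absurd hp (lt_irrefl _)
  | cons s f ih =>
    rw [pathDeg] at hp
    rw [← PathAlg.arrow_mul_of, pathDeg, pathDeg]
    exact lowersWeight f _ s ih hp

lemma deviation_mem {n w : ℕ} {z : PathAlg (Theta V)}
    (h : z ∈ weightFiltration V (n + 1) (w + 1)) :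
    deviation V z ∈ weightFiltration V (n + 1) w := by
  refine Submodule.span_induction (p := fun z _ => deviation V z ∈ weightFiltration V (n + 1) w)
    ?_ ?_ ?_ ?_ h
  · rintro _ ⟨a, b, p, hp, rfl⟩
    have := deviation_of_mem p (by rw [hp.1]; exact Nat.succ_pos n)
    rw [hp.1] at this
    exact weightFiltration_mono (Nat.le_of_lt_succ hp.2) this
  · rw [map_zero]; exact zero_mem _
  · intro x y _ _ hx hy; rw [map_add]; exact add_mem hx hy
  · intro c x _ hx; rw [map_smul]; exact Submodule.smul_mem _ _ hx

lemma contractLin_mem {n w : ℕ} {z : PathAlg (Theta V)} (h : z ∈ weightFiltration V n w) :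
    contractLin V z ∈ PathAlg.deg (W := Theta V) thetaDeg (n + 1) := by
  refine Submodule.span_induction
    (p := fun z _ => contractLin V z ∈ PathAlg.deg (W := Theta V) thetaDeg (n + 1))
    ?_ ?_ ?_ ?_ h
  · rintro _ ⟨a, b, p, hp, rfl⟩
    rw [contractLin, PathAlg.extend_of, ← hp.1]
    exact weightFiltration_le_deg _ _ (contractPath_mem p)
  · rw [map_zero]; exact zero_mem _
  · intro x y _ _ hx hy; rw [map_add]; exact add_mem hx hy
  · intro c x _ hx; rw [map_smul]; exact Submodule.smul_mem _ _ hx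

/-- The cycles of `A_cof` of positive degree are boundaries: up to a boundary, such a cycle equals
minus its deviation, which is a cycle of lower weight. -/
lemma cofDG_acyclic (n : ℕ) (z : PathAlg (Theta V))
    (hz : z ∈ PathAlg.deg (W := Theta V) thetaDeg (n + 1)) (hd : dTheta V z = 0) :
    ∃ y ∈ PathAlg.deg (W := Theta V) thetaDeg (n + 2), dTheta V y = z := by
  obtain ⟨w, hw⟩ := exists_weightFiltration hz
  clear hz
  induction w generalizing z with
  | zero => exact ⟨0, zero_mem _, by rw [map_zero, weightFiltration_zero hw]⟩
  | succ w ih =>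
    have hdev : deviation V z = dTheta V (contractLin V z) - z := by
      rw [deviation_apply, hd, map_zero, add_zero]
    obtain ⟨y, hy, hyz⟩ := ih (deviation V z) (by
      rw [hdev, map_sub, hd, sub_zero]
      exact (cofDG V).d_d _) (deviation_mem hw)
    refine ⟨contractLin V z - y, sub_mem (contractLin_mem hw) hy, ?_⟩
    rw [map_sub, hyz, hdev, sub_sub_cancel]

end Acyclic

/-! ### The projection `A_cof → A` is an acyclic fibration -/

section PathAlgHom
variable {W : Type} [Quiver.{0} W] [DecidableEq W] [Fintype W] {B : Type} [Ring B] [Algebra ℂ B]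

/-- Algebra maps out of a path algebra agree if they agree on vertices and arrows. -/
lemma PathAlg.algHom_ext {f g : PathAlg W →ₐ[ℂ] B} (he : ∀ a : W, f (.e a) = g (.e a))
    (ha : ∀ {a b : W} (x : a ⟶ b), f (.arrow x) = g (.arrow x)) : f = g := by
  have h : f.toLinearMap = g.toLinearMap := by
    refine PathAlg.hom_ext fun a b p => ?_
    change f (.of p) = g (.of p)
    induction p with
    | nil => exact he a
    | cons p x ih => rw [← PathAlg.arrow_mul_of, map_mul, map_mul, ha, ih]
  exact AlgHom.ext fun x => LinearMap.congr_fun h x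

variable (E : W → B) (F : ∀ {a b : W}, (a ⟶ b) → B)
  (hE : ∀ a b, E a * E b = if a = b then E a else 0) (hE1 : ∑ a, E a = 1)
  (hF : ∀ (a b : W) (f : a ⟶ b), E b * F f = F f)

lemma PathAlg.lift_e (a : W) : PathAlg.lift E F hE hE1 hF (.e a) = E a :=
  PathAlg.lift_of E F hE hE1 hF _

lemma PathAlg.lift_arrow {a b : W} (x : a ⟶ b) (hx : F x * E a = F x) :
    PathAlg.lift E F hE hE1 hF (.arrow x) = F x :=
  (PathAlg.lift_of E F hE hE1 hF _).trans hx

end PathAlgHom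

section AcyclicFibration
variable (V : Type) [Fintype V] [DecidableEq V] [Quiver.{0} V] [∀ a b : V, Fintype (a ⟶ b)]

/-- The inclusion of the path algebra of the framed doubled quiver in that of `Q^ϑ`. -/
def oldIncl : PathAlg (DFr V) →ₐ[ℂ] PathAlg (Theta V) :=
  PathAlg.lift (W := DFr V) (fun p => PathAlg.e (W := Theta V) p) (fun e => oldArrow e)
    (fun p q => PathAlg.e_mul_e (W := Theta V) p q) rfl
    (fun _ _ _ => PathAlg.e_mul_of (W := Theta V) _)

variable {V}

lemma oldIncl_e (p : V ⊕ V) :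
    oldIncl V (PathAlg.e (W := DFr V) p) = PathAlg.e (W := Theta V) p :=
  PathAlg.lift_e ..

lemma oldIncl_arrow {p q : V ⊕ V} (e : DFrHom (V := V) p q) :
    oldIncl V (PathAlg.arrow (W := DFr V) (a := p) (b := q) e) = oldArrow e :=
  PathAlg.lift_arrow (W := DFr V) _ _ _ _ _ _ (PathAlg.of_mul_e (W := Theta V) _)

lemma oldIncl_mu (a : V) : oldIncl V (mu a) = muTheta a :=
  map_momentElt (oldIncl V) _ _ (fun e => oldIncl_arrow e) a

lemma cofToNak_oldIncl (y : PathAlg (DFr V)) : cofToNak V (oldIncl V y) = nakMk V y := by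
  have h : (cofToNak V).comp (oldIncl V) = nakMk V := by
    refine PathAlg.algHom_ext (fun p => ?_) (fun {p q} e => ?_)
    · exact (congrArg (cofToNak V) (oldIncl_e p)).trans (PathAlg.lift_e ..)
    · exact (congrArg (cofToNak V) (oldIncl_arrow e)).trans (cofToNak_old e)
  exact DFunLike.congr_fun h y

lemma oldIncl_mem (y : PathAlg (DFr V)) :
    oldIncl V y ∈ PathAlg.deg (W := Theta V) thetaDeg 0 := by
  have h : ∀ {p q : DFr V} (s : Quiver.Path p q),
      oldIncl V (.of s) ∈ PathAlg.deg (W := Theta V) thetaDeg 0 := by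
    intro p q s
    induction s with
    | nil => exact (congrArg (· ∈ _) (oldIncl_e p)).mpr (PathAlg.of_mem_deg rfl)
    | cons s e ih =>
      rw [← PathAlg.arrow_mul_of, map_mul]
      exact SetLike.GradedMul.mul_mem (i := 0) (j := 0)
        ((congrArg (· ∈ _) (oldIncl_arrow e)).mpr (arrow_old_mem e)) ih
  have h2 : (PathAlg.deg (W := Theta V) thetaDeg 0).mkQ.comp (oldIncl V).toLinearMap = 0 :=
    PathAlg.hom_ext fun p q s => (Submodule.Quotient.mk_eq_zero _).2 (h s)
  exact (Submodule.Quotient.mk_eq_zero _).1 (LinearMap.congr_fun h2 y)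

lemma exists_oldIncl {x : PathAlg (Theta V)}
    (hx : x ∈ PathAlg.deg (W := Theta V) thetaDeg 0) : ∃ y, oldIncl V y = x := by
  have h : ∀ {p q : Theta V} (s : Quiver.Path p q), pathDeg thetaDeg s = 0 →
      ∃ y, oldIncl V y = .of s := by
    intro p q s hs
    induction s with
    | nil => exact ⟨_, oldIncl_e p⟩
    | cons s f ih =>
      rw [pathDeg] at hs
      obtain ⟨y, hy⟩ := ih (by omega)
      have hf : thetaDeg f = 0 := by omega
      obtain ⟨z, hz⟩ : ∃ z, oldIncl V z = PathAlg.arrow f := by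
        revert hf
        exact theta_cases (P := fun {p q} f => thetaDeg f = 0 →
          ∃ z, oldIncl V z = PathAlg.arrow f) (fun e _ => ⟨_, oldIncl_arrow e⟩)
          (fun a h => absurd h one_ne_zero) f
      exact ⟨z * y, by rw [map_mul, hz, hy, PathAlg.arrow_mul_of]⟩
  refine Submodule.span_induction (p := fun x _ => ∃ y, oldIncl V y = x) ?_ ⟨0, map_zero _⟩
    ?_ ?_ hx
  · rintro _ ⟨a, b, s, hs, rfl⟩
    exact h s hs
  · rintro _ _ _ _ ⟨y, rfl⟩ ⟨z, rfl⟩; exact ⟨y + z, map_add _ _ _⟩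
  · rintro c _ _ ⟨y, rfl⟩; exact ⟨c • y, map_smul _ _ _⟩

lemma dTheta_oldIncl_mul (y : PathAlg (DFr V)) (z : PathAlg (Theta V)) :
    dTheta V (oldIncl V y * z) = oldIncl V y * dTheta V z := by
  have h := (cofDG V).leibniz 0 _ (oldIncl_mem y) z
  rw [(cofDG V).d_zero _ (oldIncl_mem y)] at h
  refine h.trans ?_
  change 0 * z + (-1 : ℂ) ^ 0 • (oldIncl V y * dTheta V z) = _
  rw [zero_mul, zero_add, pow_zero, one_smul]

lemma dTheta_mul_oldIncl (y : PathAlg (DFr V)) (z : PathAlg (Theta V))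
    (hz : z ∈ PathAlg.deg (W := Theta V) thetaDeg 1) :
    dTheta V (z * oldIncl V y) = dTheta V z * oldIncl V y := by
  have h := (cofDG V).leibniz 1 _ hz (oldIncl V y)
  rw [(cofDG V).d_zero _ (oldIncl_mem y)] at h
  refine h.trans ?_
  change dTheta V z * oldIncl V y + (-1 : ℂ) ^ 1 • (z * 0) = _
  rw [mul_zero, smul_zero, add_zero]

/-- The elements of the path algebra of the framed doubled quiver that bound in `A_cof`. -/
def boundaryIdeal (V : Type) [Fintype V] [DecidableEq V] [Quiver.{0} V]
    [∀ a b : V, Fintype (a ⟶ b)] : TwoSidedIdeal (PathAlg (DFr V)) :=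
  TwoSidedIdeal.mk' {y | ∃ z ∈ PathAlg.deg (W := Theta V) thetaDeg 1, dTheta V z = oldIncl V y}
    ⟨0, zero_mem _, by rw [map_zero, map_zero]⟩
    (by
      rintro x y ⟨z, hz, h⟩ ⟨z', hz', h'⟩
      exact ⟨z + z', add_mem hz hz', by rw [map_add, map_add, h, h']⟩)
    (by
      rintro x ⟨z, hz, h⟩
      exact ⟨-z, neg_mem hz, by rw [map_neg, map_neg, h]⟩)
    (by
      rintro x y ⟨z, hz, h⟩
      exact ⟨oldIncl V x * z, SetLike.GradedMul.mul_mem (i := 0) (j := 1) (oldIncl_mem x) hz,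
        by rw [dTheta_oldIncl_mul, h, map_mul]⟩)
    (by
      rintro x y ⟨z, hz, h⟩
      exact ⟨z * oldIncl V y, SetLike.GradedMul.mul_mem (i := 1) (j := 0) hz (oldIncl_mem y),
        by rw [dTheta_mul_oldIncl _ _ hz, h, map_mul]⟩)

lemma mem_boundaryIdeal {y : PathAlg (DFr V)} : y ∈ boundaryIdeal V ↔
    ∃ z ∈ PathAlg.deg (W := Theta V) thetaDeg 1, dTheta V z = oldIncl V y :=
  TwoSidedIdeal.mem_mk' _ _ _ _ _ _ _

lemma momentIdeal_le : momentIdeal V ≤ boundaryIdeal V := by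
  refine TwoSidedIdeal.span_le.2 ?_
  rintro _ ⟨a, rfl⟩
  exact mem_boundaryIdeal.2
    ⟨thetaArrow a, thetaArrow_mem a, (cofDG_d_loop a).trans (oldIncl_mu a).symm⟩

lemma eq_zero_of_mem_trivialDeg {A : Type} [Ring A] [Algebra ℂ A] {n : ℕ} {b : A}
    (hb : b ∈ trivialDeg A (n + 1)) : b = 0 := by
  rw [trivialDeg, if_neg (Nat.succ_ne_zero n)] at hb
  exact (Submodule.mem_bot ℂ).1 hb

lemma cofProj_fibration : fibration (cofProj V).right := by
  intro n b hb
  have hb' : b = 0 := eq_zero_of_mem_trivialDeg (A := NakAlg V) (n := n) hb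
  exact ⟨0, zero_mem _, (map_zero (cofToNak V)).trans hb'.symm⟩

lemma cofProj_quasiIso : quasiIso (cofProj V).right := by
  refine (quasiIso_iff _).2 ⟨fun n z hz hd b hb hbz => ?_, fun n y hy _ => ?_⟩
  · -- in degree `0` the kernel of `A_cof → A` is the image of the moment ideal, which bounds
    rcases n with _ | n
    · have h0 : cofToNak V z = 0 := hbz.symm
      obtain ⟨y, rfl⟩ := exists_oldIncl hz
      have h1 : nakMk V y = nakMk V 0 := by
        rw [map_zero]
        exact (cofToNak_oldIncl y).symm.trans h0
      have h2 : y ∈ momentIdeal V := (TwoSidedIdeal.mem_iff _ _).2 ((RingCon.eq _).1 h1)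
      exact mem_boundaryIdeal.1 (momentIdeal_le h2)
    · exact cofDG_acyclic n z hz hd
  · rcases n with _ | n
    · -- a representative in the path algebra of the framed doubled quiver is a cycle
      obtain ⟨y, rfl⟩ : ∃ x, nakMk V x = y := (momentIdeal V).ringCon.mk'_surjective y
      refine ⟨oldIncl V y, oldIncl_mem y, (cofDG V).d_zero _ (oldIncl_mem y), 0, zero_mem _, ?_⟩
      rw [map_zero]
      exact (sub_eq_zero.2 (cofToNak_oldIncl y)).symm
    · obtain rfl : y = 0 := eq_zero_of_mem_trivialDeg (A := NakAlg V) (n := n) hy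
      refine ⟨0, zero_mem _, map_zero _, 0, zero_mem _, ?_⟩
      rw [map_zero, map_zero]
      exact (sub_self _).symm

end AcyclicFibration

/-! ### Maps out of `A_cof`, and its cofibrancy -/

section CofLift
variable {V : Type} [Fintype V] [DecidableEq V] [Quiver.{0} V] [∀ a b : V, Fintype (a ⟶ b)]

section Lift
variable (C : DGAlg) (E : Theta V → C.carrier) (F : ∀ {p q : Theta V}, (p ⟶ q) → C.carrier)
  (hE : ∀ a b, E a * E b = if a = b then E a else 0) (hE1 : ∑ a, E a = 1)
  (hF : ∀ (a b : Theta V) (f : a ⟶ b), E b * F f = F f)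
  (hFr : ∀ (a b : Theta V) (f : a ⟶ b), F f * E a = F f)
  (hE0 : ∀ a, E a ∈ C.deg 0) (hFdeg : ∀ (a b : Theta V) (f : a ⟶ b), F f ∈ C.deg (thetaDeg f))
  (hd : ∀ a : V, C.d (F (p := (Sum.inl a : V ⊕ V)) (q := (Sum.inl a : V ⊕ V)) (.loop a)) =
    momentElt (fun {p q} e => F (p := p) (q := q) (.old e)) a)

/-- The map of dg-algebras out of `A_cof` given by the images of the vertices and arrows. -/
def cofLift : cofDG V ⟶ C where
  alg := PathAlg.lift E F hE hE1 hF
  map_deg m x hx := by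
    have h : ∀ {a b : Theta V} (s : Quiver.Path a b),
        PathAlg.liftPath E F s ∈ C.deg (pathDeg thetaDeg s) := by
      intro a b s
      induction s with
      | nil => exact hE0 a
      | cons s f ih => exact SetLike.GradedMul.mul_mem (hFdeg _ _ f) ih
    refine Submodule.span_induction (p := fun x _ => PathAlg.lift E F hE hE1 hF x ∈ C.deg m)
      ?_ ?_ ?_ ?_ hx
    · rintro _ ⟨a, b, s, rfl, rfl⟩
      rw [PathAlg.lift_of]
      exact h s
    · rw [map_zero]; exact zero_mem _
    · intro x y _ _ h1 h2; rw [map_add]; exact add_mem h1 h2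
    · intro c x _ h; rw [map_smul]; exact Submodule.smul_mem _ _ h
  map_d x := by
    have hdF : ∀ {p q : Theta V} (f : p ⟶ q),
        PathAlg.lift E F hE hE1 hF (thetaD f) = C.d (F f) := by
      intro p q f
      refine theta_cases (P := fun {p q} f => F f ∈ C.deg (thetaDeg f) →
        PathAlg.lift E F hE hE1 hF (thetaD f) = C.d (F f)) ?_ ?_ f (hFdeg _ _ f)
      · intro p q e he
        rw [C.d_zero _ he]
        exact map_zero _
      · intro a _
        rw [hd]
        exact map_momentElt _ _ _ (fun e => PathAlg.lift_arrow E F hE hE1 hF _ (hFr _ _ _)) a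
    have h : (PathAlg.lift E F hE hE1 hF).toLinearMap.comp (dTheta V) =
        C.d.comp (PathAlg.lift E F hE hE1 hF).toLinearMap := by
      refine PathAlg.hom_ext fun a b s => ?_
      change PathAlg.lift E F hE hE1 hF (dTheta V (.of s)) =
        C.d (PathAlg.lift E F hE hE1 hF (.of s))
      rw [show dTheta V (.of s) = _ from cofDG_d_of s]
      induction s with
      | nil => rw [pathD, map_zero, PathAlg.lift_of]; exact (C.d_zero _ (hE0 a)).symm
      | cons s f ih =>
        rw [pathD, map_add, map_mul, map_smul, map_mul, ih, hdF,
          PathAlg.lift_arrow E F hE hE1 hF f (hFr _ _ f), ← PathAlg.arrow_mul_of, map_mul,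
          PathAlg.lift_arrow E F hE hE1 hF f (hFr _ _ f), C.leibniz _ _ (hFdeg _ _ f)]
    exact LinearMap.congr_fun h x

lemma cofLift_e (a : Theta V) :
    DGAlg.Hom.alg (cofLift C E F hE hE1 hF hFr hE0 hFdeg hd) (PathAlg.e a) = E a :=
  PathAlg.lift_e E F hE hE1 hF a

lemma cofLift_arrow {a b : Theta V} (f : a ⟶ b) :
    DGAlg.Hom.alg (cofLift C E F hE hE1 hF hFr hE0 hFdeg hd) (PathAlg.arrow f) = F f :=
  PathAlg.lift_arrow E F hE hE1 hF f (hFr _ _ f)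

end Lift

lemma map_eq_sum_single (f : V ⊕ V → ℂ) {B : Type} [Ring B] [Algebra ℂ B]
    (u : (V ⊕ V → ℂ) →ₐ[ℂ] B) : u f = ∑ p, f p • u (Pi.single p 1) := by
  have h : f = ∑ p, f p • (Pi.single p (1 : ℂ) : V ⊕ V → ℂ) := by
    ext q
    simp [Finset.sum_apply, Pi.single_apply]
  conv_lhs => rw [h]
  rw [map_sum]
  simp only [map_smul]

lemma single_mul_single (p q : V ⊕ V) : (Pi.single p 1 * Pi.single q 1 : V ⊕ V → ℂ) =
    if p = q then Pi.single p 1 else 0 := by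
  ext r
  by_cases h : p = q
  · subst h; simp [Pi.single_apply]
  · rw [if_neg h, Pi.mul_apply, Pi.single_apply, Pi.single_apply, Pi.zero_apply]
    by_cases h1 : r = p
    · subst h1; simp [h]
    · simp [h1]

lemma sum_single_one : ∑ p, (Pi.single p 1 : V ⊕ V → ℂ) = 1 := by
  ext r
  simp [Finset.sum_apply, Pi.single_apply]

/-- The images of the arrows under a lift of `φ` along an acyclic fibration: elements over the
old arrows exist by surjectivity, and over a loop `ϑ_a` because the kernel is acyclic. -/
lemma exists_arrow_lift {X B : DGAlg} {p : X ⟶ B} (hq : quasiIso p) (hf : fibration p)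
    (φ : cofDG V ⟶ B) (E : V ⊕ V → X.carrier) (hE0 : ∀ a, E a ∈ X.deg 0)
    (hE : ∀ a, E a * E a = E a)
    (hpE : ∀ a, p.alg (E a) = φ.alg (PathAlg.e (W := Theta V) a)) :
    ∃ F : ∀ {p q : Theta V}, (p ⟶ q) → X.carrier,
      (∀ (a b : Theta V) (f : a ⟶ b), E b * F f = F f) ∧
      (∀ (a b : Theta V) (f : a ⟶ b), F f * E a = F f) ∧
      (∀ (a b : Theta V) (f : a ⟶ b), F f ∈ X.deg (thetaDeg f)) ∧
      (∀ a : V, X.d (F (p := (Sum.inl a : V ⊕ V)) (q := (Sum.inl a : V ⊕ V)) (.loop a)) =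
        momentElt (fun {p q} e => F (p := p) (q := q) (.old e)) a) ∧
      ∀ (a b : Theta V) (f : a ⟶ b), p.alg (F f) = φ.alg (PathAlg.arrow f) := by
  have hold : ∀ {r s : V ⊕ V} (e : DFrHom r s), ∃ x ∈ X.deg 0,
      p.alg x = φ.alg (oldArrow e) := fun e =>
    acyclicFibration_surjective hq hf 0 _ (φ.map_deg 0 _ (arrow_old_mem e))
  choose x hx hpx using @hold
  -- cut down to the right end points by the idempotents
  let G : ∀ {r s : V ⊕ V}, DFrHom r s → X.carrier := fun {r s} e => E s * x e * E r
  have hG0 : ∀ {r s : V ⊕ V} (e : DFrHom r s), G e ∈ X.deg 0 := fun e =>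
    SetLike.GradedMul.mul_mem (i := 0) (j := 0)
      (SetLike.GradedMul.mul_mem (i := 0) (j := 0) (hE0 _) (hx e)) (hE0 _)
  have hGl : ∀ {r s : V ⊕ V} (e : DFrHom r s), E s * G e = G e := fun {r s} e => by
    simp only [G, ← mul_assoc, hE]
  have hGr : ∀ {r s : V ⊕ V} (e : DFrHom r s), G e * E r = G e := fun {r s} e => by
    simp only [G, mul_assoc, hE]
  have hpG : ∀ {r s : V ⊕ V} (e : DFrHom r s), p.alg (G e) = φ.alg (oldArrow e) := by
    intro r s e
    change p.alg (E s * x e * E r) = _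
    rw [map_mul, map_mul, hpE, hpE, hpx]
    refine (congrArg (· * _) (map_mul φ.alg _ _).symm).trans
      ((map_mul φ.alg _ _).symm.trans (congrArg φ.alg ?_))
    exact (congrArg (· * _) (PathAlg.e_mul_of (W := Theta V) _)).trans
      (PathAlg.of_mul_e (W := Theta V) _)
  have hm0 : ∀ a : V, momentElt G a ∈ X.deg 0 := by
    have h : ∀ {p q p' q' : V ⊕ V} (e : DFrHom p q) (e' : DFrHom p' q'),
        G e * G e' ∈ X.deg 0 := fun e e' =>
      SetLike.GradedMul.mul_mem (i := 0) (j := 0) (hG0 e) (hG0 e')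
    exact fun a => add_mem (sub_mem (sum_mem fun b _ => sum_mem fun γ _ => h _ _)
      (sum_mem fun b _ => sum_mem fun γ _ => h _ _)) (h _ _)
  have hpm : ∀ a : V, p.alg (momentElt G a) = φ.alg (muTheta a) := fun a =>
    (map_momentElt p.alg G (fun e => φ.alg (oldArrow e)) hpG a).trans
      (map_momentElt φ.alg _ _ (fun _ => rfl) a).symm
  have hloop : ∀ a : V, ∃ y ∈ X.deg 1, p.alg y = φ.alg (thetaArrow a) ∧
      X.d y = momentElt G a := by
    intro a
    obtain ⟨y, hy, hpy⟩ := acyclicFibration_surjective hq hf 1 (φ.alg (thetaArrow a))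
      (φ.map_deg 1 _ (thetaArrow_mem a))
    have hdy : p.alg (X.d y) = φ.alg (muTheta a) := by
      rw [p.map_d, hpy]
      exact (φ.map_d _).symm.trans (congrArg φ.alg (cofDG_d_loop a))
    -- correct the differential of `y` by an element of the kernel of `p`
    have hmem : momentElt G a - X.d y ∈ X.deg 0 := sub_mem (hm0 a) (X.d_mem 0 y hy)
    obtain ⟨c, hc, hpc, hdc⟩ := acyclicFibration_kernel hq hf 0 (momentElt G a - X.d y) hmem
      (X.d_zero _ hmem) (by rw [map_sub, hpm, hdy, sub_self])
    exact ⟨y + c, add_mem hy hc, by rw [map_add, hpc, hpy, add_zero],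
      by rw [map_add, hdc, add_sub_cancel]⟩
  choose y hy hpy hdy using hloop
  let L : V → X.carrier := fun a =>
    E (Sum.inl a) * y a * E (Sum.inl a)
  have hdE : ∀ a, X.d (E a) = 0 := fun a => X.d_zero _ (hE0 a)
  have hdL : ∀ a, X.d (L a) = momentElt G a := by
    intro a
    have h1 := X.leibniz 0 _ (hE0 (Sum.inl a)) (y a)
    have h2 := X.leibniz 1 (E (Sum.inl a) * y a)
      (SetLike.GradedMul.mul_mem (i := 0) (j := 1) (hE0 _) (hy a)) (E (Sum.inl a))
    rw [hdE, zero_mul, zero_add, pow_zero, one_smul, hdy,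
      mul_momentElt G a _ (fun e => hGl e)] at h1
    rw [hdE, mul_zero, smul_zero, add_zero, h1, momentElt_mul G a _ (fun e => hGr e)] at h2
    exact h2
  let F : ∀ {p q : Theta V}, (p ⟶ q) → X.carrier := fun {p q} f =>
    match p, q, f with
    | _, _, .old e => G e
    | _, _, .loop a => L a
  refine ⟨F, fun _ _ f => ?_, fun _ _ f => ?_, fun _ _ f => ?_, hdL, fun _ _ f => ?_⟩
  · refine theta_cases (P := fun {a b} f => E b * F f = F f) hGl (fun a => ?_) f
    change E _ * (E _ * y a * E _) = E _ * y a * E _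
    rw [← mul_assoc, ← mul_assoc, hE]
  · refine theta_cases (P := fun {a b} f => F f * E a = F f) hGr (fun a => ?_) f
    change E _ * y a * E _ * E _ = E _ * y a * E _
    rw [mul_assoc, hE]
  · refine theta_cases (P := fun {a b} f => F f ∈ X.deg (thetaDeg f)) hG0 (fun a => ?_) f
    exact SetLike.GradedMul.mul_mem (i := 1) (j := 0)
      (SetLike.GradedMul.mul_mem (i := 0) (j := 1) (hE0 _) (hy a)) (hE0 _)
  · refine theta_cases (P := fun {a b} f => p.alg (F f) = φ.alg (PathAlg.arrow f)) hpG
      (fun a => ?_) f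
    change p.alg (E _ * y a * E _) = _
    rw [map_mul, map_mul, hpE, hpy]
    refine (congrArg (· * _) (map_mul φ.alg _ _).symm).trans
      ((map_mul φ.alg _ _).symm.trans (congrArg φ.alg ?_))
    exact (congrArg (· * _) (PathAlg.e_mul_of (W := Theta V) _)).trans
      (PathAlg.of_mul_e (W := Theta V) _)

lemma vertexMap_single (p : Theta V) :
    PathAlg.vertexMap (W := Theta V) (Pi.single p 1) = PathAlg.e p := by
  change ∑ b, (Pi.single p (1 : ℂ) : Theta V → ℂ) b • PathAlg.e b = _
  rw [Finset.sum_eq_single p]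
  · rw [Pi.single_eq_same, one_smul]
  · intro b _ hb
    rw [Pi.single_eq_of_ne hb, zero_smul]
  · exact fun h => absurd (Finset.mem_univ p) h

variable (V) in
/-- The structure map `S → A_cof` is a cofibration. -/
lemma cofUnder_cofibrant : Cofibrant (cofUnder V) := by
  intro X B p hp
  refine ⟨fun {top} {φ} sq => ?_⟩
  have hcomm : ∀ c : V ⊕ V → ℂ, DGAlg.Hom.alg p (DGAlg.Hom.alg top c) =
      DGAlg.Hom.alg φ (PathAlg.vertexMap (W := Theta V) c) :=
    fun c => congrArg (fun g => DGAlg.Hom.alg g c) sq.w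
  let top' : (V ⊕ V → ℂ) →ₐ[ℂ] X.carrier := DGAlg.Hom.alg top
  let E : Theta V → X.carrier := fun a => top' (Pi.single a 1)
  have hE0 : ∀ a, E a ∈ X.deg 0 := fun a => DGAlg.Hom.map_deg top 0 _ (by
    change _ ∈ trivialDeg (V ⊕ V → ℂ) 0
    rw [trivialDeg, if_pos rfl]
    trivial)
  have hE : ∀ a b, E a * E b = if a = b then E a else 0 := by
    intro a b
    refine (map_mul top' _ _).symm.trans
      ((congrArg top' (single_mul_single (V := V) a b)).trans ?_)
    rw [apply_ite top', map_zero]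
    rfl
  have hE1 : ∑ a, E a = 1 := by
    refine (map_sum top' _ _).symm.trans ((congrArg top' sum_single_one).trans (map_one top'))
  have hpE : ∀ a, DGAlg.Hom.alg p (E a) = DGAlg.Hom.alg φ (PathAlg.e (W := Theta V) a) :=
    fun a => (hcomm _).trans (congrArg (DGAlg.Hom.alg φ) (vertexMap_single a))
  obtain ⟨F, hFl, hFr, hFdeg, hFd, hpF⟩ := exists_arrow_lift hp.1 hp.2 φ E hE0
    (fun a => (hE a a).trans (if_pos rfl)) hpE
  let u : cofDG V ⟶ X := cofLift X E F hE hE1 hFl hFr hE0 hFdeg hFd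
  refine ⟨⟨⟨u, ?_, ?_⟩⟩⟩
  · apply DGAlg.hom_ext
    intro s
    change PathAlg.lift E F hE hE1 hFl (∑ a : Theta V, s a • PathAlg.e a) = top' s
    rw [map_sum, map_eq_sum_single s top']
    simp only [map_smul]
    refine Finset.sum_congr rfl fun a _ => congrArg (s a • ·) ?_
    exact PathAlg.lift_e ..
  · have h : (DGAlg.Hom.alg p).comp (PathAlg.lift E F hE hE1 hFl) = DGAlg.Hom.alg φ := by
      refine PathAlg.algHom_ext (fun a => ?_) (fun {a b} f => ?_)
      · exact (congrArg (DGAlg.Hom.alg p) (PathAlg.lift_e E F hE hE1 hFl a)).trans (hpE a)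
      · exact (congrArg (DGAlg.Hom.alg p)
          (PathAlg.lift_arrow E F hE hE1 hFl f (hFr _ _ f))).trans (hpF _ _ f)
    exact DGAlg.hom_ext fun x => DFunLike.congr_fun h x

variable (V) in
/-- `A_cof` is a cofibrant replacement of `A`. -/
lemma cofProj_isCofibrantReplacement : IsCofibrantReplacement (cofProj V) where
  cofibrant := by
    have h : (Under.mkIdInitial.to (cofUnder V)).right = (cofUnder V).hom :=
      (Category.id_comp _).symm.trans (Under.w (Under.mkIdInitial.to (cofUnder V)))
    change cofibration (Under.mkIdInitial.to (cofUnder V)).right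
    rw [h]
    exact cofUnder_cofibrant V
  fibration := cofProj_fibration
  weakEquivalence := cofProj_quasiIso

end CofLift

/-! ### Block matrices over the dimension vectors -/

section Block
variable {V : Type} [Fintype V] [DecidableEq V] {v w : V → ℕ} {B : Type} [Ring B] [Algebra ℂ B]

/-- The matrix with a given block in the rows at the vertex `q` and the columns at the vertex `p`,
and zeros elsewhere. -/
def blockEmb (p q : V ⊕ V) (M : Matrix (Fin (dimVec v w q)) (Fin (dimVec v w p)) B) :
    Matrix (BasisIdx v w) (BasisIdx v w) B :=
  fun x y => if h : x.1 = q ∧ y.1 = p then M (h.1 ▸ x.2) (h.2 ▸ y.2) else 0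

lemma blockEmb_apply {p q : V ⊕ V} (M : Matrix (Fin (dimVec v w q)) (Fin (dimVec v w p)) B)
    (i : Fin (dimVec v w q)) (j : Fin (dimVec v w p)) :
    blockEmb p q M ⟨q, i⟩ ⟨p, j⟩ = M i j := dif_pos ⟨rfl, rfl⟩

lemma blockEmb_of_ne_left {p q : V ⊕ V}
    (M : Matrix (Fin (dimVec v w q)) (Fin (dimVec v w p)) B) {x y : BasisIdx v w} (h : x.1 ≠ q) :
    blockEmb p q M x y = 0 := dif_neg fun h' => h h'.1

lemma blockEmb_of_ne_right {p q : V ⊕ V}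
    (M : Matrix (Fin (dimVec v w q)) (Fin (dimVec v w p)) B) {x y : BasisIdx v w} (h : y.1 ≠ p) :
    blockEmb p q M x y = 0 := dif_neg fun h' => h h'.2

/-- A matrix that is supported on one block is determined by this block. -/
lemma eq_blockEmb {p q : V ⊕ V} {M : Matrix (Fin (dimVec v w q)) (Fin (dimVec v w p)) B}
    {N : Matrix (BasisIdx v w) (BasisIdx v w) B} (hl : ∀ x y, x.1 ≠ q → N x y = 0)
    (hr : ∀ x y, y.1 ≠ p → N x y = 0) (h : ∀ i j, N ⟨q, i⟩ ⟨p, j⟩ = M i j) :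
    N = blockEmb p q M := by
  ext ⟨x, i⟩ ⟨y, j⟩
  by_cases hx : x = q
  · subst hx
    by_cases hy : y = p
    · subst hy
      rw [h, blockEmb_apply]
    · rw [hr _ _ hy, blockEmb_of_ne_right _ hy]
  · rw [hl _ _ hx, blockEmb_of_ne_left _ hx]

lemma blockEmb_mul {p q r : V ⊕ V} (M : Matrix (Fin (dimVec v w r)) (Fin (dimVec v w q)) B)
    (N : Matrix (Fin (dimVec v w q)) (Fin (dimVec v w p)) B) :
    blockEmb q r M * blockEmb p q N = blockEmb p r (M * N) := by
  refine eq_blockEmb (fun x y hx => ?_) (fun x y hy => ?_) (fun i j => ?_)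
  · rw [Matrix.mul_apply]
    exact Finset.sum_eq_zero fun z _ => by rw [blockEmb_of_ne_left _ hx, zero_mul]
  · rw [Matrix.mul_apply]
    exact Finset.sum_eq_zero fun z _ => by rw [blockEmb_of_ne_right _ hy, mul_zero]
  · rw [Matrix.mul_apply, Fintype.sum_sigma, Finset.sum_eq_single q, Matrix.mul_apply]
    · exact Finset.sum_congr rfl fun k _ => by rw [blockEmb_apply, blockEmb_apply]
    · intro s _ hs
      exact Finset.sum_eq_zero fun k _ => by
        rw [blockEmb_of_ne_right (y := ⟨s, k⟩) _ hs, zero_mul]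
    · exact fun h => absurd (Finset.mem_univ q) h

/-- `blockEmb`, as a linear map. -/
def blockLin (p q : V ⊕ V) : Matrix (Fin (dimVec v w q)) (Fin (dimVec v w p)) B →ₗ[ℂ]
    Matrix (BasisIdx v w) (BasisIdx v w) B where
  toFun := blockEmb p q
  map_add' M N := by
    refine (eq_blockEmb (fun x y hx => ?_) (fun x y hy => ?_) (fun i j => ?_)).symm
    · rw [Matrix.add_apply, blockEmb_of_ne_left _ hx, blockEmb_of_ne_left _ hx, add_zero]
    · rw [Matrix.add_apply, blockEmb_of_ne_right _ hy, blockEmb_of_ne_right _ hy, add_zero]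
    · rw [Matrix.add_apply, blockEmb_apply, blockEmb_apply, Matrix.add_apply]
  map_smul' c M := by
    refine (eq_blockEmb (fun x y hx => ?_) (fun x y hy => ?_) (fun i j => ?_)).symm
    · rw [Matrix.smul_apply, RingHom.id_apply, blockEmb_of_ne_left _ hx, smul_zero]
    · rw [Matrix.smul_apply, RingHom.id_apply, blockEmb_of_ne_right _ hy, smul_zero]
    · rw [Matrix.smul_apply, RingHom.id_apply, blockEmb_apply, Matrix.smul_apply]

lemma blockEmb_map {C : Type} [Ring C] [Algebra ℂ C] (g : B →ₐ[ℂ] C) {p q : V ⊕ V}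
    (M : Matrix (Fin (dimVec v w q)) (Fin (dimVec v w p)) B) :
    g.mapMatrix (blockEmb p q M) = blockEmb p q (M.map g) := by
  refine eq_blockEmb (fun x y hx => ?_) (fun x y hy => ?_) (fun i j => ?_)
  · rw [AlgHom.mapMatrix_apply, Matrix.map_apply, blockEmb_of_ne_left _ hx, map_zero]
  · rw [AlgHom.mapMatrix_apply, Matrix.map_apply, blockEmb_of_ne_right _ hy, map_zero]
  · rw [AlgHom.mapMatrix_apply, Matrix.map_apply, blockEmb_apply, Matrix.map_apply]

lemma blockEmb_mapLinear (D : B →ₗ[ℂ] B) {p q : V ⊕ V}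
    (M : Matrix (Fin (dimVec v w q)) (Fin (dimVec v w p)) B) :
    (blockEmb p q M).map D = blockEmb p q (M.map D) := by
  refine eq_blockEmb (fun x y hx => ?_) (fun x y hy => ?_) (fun i j => ?_)
  · rw [Matrix.map_apply, blockEmb_of_ne_left _ hx, map_zero]
  · rw [Matrix.map_apply, blockEmb_of_ne_right _ hy, map_zero]
  · rw [Matrix.map_apply, blockEmb_apply, Matrix.map_apply]

variable (v w B) in
/-- The representation of `S` on `ℂ^v ⊕ ℂ^w`, with matrices over an algebra `B`. -/
def vertexMatrix : (V ⊕ V → ℂ) →ₐ[ℂ] Matrix (BasisIdx v w) (BasisIdx v w) B :=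
  ((Algebra.ofId ℂ B).mapMatrix).comp (rhoVW v w)

lemma vertexMatrix_single (q : V ⊕ V) : vertexMatrix v w B (Pi.single q 1) =
    Matrix.diagonal fun x => if x.1 = q then 1 else 0 := by
  ext x y
  change algebraMap ℂ B (rhoVW v w (Pi.single q 1) x y) = _
  have h : rhoVW v w (Pi.single q 1) x y =
      Matrix.diagonal (fun x : BasisIdx v w => (Pi.single q (1 : ℂ) : V ⊕ V → ℂ) x.1) x y := rfl
  rw [h, Matrix.diagonal_apply, Matrix.diagonal_apply, Pi.single_apply]
  split_ifs <;> simp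

lemma vertexMatrix_mul_blockEmb {p q : V ⊕ V}
    (M : Matrix (Fin (dimVec v w q)) (Fin (dimVec v w p)) B) :
    vertexMatrix v w B (Pi.single q 1) * blockEmb p q M = blockEmb p q M := by
  rw [vertexMatrix_single]
  refine eq_blockEmb (fun x y hx => ?_) (fun x y hy => ?_) (fun i j => ?_)
  · rw [Matrix.diagonal_mul, if_neg hx, zero_mul]
  · rw [Matrix.diagonal_mul, blockEmb_of_ne_right _ hy, mul_zero]
  · rw [Matrix.diagonal_mul, if_pos rfl, one_mul, blockEmb_apply]

lemma blockEmb_mul_vertexMatrix {p q : V ⊕ V}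
    (M : Matrix (Fin (dimVec v w q)) (Fin (dimVec v w p)) B) :
    blockEmb p q M * vertexMatrix v w B (Pi.single p 1) = blockEmb p q M := by
  rw [vertexMatrix_single]
  refine eq_blockEmb (fun x y hx => ?_) (fun x y hy => ?_) (fun i j => ?_)
  · rw [Matrix.mul_diagonal, blockEmb_of_ne_left _ hx, zero_mul]
  · rw [Matrix.mul_diagonal, if_neg hy, mul_zero]
  · rw [Matrix.mul_diagonal, if_pos rfl, mul_one, blockEmb_apply]

/-- A matrix that is fixed by the idempotents of two vertices is supported on one block. -/
lemma eq_blockEmb_of_mul {p q : V ⊕ V} {N : Matrix (BasisIdx v w) (BasisIdx v w) B}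
    (hl : vertexMatrix v w B (Pi.single q 1) * N = N)
    (hr : N * vertexMatrix v w B (Pi.single p 1) = N) :
    N = blockEmb p q (fun i j => N ⟨q, i⟩ ⟨p, j⟩) := by
  rw [vertexMatrix_single] at hl hr
  refine eq_blockEmb (fun x y hx => ?_) (fun x y hy => ?_) (fun i j => rfl)
  · rw [← hl, Matrix.diagonal_mul, if_neg hx, zero_mul]
  · rw [← hr, Matrix.mul_diagonal, if_neg hy, mul_zero]

lemma momentElt_blockEmb {R : Type} [CommRing R] [Algebra ℂ R] [Quiver.{0} V]
    [∀ a b : V, Fintype (a ⟶ b)] (X : RepSpace v w R) (a : V) :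
    momentElt (fun {p q} (e : DFrHom p q) => blockEmb p q (X e)) a =
      blockEmb (.inl a) (.inl a) (momentMap X a) := by
  change _ = blockLin (v := v) (w := w) (B := R) (.inl a) (.inl a) (momentMap X a)
  simp only [momentElt, blockEmb_mul]
  refine Eq.symm ((map_add (blockLin (v := v) (w := w) (B := R) (.inl a) (.inl a)) _ _).trans ?_)
  refine congrArg₂ (· + ·) ((map_sub (blockLin (.inl a) (.inl a)) _ _).trans ?_) rfl
  refine congrArg₂ (· - ·) ((map_sum (blockLin (.inl a) (.inl a)) _ _).trans ?_)
    ((map_sum (blockLin (.inl a) (.inl a)) _ _).trans ?_)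
  · exact Finset.sum_congr rfl fun b _ => map_sum (blockLin (.inl a) (.inl a)) _ _
  · exact Finset.sum_congr rfl fun b _ => map_sum (blockLin (.inl a) (.inl a)) _ _

end Block

/-! ### The representation algebra of `A_cof` is the Koszul complex of the moment map -/

section GradedInjective

/-- An injective map of dg-algebras reflects degrees. -/
lemma mem_deg_of_injective {A B : DGAlg} (f : A ⟶ B) (hf : Function.Injective f.alg) {p : ℕ}
    {x : A.carrier} (hx : f.alg x ∈ B.deg p) : x ∈ A.deg p := by
  have h : ∀ y : A.carrier, f.alg (decompose A.deg y p : A.carrier) =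
      (decompose B.deg (f.alg y) p : B.carrier) := by
    refine fun y => A.induction (P := fun y => f.alg (decompose A.deg y p : A.carrier) =
      (decompose B.deg (f.alg y) p : B.carrier)) ?_ ?_ y
    · intro q a ha
      by_cases hq : q = p
      · subst hq
        rw [decompose_of_mem_same _ ha, decompose_of_mem_same _ (f.map_deg _ _ ha)]
      · rw [decompose_of_mem_ne _ ha hq, decompose_of_mem_ne _ (f.map_deg _ _ ha) hq, map_zero]
    · intro a b ha hb
      rw [decompose_add, map_add, decompose_add, DirectSum.add_apply, DirectSum.add_apply,
        Submodule.coe_add, Submodule.coe_add, map_add, ha, hb]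
  have h2 := (h x).trans (decompose_of_mem_same _ hx)
  rw [← hf h2]
  exact SetLike.coe_mem _

/-- A map of commutative dg-algebras with an inverse as a map of algebras is an isomorphism. -/
def isoOfAlgInverse {A B : CDGAlg} (f : A ⟶ B) (g : B.obj.carrier →ₐ[ℂ] A.obj.carrier)
    (hfg : ∀ y, DGAlg.Hom.alg f.hom (g y) = y) (hgf : ∀ x, g (DGAlg.Hom.alg f.hom x) = x) :
    A ≅ B where
  hom := f
  inv := ⟨{ alg := g
            map_deg := fun p y hy =>
              mem_deg_of_injective f.hom (Function.LeftInverse.injective hgf)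
                ((hfg y).symm ▸ hy)
            map_d := fun y => by
              have h := f.hom.map_d (g y)
              rw [hfg] at h
              rw [← h, hgf] }⟩
  hom_inv_id := by
    apply ObjectProperty.hom_ext
    exact DGAlg.hom_ext hgf
  inv_hom_id := by
    apply ObjectProperty.hom_ext
    exact DGAlg.hom_ext hfg

end GradedInjective

section KoszulIso
variable {V : Type} [Fintype V] [DecidableEq V] [Quiver.{0} V] [∀ a b : V, Fintype (a ⟶ b)]
  (v w : V → ℕ)

/-- The algebra underlying the Koszul complex of the moment map. -/
abbrev KoszulAlg : Type := FunRing v w ⊗[ℂ] ExteriorAlgebra ℂ (LieG v)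

/-- The coordinate functions, as elements of the Koszul complex. -/
def koszulCoord {p q : V ⊕ V} (e : DFrHom p q) :
    Matrix (Fin (dimVec v w q)) (Fin (dimVec v w p)) (KoszulAlg v w) :=
  fun i j => (MvPolynomial.X ⟨p, q, e, i, j⟩ : FunRing v w) ⊗ₜ[ℂ]
    (1 : ExteriorAlgebra ℂ (LieG v))

/-- The elementary matrices in `g_v`, as elements of the Koszul complex. -/
def koszulElem (a : V) : Matrix (Fin (dimVec v w (.inl a))) (Fin (dimVec v w (.inl a)))
    (KoszulAlg v w) :=
  fun (i j : Fin (v a)) => (1 : FunRing v w) ⊗ₜ[ℂ]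
    ExteriorAlgebra.ι ℂ (Pi.single a (Matrix.single j i (1 : ℂ)) : LieG v)

/-- The matrices of the arrows of `Q^ϑ` over the Koszul complex. -/
def koszulArrow : ∀ {p q : Theta V}, (p ⟶ q) →
    Matrix (BasisIdx v w) (BasisIdx v w) (KoszulAlg v w)
  | p, q, .old e => blockEmb p q (koszulCoord v w e)
  | _, _, .loop a => blockEmb (.inl a) (.inl a) (koszulElem v w a)

/-- The Koszul differential, as a linear endomorphism. -/
def koszulDiff : KoszulAlg v w →ₗ[ℂ] KoszulAlg v w := (koszulMoment v w).obj.d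

lemma koszulElem_d (a : V) (i j : Fin (v a)) :
    (koszulMoment v w).obj.d (koszulElem v w a i j) =
      (momentMap (genericPoint v w) a i j) ⊗ₜ[ℂ] (1 : ExteriorAlgebra ℂ (LieG v)) := by
  refine (koszulD_ι _ _ _).trans ?_
  congr 1
  rw [Finset.sum_eq_single ⟨a, i, j⟩]
  · have h : entryForm v a j i (Pi.single a (Matrix.single j i (1 : ℂ))) = 1 := by
      simp [entryForm]
    rw [h, one_smul]
  · rintro ⟨b, k, l⟩ _ hb
    have h : entryForm v b l k (Pi.single a (Matrix.single j i (1 : ℂ))) = 0 := by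
      by_cases hab : b = a
      · subst hab
        have hkl : ¬(j = l ∧ i = k) := by
          rintro ⟨rfl, rfl⟩
          exact hb rfl
        simp only [entryForm, LinearMap.comp_apply, LinearMap.proj_apply, Pi.single_eq_same,
          Matrix.entryLinearMap_apply]
        exact Matrix.single_apply_of_ne _ _ _ _ _ hkl
      · simp [entryForm, Pi.single_eq_of_ne hab]
    rw [h, zero_smul]
  · exact fun h => absurd (Finset.mem_univ _) h

/-- The functions on `M(Q, v, w)` as elements of degree `0` of the Koszul complex. -/
def funIncl : FunRing v w →ₐ[ℂ] KoszulAlg v w := Algebra.TensorProduct.includeLeft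

lemma momentElt_koszulArrow (a : V) :
    momentElt (fun {p q} (e : DFrHom (V := V) p q) => blockEmb p q (koszulCoord v w e)) a =
      blockEmb (.inl a) (.inl a) ((momentMap (genericPoint v w) a).map (funIncl v w)) := by
  refine (map_momentElt (funIncl v w).mapMatrix
    (fun {p q} (e : DFrHom (V := V) p q) => blockEmb p q (genericPoint v w e)) _
    (fun {p q} e => blockEmb_map _ _) a).symm.trans ?_
  exact (congrArg _ (momentElt_blockEmb (genericPoint v w) a)).trans
    (blockEmb_map (funIncl v w) (p := .inl a) (q := .inl a) _)

lemma tmul_one_mem_koszulDeg (r : FunRing v w) :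
    r ⊗ₜ[ℂ] (1 : ExteriorAlgebra ℂ (LieG v)) ∈ koszulDeg (LieG v) (FunRing v w) 0 :=
  tmul_mem_koszulDeg r SetLike.GradedOne.one_mem

lemma koszulElem_mem (a : V) (i j : Fin (v a)) :
    koszulElem v w a i j ∈ koszulDeg (LieG v) (FunRing v w) 1 :=
  tmul_mem_koszulDeg _ (by
    rw [ExteriorAlgebra.exteriorPower, pow_one]; exact ⟨_, rfl⟩)

lemma blockEmb_mem {m : ℕ} {p q : V ⊕ V}
    {M : Matrix (Fin (dimVec v w q)) (Fin (dimVec v w p)) (KoszulAlg v w)}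
    (h : ∀ i j, M i j ∈ koszulDeg (LieG v) (FunRing v w) m) (x y : BasisIdx v w) :
    blockEmb p q M x y ∈ koszulDeg (LieG v) (FunRing v w) m := by
  rw [blockEmb]
  split
  · exact h _ _
  · exact zero_mem _

lemma koszulArrow_mem {p q : Theta V} (f : p ⟶ q) (x y : BasisIdx v w) :
    koszulArrow v w f x y ∈ koszulDeg (LieG v) (FunRing v w) (thetaDeg f) := by
  refine theta_cases (P := fun {p q} f =>
    koszulArrow v w f x y ∈ koszulDeg (LieG v) (FunRing v w) (thetaDeg f)) ?_ ?_ f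
  · exact fun {p q} e => blockEmb_mem v w (M := koszulCoord v w e) (fun i j => tmul_one_mem_koszulDeg v w _) x y
  · exact fun a => blockEmb_mem v w (M := koszulElem v w a) (fun i j => koszulElem_mem v w a i j) x y

/-- The idempotents of the vertices, as matrices over the Koszul complex. -/
def koszulVertex (p : V ⊕ V) : Matrix (BasisIdx v w) (BasisIdx v w) (KoszulAlg v w) :=
  vertexMatrix v w (KoszulAlg v w) (Pi.single p 1)

lemma koszulVertex_mul_arrow {p q : Theta V} (f : p ⟶ q) :
    koszulVertex v w q * koszulArrow v w f = koszulArrow v w f :=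
  theta_cases (P := fun {p q} f => koszulVertex v w q * koszulArrow v w f = koszulArrow v w f)
    (fun _ => vertexMatrix_mul_blockEmb _) (fun _ => vertexMatrix_mul_blockEmb _) f

lemma koszulArrow_mul_vertex {p q : Theta V} (f : p ⟶ q) :
    koszulArrow v w f * koszulVertex v w p = koszulArrow v w f :=
  theta_cases (P := fun {p q} f => koszulArrow v w f * koszulVertex v w p = koszulArrow v w f)
    (fun _ => blockEmb_mul_vertexMatrix _) (fun _ => blockEmb_mul_vertexMatrix _) f

lemma koszulVertex_mul (p q : V ⊕ V) : koszulVertex v w p * koszulVertex v w q =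
    if p = q then koszulVertex v w p else 0 := by
  rw [koszulVertex, koszulVertex, ← map_mul, single_mul_single, apply_ite (vertexMatrix v w _),
    map_zero]

lemma koszulVertex_sum : ∑ p : V ⊕ V, koszulVertex v w p = 1 := by
  simp only [koszulVertex]
  rw [← map_sum, sum_single_one, map_one]

lemma koszulVertex_mem (p : V ⊕ V) (x y : BasisIdx v w) :
    koszulVertex v w p x y ∈ koszulDeg (LieG v) (FunRing v w) 0 :=
  SetLike.algebraMap_mem_graded (koszulDeg (LieG v) (FunRing v w)) _

/-- The universal representation of `A_cof` over the Koszul complex, as a map of dg-algebras. -/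
def koszulRepDG : cofDG V ⟶ matrixDG (BasisIdx v w) (koszulMoment v w).obj :=
  cofLift (matrixDG (BasisIdx v w) (koszulMoment v w).obj) (fun p => koszulVertex v w p)
    (fun f => koszulArrow v w f) (fun p q => koszulVertex_mul v w p q) (koszulVertex_sum v w)
    (fun _ _ f => koszulVertex_mul_arrow v w f) (fun _ _ f => koszulArrow_mul_vertex v w f)
    (fun p => koszulVertex_mem v w p) (fun _ _ f => koszulArrow_mem v w f)
    (fun a => by
      refine (blockEmb_mapLinear (v := v) (w := w) (koszulDiff v w) (koszulElem v w a)).trans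
        (Eq.trans (congrArg (blockEmb _ _) ?_) (momentElt_koszulArrow v w a).symm)
      exact Matrix.ext fun i j => koszulElem_d v w a i j)

lemma koszulRepDG_e (p : V ⊕ V) :
    DGAlg.Hom.alg (koszulRepDG v w) (PathAlg.e (W := Theta V) p) = koszulVertex v w p :=
  cofLift_e ..

lemma koszulRepDG_arrow {p q : Theta V} (f : p ⟶ q) :
    DGAlg.Hom.alg (koszulRepDG v w) (PathAlg.arrow f) = koszulArrow v w f :=
  cofLift_arrow ..

/-- The universal representation of `A_cof` over the Koszul complex. -/
def koszulRep : cofUnder V ⟶ (matrixFunctor (rhoVW v w)).obj (koszulMoment v w) :=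
  Under.homMk (U := cofUnder V) (V := matrixUnder (rhoVW v w) (koszulMoment v w).obj)
    (koszulRepDG v w) (by
      apply DGAlg.hom_ext
      intro s
      change DGAlg.Hom.alg (koszulRepDG v w) (∑ p : Theta V, s p • PathAlg.e p) =
        vertexMatrix v w (KoszulAlg v w) s
      refine (map_sum (DGAlg.Hom.alg (koszulRepDG v w)) _ _).trans
        (Eq.trans ?_ (map_eq_sum_single s (vertexMatrix v w (KoszulAlg v w))).symm)
      refine Finset.sum_congr rfl fun p _ => ?_
      exact (map_smul (DGAlg.Hom.alg (koszulRepDG v w)) (s p) _).trans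
        (congrArg (s p • ·) (koszulRepDG_e v w p)))

/-- The map `(A_cof)_{v,w} → O(M(Q, v, w)) ⊗ Λ^• g_v`. -/
def repToKoszul : repObj (rhoVW v w) (cofUnder V) ⟶ koszulMoment v w :=
  repDesc (rhoVW v w) (koszulMoment v w) (koszulRep v w)

lemma repToKoszul_arrow {p q : Theta V} (f : p ⟶ q) (x y : BasisIdx v w) :
    DGAlg.Hom.alg (repToKoszul v w).hom (repGen (rhoVW v w) (cofUnder V) x y (PathAlg.arrow f)) =
      koszulArrow v w f x y :=
  (repDesc_gen (rhoVW v w) (koszulMoment v w) (koszulRep v w) x y _).trans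
    (congrFun (congrFun (koszulRepDG_arrow v w f) x) y)

lemma repToKoszul_old {p q : V ⊕ V} (e : DFrHom p q) (i : Fin (dimVec v w q))
    (j : Fin (dimVec v w p)) :
    DGAlg.Hom.alg (repToKoszul v w).hom
      (repGen (rhoVW v w) (cofUnder V) ⟨q, i⟩ ⟨p, j⟩ (oldArrow e)) =
      (MvPolynomial.X ⟨p, q, e, i, j⟩ : FunRing v w) ⊗ₜ[ℂ] (1 : ExteriorAlgebra ℂ (LieG v)) :=
  (repToKoszul_arrow v w (p := p) (q := q) (ThetaHom.old e) _ _).trans (blockEmb_apply _ i j)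

lemma repToKoszul_loop (a : V) (i j : Fin (v a)) :
    DGAlg.Hom.alg (repToKoszul v w).hom
      (repGen (rhoVW v w) (cofUnder V) ⟨.inl a, i⟩ ⟨.inl a, j⟩ (thetaArrow a)) =
      (1 : FunRing v w) ⊗ₜ[ℂ]
        ExteriorAlgebra.ι ℂ (Pi.single a (Matrix.single j i (1 : ℂ)) : LieG v) :=
  (repToKoszul_arrow v w (p := (Sum.inl a : V ⊕ V)) (q := (Sum.inl a : V ⊕ V))
    (ThetaHom.loop a) _ _).trans (blockEmb_apply (v := v) (w := w) (koszulElem v w a) i j)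

end KoszulIso

section KoszulInverse
variable {V : Type} [Fintype V] [DecidableEq V] [Quiver.{0} V] [∀ a b : V, Fintype (a ⟶ b)]
  (v w : V → ℕ)

variable (V) in
/-- The algebra underlying `(A_cof)_{v,w}`. -/
abbrev CofRepAlg : Type := RepAlg (rhoVW v w) (cofUnder V)

/-- The matrix entries of an arrow of the framed doubled quiver, in `(A_cof)_{v,w}`. -/
def oldEntry (k : CoordIdx v w) : CofRepAlg V v w :=
  repGen (rhoVW v w) (cofUnder V) ⟨k.2.1, k.2.2.2.1⟩ ⟨k.1, k.2.2.2.2⟩ (oldArrow k.2.2.1)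

/-- The matrix entries of a loop, in `(A_cof)_{v,w}`. -/
def loopEntry (a : V) (i j : Fin (v a)) : CofRepAlg V v w :=
  repGen (rhoVW v w) (cofUnder V) ⟨.inl a, i⟩ ⟨.inl a, j⟩ (thetaArrow a)

/-- By graded commutativity, elements of degree `0` are central. -/
lemma repDeg_zero_mem_center {x : CofRepAlg V v w}
    (hx : x ∈ repDeg (rhoVW v w) (cofUnder V) 0) :
    x ∈ Subalgebra.center ℂ (CofRepAlg V v w) := by
  rw [Subalgebra.mem_center_iff]
  intro y
  refine (repDG (rhoVW v w) (cofUnder V)).induction 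
    (P := fun y : CofRepAlg V v w => y * x = x * y) ?_ ?_ y
  · intro q b hb
    have h := repAlg_comm (rhoVW v w) (cofUnder V) 0 q x hx b hb
    rw [zero_mul, pow_zero, one_smul] at h
    exact h.symm
  · intro a b ha hb
    exact (add_mul a b x).trans ((congrArg₂ (· + ·) ha hb).trans (mul_add x a b).symm)

lemma oldEntry_mem (k : CoordIdx v w) :
    oldEntry v w k ∈ repDeg (rhoVW v w) (cofUnder V) 0 :=
  repGen_mem (rhoVW v w) (A := cofUnder V) (arrow_old_mem k.2.2.1) _ _

lemma loopEntry_mem (a : V) (i j : Fin (v a)) :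
    loopEntry v w a i j ∈ repDeg (rhoVW v w) (cofUnder V) 1 :=
  repGen_mem (rhoVW v w) (A := cofUnder V) (thetaArrow_mem a) _ _

/-- The functions on `M(Q, v, w)` in `(A_cof)_{v,w}`; they are central there. -/
def funToRep : FunRing v w →ₐ[ℂ] CofRepAlg V v w :=
  (Subalgebra.center ℂ (CofRepAlg V v w)).val.comp
    (MvPolynomial.aeval fun k => ⟨oldEntry v w k, repDeg_zero_mem_center v w (oldEntry_mem v w k)⟩)

lemma funToRep_X (k : CoordIdx v w) : funToRep v w (MvPolynomial.X k) = oldEntry v w k := by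
  rw [funToRep, AlgHom.comp_apply, MvPolynomial.aeval_X]
  rfl

lemma funToRep_comm (r : FunRing v w) (x : CofRepAlg V v w) : Commute (funToRep v w r) x := by
  have h : funToRep v w r ∈ Subalgebra.center ℂ (CofRepAlg V v w) := SetLike.coe_mem _
  exact (Subalgebra.mem_center_iff.1 h x).symm

/-- The linear map from `g_v` to `(A_cof)_{v,w}` that sends the elementary matrix `E_{ji}` at the
vertex `a` to the entry `(ϑ_a)_{ij}`. -/
def lieToRep : LieG v →ₗ[ℂ] CofRepAlg V v w :=
  ∑ a : V, ∑ i : Fin (v a), ∑ j : Fin (v a),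
    (entryForm v a j i).smulRight (loopEntry v w a i j)

lemma lieToRep_single (a : V) (i j : Fin (v a)) :
    lieToRep v w (Pi.single a (Matrix.single j i 1)) = loopEntry v w a i j := by
  simp only [lieToRep, LinearMap.sum_apply, LinearMap.smulRight_apply]
  rw [Finset.sum_eq_single a, Finset.sum_eq_single i, Finset.sum_eq_single j]
  · simp [entryForm]
  · intro l _ hl
    have h : entryForm v a l i (Pi.single a (Matrix.single j i (1 : ℂ))) = 0 := by
      simp [entryForm, hl.symm]
    rw [h, zero_smul]
  · exact fun h => absurd (Finset.mem_univ _) h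
  · intro k _ hk
    refine Finset.sum_eq_zero fun l _ => ?_
    have h : entryForm v a l k (Pi.single a (Matrix.single j i (1 : ℂ))) = 0 := by
      simp [entryForm, hk.symm]
    rw [h, zero_smul]
  · exact fun h => absurd (Finset.mem_univ _) h
  · intro b _ hb
    refine Finset.sum_eq_zero fun k _ => Finset.sum_eq_zero fun l _ => ?_
    have h : entryForm v b l k (Pi.single a (Matrix.single j i (1 : ℂ))) = 0 := by
      simp [entryForm, Pi.single_eq_of_ne hb]
    rw [h, zero_smul]
  · exact fun h => absurd (Finset.mem_univ _) h

lemma lieToRep_mem (ξ : LieG v) : lieToRep v w ξ ∈ repDeg (rhoVW v w) (cofUnder V) 1 := by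
  simp only [lieToRep, LinearMap.sum_apply, LinearMap.smulRight_apply]
  exact sum_mem fun a _ => sum_mem fun i _ => sum_mem fun j _ =>
    Submodule.smul_mem _ _ (loopEntry_mem v w a i j)

lemma lieToRep_sq (ξ : LieG v) : lieToRep v w ξ * lieToRep v w ξ = 0 := by
  have h := repAlg_comm (rhoVW v w) (cofUnder V) 1 1 _ (lieToRep_mem v w ξ) _
    (lieToRep_mem v w ξ)
  rw [mul_one, pow_one, neg_one_smul] at h
  have h2 : (2 : ℂ) • (lieToRep v w ξ * lieToRep v w ξ) = 0 := by
    rw [two_smul]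
    exact eq_neg_iff_add_eq_zero.1 h
  exact (IsUnit.smul_eq_zero (IsUnit.mk0 (2 : ℂ) two_ne_zero)).1 h2

/-- The map `O(M(Q, v, w)) ⊗ Λ^• g_v → (A_cof)_{v,w}`, as a map of algebras. -/
def koszulToRep : KoszulAlg v w →ₐ[ℂ] CofRepAlg V v w :=
  Algebra.TensorProduct.lift (funToRep v w)
    (ExteriorAlgebra.lift ℂ ⟨lieToRep v w, lieToRep_sq v w⟩)
    (fun r x => funToRep_comm v w r _)

lemma koszulToRep_coord {p q : V ⊕ V} (e : DFrHom p q) (i : Fin (dimVec v w q))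
    (j : Fin (dimVec v w p)) :
    koszulToRep v w (koszulCoord v w e i j) =
      repGen (rhoVW v w) (cofUnder V) ⟨q, i⟩ ⟨p, j⟩ (oldArrow e) := by
  rw [koszulToRep, koszulCoord, Algebra.TensorProduct.lift_tmul, map_one, mul_one, funToRep_X]
  rfl

lemma koszulToRep_elem (a : V) (i j : Fin (v a)) :
    koszulToRep v w (koszulElem v w a i j) = loopEntry v w a i j := by
  rw [koszulToRep, koszulElem, Algebra.TensorProduct.lift_tmul, map_one, one_mul,
    ExteriorAlgebra.lift_ι_apply, lieToRep_single]

lemma repToKoszul_koszulToRep (y : KoszulAlg v w) :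
    DGAlg.Hom.alg (repToKoszul v w).hom (koszulToRep v w y) = y := by
  let G : CofRepAlg V v w →ₐ[ℂ] KoszulAlg v w := DGAlg.Hom.alg (repToKoszul v w).hom
  have h : G.comp (koszulToRep v w) = AlgHom.id ℂ _ := by
    refine Algebra.TensorProduct.ext ?_ ?_
    · refine MvPolynomial.algHom_ext fun k => ?_
      obtain ⟨p, q, e, i, j⟩ := k
      exact (congrArg G (koszulToRep_coord v w e i j)).trans (repToKoszul_old v w e i j)
    · refine ExteriorAlgebra.hom_ext ?_
      refine LinearMap.pi_ext' fun a => Matrix.ext_linearMap ℂ fun j i => LinearMap.ext_ring ?_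
      exact (congrArg G (koszulToRep_elem v w a i j)).trans (repToKoszul_loop v w a i j)
  exact DFunLike.congr_fun h y

/-- The universal representation of `A_cof` over `(A_cof)_{v,w}`. -/
def cofRepUniv : PathAlg (Theta V) →ₐ[ℂ] Matrix (BasisIdx v w) (BasisIdx v w) (CofRepAlg V v w) :=
  repUniv (rhoVW v w) (cofUnder V)

lemma cofRepUniv_e (p : V ⊕ V) : cofRepUniv v w (PathAlg.e (W := Theta V) p) =
    vertexMatrix v w (CofRepAlg V v w) (Pi.single p 1) := by
  ext x y
  refine (congrArg (fun z => repGen (rhoVW v w) (cofUnder V) x y z)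
    (vertexMap_single (V := V) p)).symm.trans ?_
  exact repGen_base (rhoVW v w) (cofUnder V) (Pi.single p 1) x y

lemma cofRepUniv_arrow {p q : Theta V} (f : p ⟶ q) :
    cofRepUniv v w (PathAlg.arrow f) = blockEmb p q (fun i j =>
      repGen (rhoVW v w) (cofUnder V) ⟨q, i⟩ ⟨p, j⟩ (PathAlg.arrow f)) := by
  refine eq_blockEmb_of_mul ?_ ?_
  · exact (congrArg (· * _) (cofRepUniv_e v w q).symm).trans
      ((map_mul (cofRepUniv v w) _ _).symm.trans
        (congrArg (cofRepUniv v w) (PathAlg.e_mul_of _)))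
  · exact (congrArg (_ * ·) (cofRepUniv_e v w p).symm).trans
      ((map_mul (cofRepUniv v w) _ _).symm.trans
        (congrArg (cofRepUniv v w) (PathAlg.of_mul_e _)))

lemma koszulToRep_arrow {p q : Theta V} (f : p ⟶ q) :
    (koszulToRep v w).mapMatrix (koszulArrow v w f) = cofRepUniv v w (PathAlg.arrow f) := by
  refine theta_cases (P := fun {p q} f =>
    (koszulToRep v w).mapMatrix (koszulArrow v w f) = cofRepUniv v w (PathAlg.arrow f)) ?_ ?_ f
  · intro p q e
    refine (blockEmb_map _ _).trans (Eq.trans ?_ (cofRepUniv_arrow v w (p := p) (q := q) _).symm)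
    exact congrArg (blockEmb p q) (Matrix.ext fun i j => koszulToRep_coord v w e i j)
  · intro a
    refine (blockEmb_map (koszulToRep v w) (koszulElem v w a)).trans
      (Eq.trans ?_ (cofRepUniv_arrow v w (p := (Sum.inl a : V ⊕ V)) (q := (Sum.inl a : V ⊕ V))
        _).symm)
    exact congrArg (blockEmb (.inl a) (.inl a))
      (Matrix.ext fun i j => koszulToRep_elem v w a i j)

lemma koszulToRep_repToKoszul (x : CofRepAlg V v w) :
    koszulToRep v w (DGAlg.Hom.alg (repToKoszul v w).hom x) = x := by
  let G : CofRepAlg V v w →ₐ[ℂ] KoszulAlg v w := DGAlg.Hom.alg (repToKoszul v w).hom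
  let U : PathAlg (Theta V) →ₐ[ℂ] Matrix (BasisIdx v w) (BasisIdx v w) (KoszulAlg v w) :=
    DGAlg.Hom.alg (koszulRepDG v w)
  have hU : (koszulToRep v w).mapMatrix.comp U = cofRepUniv v w := by
    refine PathAlg.algHom_ext (fun p => ?_) (fun {p q} f => ?_)
    · refine (congrArg (koszulToRep v w).mapMatrix (koszulRepDG_e v w p)).trans
        (Eq.trans ?_ (cofRepUniv_e v w p).symm)
      exact Matrix.ext fun x y => (koszulToRep v w).commutes _
    · exact (congrArg (koszulToRep v w).mapMatrix (koszulRepDG_arrow v w f)).trans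
        (koszulToRep_arrow v w f)
  have h : (koszulToRep v w).comp G = AlgHom.id ℂ _ := by
    refine rep_algHom_ext (rhoVW v w) (cofUnder V) fun i j a => ?_
    have h1 : G (repGen (rhoVW v w) (cofUnder V) i j a) = U a i j :=
      repDesc_gen (rhoVW v w) (koszulMoment v w) (koszulRep v w) i j a
    exact (congrArg (koszulToRep v w) h1).trans
      (congrFun (congrFun (DFunLike.congr_fun hU a) i) j)
  exact DFunLike.congr_fun h x

/-- The isomorphism `(A_cof)_{v,w} ≅ O(M(Q, v, w)) ⊗ Λ^• g_v`. -/
def repIsoKoszul : (repFunctor (rhoVW v w)).obj (cofUnder V) ≅ koszulMoment v w :=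
  isoOfAlgInverse (A := repObj (rhoVW v w) (cofUnder V)) (repToKoszul v w) (koszulToRep v w)
    (repToKoszul_koszulToRep v w) (koszulToRep_repToKoszul v w)

end KoszulInverse

end DRepKoszul
end

open DRepKoszul
theorem theorem3p9 (V : Type) [Fintype V] [DecidableEq V] [Quiver.{0} V]
    [∀ a b : V, Fintype (a ⟶ b)] :
    -- `π : A_cof → A` is a cofibrant replacement of `A` in `DGA_S^+`
    IsCofibrantReplacement (cofProj V) ∧
    ∀ v w : V → ℕ,
      -- the derived representation functor `L(-)_{v,w}` exists
      ∃ (_ : (repToHo (rhoVW v w)).HasLeftDerivedFunctor (quasiIsoUnder (V ⊕ V → ℂ)))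
        -- `DRep_{v,w}(A) ≅ Rep_{v,w}(A_cof)` in `Ho(DGAff)`
        (Φ : DRepScheme (rhoVW v w) (nakUnder V) ≅
          toHoDGAff.obj (RepScheme (rhoVW v w) (cofUnder V)))
        -- `Rep_{v,w}(A_cof) ≅ Spec(O(M(Q, v, w)) ⊗ Λ^• g_v)` in `DGAff`
        (Ψ : RepScheme (rhoVW v w) (cofUnder V) ≅ Spec (koszulMoment v w)),
        -- `Φ` is the isomorphism induced by the cofibrant resolution `π`
        (derivedRepCounit (rhoVW v w)).app (cofUnder V) ≫ Φ.hom.unop =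
            (derivedRep (rhoVW v w)).map ((toHoDGAUnder (V ⊕ V → ℂ)).map (cofProj V)) ∧
        -- `Ψ` matches the entries of the old arrows with the coordinates of `M(Q, v, w)`
        (∀ (p q : V ⊕ V) (e : DFrHom p q) (i : Fin (dimVec v w q)) (j : Fin (dimVec v w p)),
          DGAlg.Hom.alg Ψ.inv.unop.hom
            (repGen (rhoVW v w) (cofUnder V) ⟨q, i⟩ ⟨p, j⟩
              (PathAlg.arrow (W := Theta V) (a := p) (b := q) (ThetaHom.old e))) =
          (MvPolynomial.X ⟨p, q, e, i, j⟩ : FunRing v w) ⊗ₜ[ℂ]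
            (1 : ExteriorAlgebra ℂ (LieG v))) ∧
        -- and the entries of the loops `ϑ_a` with the elementary matrices in `g_v`
        (∀ (a : V) (i j : Fin (v a)),
          DGAlg.Hom.alg Ψ.inv.unop.hom
            (repGen (rhoVW v w) (cofUnder V) ⟨.inl a, i⟩ ⟨.inl a, j⟩
              (PathAlg.arrow (W := Theta V) (a := (.inl a : V ⊕ V)) (b := (.inl a : V ⊕ V))
                (ThetaHom.loop a))) =
          (1 : FunRing v w) ⊗ₜ[ℂ]
            ExteriorAlgebra.ι ℂ (Pi.single a (Matrix.single j i (1 : ℂ)) : LieG v)) := by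
  refine ⟨cofProj_isCofibrantReplacement V, fun v w => ?_⟩
  obtain ⟨Φ, hΦ⟩ := exists_derivedRep_iso (rhoVW v w) (cofProj V) cofProj_quasiIso
    (cofUnder_cofibrant V)
  exact ⟨repToHo_hasLeftDerivedFunctor _, Φ, (repIsoKoszul v w).op.symm, hΦ,
    fun p q e i j => repToKoszul_old v w e i j, fun a i j => repToKoszul_loop v w a i j⟩
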